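/- **Setting.** Let $C$ be a compact connected Riemann surface with a holomorphic atlas $(U_I,z_I)_I$, $G$ a connected complex Lie group with Lie algebra $\mathfrak g$, and $\mathcal P\to C$ a smooth principal $G$-bundle with transition functions $g_{IJ}$. Fix $n\ge 1$, $N\ge 0$; points $\mathsf q_1,\dots,\mathsf q_n\in C$ with holomorphic tangent vectors $V_i\in T^{1,0}_{\mathsf q_i}C$ and $G$-invariant homogeneous polynomials $P_i$ of degree $d_i+1$ on $\mathfrak g^*$; distinct points $\mathsf p_1,\dots,\mathsf p_N\in C$, all different from the $\mathsf q_i$, with elements $\Lambda_\alpha\in\mathfrak g^*$. Write $V_i=v_{i,I}\,\partial_{z_I}$ if $\mathsf q_i\in U_I$, $\nabla P(\phi)\in\mathfrak g$ for the gradient of $P$ at $\phi\in\mathfrak g^*$, $\langle \mathrm{Ad}^*_g\phi,X\rangle=\langle\phi,\mathrm{Ad}_{g^{-1}}X\rangle$, $\langle \mathrm{ad}^*_X\phi,Y\rangle=-\langle\phi,[X,Y]\rangle$, and $\delta(z_I-w)$ for the Dirac distribution with $\int f(z_I)\,\delta(z_I-w)\,dz_I\wedge d\bar z_I=f(w)$.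 The fields depend smoothly on $u\in\mathbb R^n$: a section $B=(B_{z_I}dz_I)$ of $\bigwedge^{1,0}C\otimes\mathfrak g^*_{\mathcal P}$, smooth except for at most simple poles at the $\mathsf p_\alpha$ (i.e. locally of the form $h/(z_I-z_I(\mathsf p_\alpha))$ with $h$ smooth); a smooth partial $(0,1)$-connection $A''=(A''_{\bar z_I}d\bar z_I)$ on $\mathcal P$; a gauge field $\mathcal A=\sum_j\mathcal A_j\,du^j$ whose components $\mathcal A_j$ are sections of $\mathfrak g_{\mathcal P}$, smooth except for at most simple poles, in the same sense, at the $\mathsf q_i$; elements $\varphi_\alpha$ of the fibres $\mathcal P_{\mathsf p_\alpha}$ (represented by $\varphi^I_\alpha\in G$ in the trivialisation over $U_I\ni \mathsf p_\alpha$); and $t=(t^1,\dots,t^n)\in\mathbb R^n$. Put $H_i(B)=\langle P_i(B(\mathsf q_i)),V_i^{d_i+1}\rangle=v_{i,I}^{d_i+1}P_i(B_{z_I}(\mathsf q_i))$. For curves $\Gamma:(0,1)\to\mathbb R^n$, $s\mapsto u(s)$, tending to infinity at both ends, the 3d mixed BF action with type A and type B defects is $$S_\Gamma=\int_0^1\Big(\frac1{2\pi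 i}\int_C\big\langle B,\ \bar\partial^{A''}\mathcal A_j-\partial_{u^j}A''\big\rangle+\sum_{\alpha=1}^N\big\langle\Lambda_\alpha,\varphi_\alpha^{-1}(\partial_{u^j}+\mathcal A_j(\mathsf p_\alpha))\varphi_\alpha\big\rangle-H_i(B)\frac{\partial t^i}{\partial u^j}\Big)\frac{du^j}{ds}\,ds ,$$ where $\bar\partial^{A''}=\bar\partial+[A'',\cdot\,]$, repeated indices $i,j$ are summed, and $\bar\partial^{A''}\mathcal A_j$ is taken in the sense of distributions near the $\mathsf q_i$. The *gauged univariational principle* requires that (i) for each $u$, the linear map $\mathrm d_u\Sigma-\mathcal A^\sharp_u$ is injective, where $\Sigma=(B,A'',(\mathrm{Ad}^*_{\varphi_\alpha}\Lambda_\alpha),t)$ and $\mathcal A^\sharp$ is the infinitesimal right action of $\mathcal A$, i.e. $v=0$ is the only $v=(v^j)\in\mathbb R^n$ for which, with $\partial_v=v^j\partial_{u^j}$ and $\mathcal A_v=v^j\mathcal A_j$, all of $\partial_vB+\mathrm{ad}^*_{\mathcal A_v}B$, $\ \partial_vA''-\bar\partial^{A''}\mathcal A_v$, $\ \partial_v(\mathrm{Ad}^*_{\varphi_\alpha}\Lambda_\alpha)+\mathrm{ad}^*_{\mathcal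 A_v(\mathsf p_\alpha)}\mathrm{Ad}^*_{\varphi_\alpha}\Lambda_\alpha$ and $\partial_vt$ vanish; and (ii) for all such smooth curves $\Gamma$ the first variation of $S_\Gamma$ vanishes under all smooth variations of $(B,A'',\mathcal A,(\varphi_\alpha),t)$ with compact support in $u$. **Theorem.** Let the fields satisfy the gauged univariational principle. Then the Jacobian matrix $(\partial t^i/\partial u^j)$ is invertible at every $u\in\mathbb R^n$. With $\partial_{t^i}=\frac{\partial u^j}{\partial t^i}\partial_{u^j}$ and $\widetilde{\mathcal A}^I_i=\frac{\partial u^j}{\partial t^i}\mathcal A^I_j$, the following equations hold in every chart $(U_I,z_I)$: $$\partial_{\bar z_I}\widetilde{\mathcal A}^I_i-\partial_{t^i}A''_{\bar z_I}+[A''_{\bar z_I},\widetilde{\mathcal A}^I_i]=2\pi i\,v_{i,I}^{d_i+1}\,\nabla P_i\big(B_{z_I}(\mathsf q_i)\big)\,\delta\big(z_I-z_I(\mathsf q_i)\big),$$ $$\partial_{\bar z_I}B_{z_I}+\mathrm{ad}^*_{A''_{\bar z_I}}B_{z_I}=2\pi i\sum_{\alpha:\ \mathsf p_\alpha\in U_I}\mathrm{Ad}^*_{\varphi^I_\alpha}\Lambda_\alpha\,\delta\big(z_I-z_I(\mathsf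 p_\alpha)\big)$$ as distributions on $U_I$ (the right-hand side of the first one being $0$ if $\mathsf q_i\notin U_I$; if $V_i=\partial_{z_I}$, then $v_{i,I}=1$); $$\partial_{t^j}B_{z_I}+\mathrm{ad}^*_{\widetilde{\mathcal A}^I_j}B_{z_I}=0$$ off the points $\mathsf p_\alpha$, $\mathsf q_i$; $\ \partial_{t^j}H_i(B)=0$; and, if $\mathsf p_\alpha\in U_I$, $$\partial_{t^j}\big(\mathrm{Ad}^*_{\varphi^I_\alpha}\Lambda_\alpha\big)+\mathrm{ad}^*_{\widetilde{\mathcal A}^I_j(\mathsf p_\alpha)}\mathrm{Ad}^*_{\varphi^I_\alpha}\Lambda_\alpha=0 .$$ Moreover, at every $u$ at which $(B,A'')$ is stable, that is, at which a smooth section $X$ of $\mathfrak g_{\mathcal P}$ with $\bar\partial X+[A'',X]=0$ and $\mathrm{ad}^*_XB=0$ must vanish, the zero-curvature equations $$\partial_{t^i}\widetilde{\mathcal A}^I_j-\partial_{t^j}\widetilde{\mathcal A}^I_i+[\widetilde{\mathcal A}^I_i,\widetilde{\mathcal A}^I_j]=0$$ hold off the points $\mathsf q_k$. Finally, the equations in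 different charts are compatible: for all fields as in the setting, critical or not, the displayed local equations (with $\partial u^j/\partial t^i$ read as $0$ where the Jacobian matrix is singular) hold over $U_I\cap U_J$ in the chart $(U_I,z_I)$ if and only if they hold there in the chart $(U_J,z_J)$. The case $N=0$ is the system without type A defects. -/

import Mathlib

open Set Filter MeasureTheory
open scoped Manifold ContDiff Topology

noncomputable section

namespace MixedBF

/-! ### Lie groups: adjoint and coadjoint actions, logarithmic derivatives

`G` is a complex Lie group modelled on `E`, so that `E` is (definitionally) the tangent space of `G`
at the identity, that is, its Lie algebra; the dual of the Lie algebra is `StrongDual ℂ E`. -/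

section LieTheory

variable {E : Type*} [NormedAddCommGroup E] [NormedSpace ℂ E]
  {G : Type*} [TopologicalSpace G] [ChartedSpace E G] [Group G]

variable (G) in
/-- The Lie bracket `[X, Y]` of the Lie algebra of `G`. -/
def bracket (X Y : E) : E :=
  Bracket.bracket (L := GroupLieAlgebra 𝓘(ℂ, E) G) (M := GroupLieAlgebra 𝓘(ℂ, E) G) X Y

/-- The adjoint action `X ↦ g X g⁻¹`: the derivative at `1` of `x ↦ g x g⁻¹`. -/
def Ad (g : G) : E →L[ℂ] E :=
  mfderiv 𝓘(ℂ, E) 𝓘(ℂ, E) (fun x : G => g * x * g⁻¹) 1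

/-- The coadjoint action of the group, `⟨Ad*_g φ, X⟩ = ⟨φ, Ad_{g⁻¹} X⟩`. -/
def coAd (g : G) (φ : StrongDual ℂ E) : StrongDual ℂ E :=
  φ.comp (Ad g⁻¹)

variable (G) in
/-- `Y ↦ [X, Y]` as a continuous linear map. -/
def adCLM [LieGroup 𝓘(ℂ, E) ω G] [FiniteDimensional ℂ E] (X : E) : E →L[ℂ] E :=
  LinearMap.toContinuousLinearMap
    { toFun := bracket G X
      map_add' := fun Y Z =>
        lie_add (L := GroupLieAlgebra 𝓘(ℂ, E) G) (M := GroupLieAlgebra 𝓘(ℂ, E) G) X Y Z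
      map_smul' := fun c Y =>
        lie_smul (R := ℂ) (L := GroupLieAlgebra 𝓘(ℂ, E) G) (M := GroupLieAlgebra 𝓘(ℂ, E) G)
          c X Y }

variable (G) in
/-- The coadjoint action of the Lie algebra, `⟨ad*_X φ, Y⟩ = -⟨φ, [X, Y]⟩`. -/
def coad [LieGroup 𝓘(ℂ, E) ω G] [FiniteDimensional ℂ E] (X : E) (φ : StrongDual ℂ E) :
    StrongDual ℂ E :=
  -(φ.comp (adCLM G X))

/-- The right logarithmic derivative `(∂_v f) f⁻¹` at `w`, an element of the Lie algebra, of a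
real-smooth map `f` from a real vector space to `G`. -/
def rightLogDeriv {F : Type*} [NormedAddCommGroup F] [NormedSpace ℝ F] (f : F → G) (w v : F) : E :=
  mfderiv 𝓘(ℝ, F) 𝓘(ℝ, E) (fun y => f y * (f w)⁻¹) w v

/-- The left logarithmic derivative `f⁻¹ ∂_v f` at `w`. -/
def leftLogDeriv {F : Type*} [NormedAddCommGroup F] [NormedSpace ℝ F] (f : F → G) (w v : F) : E :=
  mfderiv 𝓘(ℝ, F) 𝓘(ℝ, E) (fun y => (f w)⁻¹ * f y) w v

/-- The `d z̄`-component `(∂_{z̄} f) f⁻¹` of `(∂̄ f) f⁻¹` for a smooth map `f` from `ℂ` to `G`. -/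
def dbarLog (f : ℂ → G) (w : ℂ) : E :=
  (1 / 2 : ℂ) • ((rightLogDeriv f w 1 : E) + Complex.I • (rightLogDeriv f w Complex.I : E))

/-- `∂f/∂z̄ = ½ (∂_x f + i ∂_y f)`. -/
def dbar {V : Type*} [NormedAddCommGroup V] [NormedSpace ℂ V] (f : ℂ → V) (w : ℂ) : V :=
  (1 / 2 : ℂ) • (fderiv ℝ f w 1 + Complex.I • fderiv ℝ f w Complex.I)

/-! A polynomial on the dual of the Lie algebra is given by an element of `MvPolynomial E ℂ`, the
variable `X : E` standing for the linear function `φ ↦ ⟨φ, X⟩`. -/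

/-- The value at `φ` of a polynomial on the dual of the Lie algebra. -/
def polyEval (P : MvPolynomial E ℂ) (φ : StrongDual ℂ E) : ℂ :=
  MvPolynomial.eval (fun X : E => φ X) P

/-- The gradient `∇P(φ)`, an element of the Lie algebra; see `hasDerivAt_polyEval`. -/
def grad (P : MvPolynomial E ℂ) (φ : StrongDual ℂ E) : E :=
  ∑ X ∈ P.vars, polyEval (MvPolynomial.pderiv X P) φ • X

theorem hasDerivAt_polyEval (P : MvPolynomial E ℂ) (φ ψ : StrongDual ℂ E) :
    HasDerivAt (fun s : ℂ => polyEval P (φ + s • ψ)) (ψ (grad P φ)) 0 := by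
  have key : ∀ Q : MvPolynomial E ℂ, HasDerivAt (fun s : ℂ => polyEval Q (φ + s • ψ))
      (polyEval (MvPolynomial.mkDerivation ℂ (fun X : E => MvPolynomial.C (ψ X)) Q) φ) 0 := by
    intro Q
    induction Q using MvPolynomial.induction_on with
    | C a => simpa [polyEval] using hasDerivAt_const (0 : ℂ) a
    | add p q hp hq =>
      simp only [polyEval, map_add] at hp hq ⊢
      exact hp.add hq
    | mul_X p X hp =>
      have h1 : HasDerivAt (fun s : ℂ => φ X + s * ψ X) (ψ X) 0 := by
        simpa using ((hasDerivAt_id (0 : ℂ)).mul_const (ψ X)).const_add (φ X)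
      have h2 := hp.mul h1
      simp only [polyEval, Derivation.leibniz, MvPolynomial.mkDerivation_X, map_add, smul_eq_mul,
        map_mul, MvPolynomial.eval_X, MvPolynomial.eval_C, add_apply, smul_apply] at h2 ⊢
      simp only [zero_mul, add_zero] at h2
      rw [add_comm, mul_comm (φ X)]
      exact h2
  have e : ∀ (S : Finset E) (Q : MvPolynomial E ℂ),
      (∑ X ∈ S, (MvPolynomial.C (ψ X) : MvPolynomial E ℂ) • MvPolynomial.pderiv (R := ℂ) X) Q =
        ∑ X ∈ S, MvPolynomial.C (ψ X) * MvPolynomial.pderiv X Q := by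
    classical
    intro S Q
    induction S using Finset.induction_on with
    | empty => simp
    | insert Y S hY ih =>
      rw [Finset.sum_insert hY, Finset.sum_insert hY, Derivation.add_apply, ih]
      simp
  have e' : MvPolynomial.mkDerivation ℂ (fun X : E => MvPolynomial.C (ψ X)) P =
      ∑ X ∈ P.vars, MvPolynomial.C (ψ X) * MvPolynomial.pderiv X P := by
    classical
    rw [← e P.vars P]
    apply MvPolynomial.derivation_eq_of_forall_mem_vars
    intro Y hY
    rw [e]
    simp only [MvPolynomial.mkDerivation_X, MvPolynomial.pderiv_X, Pi.single_apply]
    simp [hY]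
  have h := key P
  rw [e'] at h
  convert h using 1
  simp [grad, polyEval, mul_comm]

end LieTheory

/-! ### The Riemann surface, the principal bundle, and the marked points -/

/-- A holomorphic atlas of `C` indexed by `ι`, with a choice `idx x` of a chart around each point. -/
structure HolAtlas (C ι : Type*) [TopologicalSpace C] [ChartedSpace ℂ C] where
  /-- the chart `z_I`, with source `U_I` -/
  chart : ι → OpenPartialHomeomorph C ℂ
  chart_mem : ∀ I, chart I ∈ IsManifold.maximalAtlas 𝓘(ℂ) ω C
  idx : C → ι
  mem_idx : ∀ x, x ∈ (chart (idx x)).source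

/-- The derivative `d z_J / d z_I` at the point `x`. -/
def HolAtlas.jac {C ι : Type*} [TopologicalSpace C] [ChartedSpace ℂ C] (𝒰 : HolAtlas C ι)
    (I J : ι) (x : C) : ℂ :=
  deriv (fun w => 𝒰.chart J ((𝒰.chart I).symm w)) (𝒰.chart I x)

/-- A smooth principal `G`-bundle on `C`, given by a holomorphic atlas of `C` and a smooth Čech
cocycle of transition functions `g_{IJ}` on the overlaps `U_I ∩ U_J`. -/
structure PBundle (C ι E G : Type*) [TopologicalSpace C] [ChartedSpace ℂ C]
    [NormedAddCommGroup E] [NormedSpace ℂ E] [TopologicalSpace G] [ChartedSpace E G] [Group G]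
    extends HolAtlas C ι where
  /-- the transition function `g_{IJ}` -/
  g : ι → ι → C → G
  g_smooth : ∀ I J, ContMDiffOn 𝓘(ℝ, ℂ) 𝓘(ℝ, E) ∞ (fun w => g I J ((chart I).symm w))
    ((chart I).target ∩ (chart I).symm ⁻¹' (chart J).source)
  cocycle : ∀ I J K x, x ∈ (chart I).source → x ∈ (chart J).source → x ∈ (chart K).source →
    g I J x * g J K x = g I K x

/-- The data attached to the marked points. At `q i` (type B defect, `i = 1, …, n`): a holomorphic
tangent vector `V i` and a homogeneous `G`-invariant polynomial `P i` of degree `d i + 1` on the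
dual of the Lie algebra. At `p α` (type A defect, `α = 1, …, N`): an element `Λ α` of that dual. -/
structure Defects (C E G : Type*) [TopologicalSpace C] [ChartedSpace ℂ C]
    [NormedAddCommGroup E] [NormedSpace ℂ E] [TopologicalSpace G] [ChartedSpace E G] [Group G]
    (n N : ℕ) where
  q : Fin n → C
  V : ∀ i, TangentSpace 𝓘(ℂ) (q i)
  d : Fin n → ℕ
  P : Fin n → MvPolynomial E ℂ
  P_hom : ∀ i, (P i).IsHomogeneous (d i + 1)
  P_inv : ∀ (i : Fin n) (g : G) (φ : StrongDual ℂ E), polyEval (P i) (coAd g φ) = polyEval (P i) φ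
  p : Fin N → C
  p_injective : Function.Injective p
  p_ne_q : ∀ α i, p α ≠ q i
  Λ : Fin N → StrongDual ℂ E

/-! ### Fields -/

/-- The fields over the multi-time space `Fin n → ℝ` (with coordinates `u`), in local
trivialisations: the components `B_{z_I}`, `A''_{z̄_I}`, `𝒜^I_j`, the orbit variables `φ_α^I` and
the times `t`. A local field is a function of the chart index, the point of `C` and `u`; only its
values over `U_I` matter. -/
structure Fields (C ι E G : Type*) [NormedAddCommGroup E] [NormedSpace ℂ E] (n N : ℕ) where
  B : ι → C → (Fin n → ℝ) → StrongDual ℂ E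
  A : ι → C → (Fin n → ℝ) → E
  gauge : ι → C → (Fin n → ℝ) → Fin n → E
  φ : Fin N → ι → (Fin n → ℝ) → G
  t : (Fin n → ℝ) → Fin n → ℝ

section Regularity

variable {C ι : Type*} [TopologicalSpace C] [ChartedSpace ℂ C] {n : ℕ}
  {V : Type*} [NormedAddCommGroup V] [NormedSpace ℂ V]

/-- The local components `f I` are jointly smooth in the point of `U_I` and in `u`, away from `S`. -/
def SmoothOff (𝒰 : HolAtlas C ι) (S : Set C) (f : ι → C → (Fin n → ℝ) → V) : Prop :=
  ∀ I, ContDiffOn ℝ ∞ (fun y : ℂ × (Fin n → ℝ) => f I ((𝒰.chart I).symm y.1) y.2)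
    (((𝒰.chart I).target ∩ (𝒰.chart I).symm ⁻¹' Sᶜ) ×ˢ univ)

/-- The local components `f I` have at most simple poles at the points `s` of `S`: near `s` they are
of the form `h / (z_I - z_I(s))` with `h` jointly smooth. -/
def SimplePoles (𝒰 : HolAtlas C ι) (S : Set C) (f : ι → C → (Fin n → ℝ) → V) : Prop :=
  ∀ I, ∀ s ∈ S, s ∈ (𝒰.chart I).source →
    ∃ W ∈ 𝓝 (𝒰.chart I s), ∃ h : ℂ × (Fin n → ℝ) → V, ContDiffOn ℝ ∞ h (W ×ˢ univ) ∧
      ∀ w ∈ W, w ≠ 𝒰.chart I s → ∀ u,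
        f I ((𝒰.chart I).symm w) u = (w - 𝒰.chart I s)⁻¹ • h (w, u)

end Regularity

section Theory

variable {C ι E G : Type*} [TopologicalSpace C] [ChartedSpace ℂ C]
  [NormedAddCommGroup E] [NormedSpace ℂ E] [TopologicalSpace G] [ChartedSpace E G] [Group G]
  {n N : ℕ}

/-- The admissible fields: `B(u)` is a section of `⋀^{1,0} ⊗ 𝔤*_P`, smooth except for simple poles
at the points `p α`; `A''(u)` is a smooth partial `(0,1)`-connection on the bundle; `𝒜_j(u)` is a
section of `𝔤_P`, smooth except for simple poles at the points `q i`; `φ_α(u)` is an element of the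
fibre of the bundle over `p α`; everything depends smoothly on `u`. -/
structure Fields.Admissible (Pb : PBundle C ι E G) (D : Defects C E G n N)
    (F : Fields C ι E G n N) : Prop where
  B_smooth : SmoothOff Pb.toHolAtlas (range D.p) F.B
  B_poles : SimplePoles Pb.toHolAtlas (range D.p) F.B
  B_trans : ∀ I J x, x ∈ (Pb.chart I).source → x ∈ (Pb.chart J).source → x ∉ range D.p →
    ∀ u, F.B I x u = Pb.jac I J x • coAd (Pb.g I J x) (F.B J x u)
  A_smooth : SmoothOff Pb.toHolAtlas ∅ F.A
  A_trans : ∀ I J x, x ∈ (Pb.chart I).source → x ∈ (Pb.chart J).source →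
    ∀ u, F.A I x u = (starRingEnd ℂ) (Pb.jac I J x) • Ad (Pb.g I J x) (F.A J x u)
      - dbarLog (fun w => Pb.g I J ((Pb.chart I).symm w)) (Pb.chart I x)
  gauge_smooth : SmoothOff Pb.toHolAtlas (range D.q) F.gauge
  gauge_poles : SimplePoles Pb.toHolAtlas (range D.q) F.gauge
  gauge_trans : ∀ I J x, x ∈ (Pb.chart I).source → x ∈ (Pb.chart J).source → x ∉ range D.q →
    ∀ u j, F.gauge I x u j = Ad (Pb.g I J x) (F.gauge J x u j)
  φ_smooth : ∀ α I, D.p α ∈ (Pb.chart I).source →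
    ContMDiff 𝓘(ℝ, Fin n → ℝ) 𝓘(ℝ, E) ∞ (F.φ α I)
  φ_trans : ∀ α I J, D.p α ∈ (Pb.chart I).source → D.p α ∈ (Pb.chart J).source →
    ∀ u, F.φ α I u = Pb.g I J (D.p α) * F.φ α J u
  t_smooth : ContDiff ℝ ∞ F.t

/-- The contraction `𝒜_v = ∑_j v^j 𝒜_j` of the gauge field with a tangent vector `v` of the
multi-time space. -/
def Fields.gaugeAt (F : Fields C ι E G n N) (I : ι) (x : C) (u v : Fin n → ℝ) : E :=
  ∑ j, v j • F.gauge I x u j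

/-! ### The action -/

/-- The integral over `C` of the `(1,1)`-form with local components `η_I dz_I ∧ dz̄_I`, by means of a
partition of unity. Here `dz ∧ dz̄` is `-2i` times the Lebesgue measure. -/
def surfaceIntegral (𝒰 : HolAtlas C ι) (ρ : PartitionOfUnity ι C) (η : ι → C → ℂ) : ℂ :=
  ∑ᶠ I, ∫ w in (𝒰.chart I).target,
    (-2 * Complex.I) * ((ρ I ((𝒰.chart I).symm w) : ℂ) * η I ((𝒰.chart I).symm w))

/-- The residue `lim_{x → s} (z_I(x) - z_I(s)) f(x)`. -/
def residue (𝒰 : HolAtlas C ι) (I : ι) (s : C) (f : C → E) : E :=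
  limUnder (𝓝[≠] s) (fun x => (𝒰.chart I x - 𝒰.chart I s) • f x)

/-- The component of the tangent vector `V i` in the coordinate `z_I`. -/
def Defects.comp (𝒰 : HolAtlas C ι) (D : Defects C E G n N) (i : Fin n) (I : ι) : ℂ :=
  mfderiv 𝓘(ℂ) 𝓘(ℂ) (𝒰.chart I) (D.q i) (D.V i)

/-- The Hamiltonian `H_i(B) = ⟨P_i(B(q_i)), V_i^{d_i + 1}⟩`. -/
def Fields.H (𝒰 : HolAtlas C ι) (D : Defects C E G n N) (F : Fields C ι E G n N) (i : Fin n)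
    (u : Fin n → ℝ) : ℂ :=
  D.comp 𝒰 i (𝒰.idx (D.q i)) ^ (D.d i + 1) *
    polyEval (D.P i) (F.B (𝒰.idx (D.q i)) (D.q i) u)

/-- The value of `F_A` off the poles: the component
`∂_{z̄} 𝒜_v - ∂_v A'' + [A'', 𝒜_v]` of the curvature in the direction `v`. -/
def Fields.curvature (𝒰 : HolAtlas C ι) (F : Fields C ι E G n N) (u v : Fin n → ℝ) (I : ι)
    (x : C) : E :=
  dbar (fun w => F.gaugeAt I ((𝒰.chart I).symm w) u v) (𝒰.chart I x)
    - fderiv ℝ (F.A I x) u v + bracket G (F.A I x u) (F.gaugeAt I x u v)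

/-- The term `(1/2πi) ∫_C ⟨B, F_A⟩` of the action, in the direction `v`. As `𝒜` may have simple poles
at the points `q i`, the curvature `F_A` is a distribution near these points. Since
`∂_{z̄} (h / (z - w)) = (∂_{z̄} h) / (z - w) - 2πi h(w) δ(z - w)`, it is the sum of its (locally
integrable) values off the poles and of `-2πi (Res_q 𝒜_v) δ_q` for every `q` among the `q i`, where
`δ_q` has integral `1` against `dz ∧ dz̄`; its pairing with `B`, which is smooth near the `q i`, is
therefore as follows. -/
def Fields.bfTerm (𝒰 : HolAtlas C ι) (ρ : PartitionOfUnity ι C) (D : Defects C E G n N)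
    (F : Fields C ι E G n N) (u v : Fin n → ℝ) : ℂ :=
  (1 / (2 * Real.pi * Complex.I)) *
    (surfaceIntegral 𝒰 ρ (fun I x => F.B I x u (F.curvature 𝒰 u v I x))
      + ∑ᶠ s ∈ range D.q, (-(2 * Real.pi * Complex.I)) *
          F.B (𝒰.idx s) s u (residue 𝒰 (𝒰.idx s) s (fun x => F.gaugeAt (𝒰.idx s) x u v)))

/-- The term `∑_α ⟨Λ_α, φ_α⁻¹ (∂_v + 𝒜_v(p_α)) φ_α⟩` of the action. -/
def Fields.orbitTerm (𝒰 : HolAtlas C ι) (D : Defects C E G n N) (F : Fields C ι E G n N)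
    (u v : Fin n → ℝ) : ℂ :=
  ∑ α, D.Λ α (leftLogDeriv (F.φ α (𝒰.idx (D.p α))) u v
    + Ad (F.φ α (𝒰.idx (D.p α)) u)⁻¹ (F.gaugeAt (𝒰.idx (D.p α)) (D.p α) u v))

/-- The Lagrangian one-form on the multi-time space, at `u`, evaluated on the tangent vector `v`. -/
def Fields.lagrangian (𝒰 : HolAtlas C ι) (ρ : PartitionOfUnity ι C) (D : Defects C E G n N)
    (F : Fields C ι E G n N) (u v : Fin n → ℝ) : ℂ :=
  F.bfTerm 𝒰 ρ D u v + F.orbitTerm 𝒰 D u v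
    - ∑ i, F.H 𝒰 D i u * ((fderiv ℝ F.t u v i : ℝ) : ℂ)

/-! ### The gauged univariational principle -/

/-- A variation: increments of `B`, `A''`, `𝒜` and `t`, and a one-parameter family deforming `φ`. -/
structure Variation (C ι E G : Type*) [NormedAddCommGroup E] [NormedSpace ℂ E] (n N : ℕ) where
  δB : ι → C → (Fin n → ℝ) → StrongDual ℂ E
  δA : ι → C → (Fin n → ℝ) → E
  δgauge : ι → C → (Fin n → ℝ) → Fin n → E
  Φ : Fin N → ι → ℝ → (Fin n → ℝ) → G
  δt : (Fin n → ℝ) → Fin n → ℝ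

/-- The varied fields. -/
def Fields.vary (F : Fields C ι E G n N) (δ : Variation C ι E G n N) (ε : ℝ) :
    Fields C ι E G n N where
  B I x u := F.B I x u + ε • δ.δB I x u
  A I x u := F.A I x u + ε • δ.δA I x u
  gauge I x u := F.gauge I x u + ε • δ.δgauge I x u
  φ α I u := δ.Φ α I ε u
  t u := F.t u + ε • δ.δt u

/-- The variations of `F` that are allowed: smooth, with compact support in `u`. -/
structure Variation.Admissible (Pb : PBundle C ι E G) (D : Defects C E G n N)
    (F : Fields C ι E G n N) (δ : Variation C ι E G n N) : Prop where
  δB_smooth : SmoothOff Pb.toHolAtlas ∅ δ.δB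
  δB_trans : ∀ I J x, x ∈ (Pb.chart I).source → x ∈ (Pb.chart J).source →
    ∀ u, δ.δB I x u = Pb.jac I J x • coAd (Pb.g I J x) (δ.δB J x u)
  δA_smooth : SmoothOff Pb.toHolAtlas ∅ δ.δA
  δA_trans : ∀ I J x, x ∈ (Pb.chart I).source → x ∈ (Pb.chart J).source →
    ∀ u, δ.δA I x u = (starRingEnd ℂ) (Pb.jac I J x) • Ad (Pb.g I J x) (δ.δA J x u)
  δgauge_smooth : SmoothOff Pb.toHolAtlas ∅ δ.δgauge
  δgauge_trans : ∀ I J x, x ∈ (Pb.chart I).source → x ∈ (Pb.chart J).source →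
    ∀ u j, δ.δgauge I x u j = Ad (Pb.g I J x) (δ.δgauge J x u j)
  Φ_smooth : ∀ α I, D.p α ∈ (Pb.chart I).source →
    ContMDiff 𝓘(ℝ, ℝ × (Fin n → ℝ)) 𝓘(ℝ, E) ∞ (fun y : ℝ × (Fin n → ℝ) => δ.Φ α I y.1 y.2)
  Φ_trans : ∀ α I J, D.p α ∈ (Pb.chart I).source → D.p α ∈ (Pb.chart J).source →
    ∀ ε u, δ.Φ α I ε u = Pb.g I J (D.p α) * δ.Φ α J ε u
  Φ_zero : ∀ α I u, δ.Φ α I 0 u = F.φ α I u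
  δt_smooth : ContDiff ℝ ∞ δ.δt
  compact_support : ∃ K : Set (Fin n → ℝ), IsCompact K ∧ ∀ u, u ∉ K →
    (∀ I x, δ.δB I x u = 0) ∧ (∀ I x, δ.δA I x u = 0) ∧ (∀ I x, δ.δgauge I x u = 0) ∧
    (∀ α I ε, δ.Φ α I ε u = F.φ α I u) ∧ δ.δt u = 0

/-- The curves `Γ : (0,1) → ℝⁿ`: smooth, and going to infinity at both ends. -/
structure IsCurve (Γ : ℝ → Fin n → ℝ) : Prop where
  smooth : ContDiffOn ℝ ∞ Γ (Ioo 0 1)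
  left : Tendsto (fun s => ‖Γ s‖) (𝓝[>] 0) atTop
  right : Tendsto (fun s => ‖Γ s‖) (𝓝[<] 1) atTop

/-- `F` is a critical point of the actions `S_Γ = ∫_0^1 Γ^* 𝓛` for all curves `Γ`. The fields do not
decay along `Γ`, so that `S_Γ` itself may diverge; the difference of the actions of the varied and
of the original fields has an integrand with compact support in `(0,1)`, and its derivative is the
first variation `δ S_Γ`. -/
def Fields.Critical (Pb : PBundle C ι E G) (ρ : PartitionOfUnity ι C) (D : Defects C E G n N)
    (F : Fields C ι E G n N) : Prop :=
  ∀ Γ : ℝ → Fin n → ℝ, IsCurve Γ → ∀ δ : Variation C ι E G n N, δ.Admissible Pb D F →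
    HasDerivAt (fun ε : ℝ => ∫ s in Ioo (0 : ℝ) 1,
      ((F.vary δ ε).lagrangian Pb.toHolAtlas ρ D (Γ s) (deriv Γ s)
        - F.lagrangian Pb.toHolAtlas ρ D (Γ s) (deriv Γ s))) 0 0

/-- Test functions on the open subset `W` of `ℂ`. -/
structure IsTest {V : Type*} [NormedAddCommGroup V] [NormedSpace ℂ V] (W : Set ℂ) (ψ : ℂ → V) :
    Prop where
  smooth : ContDiff ℝ ∞ ψ
  compact : HasCompactSupport ψ
  supp : tsupport ψ ⊆ W

/-- The distribution `∂_{z̄} 𝒜_v - ∂_v A'' + [A'', 𝒜_v]` on the chart `z_I`, at `u`, evaluated on a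
test function `ψ` with values in the dual of the Lie algebra, with respect to `dz ∧ dz̄`. -/
def Fields.curvatureDist (𝒰 : HolAtlas C ι) (F : Fields C ι E G n N) (I : ι)
    (u v : Fin n → ℝ) (ψ : ℂ → StrongDual ℂ E) : ℂ :=
  ∫ w in (𝒰.chart I).target, (-2 * Complex.I) *
    (-(dbar ψ w (F.gaugeAt I ((𝒰.chart I).symm w) u v))
      + ψ w (-(fderiv ℝ (F.A I ((𝒰.chart I).symm w)) u v)
        + bracket G (F.A I ((𝒰.chart I).symm w) u) (F.gaugeAt I ((𝒰.chart I).symm w) u v)))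

variable [LieGroup 𝓘(ℂ, E) ω G] [FiniteDimensional ℂ E]

/-- The distribution `∂_{z̄} B + ad*_{A''} B` on the chart `z_I`, at `u`, evaluated on a test
function `X` with values in the Lie algebra, with respect to `dz ∧ dz̄`. -/
def Fields.momentDist (𝒰 : HolAtlas C ι) (F : Fields C ι E G n N) (I : ι)
    (u : Fin n → ℝ) (X : ℂ → E) : ℂ :=
  ∫ w in (𝒰.chart I).target, (-2 * Complex.I) *
    (-(F.B I ((𝒰.chart I).symm w) u (dbar X w))
      + coad G (F.A I ((𝒰.chart I).symm w) u) (F.B I ((𝒰.chart I).symm w) u) (X w))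

/-- Injectivity of `d_u Σ - 𝒜^♯_u` for every `u`, where `Σ = (B, A'', (Ad*_{φ_α} Λ_α), t)` and `𝒜^♯`
is the infinitesimal right action of `𝒜`. The components of `(d_u Σ - 𝒜^♯_u)(v)` are
`∂_v B + ad*_{𝒜_v} B`, `∂_v A'' - ∂̄^{A''} 𝒜_v` (a distribution, since `𝒜` may have poles),
`∂_v (Ad*_{φ_α} Λ_α) + ad*_{𝒜_v(p_α)} Ad*_{φ_α} Λ_α`, and `∂_v t`. -/
def Fields.Nondegenerate (𝒰 : HolAtlas C ι) (D : Defects C E G n N)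
    (F : Fields C ι E G n N) : Prop :=
  ∀ u v : Fin n → ℝ,
    (∀ I, ∀ x ∈ (𝒰.chart I).source, x ∉ range D.p → x ∉ range D.q →
      fderiv ℝ (F.B I x) u v + coad G (F.gaugeAt I x u v) (F.B I x u) = 0) →
    (∀ I ψ, IsTest (𝒰.chart I).target ψ → F.curvatureDist 𝒰 I u v ψ = 0) →
    (∀ α I, D.p α ∈ (𝒰.chart I).source →
      fderiv ℝ (fun u' => coAd (F.φ α I u') (D.Λ α)) u v
        + coad G (F.gaugeAt I (D.p α) u v) (coAd (F.φ α I u) (D.Λ α)) = 0) →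
    fderiv ℝ F.t u v = 0 → v = 0

/-- The gauged univariational principle. -/
structure Fields.GaugedUnivariational (Pb : PBundle C ι E G) (ρ : PartitionOfUnity ι C)
    (D : Defects C E G n N) (F : Fields C ι E G n N) : Prop where
  nondegenerate : F.Nondegenerate Pb.toHolAtlas D
  critical : F.Critical Pb ρ D

/-! ### The equations in the coordinates `t` -/

/-- The Jacobian matrix `(∂t^i/∂u^j)_{ij}`. -/
def Fields.jacobian (F : Fields C ι E G n N) (u : Fin n → ℝ) : Matrix (Fin n) (Fin n) ℝ :=
  Matrix.of fun i j => fderiv ℝ F.t u (Pi.single j 1) i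

/-- The vector `(∂u^j/∂t^i)_j` at `u`, so that `∂_{t^i}` is the derivative along it. -/
def Fields.timeVec (F : Fields C ι E G n N) (u : Fin n → ℝ) (i : Fin n) : Fin n → ℝ :=
  fun j => (F.jacobian u)⁻¹ j i

/-- The derivative `∂_{t^i} f` at `u`. -/
def Fields.dt {V : Type*} [NormedAddCommGroup V] [NormedSpace ℝ V] (F : Fields C ι E G n N)
    (i : Fin n) (f : (Fin n → ℝ) → V) (u : Fin n → ℝ) : V :=
  fderiv ℝ f u (F.timeVec u i)

/-- `𝒜̃_i = ∑_j (∂u^j/∂t^i) 𝒜_j`. -/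
def Fields.tgauge (F : Fields C ι E G n N) (I : ι) (x : C) (i : Fin n) (u : Fin n → ℝ) : E :=
  F.gaugeAt I x u (F.timeVec u i)

open Classical in
/-- The equations in the chart `z_I`, over the open subset `U_I ∩ W` of `C`. The first two are
equations of distributions, where `δ(z_I - w)` is the Dirac distribution with respect to
`dz_I ∧ dz̄_I`; the third one holds pointwise off the marked points. -/
structure Fields.LocalEquations (𝒰 : HolAtlas C ι) (D : Defects C E G n N)
    (F : Fields C ι E G n N) (I : ι) (W : Set C) : Prop where
  /-- `∂_{z̄} 𝒜̃_i - ∂_{t^i} A'' + [A'', 𝒜̃_i] = 2πi V_i^{d_i + 1} ∇P_i(B(q_i)) δ(z - z(q_i))` -/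
  curvature : ∀ u i ψ, IsTest (𝒰.chart I '' ((𝒰.chart I).source ∩ W)) ψ →
    F.curvatureDist 𝒰 I u (F.timeVec u i) ψ =
      if D.q i ∈ (𝒰.chart I).source then
        2 * Real.pi * Complex.I * D.comp 𝒰 i I ^ (D.d i + 1) *
          ψ (𝒰.chart I (D.q i)) (grad (D.P i) (F.B I (D.q i) u))
      else 0
  /-- `∂_{z̄} B + ad*_{A''} B = 2πi ∑_{α : p_α ∈ U_I} Ad*_{φ_α} Λ_α δ(z - z(p_α))` -/
  moment : ∀ u X, IsTest (𝒰.chart I '' ((𝒰.chart I).source ∩ W)) X →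
    F.momentDist 𝒰 I u X =
      2 * Real.pi * Complex.I * ∑ α, if D.p α ∈ (𝒰.chart I).source then
        coAd (F.φ α I u) (D.Λ α) (X (𝒰.chart I (D.p α))) else 0
  /-- `∂_{t^j} B + ad*_{𝒜̃_j} B = 0` -/
  lax : ∀ u j, ∀ x ∈ (𝒰.chart I).source ∩ W, x ∉ range D.p → x ∉ range D.q →
    F.dt j (F.B I x) u + coad G (F.tgauge I x j u) (F.B I x u) = 0
  /-- `∂_{t^j} H_i(B) = 0` -/
  conservation : ∀ u i j, F.dt j (F.H 𝒰 D i) u = 0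
  /-- `∂_{t^j} (Ad*_{φ_α} Λ_α) + ad*_{𝒜̃_j(p_α)} Ad*_{φ_α} Λ_α = 0` -/
  orbit : ∀ u j α, D.p α ∈ (𝒰.chart I).source ∩ W →
    F.dt j (fun u' => coAd (F.φ α I u') (D.Λ α)) u
      + coad G (F.tgauge I (D.p α) j u) (coAd (F.φ α I u) (D.Λ α)) = 0

/-- Stability of `(B(u), A''(u))`: a smooth section `X` of `𝔤_P` with `∂̄ X + [A'', X] = 0` and
`ad*_X B = 0` vanishes. -/
def Fields.Stable (Pb : PBundle C ι E G) (D : Defects C E G n N) (F : Fields C ι E G n N)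
    (u : Fin n → ℝ) : Prop :=
  ∀ X : ι → C → E,
    (∀ I, ContDiffOn ℝ ∞ (fun w => X I ((Pb.chart I).symm w)) (Pb.chart I).target) →
    (∀ I J x, x ∈ (Pb.chart I).source → x ∈ (Pb.chart J).source →
      X I x = Ad (Pb.g I J x) (X J x)) →
    (∀ I, ∀ x ∈ (Pb.chart I).source,
      dbar (fun w => X I ((Pb.chart I).symm w)) (Pb.chart I x) + bracket G (F.A I x u) (X I x) = 0) →
    (∀ I, ∀ x ∈ (Pb.chart I).source, x ∉ range D.p → coad G (X I x) (F.B I x u) = 0) →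
    ∀ I, ∀ x ∈ (Pb.chart I).source, X I x = 0

/-- The zero-curvature equations `∂_{t^i} 𝒜̃_j - ∂_{t^j} 𝒜̃_i + [𝒜̃_i, 𝒜̃_j] = 0` at `u`, off the
poles `q_k` of the gauge field. -/
def Fields.ZeroCurvature (𝒰 : HolAtlas C ι) (D : Defects C E G n N) (F : Fields C ι E G n N)
    (u : Fin n → ℝ) : Prop :=
  ∀ I, ∀ x ∈ (𝒰.chart I).source, x ∉ range D.q → ∀ i j,
    F.dt i (F.tgauge I x j) u - F.dt j (F.tgauge I x i) u
      + bracket G (F.tgauge I x i u) (F.tgauge I x j u) = 0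

end Theory

end MixedBF

end

open Set Filter MeasureTheory
open scoped Manifold ContDiff Topology

noncomputable section

set_option linter.unusedSectionVars false

namespace MixedBF

section RestrictScalars

variable {E : Type*} [NormedAddCommGroup E] [NormedSpace ℂ E]
  {E' : Type*} [NormedAddCommGroup E'] [NormedSpace ℂ E']
  {M : Type*} [TopologicalSpace M] [ChartedSpace E M]
  {M' : Type*} [TopologicalSpace M'] [ChartedSpace E' M']

theorem ContMDiffAt.restrict_real {n : WithTop ℕ∞} {f : M → M'} {x : M}
    (h : ContMDiffAt 𝓘(ℂ, E) 𝓘(ℂ, E') n f x) : ContMDiffAt 𝓘(ℝ, E) 𝓘(ℝ, E') n f x := by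
  rw [contMDiffAt_iff] at h ⊢
  refine ⟨h.1, ?_⟩
  have h2 := h.2.restrict_scalars ℝ
  simpa using h2

theorem HasMFDerivAt.restrict_real {f : M → M'} {x : M} {f' : E →L[ℂ] E'}
    (h : HasMFDerivAt 𝓘(ℂ, E) 𝓘(ℂ, E') f x f') :
    HasMFDerivAt 𝓘(ℝ, E) 𝓘(ℝ, E') f x (f'.restrictScalars ℝ : E →L[ℝ] E') := by
  refine ⟨h.1, ?_⟩
  exact HasFDerivWithinAt.restrictScalars ℝ h.2

theorem isManifold_real [IsManifold 𝓘(ℂ, E) ω M] : IsManifold 𝓘(ℝ, E) ω M := by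
  refine isManifold_of_contDiffOn _ _ _ fun e e' he he' => ?_
  have h := (mem_groupoid_of_pregroupoid.mp (StructureGroupoid.compatible
    (contDiffGroupoid ω 𝓘(ℂ, E)) he he')).1
  have h2 : ContDiffOn ℂ ω (e.symm ≫ₕ e') (e.symm ≫ₕ e').source := by
    simpa [contDiffPregroupoid] using h
  simpa using h2.restrict_scalars ℝ

theorem lieGroup_real {G : Type*} [TopologicalSpace G] [ChartedSpace E G] [Group G]
    [LieGroup 𝓘(ℂ, E) ω G] : LieGroup 𝓘(ℝ, E) ω G := by
  have := isManifold_real (E := E) (M := G)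
  refine { contMDiff_mul := fun x => ?_, contMDiff_inv := fun x => ?_ }
  · have h := contMDiff_mul 𝓘(ℂ, E) ω (G := G) x
    rw [contMDiffAt_iff] at h ⊢
    refine ⟨h.1, ?_⟩
    have h2 := h.2.restrict_scalars ℝ
    simpa using h2
  · exact ContMDiffAt.restrict_real (contMDiff_inv 𝓘(ℂ, E) ω (G := G) x)

end RestrictScalars

section LieGroupFacts

variable {E : Type*} [NormedAddCommGroup E] [NormedSpace ℂ E]
  {G : Type*} [TopologicalSpace G] [ChartedSpace E G] [Group G] [LieGroup 𝓘(ℂ, E) ω G]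

theorem mdifferentiableAt_conj (g : G) :
    MDifferentiableAt 𝓘(ℂ, E) 𝓘(ℂ, E) (fun x : G => g * x * g⁻¹) 1 := by
  have h : ContMDiff 𝓘(ℂ, E) 𝓘(ℂ, E) ω (fun x : G => g * x * g⁻¹) :=
    (contMDiff_const.mul contMDiff_id).mul contMDiff_const
  exact (h 1).mdifferentiableAt (by simp)

variable (G) in
/-- The multiplication of `G` in the chart around the identity. -/
def chartMul (p : E × E) : E :=
  extChartAt 𝓘(ℂ, E) (1 : G)
    ((extChartAt 𝓘(ℂ, E) (1 : G)).symm p.1 * (extChartAt 𝓘(ℂ, E) (1 : G)).symm p.2)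

variable (G) in
/-- The conjugation of `G` in the chart around the identity. -/
def chartConj (p : E × E) : E :=
  extChartAt 𝓘(ℂ, E) (1 : G)
    ((extChartAt 𝓘(ℂ, E) (1 : G)).symm p.1 * (extChartAt 𝓘(ℂ, E) (1 : G)).symm p.2 *
      ((extChartAt 𝓘(ℂ, E) (1 : G)).symm p.1)⁻¹)

variable (G) in
/-- The image of the identity in the chart around the identity. -/
def chartOne : E := extChartAt 𝓘(ℂ, E) (1 : G) (1 : G)

theorem chart_symm_one :
    (extChartAt 𝓘(ℂ, E) (1 : G)).symm (chartOne (E := E) G) = 1 :=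
  extChartAt_to_inv (I := 𝓘(ℂ, E)) (1 : G)

theorem contMDiffAt_chart_symm :
    ContMDiffAt 𝓘(ℂ, E) 𝓘(ℂ, E) ω (extChartAt 𝓘(ℂ, E) (1 : G)).symm (chartOne (E := E) G) := by
  have h := contMDiffOn_extChartAt_symm (I := 𝓘(ℂ, E)) (n := ω) (1 : G)
  exact h.contMDiffAt (extChartAt_target_mem_nhds (I := 𝓘(ℂ, E)) (1 : G))

theorem contDiffAt_chartMul :
    ContDiffAt ℂ ω (chartMul (E := E) G) (chartOne (E := E) G, chartOne (E := E) G) := by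
  rw [← contMDiffAt_iff_contDiffAt]
  have hs := contMDiffAt_chart_symm (E := E) (G := G)
  have h1 : ContMDiffAt 𝓘(ℂ, E × E) 𝓘(ℂ, E) ω
      (fun p : E × E => (extChartAt 𝓘(ℂ, E) (1 : G)).symm p.1)
      (chartOne (E := E) G, chartOne (E := E) G) :=
    ContMDiffAt.comp (g := (extChartAt 𝓘(ℂ, E) (1 : G)).symm) (f := Prod.fst) _ hs
      contDiffAt_fst.contMDiffAt
  have h2 : ContMDiffAt 𝓘(ℂ, E × E) 𝓘(ℂ, E) ω
      (fun p : E × E => (extChartAt 𝓘(ℂ, E) (1 : G)).symm p.2)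
      (chartOne (E := E) G, chartOne (E := E) G) :=
    ContMDiffAt.comp (g := (extChartAt 𝓘(ℂ, E) (1 : G)).symm) (f := Prod.snd) _ hs
      contDiffAt_snd.contMDiffAt
  have h3 := h1.mul h2
  refine ContMDiffAt.comp (g := extChartAt 𝓘(ℂ, E) (1 : G)) _ ?_ h3
  simp only [chart_symm_one, mul_one]
  exact contMDiffAt_extChartAt

theorem contDiffAt_chartConj :
    ContDiffAt ℂ ω (chartConj (E := E) G) (chartOne (E := E) G, chartOne (E := E) G) := by
  rw [← contMDiffAt_iff_contDiffAt]
  have hs := contMDiffAt_chart_symm (E := E) (G := G)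
  have h1 : ContMDiffAt 𝓘(ℂ, E × E) 𝓘(ℂ, E) ω
      (fun p : E × E => (extChartAt 𝓘(ℂ, E) (1 : G)).symm p.1)
      (chartOne (E := E) G, chartOne (E := E) G) :=
    ContMDiffAt.comp (g := (extChartAt 𝓘(ℂ, E) (1 : G)).symm) (f := Prod.fst) _ hs
      contDiffAt_fst.contMDiffAt
  have h2 : ContMDiffAt 𝓘(ℂ, E × E) 𝓘(ℂ, E) ω
      (fun p : E × E => (extChartAt 𝓘(ℂ, E) (1 : G)).symm p.2)
      (chartOne (E := E) G, chartOne (E := E) G) :=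
    ContMDiffAt.comp (g := (extChartAt 𝓘(ℂ, E) (1 : G)).symm) (f := Prod.snd) _ hs
      contDiffAt_snd.contMDiffAt
  have h3 := (h1.mul h2).mul h1.inv
  refine ContMDiffAt.comp (g := extChartAt 𝓘(ℂ, E) (1 : G)) _ ?_ h3
  simp only [chart_symm_one, mul_one, inv_one]
  exact contMDiffAt_extChartAt

theorem Ad_eq_fderiv (g : G) :
    Ad (E := E) g = fderiv ℂ (fun b => extChartAt 𝓘(ℂ, E) (1 : G)
      (g * (extChartAt 𝓘(ℂ, E) (1 : G)).symm b * g⁻¹)) (chartOne (E := E) G) := by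
  have h := (mdifferentiableAt_conj (E := E) g).mfderiv
  unfold Ad
  refine h.trans ?_
  simp only [writtenInExtChartAt, mul_one, mul_inv_cancel]
  simp only [modelWithCornersSelf_coe, range_id, fderivWithin_univ]
  rfl

theorem mfderiv_eq_fderiv {F : Type*} [NormedAddCommGroup F] [NormedSpace ℂ F] {f : G → F}
    (hf : MDifferentiableAt 𝓘(ℂ, E) 𝓘(ℂ, F) f 1) :
    (mfderiv 𝓘(ℂ, E) 𝓘(ℂ, F) f 1 : E →L[ℂ] F) =
      fderiv ℂ (f ∘ (extChartAt 𝓘(ℂ, E) (1 : G)).symm) (chartOne (E := E) G) := by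
  refine hf.mfderiv.trans ?_
  simp only [writtenInExtChartAt, modelWithCornersSelf_coe, range_id, fderivWithin_univ]
  rfl

theorem chartMul_one_right {b : E} (hb : b ∈ (extChartAt 𝓘(ℂ, E) (1 : G)).target) :
    chartMul G (b, chartOne (E := E) G) = b := by
  simp only [chartMul, chart_symm_one, mul_one]
  exact (extChartAt 𝓘(ℂ, E) (1 : G)).right_inv hb

theorem chartMul_one_left {b : E} (hb : b ∈ (extChartAt 𝓘(ℂ, E) (1 : G)).target) :
    chartMul G (chartOne (E := E) G, b) = b := by
  simp only [chartMul, chart_symm_one, one_mul]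
  exact (extChartAt 𝓘(ℂ, E) (1 : G)).right_inv hb

theorem chart_target_mem_nhds :
    (extChartAt 𝓘(ℂ, E) (1 : G)).target ∈ 𝓝 (chartOne (E := E) G) :=
  extChartAt_target_mem_nhds (I := 𝓘(ℂ, E)) (1 : G)

theorem chart_symm_mem_source {a : E} (ha : a ∈ (extChartAt 𝓘(ℂ, E) (1 : G)).target) :
    (extChartAt 𝓘(ℂ, E) (1 : G)).symm a ∈ (extChartAt 𝓘(ℂ, E) (1 : G)).source :=
  (extChartAt 𝓘(ℂ, E) (1 : G)).map_target ha

/-- The pullback to the chart of a left invariant vector field. -/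
theorem mpullback_invariant (v : E) {a : E} (ha : a ∈ (extChartAt 𝓘(ℂ, E) (1 : G)).target) :
    VectorField.mpullbackWithin 𝓘(ℂ, E) 𝓘(ℂ, E) (extChartAt 𝓘(ℂ, E) (1 : G)).symm
      (mulInvariantVectorField (I := 𝓘(ℂ, E)) (G := G) v) (range 𝓘(ℂ, E)) a =
      fderiv ℂ (fun b => chartMul G (a, b)) (chartOne (E := E) G) v := by
  rw [VectorField.mpullbackWithin_apply]
  rw [ContinuousLinearMap.inverse_eq
    (mfderivWithin_extChartAt_symm_comp_mfderiv_extChartAt (I := 𝓘(ℂ, E)) ha)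
    (mfderiv_extChartAt_comp_mfderivWithin_extChartAt_symm (I := 𝓘(ℂ, E)) ha)]
  have hs := chart_symm_mem_source ha
  set g := (extChartAt 𝓘(ℂ, E) (1 : G)).symm a with hg
  have hL : ContMDiff 𝓘(ℂ, E) 𝓘(ℂ, E) ω (fun x : G => g * x) := contMDiff_const.mul contMDiff_id
  have h1 : MDifferentiableAt 𝓘(ℂ, E) 𝓘(ℂ, E) (fun x : G => g * x) 1 :=
    (hL 1).mdifferentiableAt (by simp)
  have h2 : MDifferentiableAt 𝓘(ℂ, E) 𝓘(ℂ, E) (extChartAt 𝓘(ℂ, E) (1 : G)) (g * 1) := by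
    rw [mul_one]
    exact mdifferentiableAt_extChartAt (by simpa using hs)
  have h3 := mfderiv_comp (I' := 𝓘(ℂ, E)) (1 : G) h2 h1
  have h4 := mfderiv_eq_fderiv (h2.comp (1 : G) h1)
  have h5 : (fun b => chartMul G (a, b)) =
    ((extChartAt 𝓘(ℂ, E) (1 : G)) ∘ fun x : G => g * x) ∘ (extChartAt 𝓘(ℂ, E) (1 : G)).symm := by
    ext b
    simp [chartMul, hg]
  rw [h5, ← h4, h3]
  simp only [mulInvariantVectorField]
  have h6 : ∀ p : G, p = g → ∀ w : E,
      (mfderiv 𝓘(ℂ, E) 𝓘(ℂ, E) (extChartAt 𝓘(ℂ, E) (1 : G)) p : E →L[ℂ] E) w =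
      (mfderiv 𝓘(ℂ, E) 𝓘(ℂ, E) (extChartAt 𝓘(ℂ, E) (1 : G)) g : E →L[ℂ] E) w := by
    rintro p rfl w
    rfl
  exact (h6 _ (mul_one g) _).symm

theorem bracket_eq_chart (X Y : E) :
    bracket G X Y = fderiv ℂ (fun a => fderiv ℂ (fun b => chartMul G (a, b))
        (chartOne (E := E) G) Y) (chartOne (E := E) G) X
      - fderiv ℂ (fun a => fderiv ℂ (fun b => chartMul G (a, b))
        (chartOne (E := E) G) X) (chartOne (E := E) G) Y := by
  unfold bracket
  change (VectorField.mlieBracket 𝓘(ℂ, E) (mulInvariantVectorField (I := 𝓘(ℂ, E)) (G := G) X)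
    (mulInvariantVectorField (I := 𝓘(ℂ, E)) (G := G) Y) (1 : G) : E) = _
  rw [← VectorField.mlieBracketWithin_univ,
    VectorField.mlieBracketWithin_apply, mfderiv_extChartAt_self]
  simp only [modelWithCornersSelf_coe, range_id, preimage_univ, inter_self]
  have key : ∀ V : E, (fun y : E => (VectorField.mpullbackWithin 𝓘(ℂ, E) 𝓘(ℂ, E)
      (extChartAt 𝓘(ℂ, E) (1 : G)).symm
      (mulInvariantVectorField (I := 𝓘(ℂ, E)) (G := G) V) univ y : E))
      =ᶠ[𝓝 (chartOne (E := E) G)]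
      fun a => fderiv ℂ (fun b => chartMul G (a, b)) (chartOne (E := E) G) V := by
    intro V
    filter_upwards [chart_target_mem_nhds (E := E) (G := G)] with a ha
    have := mpullback_invariant V ha
    rw [modelWithCornersSelf_coe, range_id] at this
    exact this
  have e1 := (key X).fderiv_eq (𝕜 := ℂ)
  have e2 := (key Y).fderiv_eq (𝕜 := ℂ)
  have f1 := (key X).eq_of_nhds
  have f2 := (key Y).eq_of_nhds
  have o : ∀ V : E, fderiv ℂ (fun b => chartMul G (chartOne (E := E) G, b))
      (chartOne (E := E) G) V = V := by
    intro V
    have : (fun b => chartMul G (chartOne (E := E) G, b)) =ᶠ[𝓝 (chartOne (E := E) G)] id := by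
      filter_upwards [chart_target_mem_nhds (E := E) (G := G)] with a ha
      exact chartMul_one_left ha
    rw [this.fderiv_eq]
    simp
  rw [o] at f1 f2
  have : ∀ V W : E → E, VectorField.lieBracketWithin ℂ V W univ (chartOne (E := E) G) =
      fderiv ℂ W (chartOne (E := E) G) (V (chartOne (E := E) G)) -
      fderiv ℂ V (chartOne (E := E) G) (W (chartOne (E := E) G)) := by
    intro V W
    rw [VectorField.lieBracketWithin_univ, VectorField.lieBracket]
  have h := this (fun y : E => (VectorField.mpullbackWithin 𝓘(ℂ, E) 𝓘(ℂ, E)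
      (extChartAt 𝓘(ℂ, E) (1 : G)).symm
      (mulInvariantVectorField (I := 𝓘(ℂ, E)) (G := G) X) univ y : E))
      (fun y : E => (VectorField.mpullbackWithin 𝓘(ℂ, E) 𝓘(ℂ, E)
      (extChartAt 𝓘(ℂ, E) (1 : G)).symm
      (mulInvariantVectorField (I := 𝓘(ℂ, E)) (G := G) Y) univ y : E))
  rw [f1, f2, e1, e2] at h
  rw [← h]
  have i1 : (ContinuousLinearMap.id ℂ E).inverse = ContinuousLinearMap.id ℂ E :=
    ContinuousLinearMap.inverse_id
  exact congrArg (fun L : E →L[ℂ] E => L _) i1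

theorem chart_Ad_eq : ∀ᶠ a in 𝓝 (chartOne (E := E) G),
    (Ad (E := E) ((extChartAt 𝓘(ℂ, E) (1 : G)).symm a) : E →L[ℂ] E) =
    (fderiv ℂ (chartConj (E := E) G) (a, chartOne (E := E) G)).comp
      (ContinuousLinearMap.inr ℂ E E) := by
  have h1 : ∀ᶠ p in 𝓝 (chartOne (E := E) G, chartOne (E := E) G),
      ContDiffAt ℂ ω (chartConj (E := E) G) p := contDiffAt_chartConj.eventually (by simp)
  have hc : ContinuousAt (fun a : E => (a, chartOne (E := E) G)) (chartOne (E := E) G) := by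
    fun_prop
  filter_upwards [hc.eventually h1] with a ha
  rw [Ad_eq_fderiv]
  have h2 : HasFDerivAt (fun b : E => (a, b)) (ContinuousLinearMap.inr ℂ E E)
    (chartOne (E := E) G) := hasFDerivAt_prodMk_right a _
  exact ((ha.differentiableAt (by simp)).hasFDerivAt.comp _ h2).fderiv

/-- Close to the identity, `R_a ∘ Ad_a = L_a` in the chart. -/
theorem chart_Ad_relation : ∀ᶠ a in 𝓝 (chartOne (E := E) G), ∀ Y : E,
    fderiv ℂ (chartMul (E := E) G) (chartOne (E := E) G, a)
      (Ad (E := E) ((extChartAt 𝓘(ℂ, E) (1 : G)).symm a) Y, 0) =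
    fderiv ℂ (chartMul (E := E) G) (a, chartOne (E := E) G) (0, Y) := by
  have h1 : ∀ᶠ p in 𝓝 (chartOne (E := E) G, chartOne (E := E) G),
      ContDiffAt ℂ ω (chartConj (E := E) G) p := contDiffAt_chartConj.eventually (by simp)
  have h2 : ∀ᶠ p in 𝓝 (chartOne (E := E) G, chartOne (E := E) G),
      ContDiffAt ℂ ω (chartMul (E := E) G) p := contDiffAt_chartMul.eventually (by simp)
  have hc : ContinuousAt (fun a : E => (a, chartOne (E := E) G)) (chartOne (E := E) G) := by
    fun_prop
  have hc' : ContinuousAt (fun a : E => (chartOne (E := E) G, a)) (chartOne (E := E) G) := by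
    fun_prop
  filter_upwards [hc.eventually h1, hc.eventually h2, hc'.eventually h2, chart_Ad_eq (E := E)
    (G := G), chart_target_mem_nhds (E := E) (G := G)] with a ha1 ha2 ha3 ha4 ha5 Y
  have hb : HasFDerivAt (fun b : E => (a, b)) (ContinuousLinearMap.inr ℂ E E)
    (chartOne (E := E) G) := hasFDerivAt_prodMk_right a _
  have c1 : HasFDerivAt (fun b : E => chartConj G (a, b))
      (Ad (E := E) ((extChartAt 𝓘(ℂ, E) (1 : G)).symm a)) (chartOne (E := E) G) := by
    rw [ha4]
    exact (ha1.differentiableAt (by simp)).hasFDerivAt.comp _ hb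
  have v1 : chartConj G (a, chartOne (E := E) G) = chartOne (E := E) G := by
    simp [chartConj, chartOne]
  have c2 : HasFDerivAt (fun b : E => (chartConj G (a, b), a))
      ((Ad (E := E) ((extChartAt 𝓘(ℂ, E) (1 : G)).symm a)).prod 0) (chartOne (E := E) G) :=
    c1.prodMk (hasFDerivAt_const a _)
  have c3 : HasFDerivAt (chartMul (E := E) G)
      (fderiv ℂ (chartMul (E := E) G) (chartOne (E := E) G, a))
      ((fun b : E => (chartConj G (a, b), a)) (chartOne (E := E) G)) := by
    simp only [v1]
    exact (ha3.differentiableAt (by simp)).hasFDerivAt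
  have c4 := HasFDerivAt.comp (f := fun b : E => (chartConj G (a, b), a)) (chartOne G) c3 c2
  have c5 := (ha2.differentiableAt (by simp)).hasFDerivAt.comp _ hb
  have hcs : ContinuousAt (fun b : E => (extChartAt 𝓘(ℂ, E) (1 : G)).symm a *
      (extChartAt 𝓘(ℂ, E) (1 : G)).symm b * ((extChartAt 𝓘(ℂ, E) (1 : G)).symm a)⁻¹)
      (chartOne (E := E) G) := by
    have := topologicalGroup_of_lieGroup 𝓘(ℂ, E) ω (G := G)
    have := (contMDiffAt_chart_symm (E := E) (G := G)).continuousAt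
    exact (continuousAt_const.mul this).mul continuousAt_const
  have hev : (fun b : E => chartMul G (chartConj G (a, b), a)) =ᶠ[𝓝 (chartOne (E := E) G)]
      fun b => chartMul G (a, b) := by
    have hn : (extChartAt 𝓘(ℂ, E) (1 : G)).source ∈ 𝓝 ((extChartAt 𝓘(ℂ, E) (1 : G)).symm a *
      (extChartAt 𝓘(ℂ, E) (1 : G)).symm (chartOne (E := E) G) *
        ((extChartAt 𝓘(ℂ, E) (1 : G)).symm a)⁻¹) := by
      simp only [chart_symm_one, mul_one, mul_inv_cancel]
      exact extChartAt_source_mem_nhds (I := 𝓘(ℂ, E)) (1 : G)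
    filter_upwards [hcs.eventually_mem hn] with b hb
    simp only [chartMul, chartConj]
    rw [(extChartAt 𝓘(ℂ, E) (1 : G)).left_inv hb]
    simp
  have := (c4.congr_of_eventuallyEq hev.symm).unique c5
  simpa using DFunLike.congr_fun this Y

variable [FiniteDimensional ℂ E]

variable (G) in
/-- The adjoint representation of the Lie algebra as a continuous bilinear map. -/
def adL : E →L[ℂ] E →L[ℂ] E :=
  LinearMap.toContinuousLinearMap
    { toFun := adCLM G
      map_add' := fun X Y => by
        ext Z
        exact add_lie (L := GroupLieAlgebra 𝓘(ℂ, E) G) (M := GroupLieAlgebra 𝓘(ℂ, E) G) X Y Z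
      map_smul' := fun c X => by
        ext Z
        exact smul_lie (R := ℂ) (L := GroupLieAlgebra 𝓘(ℂ, E) G)
          (M := GroupLieAlgebra 𝓘(ℂ, E) G) c X Z }

theorem adL_apply (X Y : E) : adL G X Y = bracket G X Y := rfl

variable (G) in
/-- The adjoint action in the chart. -/
def chartAd (a : E) : E →L[ℂ] E :=
  (fderiv ℂ (chartConj (E := E) G) (a, chartOne (E := E) G)).comp (ContinuousLinearMap.inr ℂ E E)

theorem contDiffAt_chartAd : ContDiffAt ℂ ω (chartAd (E := E) G) (chartOne (E := E) G) := by
  have h1 : ContDiffAt ℂ ω (fderiv ℂ (chartConj (E := E) G))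
      (chartOne (E := E) G, chartOne (E := E) G) :=
    contDiffAt_chartConj.fderiv_right (by simp)
  have h2 : ContDiffAt ℂ ω (fun a : E => fderiv ℂ (chartConj (E := E) G) (a, chartOne (E := E) G))
      (chartOne (E := E) G) :=
    ContDiffAt.comp (g := fderiv ℂ (chartConj (E := E) G))
      (f := fun a : E => (a, chartOne (E := E) G)) _ h1 (by fun_prop)
  exact h2.clm_comp contDiffAt_const

theorem Ad_eventuallyEq : (fun g : G => (Ad (E := E) g : E →L[ℂ] E)) =ᶠ[𝓝 (1 : G)]
    fun g => chartAd G (extChartAt 𝓘(ℂ, E) (1 : G) g) := by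
  have hc : ContinuousAt (extChartAt 𝓘(ℂ, E) (1 : G)) 1 := continuousAt_extChartAt (1 : G)
  filter_upwards [hc.eventually (chart_Ad_eq (E := E) (G := G)),
    extChartAt_source_mem_nhds (I := 𝓘(ℂ, E)) (1 : G)] with g hg hs
  rw [(extChartAt 𝓘(ℂ, E) (1 : G)).left_inv hs] at hg
  exact hg

theorem contMDiffAt_Ad_one :
    ContMDiffAt 𝓘(ℂ, E) 𝓘(ℂ, E →L[ℂ] E) ω (fun g : G => (Ad (E := E) g : E →L[ℂ] E)) 1 := by
  refine ContMDiffAt.congr_of_eventuallyEq ?_ Ad_eventuallyEq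
  exact ContMDiffAt.comp (g := chartAd (E := E) G) _ contDiffAt_chartAd.contMDiffAt
    contMDiffAt_extChartAt

theorem Ad_one : (Ad (1 : G) : E →L[ℂ] E) = ContinuousLinearMap.id ℂ E := by
  unfold Ad
  have : (fun x : G => 1 * x * 1⁻¹) = id := by ext; simp
  rw [this]
  exact mfderiv_id

theorem hasFDerivAt_chartAd : HasFDerivAt (chartAd (E := E) G) (adL G) (chartOne (E := E) G) := by
  set o := chartOne (E := E) G with ho
  set M := fderiv ℂ (chartMul (E := E) G) with hM
  have hF := (contDiffAt_chartAd (E := E) (G := G)).differentiableAt (by simp)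
  rw [← ho] at hF
  have hMd : DifferentiableAt ℂ M (o, o) :=
    ((contDiffAt_chartMul (E := E) (G := G)).fderiv_right (m := ω) (by simp)).differentiableAt
      (by simp)
  have hF1 : chartAd G o = ContinuousLinearMap.id ℂ E := by
    have := (Ad_eventuallyEq (E := E) (G := G)).eq_of_nhds
    rw [← Ad_one (G := G), this]
    rfl
  have hid : ∀ Z : E, M (o, o) (Z, 0) = Z := by
    intro Z
    have h1 := HasFDerivAt.comp (f := fun a : E => (a, o)) o
      ((contDiffAt_chartMul (E := E) (G := G)).differentiableAt (by simp)).hasFDerivAt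
      (hasFDerivAt_prodMk_left o o)
    have h2 : (chartMul (E := E) G ∘ fun a => (a, chartOne (E := E) G)) =ᶠ[𝓝 o] id := by
      filter_upwards [chart_target_mem_nhds (E := E) (G := G)] with a ha
      exact chartMul_one_right ha
    have h3 := (hasFDerivAt_id (𝕜 := ℂ) o).congr_of_eventuallyEq h2
    have := DFunLike.congr_fun (h1.unique h3) Z
    simpa using this
  have hsym : ∀ X Y : E, fderiv ℂ M (o, o) (0, X) (Y, 0) = fderiv ℂ M (o, o) (Y, 0) (0, X) := by
    intro X Y
    have := (contDiffAt_chartMul (E := E) (G := G)).isSymmSndFDerivAt (by simp)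
    exact this.eq _ _
  have d1 : ∀ Y : E, HasFDerivAt (fun a => M (a, o) (0, Y))
      ((((fderiv ℂ M (o, o)).comp (ContinuousLinearMap.inl ℂ E E))).flip (0, Y)) o := by
    intro Y
    have := (HasFDerivAt.comp (f := fun a : E => (a, o)) o hMd.hasFDerivAt
      (hasFDerivAt_prodMk_left o o)).clm_apply
      (hasFDerivAt_const ((0 : E), Y) o)
    refine this.congr_fderiv ?_
    ext X
    simp
  have hbr : ∀ X Y : E, bracket G X Y =
      fderiv ℂ M (o, o) (X, 0) (0, Y) - fderiv ℂ M (o, o) (Y, 0) (0, X) := by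
    intro X Y
    have h2 : ∀ᶠ p in 𝓝 (o, o),
      ContDiffAt ℂ ω (chartMul (E := E) G) p := contDiffAt_chartMul.eventually (by simp)
    have hc : ContinuousAt (fun a : E => (a, o)) o := by fun_prop
    have e : ∀ Y : E, (fun a => fderiv ℂ (fun b => chartMul G (a, b)) o Y) =ᶠ[𝓝 o]
        fun a => M (a, o) (0, Y) := by
      intro Y
      filter_upwards [hc.eventually h2] with a ha
      have h2 : HasFDerivAt (fun b : E => (a, b)) (ContinuousLinearMap.inr ℂ E E) o :=
        hasFDerivAt_prodMk_right a _
      have h3 : HasFDerivAt (fun b => chartMul G (a, b)) _ o :=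
        (ha.differentiableAt (by simp)).hasFDerivAt.comp _ h2
      rw [h3.fderiv]
      simp [hM]
    rw [bracket_eq_chart, (e X).fderiv_eq, (e Y).fderiv_eq, (d1 X).fderiv, (d1 Y).fderiv]
    simp
  refine hF.hasFDerivAt.congr_fderiv ?_
  ext X Y
  rw [adL_apply, hbr]
  have d2 : HasFDerivAt (fun a => M (o, a) (chartAd G a Y, 0)) _ o :=
    (hMd.hasFDerivAt.comp o (hasFDerivAt_prodMk_right o o)).clm_apply
      ((hF.hasFDerivAt.clm_apply (hasFDerivAt_const Y o)).prodMk (hasFDerivAt_const (0 : E) o))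
  have hev : (fun a => M (a, o) (0, Y)) =ᶠ[𝓝 o] fun a => M (o, a) (chartAd G a Y, 0) := by
    filter_upwards [chart_Ad_relation (E := E) (G := G), chart_Ad_eq (E := E) (G := G)]
      with a h1 h2
    rw [← h1 Y, h2]
    rfl
  have := DFunLike.congr_fun ((d2.congr_of_eventuallyEq hev).unique (d1 Y)) X
  simp only [Function.comp_apply, add_apply, ContinuousLinearMap.comp_apply,
    ContinuousLinearMap.flip_apply, ContinuousLinearMap.inl_apply, ContinuousLinearMap.inr_apply,
    ContinuousLinearMap.prod_apply, zero_apply, hF1,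
    ContinuousLinearMap.id_apply, map_zero, zero_add, hid, hsym] at this
  rw [← this]
  abel

theorem hasMFDerivAt_Ad_one :
    HasMFDerivAt 𝓘(ℂ, E) 𝓘(ℂ, E →L[ℂ] E) (fun g : G => (Ad (E := E) g : E →L[ℂ] E)) 1
      (adL G : E →L[ℂ] E →L[ℂ] E) := by
  refine HasMFDerivAt.congr_of_eventuallyEq ?_ Ad_eventuallyEq
  have h1 : HasMFDerivAt 𝓘(ℂ, E) 𝓘(ℂ, E) (extChartAt 𝓘(ℂ, E) (1 : G)) 1
      (ContinuousLinearMap.id ℂ E) := by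
    have := (mdifferentiableAt_extChartAt (I := 𝓘(ℂ, E)) (mem_chart_source E (1 : G))).hasMFDerivAt
    rw [mfderiv_extChartAt_self] at this
    exact this
  have h2 := HasMFDerivAt.comp (1 : G) (g := chartAd (E := E) G)
    (hasFDerivAt_chartAd (E := E) (G := G)).hasMFDerivAt h1
  exact h2

theorem Ad_mul (g h : G) : (Ad (g * h) : E →L[ℂ] E) = (Ad g).comp (Ad h) := by
  have h3 : (fun x : G => g * h * x * (g * h)⁻¹) =
      (fun x : G => g * x * g⁻¹) ∘ fun x => h * x * h⁻¹ := by
    ext x; simp [mul_assoc]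
  have h4 : HasMFDerivAt 𝓘(ℂ, E) 𝓘(ℂ, E) (fun x : G => g * x * g⁻¹)
      ((fun x : G => h * x * h⁻¹) 1) (Ad g : E →L[ℂ] E) := by
    have e : ∀ p : G, p = 1 → HasMFDerivAt 𝓘(ℂ, E) 𝓘(ℂ, E) (fun x : G => g * x * g⁻¹) p
        (Ad g : E →L[ℂ] E) := by
      rintro _ rfl
      exact (mdifferentiableAt_conj (E := E) g).hasMFDerivAt
    exact e _ (by simp)
  have h5 := HasMFDerivAt.comp (1 : G) h4 (mdifferentiableAt_conj (E := E) h).hasMFDerivAt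
  rw [← h3] at h5
  exact h5.mfderiv

theorem Ad_mul_apply (g h : G) (X : E) : Ad (g * h) X = Ad g (Ad h X) := by
  rw [Ad_mul]; rfl

theorem Ad_inv_Ad (g : G) (X : E) : Ad g⁻¹ (Ad g X) = X := by
  rw [← Ad_mul_apply]; simp [Ad_one]

theorem Ad_Ad_inv (g : G) (X : E) : Ad g (Ad g⁻¹ X) = X := by
  rw [← Ad_mul_apply]; simp [Ad_one]

theorem contMDiff_Ad :
    ContMDiff 𝓘(ℂ, E) 𝓘(ℂ, E →L[ℂ] E) ω (fun g : G => (Ad (E := E) g : E →L[ℂ] E)) := by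
  intro g
  have h1 : (fun x : G => (Ad x : E →L[ℂ] E)) =
      (fun L : E →L[ℂ] E => (Ad g).comp L) ∘ (fun x : G => (Ad x : E →L[ℂ] E)) ∘
        fun x => g⁻¹ * x := by
    ext x Y
    simp only [Function.comp_apply, ← Ad_mul]
    simp
  rw [h1]
  have h2 : ContMDiffAt 𝓘(ℂ, E) 𝓘(ℂ, E) ω (fun x : G => g⁻¹ * x) g :=
    (contMDiff_const.mul contMDiff_id) g
  have h3 : ContMDiffAt 𝓘(ℂ, E) 𝓘(ℂ, E →L[ℂ] E) ω (fun g : G => (Ad (E := E) g : E →L[ℂ] E))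
      ((fun x : G => g⁻¹ * x) g) := by
    simp only [inv_mul_cancel]
    exact contMDiffAt_Ad_one
  have h4 : ContDiff ℂ ω (fun L : E →L[ℂ] E => (Ad g).comp L) := by fun_prop
  exact h4.contMDiff.contMDiffAt.comp g (h3.comp g h2)

end LieGroupFacts
end MixedBF

namespace MixedBF

section RealLie

variable {E : Type*} [NormedAddCommGroup E] [NormedSpace ℂ E] [FiniteDimensional ℂ E]
  {G : Type*} [TopologicalSpace G] [ChartedSpace E G] [Group G] [LieGroup 𝓘(ℂ, E) ω G]
  {F : Type*} [NormedAddCommGroup F] [NormedSpace ℝ F]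

theorem coAd_apply (g : G) (φ : StrongDual ℂ E) (X : E) : coAd g φ X = φ (Ad g⁻¹ X) := rfl

theorem coad_apply (X : E) (φ : StrongDual ℂ E) (Y : E) : coad G X φ Y = -φ (bracket G X Y) := rfl

theorem bracket_skew (X Y : E) : bracket G X Y = -bracket G Y X :=
  (lie_skew (L := GroupLieAlgebra 𝓘(ℂ, E) G) X Y).symm

theorem bracket_jacobi (X Y Z : E) :
    bracket G X (bracket G Y Z) = bracket G (bracket G X Y) Z + bracket G Y (bracket G X Z) :=
  leibniz_lie (L₁ := GroupLieAlgebra 𝓘(ℂ, E) G) (L₂ := GroupLieAlgebra 𝓘(ℂ, E) G)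
    (M := GroupLieAlgebra 𝓘(ℂ, E) G) X Y Z

theorem coAd_mul (g h : G) (φ : StrongDual ℂ E) : coAd (g * h) φ = coAd g (coAd h φ) := by
  ext X
  simp only [coAd_apply, mul_inv_rev, Ad_mul_apply]

theorem coAd_one (φ : StrongDual ℂ E) : coAd (1 : G) φ = φ := by
  ext X
  simp [coAd_apply, Ad_one]

theorem Ad_bracket (g : G) (X Y : E) : Ad g (bracket G X Y) = bracket G (Ad g X) (Ad g Y) := by
  have h1 : HasMFDerivAt 𝓘(ℂ, E) 𝓘(ℂ, E →L[ℂ] E) (fun x : G => (Ad (E := E) x : E →L[ℂ] E))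
      ((fun x : G => g * x * g⁻¹) 1) (adL G : E →L[ℂ] E →L[ℂ] E) := by
    have e : ∀ p : G, p = 1 → HasMFDerivAt 𝓘(ℂ, E) 𝓘(ℂ, E →L[ℂ] E)
        (fun x : G => (Ad (E := E) x : E →L[ℂ] E)) p (adL G : E →L[ℂ] E →L[ℂ] E) := by
      rintro _ rfl
      exact hasMFDerivAt_Ad_one
    exact e _ (by simp)
  have h2 := HasMFDerivAt.comp (1 : G) h1 (mdifferentiableAt_conj (E := E) g).hasMFDerivAt
  let T : (E →L[ℂ] E) →L[ℂ] (E →L[ℂ] E) :=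
    (ContinuousLinearMap.compL ℂ E E E (Ad g)).comp
      ((ContinuousLinearMap.compL ℂ E E E).flip (Ad g⁻¹))
  have h3 := HasMFDerivAt.comp (1 : G) T.hasFDerivAt.hasMFDerivAt
    (hasMFDerivAt_Ad_one (E := E) (G := G))
  have h4 : (T ∘ fun x : G => (Ad (E := E) x : E →L[ℂ] E)) =
      (fun x : G => (Ad (E := E) x : E →L[ℂ] E)) ∘ fun x : G => g * x * g⁻¹ := by
    ext x Z
    simp [T, Ad_mul_apply]
  rw [h4] at h3
  have h5 : (T.comp (adL G : E →L[ℂ] E →L[ℂ] E)) = (adL G : E →L[ℂ] E →L[ℂ] E).comp (Ad g) :=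
    hasMFDerivAt_unique h3 h2
  have h6 := DFunLike.congr_fun (DFunLike.congr_fun h5 X) (Ad g Y)
  simpa [T, adL_apply, Ad_inv_Ad] using h6

theorem coAd_coad (g : G) (X : E) (φ : StrongDual ℂ E) :
    coAd g (coad G X φ) = coad G (Ad g X) (coAd g φ) := by
  ext Y
  simp only [coAd_apply, coad_apply]
  rw [Ad_bracket, Ad_inv_Ad]

/-- The derivative of `Ad ∘ f`. -/
theorem hasFDerivAt_Ad_comp {f : F → G} {w : F}
    (hf : MDifferentiableAt 𝓘(ℝ, F) 𝓘(ℝ, E) f w) :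
    HasFDerivAt (fun y => (Ad (f y) : E →L[ℂ] E))
      ((((ContinuousLinearMap.compL ℂ E E E).flip (Ad (f w))).comp (adL G)).restrictScalars ℝ ∘L
        (mfderiv 𝓘(ℝ, F) 𝓘(ℝ, E) (fun y => f y * (f w)⁻¹) w : F →L[ℝ] E)) w := by
  have := lieGroup_real (E := E) (G := G)
  have hr : ContMDiff 𝓘(ℝ, E) 𝓘(ℝ, E) ω (fun x : G => x * (f w)⁻¹) :=
    contMDiff_id.mul contMDiff_const
  have hf2 : MDifferentiableAt 𝓘(ℝ, F) 𝓘(ℝ, E) (fun y => f y * (f w)⁻¹) w :=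
    MDifferentiableAt.comp w (g := fun x : G => x * (f w)⁻¹)
      ((hr _).mdifferentiableAt (by simp)) hf
  have h1 : HasMFDerivAt 𝓘(ℝ, E) 𝓘(ℝ, E →L[ℂ] E) (fun x : G => (Ad (E := E) x : E →L[ℂ] E))
      (f w * (f w)⁻¹) ((adL G : E →L[ℂ] E →L[ℂ] E).restrictScalars ℝ) := by
    have e : ∀ p : G, p = 1 → HasMFDerivAt 𝓘(ℝ, E) 𝓘(ℝ, E →L[ℂ] E)
        (fun x : G => (Ad (E := E) x : E →L[ℂ] E)) p
        ((adL G : E →L[ℂ] E →L[ℂ] E).restrictScalars ℝ : E →L[ℝ] E →L[ℂ] E) := by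
      rintro _ rfl
      exact HasMFDerivAt.restrict_real (hasMFDerivAt_Ad_one (E := E) (G := G))
    exact e _ (by simp)
  have h2 := HasMFDerivAt.comp w (f := fun y => f y * (f w)⁻¹) h1 hf2.hasMFDerivAt
  have h3 : HasFDerivAt (fun y => (Ad (f y * (f w)⁻¹) : E →L[ℂ] E))
      (((adL G : E →L[ℂ] E →L[ℂ] E).restrictScalars ℝ : E →L[ℝ] E →L[ℂ] E) ∘L
        (mfderiv 𝓘(ℝ, F) 𝓘(ℝ, E) (fun y => f y * (f w)⁻¹) w : F →L[ℝ] E)) w :=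
    hasMFDerivAt_iff_hasFDerivAt.1 h2
  have h4 := (((ContinuousLinearMap.compL ℂ E E E).flip (Ad (f w))).restrictScalars
    ℝ).hasFDerivAt.comp w h3
  have h5 : (⇑(((ContinuousLinearMap.compL ℂ E E E).flip (Ad (f w))).restrictScalars ℝ) ∘
      fun y => (Ad (f y * (f w)⁻¹) : E →L[ℂ] E)) = fun y => (Ad (f y) : E →L[ℂ] E) := by
    ext y Z
    simp [← Ad_mul_apply]
  rw [h5] at h4
  exact h4

theorem fderiv_Ad_comp {f : F → G} {w : F}
    (hf : MDifferentiableAt 𝓘(ℝ, F) 𝓘(ℝ, E) f w) (v : F) (Y : E) :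
    fderiv ℝ (fun y => (Ad (f y) : E →L[ℂ] E)) w v Y =
      bracket G (rightLogDeriv f w v) (Ad (f w) Y) := by
  rw [(hasFDerivAt_Ad_comp hf).fderiv]
  rfl

theorem contDiffAt_Ad_comp {n : WithTop ℕ∞} {f : F → G} {w : F}
    (hf : ContMDiffAt 𝓘(ℝ, F) 𝓘(ℝ, E) n f w) :
    ContDiffAt ℝ n (fun y => (Ad (f y) : E →L[ℂ] E)) w := by
  rw [← contMDiffAt_iff_contDiffAt]
  exact ContMDiffAt.comp w ((ContMDiffAt.restrict_real (contMDiff_Ad (E := E) (f w))).of_le le_top) hf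

theorem mfderiv_mul_of_eq_one {a b : F → G} {w : F} {a' b' : F →L[ℝ] E}
    (ha : HasMFDerivAt 𝓘(ℝ, F) 𝓘(ℝ, E) a w a') (hb : HasMFDerivAt 𝓘(ℝ, F) 𝓘(ℝ, E) b w b')
    (ha1 : a w = 1) (hb1 : b w = 1) :
    HasMFDerivAt 𝓘(ℝ, F) 𝓘(ℝ, E) (fun y => a y * b y) w (a' + b') := by
  have := lieGroup_real (E := E) (G := G)
  have hm : MDifferentiableAt (𝓘(ℝ, E).prod 𝓘(ℝ, E)) 𝓘(ℝ, E) (fun p : G × G => p.1 * p.2)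
      ((1 : G), (1 : G)) := (contMDiff_mul 𝓘(ℝ, E) ω (G := G)).mdifferentiableAt (by simp)
  have h1 : HasMFDerivAt (𝓘(ℝ, E).prod 𝓘(ℝ, E)) 𝓘(ℝ, E) (fun p : G × G => p.1 * p.2)
      ((1 : G), (1 : G))
      (ContinuousLinearMap.fst ℝ E E + ContinuousLinearMap.snd ℝ E E : E × E →L[ℝ] E) := by
    have h2 : ∀ X : E × E, (mfderiv (𝓘(ℝ, E).prod 𝓘(ℝ, E)) 𝓘(ℝ, E)
        (fun p : G × G => p.1 * p.2) ((1 : G), (1 : G)) : E × E →L[ℝ] E) X = X.1 + X.2 := by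
      intro X
      refine (mfderiv_prod_eq_add_apply hm).trans ?_
      have e1 : (fun z : G => z * 1) = id := by ext; simp
      have e2 : (fun z : G => 1 * z) = id := by ext; simp
      have e : ∀ f : G → G, f = id → ∀ Y : E,
          (mfderiv 𝓘(ℝ, E) 𝓘(ℝ, E) f (1 : G) : E →L[ℝ] E) Y = Y := by
        rintro _ rfl Y
        rw [mfderiv_id]
        rfl
      exact congrArg₂ (· + ·) (e _ e1 X.1) (e _ e2 X.2)
    have h3 : (mfderiv (𝓘(ℝ, E).prod 𝓘(ℝ, E)) 𝓘(ℝ, E)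
        (fun p : G × G => p.1 * p.2) ((1 : G), (1 : G)) : E × E →L[ℝ] E) =
        ContinuousLinearMap.fst ℝ E E + ContinuousLinearMap.snd ℝ E E := by
      exact ContinuousLinearMap.ext fun X => h2 X
    have h4 := hm.hasMFDerivAt
    exact h3 ▸ h4
  have h5 : HasMFDerivAt 𝓘(ℝ, F) (𝓘(ℝ, E).prod 𝓘(ℝ, E)) (fun y => (a y, b y)) w
      (a'.prod b' : F →L[ℝ] E × E) := ha.prodMk hb
  have h6 : HasMFDerivAt (𝓘(ℝ, E).prod 𝓘(ℝ, E)) 𝓘(ℝ, E) (fun p : G × G => p.1 * p.2)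
      ((fun y => (a y, b y)) w)
      (ContinuousLinearMap.fst ℝ E E + ContinuousLinearMap.snd ℝ E E : E × E →L[ℝ] E) := by
    have e : ∀ p : G × G, p = (1, 1) → HasMFDerivAt (𝓘(ℝ, E).prod 𝓘(ℝ, E)) 𝓘(ℝ, E)
      (fun p : G × G => p.1 * p.2) p
      (ContinuousLinearMap.fst ℝ E E + ContinuousLinearMap.snd ℝ E E : E × E →L[ℝ] E) := by
      rintro _ rfl
      exact h1
    exact e _ (by simp [ha1, hb1])
  have h7 := HasMFDerivAt.comp w h6 h5
  have h8 : ((ContinuousLinearMap.fst ℝ E E + ContinuousLinearMap.snd ℝ E E).comp (a'.prod b') :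
      F →L[ℝ] E) = a' + b' := by
    ext; simp
  exact h8 ▸ h7

/-- The left logarithmic derivative as a linear map. -/
def leftLogCLM (f : F → G) (w : F) : F →L[ℝ] E :=
  mfderiv 𝓘(ℝ, F) 𝓘(ℝ, E) (fun y => (f w)⁻¹ * f y) w

theorem leftLogCLM_apply (f : F → G) (w v : F) :
    leftLogCLM (E := E) f w v = leftLogDeriv f w v := rfl

theorem hasMFDerivAt_leftLog {f : F → G} {w : F}
    (hf : MDifferentiableAt 𝓘(ℝ, F) 𝓘(ℝ, E) f w) :
    HasMFDerivAt 𝓘(ℝ, F) 𝓘(ℝ, E) (fun y => (f w)⁻¹ * f y) w (leftLogCLM f w : F →L[ℝ] E) := by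
  have := lieGroup_real (E := E) (G := G)
  have hr : ContMDiff 𝓘(ℝ, E) 𝓘(ℝ, E) ω (fun x : G => (f w)⁻¹ * x) :=
    contMDiff_const.mul contMDiff_id
  exact (MDifferentiableAt.comp w (g := fun x : G => (f w)⁻¹ * x)
      ((hr _).mdifferentiableAt (by simp)) hf).hasMFDerivAt

theorem leftLogDeriv_eq_of_hasMFDerivAt {f : F → G} {w : F} {L : F →L[ℝ] E}
    (h : HasMFDerivAt 𝓘(ℝ, F) 𝓘(ℝ, E) (fun y => (f w)⁻¹ * f y) w L) (v : F) :
    (leftLogDeriv f w v : E) = L v :=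
  congrArg (fun T : F →L[ℝ] E => T v) h.mfderiv

theorem leftLogDeriv_mul {f k : F → G} {w : F} (hf : MDifferentiableAt 𝓘(ℝ, F) 𝓘(ℝ, E) f w)
    (hk : MDifferentiableAt 𝓘(ℝ, F) 𝓘(ℝ, E) k w) (v : F) :
    (leftLogDeriv (fun y => f y * k y) w v : E) =
      Ad (k w)⁻¹ (leftLogDeriv f w v) + leftLogDeriv k w v := by
  have h1 : HasMFDerivAt 𝓘(ℝ, E) 𝓘(ℝ, E) (fun x : G => (k w)⁻¹ * x * (k w)⁻¹⁻¹)
      ((fun y => (f w)⁻¹ * f y) w) ((Ad (k w)⁻¹ : E →L[ℂ] E).restrictScalars ℝ) := by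
    have e : ∀ p : G, p = 1 → HasMFDerivAt 𝓘(ℝ, E) 𝓘(ℝ, E)
        (fun x : G => (k w)⁻¹ * x * (k w)⁻¹⁻¹) p
        ((Ad (k w)⁻¹ : E →L[ℂ] E).restrictScalars ℝ : E →L[ℝ] E) := by
      rintro _ rfl
      exact HasMFDerivAt.restrict_real (mdifferentiableAt_conj (E := E) (k w)⁻¹).hasMFDerivAt
    exact e _ (by simp)
  have h2 := HasMFDerivAt.comp w h1 (hasMFDerivAt_leftLog hf)
  have h3 := mfderiv_mul_of_eq_one h2 (hasMFDerivAt_leftLog hk) (by simp) (by simp)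
  have h4 : (fun y => ((fun x : G => (k w)⁻¹ * x * (k w)⁻¹⁻¹) ∘ (fun y => (f w)⁻¹ * f y)) y *
      ((k w)⁻¹ * k y)) = fun y => (f w * k w)⁻¹ * (f y * k y) := by
    ext y
    simp [mul_assoc]
  rw [h4] at h3
  exact leftLogDeriv_eq_of_hasMFDerivAt (f := fun y => f y * k y) h3 v

theorem leftLogDeriv_comp {F' : Type*} [NormedAddCommGroup F'] [NormedSpace ℝ F'] {γ : F' → G}
    {c : F → F'} {w : F} (hγ : MDifferentiableAt 𝓘(ℝ, F') 𝓘(ℝ, E) γ (c w))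
    (hc : DifferentiableAt ℝ c w) (v : F) :
    (leftLogDeriv (fun y => γ (c y)) w v : E) = leftLogDeriv γ (c w) (fderiv ℝ c w v) := by
  have h1 := HasMFDerivAt.comp w (hasMFDerivAt_leftLog hγ) hc.hasFDerivAt.hasMFDerivAt
  exact leftLogDeriv_eq_of_hasMFDerivAt (f := fun y => γ (c y)) h1 v

variable (G) in
/-- The map `(a, b) ↦ a⁻¹ b` in the chart around the identity. -/
def chartDiv (p : E × E) : E :=
  extChartAt 𝓘(ℂ, E) (1 : G)
    (((extChartAt 𝓘(ℂ, E) (1 : G)).symm p.1)⁻¹ * (extChartAt 𝓘(ℂ, E) (1 : G)).symm p.2)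

theorem contDiffAt_chartDiv {a : E} (ha : a ∈ (extChartAt 𝓘(ℂ, E) (1 : G)).target) :
    ContDiffAt ℂ ω (chartDiv (E := E) G) (a, a) := by
  rw [← contMDiffAt_iff_contDiffAt]
  have hs : ContMDiffAt 𝓘(ℂ, E) 𝓘(ℂ, E) ω (extChartAt 𝓘(ℂ, E) (1 : G)).symm a :=
    (contMDiffOn_extChartAt_symm (I := 𝓘(ℂ, E)) (n := ω) (1 : G)).contMDiffAt
      ((isOpen_extChartAt_target (I := 𝓘(ℂ, E)) (1 : G)).mem_nhds ha)
  have h1 : ContMDiffAt 𝓘(ℂ, E × E) 𝓘(ℂ, E) ω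
      (fun p : E × E => (extChartAt 𝓘(ℂ, E) (1 : G)).symm p.1) (a, a) :=
    ContMDiffAt.comp (g := (extChartAt 𝓘(ℂ, E) (1 : G)).symm) (f := Prod.fst) _ hs
      contDiffAt_fst.contMDiffAt
  have h2 : ContMDiffAt 𝓘(ℂ, E × E) 𝓘(ℂ, E) ω
      (fun p : E × E => (extChartAt 𝓘(ℂ, E) (1 : G)).symm p.2) (a, a) :=
    ContMDiffAt.comp (g := (extChartAt 𝓘(ℂ, E) (1 : G)).symm) (f := Prod.snd) _ hs
      contDiffAt_snd.contMDiffAt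
  have h3 := h1.inv.mul h2
  refine ContMDiffAt.comp (g := extChartAt 𝓘(ℂ, E) (1 : G)) _ ?_ h3
  simp only [inv_mul_cancel]
  exact contMDiffAt_extChartAt

theorem exists_curve (X : E) : ∃ γ : ℝ → G, ContMDiff 𝓘(ℝ, ℝ) 𝓘(ℝ, E) ∞ γ ∧ γ 0 = 1 ∧
    (leftLogDeriv γ 0 1 : E) = X ∧ Continuous fun s => (leftLogDeriv γ s 1 : E) := by
  obtain ⟨r, hr, hball⟩ := Metric.mem_nhds_iff.1 (chart_target_mem_nhds (E := E) (G := G))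
  set δ : ℝ := r / (2 * (‖X‖ + 1)) with hδ
  have hX : 0 < ‖X‖ + 1 := by positivity
  have hδ0 : 0 < δ := by positivity
  let c : ℝ → E := fun s => chartOne (E := E) G + (δ * Real.sin (s / δ)) • X
  have hc : ContDiff ℝ ω c := by
    have h1 : ContDiff ℝ ω (fun s : ℝ => δ * Real.sin (s / δ)) :=
      contDiff_const.mul (Real.contDiff_sin.comp (contDiff_id.div_const δ))
    exact contDiff_const.add (h1.smul contDiff_const)
  have hct : ∀ s, c s ∈ (extChartAt 𝓘(ℂ, E) (1 : G)).target := by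
    intro s
    apply hball
    simp only [c, Metric.mem_ball, dist_self_add_left, norm_smul, Real.norm_eq_abs, abs_mul,
      abs_of_pos hδ0]
    have h1 := Real.abs_sin_le_one (s / δ)
    have h2 : δ * (‖X‖ + 1) = r / 2 := by
      rw [hδ]; field_simp
    have h3 : δ * |Real.sin (s / δ)| * ‖X‖ ≤ δ * 1 * (‖X‖ + 1) := by gcongr; linarith
    linarith
  have hc0 : c 0 = chartOne (E := E) G := by simp [c]
  have hcd : HasDerivAt c X 0 := by
    have h1 : HasDerivAt (fun s : ℝ => δ * Real.sin (s / δ)) 1 0 := by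
      have h2 := (Real.hasDerivAt_sin ((0 : ℝ) / δ)).comp 0 ((hasDerivAt_id (0 : ℝ)).div_const δ)
      refine (h2.const_mul δ).congr_deriv ?_
      rw [zero_div, Real.cos_zero]
      field_simp
    exact ((h1.smul_const X).const_add (chartOne (E := E) G)).congr_deriv (one_smul ℝ X)
  let γ : ℝ → G := fun s => (extChartAt 𝓘(ℂ, E) (1 : G)).symm (c s)
  have hγ : ContMDiff 𝓘(ℝ, ℝ) 𝓘(ℝ, E) ω γ := by
    intro s
    have hs : ContMDiffAt 𝓘(ℂ, E) 𝓘(ℂ, E) ω (extChartAt 𝓘(ℂ, E) (1 : G)).symm (c s) :=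
      (contMDiffOn_extChartAt_symm (I := 𝓘(ℂ, E)) (n := ω) (1 : G)).contMDiffAt
        ((isOpen_extChartAt_target (I := 𝓘(ℂ, E)) (1 : G)).mem_nhds (hct s))
    exact (ContMDiffAt.restrict_real hs).comp s hc.contMDiff.contMDiffAt
  have hcw : ∀ s, HasFDerivAt c (fderiv ℝ c s) s := fun s =>
    (hc.differentiable (by simp) s).hasFDerivAt
  have hlog : ∀ s, (leftLogDeriv γ s 1 : E) =
      fderiv ℝ (chartDiv (E := E) G) (c s, c s) (0, fderiv ℝ c s 1) := by
    intro s
    have hd := ((contDiffAt_chartDiv (G := G) (hct s)).restrict_scalars ℝ).differentiableAt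
      (by simp)
    have hm := hasMFDerivAt_leftLog (hγ.mdifferentiableAt (by simp) (x := s))
    have h2 : HasFDerivAt (fun y => chartDiv G (c s, c y)) (leftLogCLM (E := E) γ s) s := by
      have h3 := hm.2
      have h4 : writtenInExtChartAt 𝓘(ℝ, ℝ) 𝓘(ℝ, E) s (fun y => (γ s)⁻¹ * γ y) =
          fun y => chartDiv G (c s, c y) := by
        ext y
        simp only [writtenInExtChartAt, inv_mul_cancel]
        rfl
      rw [h4, modelWithCornersSelf_coe, range_id] at h3
      exact hasFDerivWithinAt_univ.1 h3
    have h5 : HasFDerivAt (fun y => (c s, c y)) ((0 : ℝ →L[ℝ] E).prod (fderiv ℝ c s)) s :=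
      (hasFDerivAt_const (c s) s).prodMk (hcw s)
    have h6 := HasFDerivAt.comp (f := fun y => (c s, c y)) s hd.hasFDerivAt h5
    have h7 := DFunLike.congr_fun (h2.unique h6) 1
    rw [← leftLogCLM_apply, h7]
    simp
  refine ⟨γ, hγ.of_le (by exact le_top), ?_, ?_, ?_⟩
  · simp only [γ, hc0, chart_symm_one]
  · have h1 := (hasMFDerivAt_leftLog (hγ.mdifferentiableAt (by simp) (x := 0))).2
    rw [hlog]
    have h2 : HasFDerivAt (fun b => chartDiv G (chartOne (E := E) G, b))
        ((fderiv ℝ (chartDiv (E := E) G) (c 0, c 0)).comp (ContinuousLinearMap.inr ℝ E E))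
        (chartOne (E := E) G) := by
      have hd := ((contDiffAt_chartDiv (G := G) (hct 0)).restrict_scalars ℝ).differentiableAt
        (by simp)
      rw [hc0] at hd ⊢
      exact HasFDerivAt.comp (f := fun b : E => (chartOne (E := E) G, b)) _ hd.hasFDerivAt
        (hasFDerivAt_prodMk_right _ _)
    have h3 : (fun b => chartDiv G (chartOne (E := E) G, b)) =ᶠ[𝓝 (chartOne (E := E) G)] id := by
      filter_upwards [chart_target_mem_nhds (E := E) (G := G)] with a ha
      simp only [chartDiv, chart_symm_one, inv_one, one_mul, id]
      exact (extChartAt 𝓘(ℂ, E) (1 : G)).right_inv ha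
    have h4 := DFunLike.congr_fun
      (h2.unique ((hasFDerivAt_id (𝕜 := ℝ) (chartOne (E := E) G)).congr_of_eventuallyEq h3)) X
    have h5 : fderiv ℝ c 0 1 = X := by rw [← hcd.deriv]; rfl
    rw [h5]
    simpa using h4
  · simp only [hlog]
    rw [continuous_iff_continuousAt]
    intro s
    have h1 : ContDiffAt ℝ ω (fderiv ℝ (chartDiv (E := E) G)) (c s, c s) :=
      ((contDiffAt_chartDiv (G := G) (hct s)).restrict_scalars ℝ).fderiv_right (by simp)
    have h2 : ContinuousAt (fun s => fderiv ℝ (chartDiv (E := E) G) (c s, c s)) s :=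
      ContinuousAt.comp (f := fun s => (c s, c s)) h1.continuousAt
        (hc.continuous.prodMk hc.continuous).continuousAt
    have h3 : Continuous (fun s => fderiv ℝ c s 1) :=
      (hc.continuous_fderiv (by simp)).clm_apply continuous_const
    exact h2.clm_apply (continuousAt_const.prodMk h3.continuousAt)

end RealLie

section Polynomials

variable {E : Type*} [NormedAddCommGroup E] [NormedSpace ℂ E] [FiniteDimensional ℂ E]
  {G : Type*} [TopologicalSpace G] [ChartedSpace E G] [Group G] [LieGroup 𝓘(ℂ, E) ω G]

theorem dual_separates {X Y : E} (h : ∀ ψ : StrongDual ℂ E, ψ X = ψ Y) : X = Y := by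
  by_contra hne
  obtain ⟨f, hf⟩ := SeparatingDual.exists_separating_of_ne (R := ℂ) hne
  exact hf (h f)

theorem contDiff_polyEval (P : MvPolynomial E ℂ) :
    ContDiff ℂ ω (fun φ : StrongDual ℂ E => polyEval P φ) := by
  induction P using MvPolynomial.induction_on with
  | C a => simpa [polyEval] using contDiff_const
  | add p q hp hq =>
    simp only [polyEval, map_add] at hp hq ⊢
    exact hp.add hq
  | mul_X p X hp =>
    simp only [polyEval, map_mul, MvPolynomial.eval_X] at hp ⊢
    exact hp.mul (ContinuousLinearMap.apply ℂ ℂ X).contDiff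

theorem contDiff_grad (P : MvPolynomial E ℂ) :
    ContDiff ℂ ω (fun φ : StrongDual ℂ E => grad P φ) := by
  unfold grad
  exact ContDiff.sum fun X _ => (contDiff_polyEval _).smul contDiff_const

theorem hasFDerivAt_polyEval (P : MvPolynomial E ℂ) (φ : StrongDual ℂ E) :
    HasFDerivAt (fun φ : StrongDual ℂ E => polyEval P φ)
      (ContinuousLinearMap.apply ℂ ℂ (grad P φ)) φ := by
  have h := ((contDiff_polyEval P).differentiable (by simp) φ).hasFDerivAt
  refine h.congr_fderiv ?_
  ext ψ
  have h1 : HasDerivAt (fun s : ℂ => φ + s • ψ) ψ 0 := by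
    simpa using ((hasDerivAt_id (0 : ℂ)).smul_const ψ).const_add φ
  have h2 : HasFDerivAt (fun φ : StrongDual ℂ E => polyEval P φ)
    (fderiv ℂ (fun φ : StrongDual ℂ E => polyEval P φ) φ) (φ + (0 : ℂ) • ψ) := by
    have e : φ + (0 : ℂ) • ψ = φ := by ext; simp
    exact e.symm ▸ h
  exact (h2.comp_hasDerivAt (f := fun s : ℂ => φ + s • ψ) 0 h1).unique (hasDerivAt_polyEval P φ ψ)

theorem polyEval_smul {P : MvPolynomial E ℂ} {d : ℕ} (hP : P.IsHomogeneous d) (c : ℂ)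
    (φ : StrongDual ℂ E) : polyEval P (c • φ) = c ^ d * polyEval P φ := by
  unfold polyEval
  rw [MvPolynomial.eval_eq, MvPolynomial.eval_eq, Finset.mul_sum]
  refine Finset.sum_congr rfl fun m hm => ?_
  have h1 : m.degree = d := by
    have := hP (MvPolynomial.mem_support_iff.mp hm)
    rw [Finsupp.degree_eq_weight_one]
    exact this
  simp only [smul_apply, smul_eq_mul, mul_pow, Finset.prod_mul_distrib]
  have : ∏ i ∈ m.support, c ^ m i = c ^ d := by
    rw [Finset.prod_pow_eq_pow_sum, ← h1]
    rfl
  rw [this]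
  ring

theorem grad_smul {P : MvPolynomial E ℂ} {d : ℕ} (hP : P.IsHomogeneous (d + 1)) {c : ℂ}
    (hc : c ≠ 0) (φ : StrongDual ℂ E) : grad P (c • φ) = c ^ d • grad P φ := by
  refine dual_separates fun ψ => ?_
  have h1 := hasDerivAt_polyEval P (c • φ) (c • ψ)
  have h2 : (fun s : ℂ => polyEval P (c • φ + s • c • ψ)) =
      fun s => c ^ (d + 1) * polyEval P (φ + s • ψ) := by
    ext s
    rw [← polyEval_smul hP, smul_add, smul_comm]
  rw [h2] at h1
  have h3 := h1.unique ((hasDerivAt_polyEval P φ ψ).const_mul _)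
  simp only [smul_apply, smul_eq_mul] at h3
  have : c * ψ (grad P (c • φ)) = c * ψ (c ^ d • grad P φ) := by
    rw [h3, map_smul, smul_eq_mul, pow_succ]
    ring
  exact mul_left_cancel₀ hc this

theorem coAd_add (g : G) (φ ψ : StrongDual ℂ E) : coAd g (φ + ψ) = coAd g φ + coAd g ψ := rfl

theorem coAd_smul (g : G) (c : ℂ) (φ : StrongDual ℂ E) : coAd g (c • φ) = c • coAd g φ := rfl

variable {P Q : MvPolynomial E ℂ}

theorem grad_coAd (hP : ∀ (g : G) (φ : StrongDual ℂ E), polyEval P (coAd g φ) = polyEval P φ)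
    (g : G) (φ : StrongDual ℂ E) : grad P (coAd g φ) = Ad g (grad P φ) := by
  refine dual_separates fun ψ => ?_
  have h1 := hasDerivAt_polyEval P (coAd g φ) ψ
  have h2 : (fun s : ℂ => polyEval P (coAd g φ + s • ψ)) =
      fun s => polyEval P (φ + s • coAd g⁻¹ ψ) := by
    ext s
    rw [← hP g (φ + s • coAd g⁻¹ ψ), coAd_add, coAd_smul, ← coAd_mul]
    simp [coAd_one]
  rw [h2] at h1
  rw [h1.unique (hasDerivAt_polyEval P φ (coAd g⁻¹ ψ)), coAd_apply, inv_inv]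

theorem hasDerivAt_Ad_curve {γ : ℝ → G} (hγ : ContMDiff 𝓘(ℝ, ℝ) 𝓘(ℝ, E) ∞ γ) (h0 : γ 0 = 1) :
    HasDerivAt (fun s => (Ad (γ s) : E →L[ℂ] E)) (adL G (leftLogDeriv γ 0 1)) 0 := by
  have h1 := (hasFDerivAt_Ad_comp (hγ.mdifferentiableAt (by simp) (x := 0))).hasDerivAt
  have h2 : (rightLogDeriv γ 0 1 : E) = leftLogDeriv γ 0 1 := by
    have h : ∀ f₁ f₂ : ℝ → G, f₁ = f₂ → (mfderiv 𝓘(ℝ, ℝ) 𝓘(ℝ, E) f₁ 0 1 : E) =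
        (mfderiv 𝓘(ℝ, ℝ) 𝓘(ℝ, E) f₂ 0 1 : E) := by
      rintro f _ rfl
      rfl
    exact h _ _ (by ext y; simp [h0])
  refine h1.congr_deriv ?_
  rw [← h2]
  ext Y
  have : (Ad (γ 0) : E →L[ℂ] E) = ContinuousLinearMap.id ℂ E := by rw [h0, Ad_one]
  change adL G (rightLogDeriv γ 0 1) (Ad (γ 0) Y) = _
  rw [this]
  rfl

theorem hasDerivAt_coAd_curve {γ : ℝ → G} (hγ : ContMDiff 𝓘(ℝ, ℝ) 𝓘(ℝ, E) ∞ γ) (h0 : γ 0 = 1)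
    (φ : StrongDual ℂ E) :
    HasDerivAt (fun s => coAd (γ s)⁻¹ φ) (-coad G (leftLogDeriv γ 0 1) φ) 0 := by
  have h1 := ((ContinuousLinearMap.compL ℂ E E ℂ φ).restrictScalars ℝ).hasFDerivAt.comp_hasDerivAt
    0 (hasDerivAt_Ad_curve hγ h0)
  have h2 : (⇑((ContinuousLinearMap.compL ℂ E E ℂ φ).restrictScalars ℝ) ∘
      fun s => (Ad (γ s) : E →L[ℂ] E)) = fun s => coAd (γ s)⁻¹ φ := by
    ext s X
    simp [coAd_apply]
  rw [h2] at h1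
  refine h1.congr_deriv ?_
  ext X
  simp [coad_apply, adL_apply]

theorem coad_grad (hP : ∀ (g : G) (φ : StrongDual ℂ E), polyEval P (coAd g φ) = polyEval P φ)
    (φ : StrongDual ℂ E) : coad G (grad P φ) φ = 0 := by
  ext X
  obtain ⟨γ, h1, h2, h3, -⟩ := exists_curve (G := G) X
  have h4 := hasDerivAt_coAd_curve h1 h2 φ
  have h5 : HasFDerivAt (fun φ : StrongDual ℂ E => polyEval P φ)
      ((ContinuousLinearMap.apply ℂ ℂ (grad P φ)).restrictScalars ℝ) (coAd (γ 0)⁻¹ φ) := by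
    rw [h2, inv_one, coAd_one]
    exact (hasFDerivAt_polyEval P φ).restrictScalars ℝ
  have h6 := h5.comp_hasDerivAt 0 h4
  have h7 : ((fun φ : StrongDual ℂ E => polyEval P φ) ∘ fun s => coAd (γ s)⁻¹ φ) =
      fun _ => polyEval P φ := by
    ext s
    exact hP _ _
  rw [h7] at h6
  have h8 := h6.unique (hasDerivAt_const 0 _)
  simp only [h3, ContinuousLinearMap.coe_restrictScalars', ContinuousLinearMap.apply_apply,
    neg_apply, coad_apply, neg_neg] at h8
  rw [coad_apply, bracket_skew, map_neg, neg_neg, h8]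
  simp

variable (G) in
/-- The coadjoint action of an element of the Lie algebra as a continuous linear map. -/
def coadL (X : E) : StrongDual ℂ E →L[ℂ] StrongDual ℂ E :=
  -((ContinuousLinearMap.compL ℂ E E ℂ).flip (adCLM G X))

theorem coadL_apply (X : E) (φ : StrongDual ℂ E) : coadL G X φ = coad G X φ := rfl

theorem contDiff_grad_real (P : MvPolynomial E ℂ) :
    ContDiff ℝ ∞ (fun φ : StrongDual ℂ E => grad P φ) :=
  ((contDiff_grad P).restrict_scalars ℝ).of_le le_top

/-- The infinitesimal equivariance of the gradient of an invariant polynomial. -/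
theorem fderiv_grad_coad
    (hP : ∀ (g : G) (φ : StrongDual ℂ E), polyEval P (coAd g φ) = polyEval P φ)
    (X : E) (φ : StrongDual ℂ E) :
    fderiv ℝ (fun φ => grad P φ) φ (coad G X φ) = bracket G X (grad P φ) := by
  obtain ⟨γ, h1, h2, h3, -⟩ := exists_curve (G := G) X
  have h4 := hasDerivAt_coAd_curve h1 h2 φ
  have h5 : HasFDerivAt (fun φ : StrongDual ℂ E => grad P φ)
      (fderiv ℝ (fun φ => grad P φ) φ) (coAd (γ 0)⁻¹ φ) := by
    rw [h2, inv_one, coAd_one]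
    exact ((contDiff_grad_real P).differentiable (by simp) φ).hasFDerivAt
  have h6 := h5.comp_hasDerivAt 0 h4
  have h7 := ((ContinuousLinearMap.restrictScalarsL ℂ E E ℝ ℝ).hasFDerivAt.comp_hasDerivAt 0
    (hasDerivAt_Ad_curve h1 h2)).clm_apply h6
  have h8 : (fun s => ((ContinuousLinearMap.restrictScalarsL ℂ E E ℝ ℝ) ∘
      fun s => (Ad (γ s) : E →L[ℂ] E)) s (((fun φ => grad P φ) ∘ fun s => coAd (γ s)⁻¹ φ) s)) =
      fun _ => grad P φ := by
    ext s
    simp [grad_coAd hP, Ad_Ad_inv]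
  rw [h8] at h7
  have h9 := h7.unique (hasDerivAt_const 0 _)
  have h10 : bracket G X (grad P φ) + -fderiv ℝ (fun φ => grad P φ) φ (coad G X φ) = 0 := by
    simpa [h2, coAd_one, h3, Ad_one, adL_apply] using h9
  exact (sub_eq_zero.1 (by rw [sub_eq_add_neg]; exact h10)).symm

theorem bracket_grad_grad
    (hP : ∀ (g : G) (φ : StrongDual ℂ E), polyEval P (coAd g φ) = polyEval P φ)
    (hQ : ∀ (g : G) (φ : StrongDual ℂ E), polyEval Q (coAd g φ) = polyEval Q φ)
    (φ : StrongDual ℂ E) : bracket G (grad P φ) (grad Q φ) = 0 := by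
  rw [← fderiv_grad_coad hQ, coad_grad hP, map_zero]

end Polynomials

end MixedBF

namespace MixedBF

section DbarCalculus

variable {V : Type*} [NormedAddCommGroup V] [NormedSpace ℂ V]
  {V₁ : Type*} [NormedAddCommGroup V₁] [NormedSpace ℂ V₁]
  {V₂ : Type*} [NormedAddCommGroup V₂] [NormedSpace ℂ V₂]

/-- The `∂̄`-component of a real-linear map on `ℂ`. -/
def dbarOf (L : ℂ →L[ℝ] V) : V := (1 / 2 : ℂ) • (L 1 + Complex.I • L Complex.I)

theorem dbarOf_add (L M : ℂ →L[ℝ] V) : dbarOf (L + M) = dbarOf L + dbarOf M := by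
  simp only [dbarOf, add_apply, smul_add]; abel

theorem HasFDerivAt.dbar_eq {f : ℂ → V} {L : ℂ →L[ℝ] V} {w : ℂ} (h : HasFDerivAt f L w) :
    dbar f w = dbarOf L := by
  simp only [dbar, dbarOf, h.fderiv]

theorem Filter.EventuallyEq.dbar_eq {f g : ℂ → V} {w : ℂ} (h : f =ᶠ[𝓝 w] g) :
    dbar f w = dbar g w := by
  simp only [dbar, h.fderiv_eq]

theorem dbar_add {f g : ℂ → V} {w : ℂ} (hf : DifferentiableAt ℝ f w)
    (hg : DifferentiableAt ℝ g w) : dbar (fun z => f z + g z) w = dbar f w + dbar g w := by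
  have h : HasFDerivAt (fun z => f z + g z) _ w := hf.hasFDerivAt.add hg.hasFDerivAt
  rw [HasFDerivAt.dbar_eq h, dbarOf_add]
  rfl

theorem dbar_clm_apply {L : ℂ → V₁ →L[ℂ] V₂} {f : ℂ → V₁} {w : ℂ}
    (hL : DifferentiableAt ℝ L w) (hf : DifferentiableAt ℝ f w) :
    dbar (fun z => L z (f z)) w = dbar L w (f w) + L w (dbar f w) := by
  have h1 := ((ContinuousLinearMap.restrictScalarsL ℂ V₁ V₂ ℝ ℝ).hasFDerivAt.comp w
    hL.hasFDerivAt).clm_apply hf.hasFDerivAt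
  have h2 : HasFDerivAt (fun z => L z (f z)) _ w := h1
  rw [HasFDerivAt.dbar_eq h2]
  simp [dbarOf, dbar]
  module

theorem dbar_smul {c : ℂ → ℂ} {f : ℂ → V} {w : ℂ}
    (hc : DifferentiableAt ℝ c w) (hf : DifferentiableAt ℝ f w) :
    dbar (fun z => c z • f z) w = dbar c w • f w + c w • dbar f w := by
  have h : HasFDerivAt (fun z => c z • f z) _ w := hc.hasFDerivAt.smul hf.hasFDerivAt
  rw [HasFDerivAt.dbar_eq h]
  simp [dbarOf, dbar]
  module

theorem dbar_of_holomorphic {f : ℂ → V} {w : ℂ} (hf : DifferentiableAt ℂ f w) : dbar f w = 0 := by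
  rw [HasFDerivAt.dbar_eq (hf.hasFDerivAt.restrictScalars ℝ)]
  have : fderiv ℂ f w Complex.I = Complex.I • fderiv ℂ f w 1 := by
    rw [← map_smul]; simp
  simp [dbarOf, this, smul_smul]

theorem dbar_holomorphic_smul {c : ℂ → ℂ} {f : ℂ → V} {w : ℂ}
    (hc : DifferentiableAt ℂ c w) (hf : DifferentiableAt ℝ f w) :
    dbar (fun z => c z • f z) w = c w • dbar f w := by
  rw [dbar_smul (hc.restrictScalars ℝ) hf, dbar_of_holomorphic hc, zero_smul, zero_add]

theorem dbar_clm (L : V₁ →L[ℂ] V₂) {f : ℂ → V₁} {w : ℂ} (hf : DifferentiableAt ℝ f w) :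
    dbar (fun z => L (f z)) w = L (dbar f w) := by
  have h2 : HasFDerivAt (fun z => L (f z)) _ w :=
    (L.restrictScalars ℝ).hasFDerivAt.comp w hf.hasFDerivAt
  rw [HasFDerivAt.dbar_eq h2]
  simp [dbarOf, dbar]

theorem dbar_const (c : V) (w : ℂ) : dbar (fun _ => c) w = 0 :=
  dbar_of_holomorphic (differentiableAt_const c)

theorem dbar_const_smul (c : ℂ) (f : ℂ → V) (w : ℂ) :
    dbar (fun z => c • f z) w = c • dbar f w := by
  have : fderiv ℝ (fun z => c • f z) w = c • fderiv ℝ f w :=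
    congrFun (fderiv_const_smul_field (f := f) c) w
  simp only [dbar, this, smul_apply]
  module

theorem dbar_comp_holomorphic {f : ℂ → V} {τ : ℂ → ℂ} {w : ℂ} (hτ : DifferentiableAt ℂ τ w)
    (hf : DifferentiableAt ℝ f (τ w)) :
    dbar (fun z => f (τ z)) w = (starRingEnd ℂ) (deriv τ w) • dbar f (τ w) := by
  have h2 : HasFDerivAt (fun z => f (τ z)) _ w :=
    hf.hasFDerivAt.comp w (hτ.hasFDerivAt.restrictScalars ℝ)
  rw [HasFDerivAt.dbar_eq h2]
  simp only [dbarOf, dbar, ContinuousLinearMap.comp_apply, ContinuousLinearMap.coe_restrictScalars']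
  have h1 : fderiv ℂ τ w 1 = deriv τ w := by simp
  have h3 : fderiv ℂ τ w Complex.I = Complex.I * deriv τ w := by
    rw [← h1, ← smul_eq_mul, ← map_smul]; simp
  have key : ∀ (L : ℂ →L[ℝ] V) (a : ℂ), L a = a.re • L 1 + a.im • L Complex.I := by
    intro L a
    conv_lhs => rw [← Complex.re_add_im a]
    rw [map_add]
    congr 1
    · rw [← map_smul]; congr 1; simp
    · rw [← map_smul]; congr 1
  rw [h1, h3, key _ (deriv τ w), key _ (Complex.I * deriv τ w)]
  set a := deriv τ w
  set L := fderiv ℝ f (τ w)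
  have e : (starRingEnd ℂ) a = (a.re : ℂ) - a.im * Complex.I := by
    apply Complex.ext <;> simp
  rw [e]
  simp only [Complex.mul_re, Complex.I_re, zero_mul, Complex.I_im, one_mul, zero_sub,
    Complex.mul_im, neg_smul, zero_add]
  simp only [← Complex.coe_smul, smul_add, smul_neg, smul_smul]
  have hI : Complex.I * Complex.I = -1 := Complex.I_mul_I
  match_scalars
  · ring_nf
  · ring_nf
    simp
    ring

theorem ContDiffAt.dbar {f : ℂ → V} {w : ℂ} (hf : ContDiffAt ℝ ∞ f w) :
    ContDiffAt ℝ ∞ (dbar f) w := by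
  have h1 : ContDiffAt ℝ ∞ (fderiv ℝ f) w := hf.fderiv_right (by simp)
  unfold MixedBF.dbar
  exact ((h1.clm_apply contDiffAt_const).add
    ((h1.clm_apply contDiffAt_const).const_smul Complex.I)).const_smul (1 / 2 : ℂ)

theorem tsupport_dbar_subset (f : ℂ → V) : tsupport (dbar f) ⊆ tsupport f := by
  refine (closure_mono ?_).trans (closure_minimal (support_fderiv_subset ℝ (f := f)) isClosed_closure)
  intro w hw h
  apply hw
  have : fderiv ℝ f w = 0 := by simpa using h
  simp [dbar, this]

end DbarCalculus

section Pompeiu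

/-- The unit vector in the direction `θ`. -/
def unitVec (θ : ℝ) : ℂ := Real.cos θ + Real.sin θ * Complex.I

theorem hasDerivAt_unitVec (θ : ℝ) : HasDerivAt unitVec (Complex.I * unitVec θ) θ := by
  have h1 := (Real.hasDerivAt_cos θ).ofReal_comp
  have h2 := ((Real.hasDerivAt_sin θ).ofReal_comp).mul_const Complex.I
  refine (h1.add h2).congr_deriv ?_
  simp only [unitVec]
  push_cast
  linear_combination (-Complex.sin θ) * Complex.I_mul_I

theorem continuous_unitVec : Continuous unitVec :=
  continuous_iff_continuousAt.2 fun θ => (hasDerivAt_unitVec θ).continuousAt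

theorem norm_unitVec (θ : ℝ) : ‖unitVec θ‖ = 1 := by
  have : unitVec θ = Complex.exp (θ * Complex.I) := by
    rw [Complex.exp_mul_I]; simp [unitVec]
  rw [this, Complex.norm_exp_ofReal_mul_I]

theorem unitVec_neg_pi : unitVec (-Real.pi) = unitVec Real.pi := by simp [unitVec]

theorem integrableOn_polar {a : ℝ × ℝ → ℂ} (ha : Continuous a) {R : ℝ}
    (hR : ∀ p : ℝ × ℝ, R < p.1 → a p = 0) :
    IntegrableOn a (Ioi (0 : ℝ) ×ˢ Ioo (-Real.pi) Real.pi) := by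
  have h1 : IntegrableOn a (Icc (0 : ℝ) R ×ˢ Icc (-Real.pi) Real.pi) :=
    ha.continuousOn.integrableOn_compact (isCompact_Icc.prod isCompact_Icc)
  refine IntegrableOn.of_forall_sdiff_eq_zero h1
    (measurableSet_Ioi.prod measurableSet_Ioo) ?_
  rintro p ⟨⟨h2, h3⟩, h4⟩
  apply hR
  by_contra h5
  exact h4 ⟨⟨le_of_lt h2, not_lt.1 h5⟩, ⟨h3.1.le, h3.2.le⟩⟩

/-- The Cauchy–Pompeiu formula for a compactly supported function, at the origin. -/
theorem integral_dbar_mul_inv_zero {f : ℂ → ℂ} (hf : ContDiff ℝ 1 f) (hc : HasCompactSupport f) :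
    ∫ w, dbar f w * w⁻¹ = -Real.pi * f 0 := by
  obtain ⟨R, hR0, hR⟩ : ∃ R : ℝ, 0 < R ∧ ∀ w : ℂ, R < ‖w‖ → w ∉ tsupport f := by
    obtain ⟨R, hR⟩ := hc.isBounded.exists_norm_le
    refine ⟨max R 1, by positivity, fun w hw hs => ?_⟩
    exact absurd (hR w hs) (not_le.2 (lt_of_le_of_lt (le_max_left _ _) hw))
  have hfd : Continuous (fderiv ℝ f) := hf.continuous_fderiv (by simp)
  have hf0 : ∀ w : ℂ, R < ‖w‖ → f w = 0 := fun w hw => image_eq_zero_of_notMem_tsupport (hR w hw)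
  have hfd0 : ∀ w : ℂ, R < ‖w‖ → fderiv ℝ f w = 0 := fun w hw => by
    by_contra h
    exact hR w hw (support_fderiv_subset ℝ h)
  let P : ℝ × ℝ → ℂ := fun p => p.1 * unitVec p.2
  have hP : Continuous P := by
    have := continuous_unitVec
    fun_prop
  have hPn : ∀ p : ℝ × ℝ, R < p.1 → R < ‖P p‖ := by
    intro p hp
    simp only [P, norm_mul, norm_unitVec, mul_one, Complex.norm_real, Real.norm_eq_abs]
    exact lt_of_lt_of_le hp (le_abs_self _)
  let a : ℝ × ℝ → ℂ := fun p => fderiv ℝ f (P p) (unitVec p.2)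
  let b : ℝ × ℝ → ℂ := fun p => fderiv ℝ f (P p) (Complex.I * unitVec p.2)
  have hca : Continuous a :=
    (hfd.comp hP).clm_apply (continuous_unitVec.comp continuous_snd)
  have hcb : Continuous b :=
    (hfd.comp hP).clm_apply (continuous_const.mul (continuous_unitVec.comp continuous_snd))
  have hia : IntegrableOn a (Ioi (0 : ℝ) ×ˢ Ioo (-Real.pi) Real.pi) :=
    integrableOn_polar hca (R := R) fun p hp => by simp [a, hfd0 _ (hPn p hp)]
  have hib : IntegrableOn b (Ioi (0 : ℝ) ×ˢ Ioo (-Real.pi) Real.pi) :=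
    integrableOn_polar hcb (R := R) fun p hp => by simp [b, hfd0 _ (hPn p hp)]
  have hpi : -Real.pi ≤ Real.pi := by linarith [Real.pi_pos]
  have e1 : ∫ w, dbar f w * w⁻¹ = ∫ p in Ioi (0 : ℝ) ×ˢ Ioo (-Real.pi) Real.pi,
      ((1 / 2 : ℂ) * a p + (Complex.I / 2) * b p) := by
    rw [← Complex.integral_comp_polarCoord_symm]
    refine setIntegral_congr_fun (measurableSet_Ioi.prod measurableSet_Ioo) ?_
    rintro ⟨r, θ⟩ ⟨hr, -⟩
    have hr' : (r : ℂ) ≠ 0 := by exact_mod_cast (ne_of_gt hr)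
    have hu : unitVec θ ≠ 0 := by
      intro h
      have := norm_unitVec θ
      simp [h] at this
    have e : Complex.polarCoord.symm (r, θ) = P (r, θ) := by
      simp [P, unitVec]
    have key : ∀ (L : ℂ →L[ℝ] ℂ) (z : ℂ), L z = z.re * L 1 + z.im * L Complex.I := by
      intro L z
      conv_lhs => rw [← Complex.re_add_im z]
      rw [map_add]
      have h1 : L (z.re : ℂ) = z.re * L 1 := by
        rw [← Complex.real_smul, ← L.map_smul, Complex.real_smul, mul_one]
      have h2 : L (z.im * Complex.I) = z.im * L Complex.I := by
        rw [← Complex.real_smul, ← Complex.real_smul, ← L.map_smul]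
      rw [h1, h2]
    simp only [e, a, b, dbar, smul_eq_mul, Complex.real_smul]
    rw [key _ (unitVec θ), key _ (Complex.I * unitVec θ)]
    have h1 : (unitVec θ).re = Real.cos θ := by
      simp [unitVec, Complex.cos_ofReal_re]
    have h2 : (unitVec θ).im = Real.sin θ := by simp [unitVec, Complex.sin_ofReal_re]
    have h3 : (unitVec θ)⁻¹ = Real.cos θ - Real.sin θ * Complex.I := by
      rw [inv_eq_iff_eq_inv]
      apply eq_inv_of_mul_eq_one_left
      simp only [unitVec]
      have := Complex.cos_sq_add_sin_sq (θ : ℂ)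
      push_cast
      linear_combination this - Complex.sin θ ^ 2 * Complex.I_sq
    have h4 : (r : ℂ) * (P (r, θ))⁻¹ = (unitVec θ)⁻¹ := by
      simp only [P, mul_inv]
      field_simp
    have h5 : (r : ℂ) * (1 / 2 * ((fderiv ℝ f (P (r, θ))) 1 + Complex.I *
        (fderiv ℝ f (P (r, θ))) Complex.I) * (P (r, θ))⁻¹) =
        1 / 2 * ((fderiv ℝ f (P (r, θ))) 1 + Complex.I *
        (fderiv ℝ f (P (r, θ))) Complex.I) * (r * (P (r, θ))⁻¹) := by ring
    rw [h5, h4, h3]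
    simp only [Complex.mul_re, Complex.mul_im, Complex.I_re, Complex.I_im, h1, h2, zero_mul,
      one_mul, zero_sub, zero_add]
    push_cast
    linear_combination (-(1 / 2) * (fderiv ℝ f (P (r, θ)) Complex.I) * Complex.sin θ) * Complex.I_sq
  have e2 : ∫ p in Ioi (0 : ℝ) ×ˢ Ioo (-Real.pi) Real.pi, a p = -(2 * Real.pi) * f 0 := by
    have hsw : ∫ p in Ioi (0 : ℝ) ×ˢ Ioo (-Real.pi) Real.pi, a p =
        ∫ θ in Ioo (-Real.pi) Real.pi, ∫ r in Ioi (0 : ℝ), a (r, θ) := by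
      rw [Measure.volume_eq_prod, ← setIntegral_prod_swap]
      rw [setIntegral_prod]
      · rfl
      · rw [Measure.volume_eq_prod] at hia
        exact hia.swap
    have inner : ∀ θ : ℝ, ∫ r in Ioi (0 : ℝ), a (r, θ) = -f 0 := by
      intro θ
      have hd : ∀ r : ℝ, HasDerivAt (fun r : ℝ => f (r * unitVec θ)) (a (r, θ)) r := by
        intro r
        have h1 : HasDerivAt (fun r : ℝ => (r : ℂ) * unitVec θ) (unitVec θ) r := by
          simpa using (Complex.ofRealCLM.hasDerivAt (x := r)).mul_const (unitVec θ)
        exact ((hf.differentiable (by simp) _).hasFDerivAt.comp_hasDerivAt r h1)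
      have hcd : ContDiff ℝ 1 (fun r : ℝ => f (r * unitVec θ)) :=
        hf.comp (Complex.ofRealCLM.contDiff.mul contDiff_const)
      have hcs : HasCompactSupport (fun r : ℝ => f (r * unitVec θ)) := by
        refine HasCompactSupport.intro (isCompact_Icc (a := -R) (b := R)) fun r hr => hf0 _ ?_
        rw [norm_mul, norm_unitVec, mul_one, Complex.norm_real, Real.norm_eq_abs]
        by_contra h
        exact hr (abs_le.1 (not_lt.1 h))
      have := hcs.integral_Ioi_deriv_eq hcd 0
      simp only [(hd _).deriv] at this
      simpa using this
    rw [hsw]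
    simp only [inner]
    rw [setIntegral_const, measureReal_def, Real.volume_Ioo, ENNReal.toReal_ofReal (by linarith),
      Complex.real_smul]
    push_cast
    ring
  have e3 : ∫ p in Ioi (0 : ℝ) ×ˢ Ioo (-Real.pi) Real.pi, b p = 0 := by
    rw [Measure.volume_eq_prod, setIntegral_prod _ (by rw [← Measure.volume_eq_prod]; exact hib)]
    rw [setIntegral_congr_fun (g := fun _ => (0 : ℂ)) measurableSet_Ioi]
    · simp
    intro r hr
    have hr' : (r : ℂ) ≠ 0 := by exact_mod_cast (ne_of_gt hr)
    have hd : ∀ θ : ℝ, HasDerivAt (fun θ : ℝ => (r : ℂ)⁻¹ * f (r * unitVec θ)) (b (r, θ)) θ := by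
      intro θ
      have h1 : HasDerivAt (fun θ : ℝ => (r : ℂ) * unitVec θ) (r * (Complex.I * unitVec θ)) θ :=
        (hasDerivAt_unitVec θ).const_mul _
      refine (((hf.differentiable (by simp) _).hasFDerivAt.comp_hasDerivAt θ h1).const_mul
        (r : ℂ)⁻¹).congr_deriv ?_
      simp only [b, P]
      rw [← Complex.real_smul (x := r) (z := Complex.I * unitVec θ), map_smul, Complex.real_smul]
      field_simp
    simp only
    rw [← integral_Ioc_eq_integral_Ioo, ← intervalIntegral.integral_of_le hpi,
      intervalIntegral.integral_eq_sub_of_hasDerivAt (fun θ _ => hd θ)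
        ((hcb.comp (Continuous.prodMk_right r)).intervalIntegrable _ _), unitVec_neg_pi, sub_self]
  rw [e1, integral_add (hia.const_mul _) (hib.const_mul _), integral_const_mul, integral_const_mul,
    e2, e3]
  ring

/-- The Cauchy–Pompeiu formula for a compactly supported function. -/
theorem integral_dbar_mul_inv {f : ℂ → ℂ} (hf : ContDiff ℝ 1 f) (hc : HasCompactSupport f)
    (s : ℂ) : ∫ w, dbar f w * (w - s)⁻¹ = -Real.pi * f s := by
  have h1 : ContDiff ℝ 1 (fun w => f (w + s)) := hf.comp (contDiff_id.add contDiff_const)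
  have h2 : HasCompactSupport (fun w => f (w + s)) :=
    hc.comp_homeomorph (Homeomorph.addRight s)
  have h3 := integral_dbar_mul_inv_zero h1 h2
  have h4 : ∀ w, dbar (fun w => f (w + s)) w = dbar f (w + s) := by
    intro w
    rw [dbar_comp_holomorphic (τ := fun w => w + s) (by fun_prop)
      (hf.differentiable (by simp) _)]
    simp
  rw [← integral_add_right_eq_self (fun w => dbar f w * (w - s)⁻¹) s]
  simpa [h4] using h3

theorem integral_dbar_eq_zero {f : ℂ → ℂ} (hf : ContDiff ℝ 1 f) (hc : HasCompactSupport f) :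
    ∫ w, dbar f w = 0 := by
  have h1 : ContDiff ℝ 1 (fun w : ℂ => w * f w) := contDiff_id.mul hf
  have h2 : HasCompactSupport (fun w : ℂ => w * f w) := hc.mul_left
  have h3 := integral_dbar_mul_inv_zero h1 h2
  have h4 : ∀ w, dbar (fun w => w * f w) w = w * dbar f w := fun w =>
    dbar_holomorphic_smul (c := fun w => w) differentiableAt_id (hf.differentiable (by simp) _)
  have h5 : (fun w => dbar f w) =ᵐ[volume] fun w => dbar (fun w => w * f w) w * w⁻¹ := by
    have : ∀ᵐ w : ℂ, w ≠ 0 := by simp [ae_iff]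
    filter_upwards [this] with w hw
    rw [h4]
    field_simp
  rw [integral_congr_ae h5, h3]
  simp

end Pompeiu

end MixedBF

namespace MixedBF

section Integrability

theorem lintegral_inv_norm_closedBall (R : ℝ) :
    ∫⁻ w in Metric.closedBall (0 : ℂ) R, ENNReal.ofReal ‖w‖⁻¹ < ⊤ := by
  rw [← lintegral_indicator Metric.isClosed_closedBall.measurableSet,
    ← Complex.lintegral_comp_polarCoord_symm]
  calc ∫⁻ p in polarCoord.target, ENNReal.ofReal p.1 • (Metric.closedBall (0 : ℂ) R).indicator
        (fun w => ENNReal.ofReal ‖w‖⁻¹) (Complex.polarCoord.symm p)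
      ≤ ∫⁻ p in polarCoord.target, (Icc (0 : ℝ) R ×ˢ Icc (-Real.pi) Real.pi).indicator 1 p := by
        refine setLIntegral_mono' (measurableSet_Ioi.prod measurableSet_Ioo) ?_
        rintro ⟨r, θ⟩ ⟨hr, hθ⟩
        have hr' : 0 < r := hr
        by_cases h : Complex.polarCoord.symm (r, θ) ∈ Metric.closedBall (0 : ℂ) R
        · have h2 : r ≤ R := by
            rw [mem_closedBall_zero_iff, Complex.norm_polarCoord_symm, abs_of_pos hr'] at h
            exact h
          rw [indicator_of_mem h, indicator_of_mem (show (r, θ) ∈ Icc (0 : ℝ) R ×ˢ Icc (-Real.pi) Real.pi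
            from ⟨⟨hr'.le, h2⟩, hθ.1.le, hθ.2.le⟩), Complex.norm_polarCoord_symm, abs_of_pos hr',
            smul_eq_mul, ← ENNReal.ofReal_mul hr'.le, mul_inv_cancel₀ hr'.ne']
          simp
        · rw [indicator_of_notMem h]
          simp
    _ ≤ ∫⁻ p, (Icc (0 : ℝ) R ×ˢ Icc (-Real.pi) Real.pi).indicator 1 p :=
        setLIntegral_le_lintegral _ _
    _ < ⊤ := by
        rw [lintegral_indicator_one (measurableSet_Icc.prod measurableSet_Icc)]
        exact (isCompact_Icc.prod isCompact_Icc).measure_lt_top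

theorem integrableOn_inv_norm (s : ℂ) (R : ℝ) :
    IntegrableOn (fun w => ‖w - s‖⁻¹) (Metric.closedBall s R) := by
  refine ⟨(by fun_prop), ?_⟩
  have h1 : ∫⁻ w in Metric.closedBall s R, ENNReal.ofReal ‖w - s‖⁻¹ =
      ∫⁻ w in Metric.closedBall (0 : ℂ) R, ENNReal.ofReal ‖w‖⁻¹ := by
    rw [← lintegral_indicator Metric.isClosed_closedBall.measurableSet,
      ← lintegral_indicator Metric.isClosed_closedBall.measurableSet,
      ← lintegral_sub_right_eq_self ((Metric.closedBall (0 : ℂ) R).indicator _) s]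
    congr 1
    ext w
    simp only [indicator, mem_closedBall_iff_norm, sub_zero]
  rw [HasFiniteIntegral]
  have h2 : ∀ w : ℂ, ‖‖w - s‖⁻¹‖ₑ = ENNReal.ofReal ‖w - s‖⁻¹ := fun w =>
    Real.enorm_of_nonneg (by positivity)
  simp only [h2]
  rw [h1]
  exact lintegral_inv_norm_closedBall R

theorem ae_restrict_diff_finite {T S : Set ℂ} (hS : S.Finite) :
    (volume : Measure ℂ).restrict (T \ S) = volume.restrict T :=
  Measure.restrict_congr_set (sdiff_null_ae_eq_self (hS.measure_zero _))

theorem aestronglyMeasurable_of_finite {V : Type*} [NormedAddCommGroup V] {f : ℂ → V}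
    {T S : Set ℂ} (hT : IsOpen T) (hS : S.Finite) (hf : ContinuousOn f (T \ S)) :
    AEStronglyMeasurable f (volume.restrict T) := by
  rw [← ae_restrict_diff_finite hS]
  exact hf.aestronglyMeasurable (hT.sdiff hS.isClosed).measurableSet

/-- A function that is continuous off a finite set, with singularities at most those of a simple
pole, is integrable on compact sets. -/
theorem integrableOn_of_simple_poles {V : Type*} [NormedAddCommGroup V] {f : ℂ → V}
    {T S K : Set ℂ} (hT : IsOpen T) (hS : S.Finite) (hf : ContinuousOn f (T \ S))
    (hp : ∀ s ∈ S, s ∈ T → ∃ c : ℝ, ∀ᶠ w in 𝓝[≠] s, ‖f w‖ ≤ c * ‖w - s‖⁻¹)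
    (hK : IsCompact K) (hKT : K ⊆ T) : IntegrableOn f K := by
  have hm := aestronglyMeasurable_of_finite hT hS hf
  refine LocallyIntegrableOn.integrableOn_isCompact (fun x hx => ?_) hK
  suffices h : IntegrableAtFilter f (𝓝 x) from h.filter_mono nhdsWithin_le_nhds
  by_cases hxS : x ∈ S
  · obtain ⟨c, hc⟩ := hp x hxS (hKT hx)
    rw [eventually_nhdsWithin_iff] at hc
    obtain ⟨r, hr, hr2⟩ := Metric.nhds_basis_closedBall.mem_iff.1
      (Filter.inter_mem hc (hT.mem_nhds (hKT hx)))
    refine ⟨Metric.closedBall x r, Metric.closedBall_mem_nhds x hr, ?_⟩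
    refine Integrable.mono' ((integrableOn_inv_norm x r).const_mul c) ?_ ?_
    · exact hm.mono_measure (Measure.restrict_mono (fun w hw => (hr2 hw).2) le_rfl)
    · have h0 : ∀ᵐ w ∂(volume : Measure ℂ).restrict (Metric.closedBall x r), w ≠ x :=
        ae_restrict_of_ae (by simp [ae_iff])
      filter_upwards [h0, ae_restrict_mem Metric.isClosed_closedBall.measurableSet] with w h1 h2
      exact (hr2 h2).1 h1
  · have h1 : T \ S ∈ 𝓝 x := (hT.sdiff hS.isClosed).mem_nhds ⟨hKT hx, hxS⟩
    obtain ⟨r, hr, hr2⟩ := Metric.nhds_basis_closedBall.mem_iff.1 h1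
    exact ⟨Metric.closedBall x r, Metric.closedBall_mem_nhds x hr,
      (hf.mono hr2).integrableOn_compact (isCompact_closedBall x r)⟩

end Integrability

section ChangeOfVariables

theorem integral_image_holomorphic {V : Type*} [NormedAddCommGroup V] [NormedSpace ℝ V] {s : Set ℂ}
    (hs : MeasurableSet s) {τ τ' : ℂ → ℂ} (hτ : ∀ w ∈ s, HasDerivAt τ (τ' w) w)
    (hinj : InjOn τ s) (f : ℂ → V) :
    ∫ w in τ '' s, f w = ∫ w in s, (‖τ' w‖ ^ 2) • f (τ w) := by
  rw [integral_image_eq_integral_abs_det_fderiv_smul volume hs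
    (fun w hw => ((hτ w hw).hasFDerivAt.restrictScalars ℝ).hasFDerivWithinAt) hinj]
  refine setIntegral_congr_fun hs fun w _ => ?_
  have : (ContinuousLinearMap.restrictScalars ℝ
      (ContinuousLinearMap.toSpanSingleton ℂ (τ' w) : ℂ →L[ℂ] ℂ)).det = ‖τ' w‖ ^ 2 := by
    simp [ContinuousLinearMap.det, LinearMap.det_restrictScalars, Algebra.norm_complex_eq,
      Complex.normSq_eq_norm_sq]
  simp only [this, abs_of_nonneg (sq_nonneg ‖τ' w‖)]

end ChangeOfVariables

section FundamentalLemma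

theorem eq_zero_of_integral_test {f : ℝ → ℂ} (hf : Continuous f)
    (h : ∀ g : ℝ → ℝ, ContDiff ℝ ∞ g → HasCompactSupport g → ∫ x, g x • f x = 0) (x : ℝ) :
    f x = 0 := by
  have h1 := ae_eq_zero_of_integral_contDiff_smul_eq_zero hf.locallyIntegrable h
  have h2 : f =ᵐ[volume] fun _ => 0 := h1
  exact congrFun (hf.ae_eq_iff_eq volume continuous_const |>.1 h2) x

theorem eqOn_zero_of_integral_test {T : Set ℂ} (hT : IsOpen T) {f : ℂ → ℂ}
    (hf : ContinuousOn f T)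
    (h : ∀ g : ℂ → ℝ, ContDiff ℝ ∞ g → HasCompactSupport g → tsupport g ⊆ T →
      ∫ x, g x • f x = 0) {w : ℂ} (hw : w ∈ T) : f w = 0 := by
  have h1 := hT.ae_eq_zero_of_integral_contDiff_smul_eq_zero
    (hf.locallyIntegrableOn hT.measurableSet) h
  have h2 : f =ᵐ[volume.restrict T] fun _ => 0 := by
    rw [Filter.EventuallyEq, ae_restrict_iff' hT.measurableSet]
    exact h1
  exact Measure.eqOn_open_of_ae_eq h2 hT hf continuousOn_const hw

end FundamentalLemma

section ParametricIntegrals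

variable {X : Type*} [TopologicalSpace X] [MeasurableSpace X] [BorelSpace X]
  [SecondCountableTopology X] [T2Space X] {μ : Measure X} [IsFiniteMeasureOnCompacts μ]
  {V : Type*} [NormedAddCommGroup V] [NormedSpace ℝ V]

theorem hasDerivAt_integral_of_compact {F F' : ℝ → X → V} (hF : ∀ ε, Continuous (F ε))
    (hF' : Continuous (Function.uncurry F')) (hd : ∀ ε x, HasDerivAt (fun e => F e x) (F' ε x) ε)
    {K : Set X} (hK : IsCompact K) (h0 : ∀ ε, ∀ x ∉ K, F ε x = 0) (ε₀ : ℝ) :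
    HasDerivAt (fun ε => ∫ x, F ε x ∂μ) (∫ x, F' ε₀ x ∂μ) ε₀ := by
  obtain ⟨M, hM⟩ := ((isCompact_closedBall ε₀ 1).prod hK).bddAbove_image hF'.norm.continuousOn
  have hM' : ∀ x ∈ K, ∀ ε ∈ Metric.ball ε₀ 1, ‖F' ε x‖ ≤ M := by
    intro x hx ε hε
    exact hM ⟨(ε, x), ⟨Metric.ball_subset_closedBall hε, hx⟩, rfl⟩
  have h0' : ∀ ε, ∀ x ∉ K, F' ε x = 0 := by
    intro ε x hx
    have h1 := hd ε x
    simp only [h0 _ x hx] at h1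
    exact h1.unique (hasDerivAt_const ε 0)
  refine (hasDerivAt_integral_of_dominated_loc_of_deriv_le (F := F) (F' := F')
    (bound := K.indicator fun _ => M)
    (Metric.ball_mem_nhds ε₀ one_pos) (Eventually.of_forall fun ε =>
      (hF ε).aestronglyMeasurable) ?_ ?_ ?_ ?_ ?_).2
  · exact (hF ε₀).integrable_of_hasCompactSupport (HasCompactSupport.intro hK (h0 ε₀))
  · exact (hF'.comp (Continuous.prodMk_right ε₀)).aestronglyMeasurable
  · refine Eventually.of_forall fun x ε hε => ?_
    by_cases hx : x ∈ K
    · rw [indicator_of_mem hx]; exact hM' x hx ε hε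
    · rw [indicator_of_notMem hx, h0' ε x hx, norm_zero]
  · rw [integrable_indicator_iff hK.measurableSet]
    exact integrableOn_const hK.measure_lt_top.ne
  · exact Eventually.of_forall fun x ε _ => hd ε x

end ParametricIntegrals

section Division

variable {V : Type*} [NormedAddCommGroup V] [NormedSpace ℂ V]

theorem contDiff_conj_pow_inv_pow (n : ℕ) : ∀ a b : ℕ, b + n + 1 ≤ a →
    ContDiff ℝ n (fun z : ℂ => (starRingEnd ℂ z) ^ a * (z⁻¹) ^ b) := by
  have hnorm : ∀ a b : ℕ, b ≤ a → ∀ z : ℂ,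
      ‖(starRingEnd ℂ z) ^ a * (z⁻¹) ^ b‖ ≤ ‖z‖ ^ (a - b) := by
    intro a b hab z
    rw [norm_mul, norm_pow, norm_pow, norm_inv, Complex.norm_conj]
    rcases eq_or_ne z 0 with rfl | hz
    · rcases Nat.eq_zero_or_pos b with rfl | hb
      · simp
      · simp [hb.ne']
    · have h1 : ‖z‖ ≠ 0 := by simpa using hz
      rw [inv_pow, ← div_eq_mul_inv, pow_sub₀ _ h1 hab, div_eq_mul_inv]
  have hd : ∀ a b : ℕ, b + 2 ≤ a → ∀ z : ℂ,
      HasFDerivAt (fun z : ℂ => (starRingEnd ℂ z) ^ a * (z⁻¹) ^ b)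
        ((a * ((starRingEnd ℂ z) ^ (a - 1) * (z⁻¹) ^ b)) • (Complex.conjCLE : ℂ →L[ℝ] ℂ) +
          (-b * ((starRingEnd ℂ z) ^ a * (z⁻¹) ^ (b + 1))) • ContinuousLinearMap.id ℝ ℂ) z := by
    intro a b hab z
    rcases eq_or_ne z 0 with rfl | hz
    · have h1 : a - 1 ≠ 0 := by omega
      have h2 : a ≠ 0 := by omega
      simp only [map_zero, ne_eq, h1, h2, not_false_eq_true, zero_pow, zero_mul, mul_zero]
      have h3 : (0 : ℂ) • (Complex.conjCLE : ℂ →L[ℝ] ℂ) + (0 : ℂ) • ContinuousLinearMap.id ℝ ℂ =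
          0 := by ext v; simp
      refine HasFDerivAt.congr_fderiv (f' := 0) ?_ h3.symm
      rw [hasFDerivAt_iff_isLittleO_nhds_zero]
      simp only [zero_add, map_zero, ne_eq, h2, not_false_eq_true, zero_pow, zero_mul, sub_zero,
        zero_apply]
      refine Asymptotics.IsBigO.trans_isLittleO (g := fun h : ℂ => ‖h‖ ^ 2) ?_ ?_
      · refine Asymptotics.IsBigO.of_bound 1 ?_
        filter_upwards [Metric.ball_mem_nhds (0 : ℂ) one_pos] with h hh
        refine (hnorm a b (by omega) h).trans ?_
        rw [norm_pow, norm_norm, one_mul]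
        exact pow_le_pow_of_le_one (norm_nonneg h) (by simpa using (mem_ball_zero_iff.1 hh).le)
          (by omega)
      · have := (Asymptotics.isLittleO_pow_id (𝕜 := ℝ) (n := 2) (by norm_num)).comp_tendsto
          (tendsto_norm_zero (E := ℂ))
        exact (this.trans_isBigO (Asymptotics.isBigO_refl _ _).norm_left)
    · have h1 : HasFDerivAt (fun z : ℂ => (starRingEnd ℂ z) ^ a) _ z :=
        ((Complex.conjCLE : ℂ →L[ℝ] ℂ).hasFDerivAt (x := z)).pow a
      have h2 : HasFDerivAt (fun z : ℂ => (z⁻¹) ^ b)  _ z :=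
        ((((hasDerivAt_inv hz).pow b)).hasFDerivAt.restrictScalars ℝ)
      refine (h1.mul h2).congr_fderiv ?_
      obtain ⟨a, rfl⟩ : ∃ c, a = c + 1 := ⟨a - 1, by omega⟩
      rcases Nat.eq_zero_or_pos b with rfl | hb
      · ext v
        simp
      obtain ⟨b, rfl⟩ : ∃ c, b = c + 1 := ⟨b - 1, by omega⟩
      ext v
      simp
      field_simp
      ring
  induction n with
  | zero =>
    intro a b hab
    rw [Nat.cast_zero, contDiff_zero, continuous_iff_continuousAt]
    intro z
    rcases eq_or_ne z 0 with rfl | hz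
    · have h2 : a ≠ 0 := by omega
      rw [ContinuousAt]
      simp only [map_zero, ne_eq, h2, not_false_eq_true, zero_pow, zero_mul]
      refine squeeze_zero_norm (hnorm a b (by omega)) ?_
      have : Continuous fun z : ℂ => ‖z‖ ^ (a - b) := by fun_prop
      have h3 := this.tendsto 0
      have h4 : a - b ≠ 0 := by omega
      simpa [h4] using h3
    · have : ContinuousAt (fun z : ℂ => z⁻¹) z := continuousAt_inv₀ hz
      exact (Complex.continuous_conj.continuousAt.pow a).mul (this.pow b)
  | succ n ih =>
    intro a b hab
    rw [Nat.cast_succ, contDiff_succ_iff_fderiv]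
    refine ⟨fun z => (hd a b (by omega) z).differentiableAt, by simp, ?_⟩
    have : fderiv ℝ (fun z : ℂ => (starRingEnd ℂ z) ^ a * (z⁻¹) ^ b) = _ :=
      funext fun z => (hd a b (by omega) z).fderiv
    rw [this]
    exact ((contDiff_const.mul (ih (a - 1) b (by omega))).smul contDiff_const).add
      ((contDiff_const.mul (ih a (b + 1) (by omega))).smul contDiff_const)

section

universe w

theorem contDiff_integral_segment (n : ℕ) : ∀ (V : Type w) [NormedAddCommGroup V] [NormedSpace ℝ V]
    (f : ℂ → V) (p : ℝ → ℝ), ContDiff ℝ ∞ f → Continuous p →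
    ContDiff ℝ n (fun z : ℂ => ∫ t in (0 : ℝ)..1, p t • f (t • z)) := by
  induction n with
  | zero =>
    intro V _ _ f p hf hp
    rw [Nat.cast_zero, contDiff_zero]
    have := hf.continuous
    exact intervalIntegral.continuous_parametric_intervalIntegral_of_continuous' (by fun_prop) 0 1
  | succ n ih =>
    intro V _ _ f p hf hp
    have hf0 := hf.continuous
    have hf1 : ContDiff ℝ ∞ (fderiv ℝ f) := (contDiff_infty_iff_fderiv.1 hf).2
    have hf2 := hf1.continuous
    have hF' : Continuous (fun y : ℂ × ℝ => (p y.2 * y.2) • fderiv ℝ f (y.2 • y.1)) := by fun_prop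
    have hd : ∀ z, HasFDerivAt (fun z : ℂ => ∫ t in (0 : ℝ)..1, p t • f (t • z))
        (∫ t in (0 : ℝ)..1, (p t * t) • fderiv ℝ f (t • z)) z := by
      intro z
      obtain ⟨M, hM⟩ := ((isCompact_closedBall z 1).prod (isCompact_Icc (a := (0 : ℝ))
        (b := 1))).bddAbove_image hF'.norm.continuousOn
      refine intervalIntegral.hasFDerivAt_integral_of_dominated_of_fderiv_le
        (F' := fun z t => (p t * t) • fderiv ℝ f (t • z)) (bound := fun _ => M)
        (Metric.ball_mem_nhds z one_pos) (Eventually.of_forall fun x => ?_) ?_ ?_ ?_ ?_ ?_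
      · exact Continuous.aestronglyMeasurable (by fun_prop)
      · exact Continuous.intervalIntegrable (by fun_prop) _ _
      · exact Continuous.aestronglyMeasurable (by fun_prop)
      · refine Eventually.of_forall fun t ht x hx => ?_
        rw [uIoc_of_le zero_le_one] at ht
        exact hM ⟨(x, t), ⟨Metric.ball_subset_closedBall hx, ht.1.le, ht.2⟩, rfl⟩
      · exact intervalIntegrable_const
      · refine Eventually.of_forall fun t ht x hx => ?_
        have h1 : HasFDerivAt (fun x : ℂ => t • x) (t • ContinuousLinearMap.id ℝ ℂ) x :=
          (hasFDerivAt_id x).const_smul t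
        have h2 : HasFDerivAt f (fderiv ℝ f (t • x)) (t • x) :=
          (hf.differentiable (by simp) _).hasFDerivAt
        refine ((h2.comp x h1).const_smul (p t)).congr_fderiv ?_
        ext v
        simp [smul_smul]
    rw [Nat.cast_succ, contDiff_succ_iff_fderiv]
    refine ⟨fun z => (hd z).differentiableAt, by simp, ?_⟩
    rw [funext fun z => (hd z).fderiv]
    exact ih (ℂ →L[ℝ] V) (fderiv ℝ f) (fun t => p t * t) hf1 (by fun_prop)

end

/-- Hadamard's lemma. -/
theorem exists_eq_add_smul_add_conj_smul [CompleteSpace V] {f : ℂ → V} (hf : ContDiff ℝ ∞ f) :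
    ∃ a b : ℂ → V, ContDiff ℝ ∞ a ∧ ContDiff ℝ ∞ b ∧
      ∀ z, f z = f 0 + z • a z + (starRingEnd ℂ z) • b z := by
  have hf1 : ContDiff ℝ ∞ (fderiv ℝ f) := (contDiff_infty_iff_fderiv.1 hf).2
  let A : ℂ → V := fun z => (1 / 2 : ℂ) • (fderiv ℝ f z 1 - Complex.I • fderiv ℝ f z Complex.I)
  have h1 : ContDiff ℝ ∞ fun z => fderiv ℝ f z 1 := hf1.clm_apply contDiff_const
  have hI : ContDiff ℝ ∞ fun z => fderiv ℝ f z Complex.I := hf1.clm_apply contDiff_const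
  have hA : ContDiff ℝ ∞ A := (h1.sub (hI.const_smul Complex.I)).const_smul (1 / 2 : ℂ)
  have hB : ContDiff ℝ ∞ (dbar f) := (h1.add (hI.const_smul Complex.I)).const_smul (1 / 2 : ℂ)
  have hAB : ∀ z v : ℂ, fderiv ℝ f z v = v • A z + (starRingEnd ℂ v) • dbar f z := by
    intro z v
    have h2 : fderiv ℝ f z v = v.re • fderiv ℝ f z 1 + v.im • fderiv ℝ f z Complex.I := by
      rw [← map_smul, ← map_smul, ← map_add]
      congr 1
      apply Complex.ext <;> simp
    have h3 : v = (v.re : ℂ) + (v.im : ℂ) * Complex.I := (Complex.re_add_im v).symm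
    rw [h2]
    generalize hre : v.re = a at *
    generalize him : v.im = b at *
    subst h3
    simp only [A, dbar, map_add, map_mul, Complex.conj_ofReal, Complex.conj_I]
    rw [← Complex.coe_smul a, ← Complex.coe_smul b]
    simp only [smul_add, smul_sub, smul_smul]
    have e := Complex.I_sq
    match_scalars
    · ring
    · linear_combination (b : ℂ) * e
  have hseg : ∀ g : ℂ → V, ContDiff ℝ ∞ g → ContDiff ℝ ∞ fun z : ℂ => ∫ t in (0 : ℝ)..1, g (t • z) := by
    intro g hg
    rw [contDiff_infty]
    intro n
    simpa using contDiff_integral_segment n V g (fun _ => 1) hg continuous_const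
  refine ⟨fun z => ∫ t in (0 : ℝ)..1, A (t • z), fun z => ∫ t in (0 : ℝ)..1, dbar f (t • z),
    hseg _ hA, hseg _ hB, fun z => ?_⟩
  have hA' := hA.continuous
  have hB' := hB.continuous
  have h4 : ∀ t : ℝ, HasDerivAt (fun t : ℝ => f (t • z))
      (z • A (t • z) + (starRingEnd ℂ z) • dbar f (t • z)) t := by
    intro t
    rw [← hAB]
    have h2 : HasFDerivAt f (fderiv ℝ f (t • z)) (t • z) :=
      (hf.differentiable (by simp) _).hasFDerivAt
    have h5 : HasDerivAt (fun t : ℝ => t • z) z t := by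
      simpa using (hasDerivAt_id t).smul_const z
    exact h2.comp_hasDerivAt t h5
  have h6 := intervalIntegral.integral_eq_sub_of_hasDerivAt (a := 0) (b := 1) (fun t _ => h4 t)
    (Continuous.intervalIntegrable (by fun_prop) _ _)
  rw [intervalIntegral.integral_add (Continuous.intervalIntegrable (by fun_prop) _ _)
    (Continuous.intervalIntegrable (by fun_prop) _ _), one_smul, zero_smul] at h6
  have h7 : ∀ (c : ℂ) (g : ℂ → V), ∫ t in (0 : ℝ)..1, c • g (t • z) =
      c • ∫ t in (0 : ℝ)..1, g (t • z) := fun c g => intervalIntegral.integral_smul c _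
  rw [h7, h7] at h6
  rw [add_assoc, h6]
  abel

theorem contDiff_smul_of_tsupport_subset {X W : Type*} [NormedAddCommGroup X] [NormedSpace ℝ X]
    [NormedAddCommGroup W] [NormedSpace ℝ W] {χ : X → ℝ} {f : X → W} {U : Set X} (hU : IsOpen U)
    (hχ : ContDiff ℝ ∞ χ) (hf : ContDiffOn ℝ ∞ f U) (hs : tsupport χ ⊆ U) :
    ContDiff ℝ ∞ (fun x => χ x • f x) := by
  rw [contDiff_iff_contDiffAt]
  intro x
  by_cases hx : x ∈ tsupport χ
  · exact hχ.contDiffAt.smul (hf.contDiffAt (hU.mem_nhds (hs hx)))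
  · have : (fun x => χ x • f x) =ᶠ[𝓝 x] fun _ => 0 := by
      filter_upwards [notMem_tsupport_iff_eventuallyEq.1 hx] with y hy
      rw [hy]; simp
    exact contDiffAt_const.congr_of_eventuallyEq this

theorem exists_bump {X : Type*} [NormedAddCommGroup X] [NormedSpace ℝ X]
    [FiniteDimensional ℝ X] {s : X} {U : Set X} (hU : U ∈ 𝓝 s) :
    ∃ χ : X → ℝ, ContDiff ℝ ∞ χ ∧ HasCompactSupport χ ∧ tsupport χ ⊆ U ∧ χ =ᶠ[𝓝 s] 1 := by
  obtain ⟨r, hr, hr2⟩ := Metric.nhds_basis_closedBall.mem_iff.1 hU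
  let χ : ContDiffBump s := ⟨r / 2, r, by positivity, by linarith⟩
  have : HasContDiffBump X := inferInstance
  exact ⟨χ, χ.contDiff, χ.hasCompactSupport, by rw [χ.tsupport_eq]; exact hr2,
    χ.eventuallyEq_one⟩

theorem exists_contDiff_eventuallyEq {X W : Type*} [NormedAddCommGroup X] [NormedSpace ℝ X]
    [FiniteDimensional ℝ X] [NormedAddCommGroup W] [NormedSpace ℝ W] {f : X → W} {U : Set X}
    (hU : IsOpen U) (hf : ContDiffOn ℝ ∞ f U) {s : X} (hs : s ∈ U) :
    ∃ g : X → W, ContDiff ℝ ∞ g ∧ g =ᶠ[𝓝 s] f := by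
  obtain ⟨χ, h1, -, h2, h3⟩ := exists_bump (hU.mem_nhds hs)
  refine ⟨_, contDiff_smul_of_tsupport_subset hU h1 hf h2, ?_⟩
  filter_upwards [h3] with y hy
  rw [hy]; simp

theorem dbar_conj_pow (r : ℕ) (z : ℂ) :
    dbar (fun z : ℂ => (starRingEnd ℂ z) ^ r) z = r * (starRingEnd ℂ z) ^ (r - 1) := by
  have h1 : HasFDerivAt (fun z : ℂ => (starRingEnd ℂ z) ^ r) _ z :=
    ((Complex.conjCLE : ℂ →L[ℝ] ℂ).hasFDerivAt (x := z)).pow r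
  rw [HasFDerivAt.dbar_eq h1]
  simp [dbarOf]
  linear_combination (-(1 / 2 : ℂ) * (r * (starRingEnd ℂ z) ^ (r - 1))) * Complex.I_sq

theorem dbar_conj_pow_smul (r : ℕ) {f : ℂ → V} {z : ℂ} (hf : DifferentiableAt ℝ f z) :
    dbar (fun z : ℂ => (starRingEnd ℂ z) ^ r • f z) z =
      (r * (starRingEnd ℂ z) ^ (r - 1)) • f z + (starRingEnd ℂ z) ^ r • dbar f z := by
  have h : DifferentiableAt ℝ (fun z : ℂ => (starRingEnd ℂ z) ^ r) z :=
    ((Complex.conjCLE : ℂ →L[ℝ] ℂ).hasFDerivAt.pow r).differentiableAt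
  rw [dbar_smul h hf, dbar_conj_pow]

theorem dbar_id_smul {f : ℂ → V} {z : ℂ} (hf : DifferentiableAt ℝ f z) :
    dbar (fun z : ℂ => z • f z) z = z • dbar f z :=
  dbar_holomorphic_smul (c := fun z => z) differentiableAt_id hf

theorem dbar_id_smul_add_conj_pow_smul (r : ℕ) {f g : ℂ → V} {z : ℂ} (hf : DifferentiableAt ℝ f z)
    (hg : DifferentiableAt ℝ g z) :
    dbar (fun z : ℂ => z • f z + (starRingEnd ℂ z) ^ r • g z) z =
      z • dbar f z + ((r * (starRingEnd ℂ z) ^ (r - 1)) • g z + (starRingEnd ℂ z) ^ r • dbar g z) := by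
  have h : DifferentiableAt ℝ (fun z : ℂ => (starRingEnd ℂ z) ^ r) z :=
    ((Complex.conjCLE : ℂ →L[ℝ] ℂ).hasFDerivAt.pow r).differentiableAt
  have h1 : DifferentiableAt ℝ (fun z : ℂ => z • f z) z := differentiableAt_id.smul hf
  have h2 : DifferentiableAt ℝ (fun z : ℂ => (starRingEnd ℂ z) ^ r • g z) z := h.smul hg
  rw [dbar_add h1 h2, dbar_id_smul hf, dbar_conj_pow_smul _ hg]

theorem eventually_differentiableAt {W : Type*} [NormedAddCommGroup W] [NormedSpace ℝ W]
    {f : ℂ → W} {s : ℂ} (hf : ContDiffAt ℝ ∞ f s) : ∀ᶠ z in 𝓝 s, DifferentiableAt ℝ f z := by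
  have : ContDiffAt ℝ (1 : ℕ) f s := hf.of_le (by exact_mod_cast le_top)
  filter_upwards [this.eventually (by simp)] with z hz
  exact hz.differentiableAt (by simp)

theorem contDiff_conj_pow (r : ℕ) : ContDiff ℝ ∞ fun z : ℂ => (starRingEnd ℂ z) ^ r :=
  (Complex.conjCLE : ℂ →L[ℝ] ℂ).contDiff.pow r

theorem eq_zero_of_conj_pow_smul (r : ℕ) : ∀ (c : V) (α β : ℂ → V), ContDiffAt ℝ ∞ α 0 →
    ContDiffAt ℝ ∞ β 0 →
    (∀ᶠ z in 𝓝 (0 : ℂ), (starRingEnd ℂ z) ^ r • c = z • α z + (starRingEnd ℂ z) ^ (r + 1) • β z) →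
    c = 0 := by
  induction r with
  | zero =>
    intro c α β _ _ h
    simpa using h.self_of_nhds
  | succ r ih =>
    intro c α β hα hβ h
    have h1 := ih ((r + 1 : ℂ) • c) (dbar α)
      (fun z => (r + 2 : ℂ) • β z + (starRingEnd ℂ z) • dbar β z) (ContDiffAt.dbar hα)
      ((contDiffAt_const.smul hβ).add
        (((Complex.conjCLE : ℂ →L[ℝ] ℂ).contDiff.contDiffAt).smul (ContDiffAt.dbar hβ))) ?_
    · have h2 : (r + 1 : ℂ) ≠ 0 := by exact_mod_cast Nat.succ_ne_zero r
      exact (smul_eq_zero.1 h1).resolve_left h2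
    · filter_upwards [h.eventually_nhds, eventually_differentiableAt hα,
        eventually_differentiableAt hβ] with z hz h3 h4
      have h5 := Filter.EventuallyEq.dbar_eq hz
      rw [dbar_conj_pow_smul _ (differentiableAt_const c), dbar_const,
        dbar_id_smul_add_conj_pow_smul _ h3 h4] at h5
      simp only [Nat.add_sub_cancel, smul_zero, add_zero] at h5
      push_cast at h5
      simp only [smul_add, smul_smul] at h5 ⊢
      rw [mul_comm] at h5
      rw [h5]
      module

/-- If `∂̄ k = L k` and `k 0 = 0` then `k` is divisible by `z` in the ring of smooth functions. -/
theorem exists_eq_smul_of_dbar_eq [CompleteSpace V] {k : ℂ → V} {L : ℂ → V →L[ℂ] V}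
    (hk : ContDiff ℝ ∞ k) (hL : ContDiffAt ℝ ∞ L 0)
    (hd : ∀ᶠ z in 𝓝 0, dbar k z = L z (k z)) (h0 : k 0 = 0) :
    ∃ m : ℂ → V, ContDiffAt ℝ ∞ m 0 ∧ ∀ z, k z = z • m z := by
  have hLR : ContDiffAt ℝ ∞ (fun z => (L z).restrictScalars ℝ) 0 :=
    (ContinuousLinearMap.restrictScalarsL ℂ V V ℝ ℝ).contDiff.contDiffAt.comp 0 hL
  have dec : ∀ r : ℕ, ∃ M b : ℂ → V, ContDiff ℝ ∞ M ∧ ContDiff ℝ ∞ b ∧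
      ∀ᶠ z in 𝓝 0, k z = z • M z + (starRingEnd ℂ z) ^ r • b z := by
    intro r
    induction r with
    | zero => exact ⟨0, k, contDiff_const, hk, by simp⟩
    | succ r ih =>
      obtain ⟨M, b, hM, hb, h⟩ := ih
      obtain ⟨a, b', ha, hb', hab⟩ := exists_eq_add_smul_add_conj_smul hb
      have hb0 : b 0 = 0 := by
        rcases Nat.eq_zero_or_pos r with rfl | hr
        · simpa [h0] using h.self_of_nhds.symm
        obtain ⟨r, rfl⟩ : ∃ c, r = c + 1 := ⟨r - 1, by omega⟩
        have h1 := eq_zero_of_conj_pow_smul r ((r + 1 : ℂ) • b 0)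
          (fun z => L z (M z) - dbar M z - (r + 1 : ℂ) • (starRingEnd ℂ z) ^ r • a z)
          (fun z => L z (b z) - dbar b z - (r + 1 : ℂ) • b' z)
          (((hLR.clm_apply hM.contDiffAt).sub (ContDiffAt.dbar hM.contDiffAt)).sub
            (contDiffAt_const.smul ((contDiff_conj_pow r).contDiffAt.smul ha.contDiffAt)))
          (((hLR.clm_apply hb.contDiffAt).sub (ContDiffAt.dbar hb.contDiffAt)).sub
            (contDiffAt_const.smul hb'.contDiffAt)) ?_
        · have h2 : (r + 1 : ℂ) ≠ 0 := by exact_mod_cast Nat.succ_ne_zero r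
          exact (smul_eq_zero.1 h1).resolve_left h2
        · filter_upwards [h.eventually_nhds, hd] with z hz hdz
          have h3 : DifferentiableAt ℝ M z := hM.differentiable (by simp) z
          have h4 : DifferentiableAt ℝ b z := hb.differentiable (by simp) z
          have h5 := Filter.EventuallyEq.dbar_eq hz
          rw [hdz, hz.self_of_nhds, dbar_id_smul_add_conj_pow_smul _ h3 h4] at h5
          simp only [Nat.add_sub_cancel, map_add, map_smul] at h5
          push_cast at h5
          have h7 := hab z
          have h8 : (r + 1 : ℂ) • b 0 = (r + 1 : ℂ) • b z - (r + 1 : ℂ) • z • a z -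
              (r + 1 : ℂ) • (starRingEnd ℂ z) • b' z := by
            rw [h7]; module
          rw [h8]
          simp only [smul_sub]
          have h9 : (starRingEnd ℂ z) ^ r • (r + 1 : ℂ) • b z = z • L z (M z) +
              (starRingEnd ℂ z) ^ (r + 1) • L z (b z) - z • dbar M z -
              (starRingEnd ℂ z) ^ (r + 1) • dbar b z := by
            rw [h5]; module
          rw [h9]
          module
      refine ⟨fun z => M z + (starRingEnd ℂ z) ^ r • a z, b', hM.add
        ((contDiff_conj_pow r).smul ha), hb', ?_⟩
      filter_upwards [h] with z hz
      rw [hz, hab z, hb0, zero_add]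
      module
  obtain ⟨M₂, b₂, hM₂, hb₂, h₂⟩ := dec 2
  let m : ℂ → V := fun z => if z = 0 then M₂ 0 else z⁻¹ • k z
  refine ⟨m, ?_, fun z => ?_⟩
  · rw [contDiffAt_infty]
    intro n
    obtain ⟨M, b, hM, hb, h⟩ := dec (n + 2)
    have hform : ∀ (r : ℕ) (M b : ℂ → V), (∀ᶠ z in 𝓝 0, k z = z • M z + (starRingEnd ℂ z) ^ r • b z) →
        ∀ᶠ z in 𝓝 0, z ≠ 0 → m z = M z + ((starRingEnd ℂ z) ^ r * (z⁻¹) ^ 1) • b z := by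
      intro r M b h
      filter_upwards [h] with z hz h0
      simp only [m, if_neg h0]
      rw [hz, smul_add, inv_smul_smul₀ h0, smul_smul, pow_one, mul_comm]
    have hc : ∀ (n : ℕ) (M b : ℂ → V), ContDiff ℝ ∞ M → ContDiff ℝ ∞ b → ContDiff ℝ n
        fun z => M z + ((starRingEnd ℂ z) ^ (n + 2) * (z⁻¹) ^ 1) • b z := fun n M b hM hb =>
      (hM.of_le (by exact_mod_cast le_top)).add ((contDiff_conj_pow_inv_pow n (n + 2) 1
        (by omega)).smul (hb.of_le (by exact_mod_cast le_top)))
    have h0 : M 0 = M₂ 0 := by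
      have hle : 𝓝[≠] (0 : ℂ) ≤ 𝓝 0 := nhdsWithin_le_nhds
      have t1 := ((hc n M b hM hb).continuous.tendsto 0).mono_left hle
      have t2 := ((hc 0 M₂ b₂ hM₂ hb₂).continuous.tendsto 0).mono_left hle
      have t3 := tendsto_nhds_unique (t1.congr' ?_) t2
      · simpa using t3
      · filter_upwards [eventually_nhdsWithin_of_eventually_nhds (hform _ _ _ h),
          eventually_nhdsWithin_of_eventually_nhds (hform _ _ _ h₂), self_mem_nhdsWithin]
          with z h1 h2 h3
        rw [← h1 h3, h2 h3]
    refine (hc n M b hM hb).contDiffAt.congr_of_eventuallyEq ?_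
    filter_upwards [hform _ _ _ h] with z hz
    rcases eq_or_ne z 0 with rfl | h3
    · simp [m, h0]
    · exact hz h3
  · rcases eq_or_ne z 0 with rfl | h3
    · simp [h0]
    · simp only [m, if_neg h3]
      rw [smul_inv_smul₀ h3]

theorem exists_eq_sub_smul_of_dbar_eq [CompleteSpace V] {U : Set ℂ} (hU : IsOpen U) {s : ℂ}
    (hs : s ∈ U) {k : ℂ → V} {L : ℂ → V →L[ℂ] V}
    (hk : ContDiffOn ℝ ∞ k U) (hL : ContDiffOn ℝ ∞ L U)
    (hd : ∀ z ∈ U, dbar k z = L z (k z)) (h0 : k s = 0) :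
    ∃ m : ℂ → V, ContDiffOn ℝ ∞ m U ∧ ∀ z, k z = (z - s) • m z := by
  obtain ⟨g, hg, hgk⟩ := exists_contDiff_eventuallyEq hU hk hs
  have hsh : Tendsto (fun z => s + z) (𝓝 0) (𝓝 s) := by
    simpa using (continuous_const_add s).tendsto 0
  have hsub : Tendsto (fun z => z - s) (𝓝 s) (𝓝 0) := by
    simpa using (continuous_sub_right s).tendsto s
  have hadd : ContDiff ℝ ∞ fun z : ℂ => s + z := contDiff_const.add contDiff_id
  have hdd : ∀ᶠ z in 𝓝 0, dbar (fun z => g (s + z)) z = L (s + z) (g (s + z)) := by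
    filter_upwards [hsh.eventually hgk.eventually_nhds, hsh.eventually (hU.mem_nhds hs)]
      with z hz1 hz2
    have h1 : dbar (fun z => g (s + z)) z = dbar g (s + z) := by
      simp only [dbar, fderiv_comp_add_left]
    rw [h1, Filter.EventuallyEq.dbar_eq hz1, hd _ hz2, hz1.self_of_nhds]
  obtain ⟨m₀, hm₀, h⟩ := exists_eq_smul_of_dbar_eq (k := fun z => g (s + z))
    (L := fun z => L (s + z)) (hg.comp hadd)
    (ContDiffAt.comp (g := L) (0 : ℂ) (by simpa using hL.contDiffAt (hU.mem_nhds hs))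
      hadd.contDiffAt) hdd (by simp [hgk.self_of_nhds, h0])
  · let m : ℂ → V := fun w => if w = s then m₀ 0 else (w - s)⁻¹ • k w
    have hm : ∀ z, k z = (z - s) • m z := by
      intro z
      rcases eq_or_ne z s with rfl | h3
      · simp [h0]
      · simp only [m, if_neg h3]
        rw [smul_inv_smul₀ (sub_ne_zero.2 h3)]
    refine ⟨m, fun w hw => ContDiffAt.contDiffWithinAt ?_, hm⟩
    rcases eq_or_ne w s with rfl | h3
    · have h4 : ContDiffAt ℝ ∞ (fun z => m₀ (z - w)) w :=
        ContDiffAt.comp (g := m₀) w (by simpa using hm₀) (contDiffAt_id.sub contDiffAt_const)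
      refine h4.congr_of_eventuallyEq ?_
      filter_upwards [hgk] with z hz
      rcases eq_or_ne z w with rfl | h3
      · simp [m]
      · have h5 := h (z - w)
        simp only [add_sub_cancel] at h5
        simp only [m, if_neg h3]
        rw [← hz, h5, inv_smul_smul₀ (sub_ne_zero.2 h3)]
    · have h4 : ContDiffAt ℝ ∞ (fun z => (z - s)⁻¹ • k z) w :=
        ((contDiffAt_id.sub contDiffAt_const).inv (sub_ne_zero.2 h3)).smul
          (hk.contDiffAt (hU.mem_nhds hw))
      refine h4.congr_of_eventuallyEq ?_
      filter_upwards [isOpen_ne.mem_nhds h3] with z hz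
      simp only [m, if_neg hz]

end Division

section SlopeIntegral

variable {X : Type*} [TopologicalSpace X] [MeasurableSpace X] [BorelSpace X]
  [SecondCountableTopology X] [T2Space X] {μ : Measure X} [IsLocallyFiniteMeasure μ]
  {V : Type*} [NormedAddCommGroup V] [NormedSpace ℝ V]

theorem hasDerivAt_integral_smul_of_compact {a : ℝ → X → V}
    (ha : Continuous (Function.uncurry a)) {K : Set X} (hK : IsCompact K)
    (h0 : ∀ ε, ∀ x ∉ K, a ε x = 0) :
    HasDerivAt (fun ε => ∫ x, ε • a ε x ∂μ) (∫ x, a 0 x ∂μ) 0 := by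
  have hc : Continuous fun ε => ∫ x, a ε x ∂μ := by
    have h1 : ∀ ε, ∫ x in K, a ε x ∂μ = ∫ x, a ε x ∂μ := fun ε =>
      setIntegral_eq_integral_of_forall_compl_eq_zero (h0 ε)
    have := continuous_parametric_integral_of_continuous (μ := μ) ha hK
    simpa only [h1] using this
  rw [hasDerivAt_iff_tendsto_slope]
  refine ((hc.tendsto 0).mono_left nhdsWithin_le_nhds).congr' ?_
  filter_upwards [self_mem_nhdsWithin] with ε hε
  have hε' : ε ≠ 0 := hε
  simp [slope, integral_smul, hε']

end SlopeIntegral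

end MixedBF

namespace MixedBF

section Charts

variable {C ι : Type*} [TopologicalSpace C] [ChartedSpace ℂ C] [IsManifold 𝓘(ℂ) ω C]
  (𝒰 : HolAtlas C ι) {I J K : ι} {x : C} {w : ℂ}

/-- The change of coordinates from `z_I` to `z_J`. -/
def HolAtlas.trans (I J : ι) (w : ℂ) : ℂ := 𝒰.chart J ((𝒰.chart I).symm w)

/-- The image of `U_I ∩ U_J` under `z_I`. -/
def HolAtlas.overlap (I J : ι) : Set ℂ :=
  (𝒰.chart I).target ∩ (𝒰.chart I).symm ⁻¹' (𝒰.chart J).source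

namespace HolAtlas

theorem isOpen_overlap (I J : ι) : IsOpen (𝒰.overlap I J) :=
  (𝒰.chart I).isOpen_inter_preimage_symm (𝒰.chart J).open_source

theorem chart_mem_overlap (hI : x ∈ (𝒰.chart I).source) (hJ : x ∈ (𝒰.chart J).source) :
    𝒰.chart I x ∈ 𝒰.overlap I J :=
  ⟨(𝒰.chart I).map_source hI, by simpa [(𝒰.chart I).left_inv hI] using hJ⟩

theorem trans_chart (hI : x ∈ (𝒰.chart I).source) : 𝒰.trans I J (𝒰.chart I x) = 𝒰.chart J x := by
  simp [trans, (𝒰.chart I).left_inv hI]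

theorem symm_trans (hw : w ∈ 𝒰.overlap I J) :
    (𝒰.chart J).symm (𝒰.trans I J w) = (𝒰.chart I).symm w :=
  (𝒰.chart J).left_inv hw.2

theorem trans_mem_overlap (hw : w ∈ 𝒰.overlap I J) : 𝒰.trans I J w ∈ 𝒰.overlap J I :=
  𝒰.chart_mem_overlap hw.2 ((𝒰.chart I).map_target hw.1)

theorem trans_trans (hw : w ∈ 𝒰.overlap I J) : 𝒰.trans J I (𝒰.trans I J w) = w := by
  rw [trans, 𝒰.symm_trans hw, (𝒰.chart I).right_inv hw.1]

theorem contDiffOn_trans (I J : ι) : ContDiffOn ℂ ω (𝒰.trans I J) (𝒰.overlap I J) := by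
  rw [← contMDiffOn_iff_contDiffOn]
  exact (contMDiffOn_of_mem_maximalAtlas (𝒰.chart_mem J)).comp
    ((contMDiffOn_symm_of_mem_maximalAtlas (𝒰.chart_mem I)).mono inter_subset_left)
    (fun w hw => hw.2)

theorem hasDerivAt_trans (hw : w ∈ 𝒰.overlap I J) :
    HasDerivAt (𝒰.trans I J) (𝒰.jac I J ((𝒰.chart I).symm w)) w := by
  have h := ((𝒰.contDiffOn_trans I J).contDiffAt ((𝒰.isOpen_overlap I J).mem_nhds hw))
  have h2 := (h.differentiableAt (by simp)).hasDerivAt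
  rw [jac, (𝒰.chart I).right_inv hw.1]
  exact h2

theorem contDiffOn_jac (I J : ι) :
    ContDiffOn ℂ ω (fun w => 𝒰.jac I J ((𝒰.chart I).symm w)) (𝒰.overlap I J) := by
  have h : ContDiffOn ℂ ω (deriv (𝒰.trans I J)) (𝒰.overlap I J) :=
    (𝒰.contDiffOn_trans I J).deriv_of_isOpen (m := ω) (𝒰.isOpen_overlap I J) (by simp)
  refine h.congr fun w hw => (𝒰.hasDerivAt_trans hw).deriv.symm

theorem trans_eventuallyEq_comp (hI : x ∈ (𝒰.chart I).source) (hJ : x ∈ (𝒰.chart J).source) :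
    𝒰.trans I K =ᶠ[𝓝 (𝒰.chart I x)] 𝒰.trans J K ∘ 𝒰.trans I J := by
  filter_upwards [(𝒰.isOpen_overlap I J).mem_nhds (𝒰.chart_mem_overlap hI hJ)] with w hw
  simp [trans, (𝒰.chart J).left_inv hw.2]

theorem jac_self (hI : x ∈ (𝒰.chart I).source) : 𝒰.jac I I x = 1 := by
  have h := 𝒰.hasDerivAt_trans (𝒰.chart_mem_overlap hI hI)
  rw [(𝒰.chart I).left_inv hI] at h
  refine h.unique ((hasDerivAt_id _).congr_of_eventuallyEq ?_)
  filter_upwards [(𝒰.chart I).open_target.mem_nhds ((𝒰.chart I).map_source hI)] with w hw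
  exact (𝒰.chart I).right_inv hw

theorem hasDerivAt_trans_chart (hI : x ∈ (𝒰.chart I).source) (hJ : x ∈ (𝒰.chart J).source) :
    HasDerivAt (𝒰.trans I J) (𝒰.jac I J x) (𝒰.chart I x) := by
  have h := 𝒰.hasDerivAt_trans (𝒰.chart_mem_overlap hI hJ)
  rwa [(𝒰.chart I).left_inv hI] at h

theorem jac_mul (hI : x ∈ (𝒰.chart I).source) (hJ : x ∈ (𝒰.chart J).source)
    (hK : x ∈ (𝒰.chart K).source) : 𝒰.jac I J x * 𝒰.jac J K x = 𝒰.jac I K x := by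
  have h1 := 𝒰.hasDerivAt_trans_chart hI hJ
  have h2 := 𝒰.hasDerivAt_trans_chart hJ hK
  rw [← 𝒰.trans_chart hI (J := J)] at h2
  rw [mul_comm]
  exact ((h2.comp _ h1).congr_of_eventuallyEq (𝒰.trans_eventuallyEq_comp hI hJ)).unique
    (𝒰.hasDerivAt_trans_chart hI hK)

theorem jac_mul_symm (hI : x ∈ (𝒰.chart I).source) (hJ : x ∈ (𝒰.chart J).source) :
    𝒰.jac I J x * 𝒰.jac J I x = 1 := by
  rw [𝒰.jac_mul hI hJ hI, 𝒰.jac_self hI]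

theorem jac_ne_zero (hI : x ∈ (𝒰.chart I).source) (hJ : x ∈ (𝒰.chart J).source) :
    𝒰.jac I J x ≠ 0 := left_ne_zero_of_mul_eq_one (𝒰.jac_mul_symm hI hJ)

theorem injOn_trans (I J : ι) : InjOn (𝒰.trans I J) (𝒰.overlap I J) := by
  intro w hw w' hw' h
  rw [← 𝒰.trans_trans hw, h, 𝒰.trans_trans hw']

end HolAtlas

theorem Defects.comp_trans {E G : Type*} [NormedAddCommGroup E] [NormedSpace ℂ E]
    [TopologicalSpace G] [ChartedSpace E G] [Group G] {n N : ℕ} (D : Defects C E G n N) (i : Fin n)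
    (hI : D.q i ∈ (𝒰.chart I).source) (hJ : D.q i ∈ (𝒰.chart J).source) :
    D.comp 𝒰 i J = 𝒰.jac I J (D.q i) * D.comp 𝒰 i I := by
  have hcI : MDifferentiableAt 𝓘(ℂ) 𝓘(ℂ) (𝒰.chart I) (D.q i) :=
    ((contMDiffOn_of_mem_maximalAtlas (𝒰.chart_mem I)).contMDiffAt
      ((𝒰.chart I).open_source.mem_nhds hI)).mdifferentiableAt (by simp)
  have h1 := (𝒰.hasDerivAt_trans_chart hI hJ).hasFDerivAt.hasMFDerivAt
  have h2 := (h1.comp (D.q i) hcI.hasMFDerivAt).congr_of_eventuallyEq (f₁ := 𝒰.chart J) (by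
    filter_upwards [(𝒰.chart I).open_source.mem_nhds hI] with y hy
    exact (𝒰.trans_chart hy).symm)
  rw [comp, h2.mfderiv]
  exact mul_comm _ _

end Charts

end MixedBF

namespace MixedBF

section PoleDecomposition

variable {X V : Type*} [NormedAddCommGroup X] [NormedSpace ℝ X] [NormedAddCommGroup V]
  [NormedSpace ℂ V]

theorem contDiff_bump_smul {χ : ℂ → ℝ} {U : Set ℂ} {h : ℂ × X → V} (hU : IsOpen U)
    (hχ : ContDiff ℝ ∞ χ) (hs : tsupport χ ⊆ U) (hh : ContDiffOn ℝ ∞ h (U ×ˢ univ)) :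
    ContDiff ℝ ∞ fun y : ℂ × X => χ y.1 • h y := by
  refine contDiff_smul_of_tsupport_subset (χ := fun y : ℂ × X => χ y.1) (hU.prod isOpen_univ)
    (hχ.comp contDiff_fst) hh fun y hy => ⟨hs ?_, trivial⟩
  by_contra hcon
  rw [notMem_tsupport_iff_eventuallyEq] at hcon
  refine (notMem_tsupport_iff_eventuallyEq.2 ?_) hy
  exact continuous_fst.continuousAt.eventually hcon

/-- A function with simple poles at the points of a finite set is the sum of a smooth function and
of smooth multiples of the functions `(w - s)⁻¹`. -/
theorem exists_pole_decomposition {T : Set ℂ} (hT : IsOpen T) (S : Finset ℂ) : ∀ f : ℂ × X → V,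
    ContDiffOn ℝ ∞ f ((T \ S) ×ˢ univ) →
    (∀ s ∈ S, ∃ W ∈ 𝓝 s, ∃ h : ℂ × X → V, ContDiffOn ℝ ∞ h (W ×ˢ univ) ∧
      ∀ w ∈ W, w ≠ s → ∀ u, f (w, u) = (w - s)⁻¹ • h (w, u)) →
    ∃ (H₀ : ℂ × X → V) (H : ℂ → ℂ × X → V), ContDiffOn ℝ ∞ H₀ (T ×ˢ univ) ∧
      (∀ s, ContDiff ℝ ∞ (H s)) ∧ ∀ w ∈ T, w ∉ S → ∀ u,
        f (w, u) = H₀ (w, u) + ∑ s ∈ S, (w - s)⁻¹ • H s (w, u) := by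
  classical
  induction S using Finset.induction_on with
  | empty =>
    intro f hf _
    exact ⟨f, fun _ _ => 0, by simpa using hf, fun _ => contDiff_const, by simp⟩
  | insert s S hs ih =>
    intro f hf hp
    obtain ⟨W, hW, h, hh, hfh⟩ := hp s (Finset.mem_insert_self s S)
    have hWo : interior W ∩ (S : Set ℂ)ᶜ ∈ 𝓝 s :=
      inter_mem (interior_mem_nhds.2 hW)
        (S.finite_toSet.isClosed.isOpen_compl.mem_nhds (by simpa using hs))
    obtain ⟨χ, hχ, -, hsupp, hχ1⟩ := exists_bump hWo
    have hg : ContDiff ℝ ∞ fun y : ℂ × X => χ y.1 • h y :=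
      contDiff_bump_smul isOpen_interior hχ (hsupp.trans inter_subset_left)
        (hh.mono (prod_mono interior_subset subset_rfl))
    let f₁ : ℂ × X → V := fun y => if y.1 = s then 0 else f y - (y.1 - s)⁻¹ • χ y.1 • h y
    have hf₁ : ContDiffOn ℝ ∞ f₁ ((T \ S) ×ˢ univ) := by
      rintro ⟨w, u⟩ ⟨⟨hwT, hwS⟩, -⟩
      refine ContDiffAt.contDiffWithinAt ?_
      have hfst : Tendsto Prod.fst (𝓝 (w, u)) (𝓝 w) := continuous_fst.tendsto (w, u)
      by_cases hws : w = s
      · subst hws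
        refine contDiffAt_const (c := (0 : V)).congr_of_eventuallyEq ?_
        have h1 : ∀ᶠ y : ℂ × X in 𝓝 (w, u), χ y.1 = 1 := hfst.eventually hχ1
        have h2 : ∀ᶠ y : ℂ × X in 𝓝 (w, u), y.1 ∈ W := hfst.eventually hW
        filter_upwards [h1, h2] with y h3 h4
        by_cases h5 : y.1 = w
        · simp [f₁, h5]
        · simp only [f₁, if_neg h5, h3, one_smul]
          rw [← hfh y.1 h4 h5 y.2, sub_self]
      · have h1 : ContDiffAt ℝ ∞ (fun y : ℂ × X => f y - (y.1 - s)⁻¹ • χ y.1 • h y) (w, u) := by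
          refine ContDiffAt.sub ?_ (ContDiffAt.smul ?_ hg.contDiffAt)
          · refine hf.contDiffAt (((hT.sdiff (Finset.finite_toSet _).isClosed).prod
              isOpen_univ).mem_nhds ⟨⟨hwT, ?_⟩, trivial⟩)
            simpa [hws] using hwS
          · exact (contDiff_fst.contDiffAt.sub contDiffAt_const).inv (sub_ne_zero.2 hws)
        refine h1.congr_of_eventuallyEq ?_
        have h2 : ∀ᶠ y : ℂ × X in 𝓝 (w, u), y.1 ≠ s :=
          hfst.eventually (isOpen_ne.mem_nhds hws)
        filter_upwards [h2] with y hy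
        simp only [f₁, if_neg hy]
    obtain ⟨H₀, H, hH₀, hH, hdec⟩ := ih f₁ hf₁ fun s' hs' => by
      obtain ⟨W', hW', h', hh', hfh'⟩ := hp s' (Finset.mem_insert_of_mem hs')
      have hne : s' ≠ s := fun h => hs (h ▸ hs')
      have h0 : χ =ᶠ[𝓝 s'] 0 := notMem_tsupport_iff_eventuallyEq.1 fun hcon =>
        (hsupp hcon).2 hs'
      refine ⟨W' ∩ {w | w ≠ s ∧ χ w = 0}, inter_mem hW' (inter_mem (isOpen_ne.mem_nhds hne) h0), h',
        hh'.mono (prod_mono inter_subset_left subset_rfl), fun w hw hws u => ?_⟩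
      simp only [f₁, if_neg hw.2.1, hw.2.2, zero_smul, smul_zero, sub_zero]
      exact hfh' w hw.1 hws u
    refine ⟨H₀, Function.update H s fun y => χ y.1 • h y, hH₀, fun s' => ?_, fun w hw hwS u => ?_⟩
    · by_cases hs' : s' = s
      · subst hs'; simpa using hg
      · simpa [hs'] using hH s'
    · rw [Finset.mem_insert, not_or] at hwS
      have h1 := hdec w hw hwS.2 u
      simp only [f₁, if_neg hwS.1] at h1
      rw [Finset.sum_insert hs, Function.update_self, Finset.sum_congr rfl (g := fun s =>
        (w - s)⁻¹ • H s (w, u)), add_left_comm, ← h1]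
      · abel
      · intro s' hs'
        rw [Function.update_of_ne]
        rintro rfl
        exact hs hs'

theorem tendsto_sub_smul_of_pole_decomposition {T : Set ℂ} {S : Finset ℂ} {f : ℂ → V}
    {H₀ : ℂ → V} {H : ℂ → ℂ → V} (hT : IsOpen T)
    (hH₀ : ContinuousOn H₀ T) (hH : ∀ s, Continuous (H s))
    (h : ∀ w ∈ T, w ∉ S → f w = H₀ w + ∑ s ∈ S, (w - s)⁻¹ • H s w) {s : ℂ} (hs : s ∈ S)
    (hsT : s ∈ T) : Tendsto (fun w => (w - s) • f w) (𝓝[≠] s) (𝓝 (H s s)) := by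
  classical
  have hc : ContinuousAt (fun w => (w - s) • H₀ w + (H s w +
      ∑ s' ∈ S.erase s, (w - s) • (w - s')⁻¹ • H s' w)) s := by
    refine ContinuousAt.add ?_ (ContinuousAt.add (hH s).continuousAt ?_)
    · exact (continuousAt_id.sub continuousAt_const).smul (hH₀.continuousAt (hT.mem_nhds hsT))
    · refine tendsto_finsetSum _ fun s' hs' => ?_
      refine ContinuousAt.smul (continuousAt_id.sub continuousAt_const)
        (ContinuousAt.smul (ContinuousAt.inv₀ (continuousAt_id.sub continuousAt_const) ?_)
          (hH s').continuousAt)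
      exact sub_ne_zero.2 (Finset.ne_of_mem_erase hs').symm
  have h2 : (fun w => (w - s) • f w) =ᶠ[𝓝[≠] s] (fun w => (w - s) • H₀ w + (H s w +
      ∑ s' ∈ S.erase s, (w - s) • (w - s')⁻¹ • H s' w)) := by
    have h3 : T ∩ (↑(S.erase s) : Set ℂ)ᶜ ∈ 𝓝 s := inter_mem (hT.mem_nhds hsT)
      ((Finset.finite_toSet _).isClosed.isOpen_compl.mem_nhds (by simp))
    filter_upwards [nhdsWithin_le_nhds h3, self_mem_nhdsWithin] with w hw hws
    have hws' : w ≠ s := hws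
    have hwS : w ∉ S := fun hcon => hw.2 (by simp [hws', hcon])
    rw [h w hw.1 hwS, smul_add, ← Finset.add_sum_erase _ _ hs, smul_add, Finset.smul_sum,
      smul_inv_smul₀ (sub_ne_zero.2 hws')]
  have h5 : 𝓝[≠] s ≤ 𝓝 s := nhdsWithin_le_nhds
  have h4 := (hc.tendsto.mono_left h5).congr' h2.symm
  simpa using h4

end PoleDecomposition

section SingularIntegrals

variable {X V : Type*} [NormedAddCommGroup V] [NormedSpace ℂ V]

theorem continuous_of_eq_zero_off {X : Type*} [TopologicalSpace X] {f : ℂ × X → V} {T K : Set ℂ}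
    (hT : IsOpen T) (hK : IsClosed K) (hKT : K ⊆ T) (hf : ContinuousOn f (T ×ˢ univ))
    (h0 : ∀ w ∉ K, ∀ u, f (w, u) = 0) : Continuous f := by
  rw [continuous_iff_continuousAt]
  rintro ⟨w, u⟩
  by_cases hw : w ∈ T
  · exact hf.continuousAt ((hT.prod isOpen_univ).mem_nhds ⟨hw, trivial⟩)
  · have h1 : ∀ᶠ y : ℂ × X in 𝓝 (w, u), y.1 ∈ Kᶜ :=
      continuous_fst.continuousAt.eventually (hK.isOpen_compl.mem_nhds fun h => hw (hKT h))
    refine (continuousAt_const (y := (0 : V))).congr ?_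
    filter_upwards [h1] with y hy
    exact (h0 y.1 hy y.2).symm

theorem integrable_inv_smul {f : ℂ → V} (hf : Continuous f) (hc : HasCompactSupport f) (s : ℂ) :
    Integrable fun w => (w - s)⁻¹ • f w := by
  have h1 : IntegrableOn (fun w => (w - s)⁻¹ • f w) (tsupport f) := by
    refine integrableOn_of_simple_poles (T := univ) (S := {s}) isOpen_univ (finite_singleton s) ?_ ?_
      hc (subset_univ _)
    · refine ContinuousOn.smul (ContinuousOn.inv₀ (by fun_prop) ?_) hf.continuousOn
      intro w hw
      exact sub_ne_zero.2 hw.2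
    · rintro s rfl -
      obtain ⟨c, hc⟩ := hc.exists_bound_of_continuous hf
      refine ⟨c, Eventually.of_forall fun w => ?_⟩
      rw [norm_smul, norm_inv, mul_comm]
      exact mul_le_mul_of_nonneg_right (hc w) (by positivity)
  refine (integrableOn_iff_integrable_of_support_subset ?_).1 h1
  intro w hw
  refine subset_tsupport f ?_
  intro h0
  exact hw (by simp [h0])

theorem continuous_integral_inv_smul {X : Type*} [TopologicalSpace X] [FirstCountableTopology X]
    [LocallyCompactSpace X] {f : ℂ × X → V}
    (hf : Continuous f) {K : Set ℂ} (hK : IsCompact K) (h0 : ∀ w ∉ K, ∀ u, f (w, u) = 0) (s : ℂ) :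
    Continuous fun u => ∫ w, (w - s)⁻¹ • f (w, u) := by
  rw [continuous_iff_continuousAt]
  intro u₀
  obtain ⟨U, hU, hU2⟩ := exists_compact_mem_nhds u₀
  obtain ⟨M, hM⟩ := (hK.prod hU).bddAbove_image hf.norm.continuousOn
  have hint : Integrable (fun w => ‖w - s‖⁻¹) ((volume : Measure ℂ).restrict K) := by
    obtain ⟨R, hR⟩ := hK.isBounded.subset_closedBall s
    exact (integrableOn_inv_norm s R).mono_set hR
  have hcont : ∀ u, Continuous fun w => f (w, u) := fun u => hf.comp (by fun_prop)
  refine continuousAt_of_dominated (bound := K.indicator fun w => ‖w - s‖⁻¹ * M) ?_ ?_ ?_ ?_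
  · refine Eventually.of_forall fun u => ?_
    exact (integrable_inv_smul (hcont u) (HasCompactSupport.intro hK fun w hw => h0 w hw u)
      s).aestronglyMeasurable
  · filter_upwards [hU2] with u hu
    refine Eventually.of_forall fun w => ?_
    by_cases hw : w ∈ K
    · rw [indicator_of_mem hw, norm_smul, norm_inv]
      exact mul_le_mul_of_nonneg_left (hM ⟨(w, u), ⟨hw, hu⟩, rfl⟩) (by positivity)
    · rw [indicator_of_notMem hw, h0 w hw, smul_zero, norm_zero]
  · rw [integrable_indicator_iff hK.measurableSet]
    exact hint.mul_const M
  · refine Eventually.of_forall fun w => ?_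
    exact (continuous_const.smul (hf.comp (by fun_prop))).continuousAt

end SingularIntegrals

end MixedBF

namespace MixedBF

section Regularity

variable {C ι : Type*} [TopologicalSpace C] [ChartedSpace ℂ C] {n : ℕ}
  {V : Type*} [NormedAddCommGroup V] [NormedSpace ℂ V] {𝒰 : HolAtlas C ι} {S : Set C}
  {f : ι → C → (Fin n → ℝ) → V} {I : ι} {x : C}

theorem SmoothOff.contDiffAt (h : SmoothOff 𝒰 S f) (hS : IsClosed S)
    (hx : x ∈ (𝒰.chart I).source) (hxS : x ∉ S) (u : Fin n → ℝ) :
    ContDiffAt ℝ ∞ (fun y : ℂ × (Fin n → ℝ) => f I ((𝒰.chart I).symm y.1) y.2)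
      (𝒰.chart I x, u) := by
  refine (h I).contDiffAt (IsOpen.mem_nhds (IsOpen.prod ?_ isOpen_univ) ⟨⟨?_, ?_⟩, trivial⟩)
  · exact (𝒰.chart I).isOpen_inter_preimage_symm hS.isOpen_compl
  · exact (𝒰.chart I).map_source hx
  · simpa [(𝒰.chart I).left_inv hx] using hxS

theorem SmoothOff.contDiffAt_point (h : SmoothOff 𝒰 S f) (hS : IsClosed S)
    (hx : x ∈ (𝒰.chart I).source) (hxS : x ∉ S) (u : Fin n → ℝ) :
    ContDiffAt ℝ ∞ (fun w => f I ((𝒰.chart I).symm w) u) (𝒰.chart I x) :=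
  ContDiffAt.comp (g := fun y : ℂ × (Fin n → ℝ) => f I ((𝒰.chart I).symm y.1) y.2)
    (f := fun w : ℂ => (w, u)) _ (h.contDiffAt hS hx hxS u) (contDiffAt_id.prodMk contDiffAt_const)

theorem SmoothOff.contDiff_time (h : SmoothOff 𝒰 S f) (hS : IsClosed S)
    (hx : x ∈ (𝒰.chart I).source) (hxS : x ∉ S) : ContDiff ℝ ∞ (f I x) := by
  rw [contDiff_iff_contDiffAt]
  intro u
  have h1 := ContDiffAt.comp (g := fun y : ℂ × (Fin n → ℝ) => f I ((𝒰.chart I).symm y.1) y.2)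
    (f := fun u : Fin n → ℝ => (𝒰.chart I x, u)) u (h.contDiffAt hS hx hxS u)
    (contDiffAt_const.prodMk contDiffAt_id)
  have h2 : (fun y : ℂ × (Fin n → ℝ) => f I ((𝒰.chart I).symm y.1) y.2) ∘
      (fun u : Fin n → ℝ => (𝒰.chart I x, u)) = f I x := by
    ext u
    simp [(𝒰.chart I).left_inv hx]
  rwa [h2] at h1

theorem SmoothOff.mono {S' : Set C} (h : SmoothOff 𝒰 S f) (hS : S ⊆ S') : SmoothOff 𝒰 S' f :=
  fun I => (h I).mono (prod_mono (inter_subset_inter_right _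
    (preimage_mono (compl_subset_compl.2 hS))) subset_rfl)

theorem SmoothOff.simplePoles (h : SmoothOff 𝒰 ∅ f) : SimplePoles 𝒰 S f := by
  intro I s _ hsI
  refine ⟨(𝒰.chart I).target, (𝒰.chart I).open_target.mem_nhds ((𝒰.chart I).map_source hsI),
    fun y => (y.1 - 𝒰.chart I s) • f I ((𝒰.chart I).symm y.1) y.2, ?_, fun w _ hws u => ?_⟩
  · refine ContDiffOn.smul ((contDiff_fst.sub contDiff_const).contDiffOn) ?_
    simpa using h I
  · simp only [inv_smul_smul₀ (sub_ne_zero.2 hws)]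

theorem SimplePoles.add {g : ι → C → (Fin n → ℝ) → V} (hf : SimplePoles 𝒰 S f)
    (hg : SimplePoles 𝒰 S g) : SimplePoles 𝒰 S (fun I x u => f I x u + g I x u) := by
  intro I s hs hsI
  obtain ⟨W, hW, h, hh, hfh⟩ := hf I s hs hsI
  obtain ⟨W', hW', h', hh', hfh'⟩ := hg I s hs hsI
  refine ⟨W ∩ W', inter_mem hW hW', fun y => h y + h' y,
    (hh.mono (prod_mono inter_subset_left subset_rfl)).add
      (hh'.mono (prod_mono inter_subset_right subset_rfl)), fun w hw hws u => ?_⟩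
  simp only [hfh w hw.1 hws, hfh' w hw.2 hws, smul_add]

theorem SmoothOff.add {g : ι → C → (Fin n → ℝ) → V} (hf : SmoothOff 𝒰 S f)
    (hg : SmoothOff 𝒰 S g) : SmoothOff 𝒰 S (fun I x u => f I x u + g I x u) :=
  fun I => (hf I).add (hg I)

theorem SmoothOff.const_smul (hf : SmoothOff 𝒰 S f) (c : ℝ) :
    SmoothOff 𝒰 S (fun I x u => c • f I x u) :=
  fun I => (hf I).const_smul c

theorem SmoothOff.continuousLinearMap {W : Type*} [NormedAddCommGroup W] [NormedSpace ℂ W]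
    (L : V →L[ℂ] W) (hf : SmoothOff 𝒰 S f) : SmoothOff 𝒰 S (fun I x u => L (f I x u)) :=
  fun I => (L.restrictScalars ℝ).contDiff.comp_contDiffOn (hf I)

/-- The coordinates of the points of a finite set. -/
def HolAtlas.coords (𝒰 : HolAtlas C ι) (hS : S.Finite) (I : ι) : Finset ℂ :=
  ((hS.inter_of_left (𝒰.chart I).source).image (𝒰.chart I)).toFinset

theorem HolAtlas.mem_coords {hS : S.Finite} {w : ℂ} :
    w ∈ 𝒰.coords hS I ↔ ∃ s ∈ S, s ∈ (𝒰.chart I).source ∧ 𝒰.chart I s = w := by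
  simp [coords, and_assoc]

theorem HolAtlas.mem_coords_iff {hS : S.Finite} {w : ℂ} (hw : w ∈ (𝒰.chart I).target) :
    w ∈ 𝒰.coords hS I ↔ (𝒰.chart I).symm w ∈ S := by
  rw [mem_coords]
  constructor
  · rintro ⟨s, hs, hsI, rfl⟩
    rwa [(𝒰.chart I).left_inv hsI]
  · intro h
    exact ⟨_, h, (𝒰.chart I).map_target hw, (𝒰.chart I).right_inv hw⟩

theorem HolAtlas.finite_preimage (𝒰 : HolAtlas C ι) {S : Set C} (hS : S.Finite) (I : ι) :
    ((𝒰.chart I).target ∩ (𝒰.chart I).symm ⁻¹' S).Finite := by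
  refine (𝒰.coords hS I).finite_toSet.subset fun w hw => ?_
  exact (HolAtlas.mem_coords_iff hw.1).2 hw.2

theorem SmoothOff.exists_decomposition (h : SmoothOff 𝒰 S f) (hp : SimplePoles 𝒰 S f)
    (hS : S.Finite) (I : ι) :
    ∃ (H₀ : ℂ × (Fin n → ℝ) → V) (H : ℂ → ℂ × (Fin n → ℝ) → V),
      ContDiffOn ℝ ∞ H₀ ((𝒰.chart I).target ×ˢ univ) ∧ (∀ s, ContDiff ℝ ∞ (H s)) ∧
      ∀ w ∈ (𝒰.chart I).target, (𝒰.chart I).symm w ∉ S → ∀ u, f I ((𝒰.chart I).symm w) u =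
        H₀ (w, u) + ∑ s ∈ 𝒰.coords hS I, (w - s)⁻¹ • H s (w, u) := by
  have hsm : ContDiffOn ℝ ∞ (fun y : ℂ × (Fin n → ℝ) => f I ((𝒰.chart I).symm y.1) y.2)
      (((𝒰.chart I).target \ 𝒰.coords hS I) ×ˢ univ) := by
    refine (h I).mono (prod_mono (fun w hw => ⟨hw.1, fun hcon => hw.2 ?_⟩) subset_rfl)
    exact (HolAtlas.mem_coords_iff hw.1).2 hcon
  obtain ⟨H₀, H, h1, h2, h3⟩ := exists_pole_decomposition (𝒰.chart I).open_target (𝒰.coords hS I)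
    (fun y => f I ((𝒰.chart I).symm y.1) y.2) hsm fun w hw => by
      obtain ⟨s, hs, hsI, rfl⟩ := HolAtlas.mem_coords.1 hw
      exact hp I s hs hsI
  refine ⟨H₀, H, h1, h2, fun w hw hwS u => h3 w hw ?_ u⟩
  rwa [HolAtlas.mem_coords_iff hw]

end Regularity

section Transport

variable {C ι : Type*} [TopologicalSpace C] [ChartedSpace ℂ C] [IsManifold 𝓘(ℂ) ω C] [T2Space C]
  {V : Type*} [NormedAddCommGroup V] [NormedSpace ℂ V] {𝒰 : HolAtlas C ι}

/-- Operators gluing local components into sections of a vector bundle. -/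
structure IsCocycle (𝒰 : HolAtlas C ι) (T : ι → ι → C → V →L[ℂ] V) : Prop where
  smooth : ∀ I J, ContDiffOn ℝ ∞ (fun w => T I J ((𝒰.chart I).symm w)) (𝒰.overlap I J)
  mul : ∀ I J K x, x ∈ (𝒰.chart I).source → x ∈ (𝒰.chart J).source → x ∈ (𝒰.chart K).source →
    ∀ v, T I J x (T J K x v) = T I K x v
  self : ∀ I x, x ∈ (𝒰.chart I).source → ∀ v, T I I x v = v

open Classical in
/-- The section with local component `ψ` over `U_J`, extended by zero. -/
def transport (𝒰 : HolAtlas C ι) (T : ι → ι → C → V →L[ℂ] V) (J : ι) (ψ : ℂ → V) (K : ι) (x : C) :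
    V := if x ∈ (𝒰.chart J).source then T K J x (ψ (𝒰.chart J x)) else 0

variable {T : ι → ι → C → V →L[ℂ] V} {J K : ι} {ψ : ℂ → V} {x : C}

theorem transport_of_mem (hx : x ∈ (𝒰.chart J).source) :
    transport 𝒰 T J ψ K x = T K J x (ψ (𝒰.chart J x)) := if_pos hx

theorem transport_of_notMem (hx : x ∉ (𝒰.chart J).source) : transport 𝒰 T J ψ K x = 0 := if_neg hx

theorem IsCocycle.transport_self (hT : IsCocycle 𝒰 T) (hx : x ∈ (𝒰.chart J).source) :
    transport 𝒰 T J ψ J x = ψ (𝒰.chart J x) := by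
  rw [transport_of_mem hx, hT.self J x hx]

theorem transport_eq_zero (hx : x ∉ (𝒰.chart J).symm '' tsupport ψ) :
    transport 𝒰 T J ψ K x = 0 := by
  by_cases hJ : x ∈ (𝒰.chart J).source
  · rw [transport_of_mem hJ]
    have : ψ (𝒰.chart J x) = 0 := by
      by_contra hne
      exact hx ⟨_, subset_tsupport ψ hne, (𝒰.chart J).left_inv hJ⟩
    rw [this, map_zero]
  · exact transport_of_notMem hJ

theorem IsTest.isCompact_image (h : IsTest (𝒰.chart J).target ψ) :
    IsCompact ((𝒰.chart J).symm '' tsupport ψ) :=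
  IsCompact.image_of_continuousOn h.compact ((𝒰.chart J).continuousOn_symm.mono h.supp)

theorem IsTest.image_subset (h : IsTest (𝒰.chart J).target ψ) :
    (𝒰.chart J).symm '' tsupport ψ ⊆ (𝒰.chart J).source := by
  rintro _ ⟨w, hw, rfl⟩
  exact (𝒰.chart J).map_target (h.supp hw)

theorem IsCocycle.transport_trans (hT : IsCocycle 𝒰 T) {I : ι} (hI : x ∈ (𝒰.chart I).source)
    (hK : x ∈ (𝒰.chart K).source) :
    transport 𝒰 T J ψ I x = T I K x (transport 𝒰 T J ψ K x) := by
  by_cases hJ : x ∈ (𝒰.chart J).source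
  · rw [transport_of_mem hJ, transport_of_mem hJ, hT.mul I K J x hI hK hJ]
  · rw [transport_of_notMem hJ, transport_of_notMem hJ, map_zero]

theorem contDiffAt_clm_apply {L : ℂ → V →L[ℂ] V} {f : ℂ → V} {w : ℂ} (hL : ContDiffAt ℝ ∞ L w)
    (hf : ContDiffAt ℝ ∞ f w) : ContDiffAt ℝ ∞ (fun z => L z (f z)) w := by
  have h1 : ContDiffAt ℝ ∞ (fun z => (L z).restrictScalars ℝ) w :=
    (ContinuousLinearMap.restrictScalarsL ℂ V V ℝ ℝ).contDiff.contDiffAt.comp w hL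
  exact h1.clm_apply hf

theorem IsCocycle.contDiffOn_transport (hT : IsCocycle 𝒰 T) (h : IsTest (𝒰.chart J).target ψ)
    (K : ι) : ContDiffOn ℝ ∞ (fun w => transport 𝒰 T J ψ K ((𝒰.chart K).symm w))
      (𝒰.chart K).target := by
  intro w hw
  refine ContDiffAt.contDiffWithinAt ?_
  by_cases hJ : (𝒰.chart K).symm w ∈ (𝒰.chart J).source
  · have hwo : w ∈ 𝒰.overlap K J := ⟨hw, hJ⟩
    have h1 : ContDiffAt ℝ ∞ (fun w => T K J ((𝒰.chart K).symm w) (ψ (𝒰.trans K J w))) w := by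
      refine contDiffAt_clm_apply ((hT.smooth K J).contDiffAt
        ((𝒰.isOpen_overlap K J).mem_nhds hwo)) ?_
      refine ContDiffAt.comp (g := ψ) w h.smooth.contDiffAt ?_
      exact (((𝒰.contDiffOn_trans K J).contDiffAt
        ((𝒰.isOpen_overlap K J).mem_nhds hwo)).restrict_scalars ℝ).of_le le_top
    refine h1.congr_of_eventuallyEq ?_
    filter_upwards [(𝒰.isOpen_overlap K J).mem_nhds hwo] with z hz
    exact transport_of_mem hz.2
  · have h1 : (𝒰.chart K).target ∩ (𝒰.chart K).symm ⁻¹' ((𝒰.chart J).symm '' tsupport ψ)ᶜ ∈ 𝓝 w :=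
      ((𝒰.chart K).isOpen_inter_preimage_symm h.isCompact_image.isClosed.isOpen_compl).mem_nhds
        ⟨hw, fun hcon => hJ (h.image_subset hcon)⟩
    refine (contDiffAt_const (c := (0 : V))).congr_of_eventuallyEq ?_
    filter_upwards [h1] with z hz
    exact transport_eq_zero hz.2

theorem IsCocycle.smoothOff_transport {n : ℕ} (hT : IsCocycle 𝒰 T)
    (h : IsTest (𝒰.chart J).target ψ) {χ : (Fin n → ℝ) → ℝ} (hχ : ContDiff ℝ ∞ χ) :
    SmoothOff 𝒰 ∅ (fun K x u => χ u • transport 𝒰 T J ψ K x) := by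
  intro K
  have h1 : ContDiffOn ℝ ∞ (fun y : ℂ × (Fin n → ℝ) => χ y.2)
      (((𝒰.chart K).target ∩ (𝒰.chart K).symm ⁻¹' ∅ᶜ) ×ˢ univ) :=
    (hχ.comp contDiff_snd).contDiffOn
  refine h1.smul ?_
  refine (hT.contDiffOn_transport h K).comp contDiff_fst.contDiffOn ?_
  rintro y ⟨hy, -⟩
  exact hy.1

end Transport

section Bundle

variable {C ι E G : Type*} [TopologicalSpace C] [ChartedSpace ℂ C] [IsManifold 𝓘(ℂ) ω C]
  [NormedAddCommGroup E] [NormedSpace ℂ E] [FiniteDimensional ℂ E]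
  [TopologicalSpace G] [ChartedSpace E G] [Group G] [LieGroup 𝓘(ℂ, E) ω G]
  (Pb : PBundle C ι E G) {I J K : ι} {x : C} {w : ℂ}

theorem PBundle.g_self (hI : x ∈ (Pb.chart I).source) : Pb.g I I x = 1 := by
  have h := Pb.cocycle I I I x hI hI hI
  simpa using h

/-- The coadjoint action of a group element as a continuous linear map. -/
def coAdL (g : G) : StrongDual ℂ E →L[ℂ] StrongDual ℂ E :=
  (ContinuousLinearMap.compL ℂ E E ℂ).flip (Ad g⁻¹)

theorem coAdL_apply (g : G) (φ : StrongDual ℂ E) : coAdL g φ = coAd g φ := rfl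

theorem PBundle.mdifferentiableAt_g (hw : w ∈ Pb.toHolAtlas.overlap I J) :
    ContMDiffAt 𝓘(ℝ, ℂ) 𝓘(ℝ, E) ∞ (fun w => Pb.g I J ((Pb.chart I).symm w)) w :=
  (Pb.g_smooth I J).contMDiffAt ((Pb.toHolAtlas.isOpen_overlap I J).mem_nhds hw)

theorem PBundle.contDiffOn_Ad (I J : ι) : ContDiffOn ℝ ∞
    (fun w => (Ad (Pb.g I J ((Pb.chart I).symm w)) : E →L[ℂ] E)) (Pb.toHolAtlas.overlap I J) :=
  fun _ hw => (contDiffAt_Ad_comp (Pb.mdifferentiableAt_g hw)).contDiffWithinAt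

theorem PBundle.contDiffOn_coAd (I J : ι) : ContDiffOn ℝ ∞
    (fun w => (coAdL (Pb.g I J ((Pb.chart I).symm w)) : StrongDual ℂ E →L[ℂ] StrongDual ℂ E))
    (Pb.toHolAtlas.overlap I J) := by
  have := lieGroup_real (E := E) (G := G)
  have h : ContDiffOn ℝ ∞ (fun w => (Ad (Pb.g I J ((Pb.chart I).symm w))⁻¹ : E →L[ℂ] E))
      (Pb.toHolAtlas.overlap I J) := fun w hw => by
    have h1 : ContMDiffAt 𝓘(ℝ, ℂ) 𝓘(ℝ, E) ∞ (fun w => (Pb.g I J ((Pb.chart I).symm w))⁻¹) w :=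
      ((contMDiff_inv 𝓘(ℝ, E) ω).of_le le_top).contMDiffAt.comp w (Pb.mdifferentiableAt_g hw)
    exact (contDiffAt_Ad_comp h1).contDiffWithinAt
  have hL : ContDiff ℂ ω (fun T : E →L[ℂ] E => (ContinuousLinearMap.compL ℂ E E ℂ).flip T) :=
    (ContinuousLinearMap.compL ℂ E E ℂ).flip.isBoundedLinearMap.contDiff
  exact ((hL.restrict_scalars ℝ).of_le le_top).comp_contDiffOn h

theorem HolAtlas.contDiffOn_jac_real (𝒰 : HolAtlas C ι) (I J : ι) :
    ContDiffOn ℝ ∞ (fun w => 𝒰.jac I J ((𝒰.chart I).symm w)) (𝒰.overlap I J) :=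
  ((𝒰.contDiffOn_jac I J).restrict_scalars ℝ).of_le le_top

theorem PBundle.isCocycle_Ad :
    IsCocycle Pb.toHolAtlas (fun I J x => (Ad (Pb.g I J x) : E →L[ℂ] E)) where
  smooth := Pb.contDiffOn_Ad
  mul I J K x hI hJ hK v := by
    rw [← Ad_mul_apply, Pb.cocycle I J K x hI hJ hK]
  self I x hI v := by rw [Pb.g_self hI, Ad_one]; rfl

theorem PBundle.isCocycle_conj_Ad : IsCocycle Pb.toHolAtlas
    (fun I J x => (starRingEnd ℂ) (Pb.jac I J x) • (Ad (Pb.g I J x) : E →L[ℂ] E)) where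
  smooth I J := ((Complex.conjCLE : ℂ →L[ℝ] ℂ).contDiff.comp_contDiffOn
    (Pb.toHolAtlas.contDiffOn_jac_real I J)).smul (Pb.contDiffOn_Ad I J)
  mul I J K x hI hJ hK v := by
    simp only [smul_apply, map_smul, smul_smul]
    rw [← map_mul, mul_comm (Pb.jac J K x), Pb.toHolAtlas.jac_mul hI hJ hK, ← Ad_mul_apply, Pb.cocycle I J K x hI hJ hK]
  self I x hI v := by
    rw [Pb.g_self hI, Ad_one, Pb.toHolAtlas.jac_self hI]; simp

theorem PBundle.isCocycle_coAd : IsCocycle Pb.toHolAtlas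
    (fun I J x => Pb.jac I J x •
      (coAdL (Pb.g I J x) : StrongDual ℂ E →L[ℂ] StrongDual ℂ E)) where
  smooth I J := (Pb.toHolAtlas.contDiffOn_jac_real I J).smul (Pb.contDiffOn_coAd I J)
  mul I J K x hI hJ hK v := by
    simp only [smul_apply, map_smul, smul_smul, coAdL_apply]
    rw [mul_comm (Pb.jac J K x), Pb.toHolAtlas.jac_mul hI hJ hK, ← coAd_mul, Pb.cocycle I J K x hI hJ hK]
  self I x hI v := by
    rw [smul_apply, coAdL_apply, Pb.g_self hI, coAd_one, Pb.toHolAtlas.jac_self hI, one_smul]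

/-- The derivative of a gauge transformation of a section of the adjoint bundle. -/
theorem dbar_Ad_comp {f : ℂ → G} {Y : ℂ → E} {τ : ℂ → ℂ} {w : ℂ}
    (hf : MDifferentiableAt 𝓘(ℝ, ℂ) 𝓘(ℝ, E) f w) (hτ : DifferentiableAt ℂ τ w)
    (hY : DifferentiableAt ℝ Y (τ w)) :
    dbar (fun z => Ad (f z) (Y (τ z))) w =
      bracket G (dbarLog f w) (Ad (f w) (Y (τ w))) +
        (starRingEnd ℂ) (deriv τ w) • Ad (f w) (dbar Y (τ w)) := by
  have h1 : DifferentiableAt ℝ (fun z => (Ad (f z) : E →L[ℂ] E)) w :=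
    (hasFDerivAt_Ad_comp hf).differentiableAt
  have h2 : DifferentiableAt ℝ (fun z => Y (τ z)) w :=
    hY.comp w (hτ.restrictScalars ℝ)
  rw [dbar_clm_apply h1 h2, dbar_comp_holomorphic hτ hY, map_smul]
  congr 1
  rw [dbar, smul_apply, add_apply, smul_apply, fderiv_Ad_comp hf, fderiv_Ad_comp hf, dbarLog]
  simp only [← adL_apply, map_add, map_smul, add_apply, smul_apply]

end Bundle

end MixedBF

namespace MixedBF

section Residues

variable {C ι : Type*} [TopologicalSpace C] [ChartedSpace ℂ C] {n : ℕ} {𝒰 : HolAtlas C ι} {I : ι}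
  {s : C}

theorem HolAtlas.tendsto_chart (hs : s ∈ (𝒰.chart I).source) :
    Tendsto (𝒰.chart I) (𝓝[≠] s) (𝓝[≠] (𝒰.chart I s)) := by
  refine tendsto_nhdsWithin_iff.2 ⟨((𝒰.chart I).continuousAt hs).tendsto.mono_left
    nhdsWithin_le_nhds, ?_⟩
  filter_upwards [self_mem_nhdsWithin, nhdsWithin_le_nhds ((𝒰.chart I).open_source.mem_nhds hs)]
    with x hx hxI hcon
  exact hx ((𝒰.chart I).injOn hxI hs hcon)

theorem HolAtlas.tendsto_symm (hs : s ∈ (𝒰.chart I).source) :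
    Tendsto (𝒰.chart I).symm (𝓝[≠] (𝒰.chart I s)) (𝓝[≠] s) := by
  have hw := (𝒰.chart I).map_source hs
  refine tendsto_nhdsWithin_iff.2 ⟨?_, ?_⟩
  · have h := ((𝒰.chart I).continuousAt_symm hw).tendsto
    rw [(𝒰.chart I).left_inv hs] at h
    exact h.mono_left nhdsWithin_le_nhds
  · filter_upwards [self_mem_nhdsWithin,
      nhdsWithin_le_nhds ((𝒰.chart I).open_target.mem_nhds hw)] with w hws hwI hcon
    have hcon' : (𝒰.chart I).symm w = s := hcon
    exact hws (by rw [mem_singleton_iff, ← hcon', (𝒰.chart I).right_inv hwI])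

theorem HolAtlas.neBot_nhdsNE (hs : s ∈ (𝒰.chart I).source) : (𝓝[≠] s).NeBot :=
  (HolAtlas.tendsto_symm hs).neBot

variable {E : Type*} [NormedAddCommGroup E] [NormedSpace ℂ E]

theorem residue_eq_of_tendsto (hs : s ∈ (𝒰.chart I).source) {f : C → E} {r : E}
    (h : Tendsto (fun x => (𝒰.chart I x - 𝒰.chart I s) • f x) (𝓝[≠] s) (𝓝 r)) :
    residue 𝒰 I s f = r := by
  have := HolAtlas.neBot_nhdsNE hs
  exact h.limUnder_eq

variable {S : Set C} {f : ι → C → (Fin n → ℝ) → E}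

theorem SimplePoles.tendsto_residue (hp : SimplePoles 𝒰 S f) (hs : s ∈ S)
    (hsI : s ∈ (𝒰.chart I).source) (u : Fin n → ℝ) :
    Tendsto (fun x => (𝒰.chart I x - 𝒰.chart I s) • f I x u) (𝓝[≠] s)
      (𝓝 (residue 𝒰 I s (fun x => f I x u))) := by
  obtain ⟨W, hW, h, hh, hfh⟩ := hp I s hs hsI
  have h1 : ContinuousAt (fun w => h (w, u)) (𝒰.chart I s) :=
    ContinuousAt.comp (g := h) (f := fun w : ℂ => (w, u))
      (hh.continuousOn.continuousAt (prod_mem_nhds hW univ_mem)) (by fun_prop)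
  have h2 : Tendsto (fun x => h (𝒰.chart I x, u)) (𝓝[≠] s) (𝓝 (h (𝒰.chart I s, u))) :=
    h1.tendsto.comp (((𝒰.chart I).continuousAt hsI).tendsto.mono_left nhdsWithin_le_nhds)
  have h3 : Tendsto (fun x => (𝒰.chart I x - 𝒰.chart I s) • f I x u) (𝓝[≠] s)
      (𝓝 (h (𝒰.chart I s, u))) := by
    refine h2.congr' ?_
    filter_upwards [self_mem_nhdsWithin, (HolAtlas.tendsto_chart hsI).eventually
      self_mem_nhdsWithin, nhdsWithin_le_nhds ((𝒰.chart I).open_source.mem_nhds hsI),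
      nhdsWithin_le_nhds (((𝒰.chart I).continuousAt hsI).eventually hW)] with x hx hx2 hxI hxW
    have h4 := hfh _ hxW hx2 u
    rw [(𝒰.chart I).left_inv hxI] at h4
    rw [h4, smul_inv_smul₀ (sub_ne_zero.2 hx2)]
  rwa [residue_eq_of_tendsto hsI h3]

theorem residue_eq_of_decomposition {H₀ : ℂ × (Fin n → ℝ) → E} {H : ℂ → ℂ × (Fin n → ℝ) → E}
    {hS : S.Finite} (hH₀ : ContDiffOn ℝ ∞ H₀ ((𝒰.chart I).target ×ˢ univ))
    (hH : ∀ s, ContDiff ℝ ∞ (H s))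
    (h : ∀ w ∈ (𝒰.chart I).target, (𝒰.chart I).symm w ∉ S → ∀ u, f I ((𝒰.chart I).symm w) u =
        H₀ (w, u) + ∑ s ∈ 𝒰.coords hS I, (w - s)⁻¹ • H s (w, u)) (hs : s ∈ S)
    (hsI : s ∈ (𝒰.chart I).source) (u : Fin n → ℝ) :
    residue 𝒰 I s (fun x => f I x u) = H (𝒰.chart I s) (𝒰.chart I s, u) := by
  refine residue_eq_of_tendsto hsI ?_
  have h1 := tendsto_sub_smul_of_pole_decomposition (f := fun w => f I ((𝒰.chart I).symm w) u)
    (H₀ := fun w => H₀ (w, u)) (H := fun s w => H s (w, u)) (S := 𝒰.coords hS I)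
    (𝒰.chart I).open_target
    (hH₀.continuousOn.comp (by fun_prop) fun w hw => ⟨hw, trivial⟩)
    (fun s => (hH s).continuous.comp (by fun_prop))
    (fun w hw hwS => h w hw (by rwa [← HolAtlas.mem_coords_iff hw]) u)
    (HolAtlas.mem_coords.2 ⟨s, hs, hsI, rfl⟩) ((𝒰.chart I).map_source hsI)
  refine (h1.comp (HolAtlas.tendsto_chart hsI)).congr' ?_
  filter_upwards [nhdsWithin_le_nhds ((𝒰.chart I).open_source.mem_nhds hsI)] with x hx
  simp [(𝒰.chart I).left_inv hx]

end Residues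

section MildSingularities

variable {V : Type*} [NormedAddCommGroup V] [NormedSpace ℂ V] {T S : Set ℂ} {f : ℂ → V}

/-- The function `f` is continuous on `T` off `S`, and `O(1/|w - s|)` at the points `s` of `S`. -/
def MildSing (T S : Set ℂ) (f : ℂ → V) : Prop :=
  ContinuousOn f (T \ S) ∧ ∀ s ∈ S, s ∈ T → ∃ c : ℝ, ∀ᶠ w in 𝓝[≠] s, ‖f w‖ ≤ c * ‖w - s‖⁻¹

theorem MildSing.integrableOn (h : MildSing T S f) (hT : IsOpen T) (hS : S.Finite) {K : Set ℂ}
    (hK : IsCompact K) (hKT : K ⊆ T) : IntegrableOn f K :=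
  integrableOn_of_simple_poles hT hS h.1 h.2 hK hKT

theorem MildSing.apply {φ : ℂ → StrongDual ℂ V} {S' : Set ℂ} (hφ : MildSing T S φ)
    (hf : MildSing T S' f) (hT : IsOpen T) (hS : S.Finite) (hS' : S'.Finite) (hd : Disjoint S S') :
    MildSing T (S ∪ S') (fun w => φ w (f w)) := by
  have hb : ∀ {W : Type _} [NormedAddCommGroup W] {g : ℂ → W} {s : ℂ}, ContinuousAt g s →
      ∃ c : ℝ, 0 ≤ c ∧ ∀ᶠ w in 𝓝[≠] s, ‖g w‖ ≤ c := by
    intro W _ g s hg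
    refine ⟨‖g s‖ + 1, by positivity, nhdsWithin_le_nhds ?_⟩
    exact (hg.norm.tendsto.eventually (Iio_mem_nhds (lt_add_one ‖g s‖))).mono fun w hw => le_of_lt hw
  refine ⟨?_, ?_⟩
  · refine (hφ.1.mono ?_).clm_apply (hf.1.mono ?_)
    · exact sdiff_subset_sdiff_right subset_union_left
    · exact sdiff_subset_sdiff_right subset_union_right
  · rintro s (hs | hs) hsT
    · obtain ⟨c, hc⟩ := hφ.2 s hs hsT
      obtain ⟨c', hc'0, hc'⟩ := hb (hf.1.continuousAt ((hT.sdiff hS'.isClosed).mem_nhds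
        ⟨hsT, fun h => hd.ne_of_mem hs h rfl⟩))
      refine ⟨c * c', ?_⟩
      filter_upwards [hc, hc'] with w h1 h2
      calc ‖φ w (f w)‖ ≤ ‖φ w‖ * ‖f w‖ := (φ w).le_opNorm _
        _ ≤ (c * ‖w - s‖⁻¹) * c' := mul_le_mul h1 h2 (norm_nonneg _) ((norm_nonneg _).trans h1)
        _ = c * c' * ‖w - s‖⁻¹ := by ring
    · obtain ⟨c, hc⟩ := hf.2 s hs hsT
      obtain ⟨c', hc'0, hc'⟩ := hb (hφ.1.continuousAt ((hT.sdiff hS.isClosed).mem_nhds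
        ⟨hsT, fun h => hd.ne_of_mem h hs rfl⟩))
      refine ⟨c' * c, ?_⟩
      filter_upwards [hc, hc'] with w h1 h2
      calc ‖φ w (f w)‖ ≤ ‖φ w‖ * ‖f w‖ := (φ w).le_opNorm _
        _ ≤ c' * (c * ‖w - s‖⁻¹) := mul_le_mul h2 h1 (norm_nonneg _) hc'0
        _ = c' * c * ‖w - s‖⁻¹ := by ring

theorem MildSing.add {g : ℂ → V} (hf : MildSing T S f) (hg : MildSing T S g) :
    MildSing T S (fun w => f w + g w) := by
  refine ⟨hf.1.add hg.1, fun s hs hsT => ?_⟩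
  obtain ⟨c, hc⟩ := hf.2 s hs hsT
  obtain ⟨c', hc'⟩ := hg.2 s hs hsT
  refine ⟨c + c', ?_⟩
  filter_upwards [hc, hc'] with w h1 h2
  rw [add_mul]
  exact (norm_add_le _ _).trans (add_le_add h1 h2)

theorem MildSing.neg (hf : MildSing T S f) : MildSing T S (fun w => -f w) :=
  ⟨hf.1.neg, fun s hs hsT => by simpa using hf.2 s hs hsT⟩

theorem mildSing_of_continuousOn (hT : IsOpen T) (hf : ContinuousOn f T) : MildSing T S f := by
  refine ⟨hf.mono sdiff_subset, fun s _ hsT => ⟨‖f s‖ + 1, ?_⟩⟩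
  have hg := hf.continuousAt (hT.mem_nhds hsT)
  filter_upwards [nhdsWithin_le_nhds (hg.norm.tendsto.eventually
    (Iio_mem_nhds (lt_add_one ‖f s‖))), nhdsWithin_le_nhds (Metric.ball_mem_nhds s one_pos),
    self_mem_nhdsWithin] with w h1 h2 h3
  have h4 : 0 < ‖w - s‖ := norm_pos_iff.2 (sub_ne_zero.2 h3)
  have h5 : 1 ≤ ‖w - s‖⁻¹ := (one_le_inv₀ h4).2 (by
    rw [← dist_eq_norm]; exact le_of_lt h2)
  exact (le_of_lt h1).trans (le_mul_of_one_le_right (by positivity) h5)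

theorem MildSing.of_poles {f : ℂ → V} (hf : ContinuousOn f (T \ S))
    (hp : ∀ s ∈ S, s ∈ T → ∃ h : ℂ → V, ContinuousAt h s ∧
      ∀ᶠ w in 𝓝[≠] s, f w = (w - s)⁻¹ • h w) : MildSing T S f := by
  refine ⟨hf, fun s hs hsT => ?_⟩
  obtain ⟨h, hh, hfh⟩ := hp s hs hsT
  refine ⟨‖h s‖ + 1, ?_⟩
  filter_upwards [hfh, nhdsWithin_le_nhds (hh.norm.tendsto.eventually
    (Iio_mem_nhds (lt_add_one ‖h s‖)))] with w h1 h2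
  rw [h1, norm_smul, norm_inv, mul_comm]
  exact mul_le_mul_of_nonneg_right (le_of_lt h2) (by positivity)

theorem MildSing.bilinear {V₁ V₂ : Type*} [NormedAddCommGroup V₁] [NormedSpace ℂ V₁]
    [NormedAddCommGroup V₂] [NormedSpace ℂ V₂] {L : ℂ → V₁ →L[ℂ] V₂} {f : ℂ → V₁}
    (hT : IsOpen T) (hL : ContinuousOn L T) (hf : MildSing T S f) :
    MildSing T S (fun w => L w (f w)) := by
  refine ⟨(hL.mono sdiff_subset).clm_apply hf.1, fun s hs hsT => ?_⟩
  obtain ⟨c, hc⟩ := hf.2 s hs hsT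
  have hg := hL.continuousAt (hT.mem_nhds hsT)
  refine ⟨(‖L s‖ + 1) * c, ?_⟩
  filter_upwards [hc, nhdsWithin_le_nhds (hg.norm.tendsto.eventually
    (Iio_mem_nhds (lt_add_one ‖L s‖)))] with w h1 h2
  calc ‖L w (f w)‖ ≤ ‖L w‖ * ‖f w‖ := (L w).le_opNorm _
    _ ≤ (‖L s‖ + 1) * (c * ‖w - s‖⁻¹) :=
      mul_le_mul (le_of_lt h2) h1 (norm_nonneg _) (by positivity)
    _ = (‖L s‖ + 1) * c * ‖w - s‖⁻¹ := by ring

end MildSingularities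

section SurfaceIntegral

variable {C ι : Type*} [TopologicalSpace C] [T2Space C] [CompactSpace C] [ChartedSpace ℂ C]
  [IsManifold 𝓘(ℂ) ω C] {𝒰 : HolAtlas C ι} {ρ : PartitionOfUnity ι C}

/-- A family of local functions with mild singularities at the points of `S`. -/
def SurfaceSing (𝒰 : HolAtlas C ι) (S : Set C) (η : ι → C → ℂ) : Prop :=
  ∀ I, MildSing (𝒰.chart I).target ((𝒰.chart I).target ∩ (𝒰.chart I).symm ⁻¹' S)
    (fun w => η I ((𝒰.chart I).symm w))

theorem integrableOn_partition (hρ : ρ.IsSubordinate (fun I => (𝒰.chart I).source)) {S : Set C}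
    (hS : S.Finite) {η : ι → C → ℂ} (hη : SurfaceSing 𝒰 S η) (I : ι) :
    IntegrableOn (fun w => (ρ I ((𝒰.chart I).symm w) : ℂ) * η I ((𝒰.chart I).symm w))
      (𝒰.chart I).target := by
  set Z := (𝒰.chart I) '' tsupport (ρ I) with hZ
  have hZc : IsCompact Z := (isClosed_tsupport _).isCompact.image_of_continuousOn
    ((𝒰.chart I).continuousOn.mono (hρ I))
  have hZT : Z ⊆ (𝒰.chart I).target := by
    rintro _ ⟨x, hx, rfl⟩
    exact (𝒰.chart I).map_source (hρ I hx)
  have hmild : MildSing (𝒰.chart I).target ((𝒰.chart I).target ∩ (𝒰.chart I).symm ⁻¹' S)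
      (fun w => (ρ I ((𝒰.chart I).symm w) : ℂ) * η I ((𝒰.chart I).symm w)) := by
    refine MildSing.bilinear (L := fun w => ContinuousLinearMap.mul ℂ ℂ
      (ρ I ((𝒰.chart I).symm w) : ℂ)) (𝒰.chart I).open_target ?_ (hη I)
    refine (ContinuousLinearMap.mul ℂ ℂ).continuous.comp_continuousOn ?_
    refine Complex.continuous_ofReal.comp_continuousOn ?_
    exact (ρ I).continuous.comp_continuousOn (𝒰.chart I).continuousOn_symm
  have h1 := hmild.integrableOn (𝒰.chart I).open_target (𝒰.finite_preimage hS I) hZc hZT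
  refine h1.of_forall_sdiff_eq_zero (𝒰.chart I).open_target.measurableSet fun w hw => ?_
  have h2 : ρ I ((𝒰.chart I).symm w) = 0 := by
    by_contra hne
    exact hw.2 ⟨_, subset_tsupport _ hne, (𝒰.chart I).right_inv hw.1⟩
  simp [h2]

theorem setIntegral_sdiff_finite {T S : Set ℂ} (hS : S.Finite) (f : ℂ → ℂ) :
    ∫ w in T \ S, f w = ∫ w in T, f w := by
  rw [ae_restrict_diff_finite hS]

/-- Change of coordinates in the integral of a `(1,1)`-form supported in the overlap of two charts,
defined off a finite set. -/
theorem integral_target_eq {S : Set C} (hS : S.Finite) {I J : ι} {f f' : ℂ → ℂ}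
    (hf : ∀ w ∈ (𝒰.chart I).target, (𝒰.chart I).symm w ∉ S →
      (𝒰.chart I).symm w ∉ (𝒰.chart J).source → f w = 0)
    (hf' : ∀ w ∈ (𝒰.chart J).target, (𝒰.chart J).symm w ∉ S →
      (𝒰.chart J).symm w ∉ (𝒰.chart I).source → f' w = 0)
    (h : ∀ w ∈ 𝒰.overlap J I, (𝒰.chart J).symm w ∉ S →
      f' w = (‖𝒰.jac J I ((𝒰.chart J).symm w)‖ ^ 2) • f (𝒰.trans J I w)) :
    ∫ w in (𝒰.chart I).target, f w = ∫ w in (𝒰.chart J).target, f' w := by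
  let SI : ι → Set ℂ := fun I => (𝒰.chart I).target ∩ (𝒰.chart I).symm ⁻¹' S
  have hSI : ∀ I, (SI I).Finite := 𝒰.finite_preimage hS
  have hmeas : ∀ I J, MeasurableSet (𝒰.overlap I J \ SI I) := fun I J =>
    (𝒰.isOpen_overlap I J).measurableSet.diff (hSI I).measurableSet
  have himg : 𝒰.trans J I '' (𝒰.overlap J I \ SI J) = 𝒰.overlap I J \ SI I := by
    ext w
    constructor
    · rintro ⟨w, ⟨hw, hwS⟩, rfl⟩
      refine ⟨𝒰.trans_mem_overlap hw, fun hcon => hwS ⟨hw.1, ?_⟩⟩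
      have := hcon.2
      rwa [mem_preimage, 𝒰.symm_trans hw] at this
    · rintro ⟨hw, hwS⟩
      refine ⟨_, ⟨𝒰.trans_mem_overlap hw, fun hcon => hwS ⟨hw.1, ?_⟩⟩, 𝒰.trans_trans hw⟩
      have := hcon.2
      rwa [mem_preimage, 𝒰.symm_trans hw] at this
  have hres : ∀ I J (f : ℂ → ℂ), (∀ w ∈ (𝒰.chart I).target, (𝒰.chart I).symm w ∉ S →
      (𝒰.chart I).symm w ∉ (𝒰.chart J).source → f w = 0) →
      ∫ w in (𝒰.chart I).target, f w = ∫ w in 𝒰.overlap I J \ SI I, f w := by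
    intro I J f hf
    rw [← setIntegral_sdiff_finite (hSI I)]
    refine setIntegral_eq_of_subset_of_forall_sdiff_eq_zero
      ((𝒰.chart I).open_target.measurableSet.diff (hSI I).measurableSet)
      (sdiff_subset_sdiff_left inter_subset_left) ?_
    rintro w ⟨⟨hw, hwS⟩, hw2⟩
    exact hf w hw (fun h => hwS ⟨hw, h⟩) fun h => hw2 ⟨⟨hw, h⟩, hwS⟩
  rw [hres I J f hf, hres J I f' hf', ← himg, integral_image_holomorphic (hmeas J I)
    (fun w hw => 𝒰.hasDerivAt_trans hw.1) ((𝒰.injOn_trans J I).mono sdiff_subset)]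
  exact setIntegral_congr_fun (hmeas J I) fun w hw =>
    (h w hw.1 fun hS => hw.2 ⟨hw.1.1, hS⟩).symm

/-- If the local components of two `(1,1)`-forms differ only on a compact subset of the chart `U_J`,
the difference of the surface integrals can be computed in this chart. -/
theorem surfaceIntegral_sub (hρ : ρ.IsSubordinate (fun I => (𝒰.chart I).source)) {S : Set C}
    (hS : S.Finite) {η η' : ι → C → ℂ} (hη : SurfaceSing 𝒰 S η) (hη' : SurfaceSing 𝒰 S η')
    {J : ι} {Z : Set C} (hZ : IsCompact Z) (hZJ : Z ⊆ (𝒰.chart J).source)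
    (h0 : ∀ I x, x ∈ (𝒰.chart I).source → x ∉ S → x ∉ Z → η' I x = η I x)
    (htr : ∀ I x, x ∈ (𝒰.chart I).source → x ∈ (𝒰.chart J).source → x ∉ S →
      η' J x - η J x = (‖𝒰.jac J I x‖ ^ 2 : ℝ) • (η' I x - η I x)) :
    surfaceIntegral 𝒰 ρ η' - surfaceIntegral 𝒰 ρ η =
      ∫ w in (𝒰.chart J).target, (-2 * Complex.I) *
        (η' J ((𝒰.chart J).symm w) - η J ((𝒰.chart J).symm w)) := by
  have hfin : {I | (tsupport (ρ I)).Nonempty}.Finite :=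
    (ρ.locallyFinite.closure).finite_nonempty_of_compact
  set Tf := hfin.toFinset with hTf
  have hTf0 : ∀ I, I ∉ Tf → ∀ x, ρ I x = 0 := by
    intro I hI x
    by_contra hne
    exact hI (hfin.mem_toFinset.2 ⟨x, subset_tsupport _ hne⟩)
  have hsum : ∀ η : ι → C → ℂ, surfaceIntegral 𝒰 ρ η = ∑ I ∈ Tf, ∫ w in (𝒰.chart I).target,
      (-2 * Complex.I) * ((ρ I ((𝒰.chart I).symm w) : ℂ) * η I ((𝒰.chart I).symm w)) := by
    intro η
    refine finsum_eq_sum_of_support_subset _ fun I hI => ?_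
    by_contra hcon
    exact hI (by simp [hTf0 I hcon])
  let SI : ι → Set ℂ := fun I => (𝒰.chart I).target ∩ (𝒰.chart I).symm ⁻¹' S
  have hSI : ∀ I, (SI I).Finite := 𝒰.finite_preimage hS
  let δ : ι → ℂ → ℂ := fun I w => η' I ((𝒰.chart I).symm w) - η I ((𝒰.chart I).symm w)
  have step : ∀ I, (∫ w in (𝒰.chart I).target,
      (-2 * Complex.I) * ((ρ I ((𝒰.chart I).symm w) : ℂ) * η' I ((𝒰.chart I).symm w))) -
      ∫ w in (𝒰.chart I).target,
      (-2 * Complex.I) * ((ρ I ((𝒰.chart I).symm w) : ℂ) * η I ((𝒰.chart I).symm w)) =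
      ∫ w in (𝒰.chart J).target,
        (-2 * Complex.I) * ((ρ I ((𝒰.chart J).symm w) : ℂ) * δ J w) := by
    intro I
    rw [← integral_sub ((integrableOn_partition hρ hS hη' I).const_mul _)
      ((integrableOn_partition hρ hS hη I).const_mul _)]
    have e1 : ∀ w, -2 * Complex.I * ((ρ I ((𝒰.chart I).symm w) : ℂ) * η' I ((𝒰.chart I).symm w)) -
        -2 * Complex.I * ((ρ I ((𝒰.chart I).symm w) : ℂ) * η I ((𝒰.chart I).symm w)) =
        -2 * Complex.I * ((ρ I ((𝒰.chart I).symm w) : ℂ) * δ I w) := by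
      intro w; simp only [δ]; ring
    simp only [e1]
    refine integral_target_eq hS (fun w hw hwS hwJ => ?_) (fun w hw hwS hwI => ?_)
      fun w hw hwS => ?_
    · have h1 : δ I w = 0 :=
        sub_eq_zero.2 (h0 I _ ((𝒰.chart I).map_target hw) hwS fun h => hwJ (hZJ h))
      rw [h1, mul_zero, mul_zero]
    · have h1 : ρ I ((𝒰.chart J).symm w) = 0 := by
        by_contra hne
        exact hwI (hρ I (subset_tsupport _ hne))
      rw [h1, Complex.ofReal_zero, zero_mul, mul_zero]
    · have h1 := htr I _ hw.2 ((𝒰.chart J).map_target hw.1) hwS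
      simp only [δ, 𝒰.symm_trans hw]
      rw [h1, Complex.real_smul, Complex.real_smul]
      ring
  have hδ : MildSing (𝒰.chart J).target (SI J) (δ J) := by
    simpa [δ, sub_eq_add_neg] using (hη' J).add (hη J).neg
  have hδint : IntegrableOn (δ J) (𝒰.chart J).target := by
    have h1 := hδ.integrableOn (𝒰.chart J).open_target (hSI J)
      (hZ.image_of_continuousOn ((𝒰.chart J).continuousOn.mono hZJ))
      (by rintro _ ⟨x, hx, rfl⟩; exact (𝒰.chart J).map_source (hZJ hx))
    have h2 : IntegrableOn (δ J) ((𝒰.chart J).target \ SI J) := by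
      refine h1.of_forall_sdiff_eq_zero
        ((𝒰.chart J).open_target.measurableSet.diff (hSI J).measurableSet) fun w hw => ?_
      refine sub_eq_zero.2 (h0 J _ ((𝒰.chart J).map_target hw.1.1)
        (fun h => hw.1.2 ⟨hw.1.1, h⟩) fun h => hw.2 ⟨_, h, (𝒰.chart J).right_inv hw.1.1⟩)
    rwa [IntegrableOn, ae_restrict_diff_finite (hSI J)] at h2
  have hρint : ∀ I ∈ Tf, Integrable
      (fun w => (-2 * Complex.I) * ((ρ I ((𝒰.chart J).symm w) : ℂ) * δ J w))
      (volume.restrict (𝒰.chart J).target) := by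
    intro I _
    refine Integrable.const_mul ?_ _
    refine Integrable.bdd_mul (c := 1) hδint ?_ ?_
    · refine ContinuousOn.aestronglyMeasurable ?_ (𝒰.chart J).open_target.measurableSet
      refine Complex.continuous_ofReal.comp_continuousOn ?_
      exact (ρ I).continuous.comp_continuousOn (𝒰.chart J).continuousOn_symm
    · refine Eventually.of_forall fun w => ?_
      rw [Complex.norm_real, Real.norm_of_nonneg (ρ.nonneg I _)]
      exact ρ.le_one I _
  rw [hsum, hsum, ← Finset.sum_sub_distrib, Finset.sum_congr rfl fun I _ => step I,
    ← integral_finsetSum _ hρint]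
  refine setIntegral_congr_fun (𝒰.chart J).open_target.measurableSet fun w _ => ?_
  have h1 : ∑ I ∈ Tf, ρ I ((𝒰.chart J).symm w) = 1 := by
    rw [← ρ.sum_eq_one (mem_univ ((𝒰.chart J).symm w))]
    refine (finsum_eq_sum_of_support_subset _ fun I hI => ?_).symm
    by_contra hcon
    exact hI (hTf0 I hcon _)
  rw [← Finset.mul_sum, ← Finset.sum_mul, ← Complex.ofReal_sum, h1]
  simp [δ]

end SurfaceIntegral

end MixedBF

namespace MixedBF

section TimeDerivatives

variable {C ι : Type*} [TopologicalSpace C] [ChartedSpace ℂ C] {n : ℕ}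
  {V : Type*} [NormedAddCommGroup V] [NormedSpace ℂ V] {𝒰 : HolAtlas C ι} {S : Set C}
  {f : ι → C → (Fin n → ℝ) → V} {I : ι} {x : C}

theorem SmoothOff.fderiv_eq (h : SmoothOff 𝒰 S f) (hS : IsClosed S) {w : ℂ}
    (hw : w ∈ (𝒰.chart I).target) (hwS : (𝒰.chart I).symm w ∉ S) (u v : Fin n → ℝ) :
    fderiv ℝ (f I ((𝒰.chart I).symm w)) u v =
      fderiv ℝ (fun y : ℂ × (Fin n → ℝ) => f I ((𝒰.chart I).symm y.1) y.2) (w, u) (0, v) := by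
  have h1 := h.contDiffAt hS ((𝒰.chart I).map_target hw) hwS u
  rw [(𝒰.chart I).right_inv hw] at h1
  have h2 : HasFDerivAt (fun u : Fin n → ℝ => (w, u)) (ContinuousLinearMap.inr ℝ ℂ (Fin n → ℝ)) u :=
    hasFDerivAt_prodMk_right w u
  have h3 := (h1.differentiableAt (by simp)).hasFDerivAt.comp u h2
  have h4 : HasFDerivAt (f I ((𝒰.chart I).symm w)) _ u := h3
  rw [h4.fderiv]
  rfl

theorem SmoothOff.fderiv_time (h : SmoothOff 𝒰 S f) (hS : IsClosed S)
    {X : (Fin n → ℝ) → Fin n → ℝ} (hX : ContDiff ℝ ∞ X) :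
    SmoothOff 𝒰 S (fun I x u => fderiv ℝ (f I x) u (X u)) := by
  intro I
  have ho : IsOpen (((𝒰.chart I).target ∩ (𝒰.chart I).symm ⁻¹' Sᶜ) ×ˢ (univ : Set (Fin n → ℝ))) :=
    ((𝒰.chart I).isOpen_inter_preimage_symm hS.isOpen_compl).prod isOpen_univ
  have h1 := ((h I).fderiv_of_isOpen (m := ∞) ho (by simp)).clm_apply
    (g := fun y : ℂ × (Fin n → ℝ) => ((0 : ℂ), X y.2))
    (contDiff_const.prodMk (hX.comp contDiff_snd)).contDiffOn
  exact h1.congr fun y hy => h.fderiv_eq hS hy.1.1 hy.1.2 y.2 (X y.2)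

end TimeDerivatives

section FieldRegularity

variable {C ι E G : Type*} [TopologicalSpace C] [T2Space C] [ChartedSpace ℂ C]
  [IsManifold 𝓘(ℂ) ω C]
  [NormedAddCommGroup E] [NormedSpace ℂ E] [FiniteDimensional ℂ E]
  [TopologicalSpace G] [ChartedSpace E G] [Group G] [LieGroup 𝓘(ℂ, E) ω G]
  {n N : ℕ} {Pb : PBundle C ι E G} {D : Defects C E G n N} {F : Fields C ι E G n N}
  {I J : ι} {x : C} {u v : Fin n → ℝ}

theorem Defects.disjoint (D : Defects C E G n N) : Disjoint (range D.p) (range D.q) := by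
  rw [Set.disjoint_left]
  rintro _ ⟨α, rfl⟩ ⟨i, hi⟩
  exact D.p_ne_q α i hi.symm

theorem Fields.gaugeAt_smul (F : Fields C ι E G n N) (I : ι) (x : C) (u v : Fin n → ℝ) (c : ℝ) :
    F.gaugeAt I x u (c • v) = c • F.gaugeAt I x u v := by
  simp [Fields.gaugeAt, Finset.smul_sum, mul_smul]

namespace Fields.Admissible

variable (hF : F.Admissible Pb D)
include hF

theorem gaugeAt_smooth {V : (Fin n → ℝ) → Fin n → ℝ} (hV : ContDiff ℝ ∞ V) :
    SmoothOff Pb.toHolAtlas (range D.q) (fun I x u => F.gaugeAt I x u (V u)) := by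
  intro I
  refine ContDiffOn.sum fun j _ => ?_
  have h1 : ContDiff ℝ ∞ fun y : ℂ × (Fin n → ℝ) => V y.2 j :=
    (contDiff_pi.1 hV j).comp contDiff_snd
  exact h1.contDiffOn.smul (contDiffOn_pi.1 (hF.gauge_smooth I) j)

theorem gaugeAt_poles {V : (Fin n → ℝ) → Fin n → ℝ} (hV : ContDiff ℝ ∞ V) :
    SimplePoles Pb.toHolAtlas (range D.q) (fun I x u => F.gaugeAt I x u (V u)) := by
  intro I s hs hsI
  obtain ⟨W, hW, h, hh, hfh⟩ := hF.gauge_poles I s hs hsI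
  refine ⟨W, hW, fun y => ∑ j, V y.2 j • h y j, ContDiffOn.sum fun j _ => ?_, fun w hw hws u => ?_⟩
  · have h1 : ContDiff ℝ ∞ fun y : ℂ × (Fin n → ℝ) => V y.2 j :=
      (contDiff_pi.1 hV j).comp contDiff_snd
    exact h1.contDiffOn.smul (contDiffOn_pi.1 hh j)
  · simp only [gaugeAt, hfh w hw hws u, Pi.smul_apply, Finset.smul_sum]
    exact Finset.sum_congr rfl fun j _ => smul_comm _ _ _

theorem gaugeAt_trans (hI : x ∈ (Pb.chart I).source) (hJ : x ∈ (Pb.chart J).source)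
    (hx : x ∉ range D.q) (u v : Fin n → ℝ) :
    F.gaugeAt I x u v = Ad (Pb.g I J x) (F.gaugeAt J x u v) := by
  simp only [gaugeAt, map_sum, hF.gauge_trans I J x hI hJ hx]
  refine Finset.sum_congr rfl fun j _ => ?_
  exact (((Ad (Pb.g I J x) : E →L[ℂ] E).restrictScalars ℝ).map_smul (v j) _).symm

theorem fderiv_A_trans (hI : x ∈ (Pb.chart I).source) (hJ : x ∈ (Pb.chart J).source)
    (u v : Fin n → ℝ) :
    fderiv ℝ (F.A I x) u v = (starRingEnd ℂ) (Pb.jac I J x) •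
      Ad (Pb.g I J x) (fderiv ℝ (F.A J x) u v) := by
  have h1 : F.A I x = fun u => (((starRingEnd ℂ) (Pb.jac I J x) •
      (Ad (Pb.g I J x) : E →L[ℂ] E)).restrictScalars ℝ) (F.A J x u) -
      dbarLog (fun w => Pb.g I J ((Pb.chart I).symm w)) (Pb.chart I x) := by
    ext u; exact hF.A_trans I J x hI hJ u
  have h2 : HasFDerivAt (F.A J x) (fderiv ℝ (F.A J x) u) u :=
    (((hF.A_smooth.contDiff_time isClosed_empty hJ (notMem_empty x)).differentiable
      (by simp)) u).hasFDerivAt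
  have h3 := ((ContinuousLinearMap.hasFDerivAt (((starRingEnd ℂ) (Pb.jac I J x) •
      (Ad (Pb.g I J x) : E →L[ℂ] E)).restrictScalars ℝ)).comp u h2).sub_const
      (dbarLog (fun w => Pb.g I J ((Pb.chart I).symm w)) (Pb.chart I x))
  have h4 : HasFDerivAt (F.A I x) _ u := h3.congr_of_eventuallyEq (Eventually.of_forall (congrFun h1))
  rw [h4.fderiv]
  rfl

theorem fderiv_B_trans (hI : x ∈ (Pb.chart I).source) (hJ : x ∈ (Pb.chart J).source)
    (hx : x ∉ range D.p) (u v : Fin n → ℝ) :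
    fderiv ℝ (F.B I x) u v = Pb.jac I J x • coAd (Pb.g I J x) (fderiv ℝ (F.B J x) u v) := by
  have h1 : F.B I x = fun u => ((Pb.jac I J x •
      (coAdL (Pb.g I J x) : StrongDual ℂ E →L[ℂ] StrongDual ℂ E)).restrictScalars ℝ) (F.B J x u) := by
    ext1 u; exact hF.B_trans I J x hI hJ hx u
  have h2 : HasFDerivAt (F.B J x) (fderiv ℝ (F.B J x) u) u :=
    (((hF.B_smooth.contDiff_time (finite_range D.p).isClosed hJ hx).differentiable
      (by simp)) u).hasFDerivAt
  have h3 := ((ContinuousLinearMap.hasFDerivAt ((Pb.jac I J x •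
      (coAdL (Pb.g I J x) : StrongDual ℂ E →L[ℂ] StrongDual ℂ E)).restrictScalars ℝ)).comp u h2)
  have h4 : HasFDerivAt (F.B I x) _ u := h3.congr_of_eventuallyEq (Eventually.of_forall (congrFun h1))
  rw [h4.fderiv]
  rfl

end Fields.Admissible

/-- The operator `∂̄ + [A, ·]` is covariant. -/
theorem dbar_add_bracket_trans {Y Y' : ℂ → E} {a a' : E} (hI : x ∈ (Pb.chart I).source)
    (hJ : x ∈ (Pb.chart J).source) (hY' : DifferentiableAt ℝ Y' (Pb.chart J x))
    (hY : ∀ᶠ w in 𝓝 (Pb.chart I x), Y w =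
      Ad (Pb.g I J ((Pb.chart I).symm w)) (Y' (Pb.toHolAtlas.trans I J w)))
    (ha : a = (starRingEnd ℂ) (Pb.jac I J x) • Ad (Pb.g I J x) a'
      - dbarLog (fun w => Pb.g I J ((Pb.chart I).symm w)) (Pb.chart I x)) :
    dbar Y (Pb.chart I x) + bracket G a (Y (Pb.chart I x)) =
      (starRingEnd ℂ) (Pb.jac I J x) • Ad (Pb.g I J x)
        (dbar Y' (Pb.chart J x) + bracket G a' (Y' (Pb.chart J x))) := by
  have ho := Pb.toHolAtlas.chart_mem_overlap hI hJ
  have hτ := Pb.toHolAtlas.hasDerivAt_trans_chart hI hJ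
  have hτx : Pb.toHolAtlas.trans I J (Pb.chart I x) = Pb.chart J x :=
    Pb.toHolAtlas.trans_chart hI
  have hg := (Pb.mdifferentiableAt_g ho).mdifferentiableAt (by simp)
  rw [Filter.EventuallyEq.dbar_eq hY, hY.self_of_nhds,
    dbar_Ad_comp hg hτ.differentiableAt (by rwa [hτx]), hτ.deriv, hτx,
    (Pb.chart I).left_inv hI, ha, map_add, Ad_bracket]
  simp only [← adL_apply, map_sub, map_smul, sub_apply, smul_apply, smul_add]
  abel

namespace Fields.Admissible

variable (hF : F.Admissible Pb D)
include hF

theorem dbar_gaugeAt_trans (hI : x ∈ (Pb.chart I).source) (hJ : x ∈ (Pb.chart J).source)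
    (hx : x ∉ range D.q) (u v : Fin n → ℝ) :
    dbar (fun w => F.gaugeAt I ((Pb.chart I).symm w) u v) (Pb.chart I x) +
      bracket G (F.A I x u) (F.gaugeAt I x u v) =
    (starRingEnd ℂ) (Pb.jac I J x) • Ad (Pb.g I J x)
      (dbar (fun w => F.gaugeAt J ((Pb.chart J).symm w) u v) (Pb.chart J x) +
      bracket G (F.A J x u) (F.gaugeAt J x u v)) := by
  have hq : IsClosed (range D.q) := (finite_range D.q).isClosed
  have h := dbar_add_bracket_trans (Pb := Pb) (G := G)
    (Y := fun w => F.gaugeAt I ((Pb.chart I).symm w) u v)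
    (Y' := fun w => F.gaugeAt J ((Pb.chart J).symm w) u v) hI hJ
    (((hF.gaugeAt_smooth (V := fun _ => v) contDiff_const).contDiffAt_point hq hJ hx u
      |>.differentiableAt (by simp))) ?_ (hF.A_trans I J x hI hJ u)
  · simpa [(Pb.chart I).left_inv hI, (Pb.chart J).left_inv hJ] using h
  · have h1 : (Pb.chart I).target ∩ (Pb.chart I).symm ⁻¹' (range D.q)ᶜ ∈ 𝓝 (Pb.chart I x) :=
      ((Pb.chart I).isOpen_inter_preimage_symm hq.isOpen_compl).mem_nhds
        ⟨(Pb.chart I).map_source hI, by simpa [(Pb.chart I).left_inv hI] using hx⟩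
    filter_upwards [h1, (Pb.toHolAtlas.isOpen_overlap I J).mem_nhds
      (Pb.toHolAtlas.chart_mem_overlap hI hJ)] with w hw hwo
    rw [Pb.toHolAtlas.symm_trans hwo]
    exact hF.gaugeAt_trans ((Pb.chart I).map_target hwo.1) hwo.2 hw.2 u v

theorem curvature_trans (hI : x ∈ (Pb.chart I).source) (hJ : x ∈ (Pb.chart J).source)
    (hx : x ∉ range D.q) (u v : Fin n → ℝ) :
    F.curvature Pb.toHolAtlas u v I x =
      (starRingEnd ℂ) (Pb.jac I J x) • Ad (Pb.g I J x) (F.curvature Pb.toHolAtlas u v J x) := by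
  rw [curvature, curvature, sub_add_eq_add_sub, hF.dbar_gaugeAt_trans hI hJ hx,
    hF.fderiv_A_trans hI hJ, sub_add_eq_add_sub, map_sub, smul_sub]

theorem pairing_trans (hI : x ∈ (Pb.chart I).source) (hJ : x ∈ (Pb.chart J).source)
    (hx : x ∉ range D.p ∪ range D.q) (u v : Fin n → ℝ) :
    F.B I x u (F.curvature Pb.toHolAtlas u v I x) =
      (‖Pb.jac I J x‖ ^ 2 : ℝ) • F.B J x u (F.curvature Pb.toHolAtlas u v J x) := by
  rw [mem_union, not_or] at hx
  rw [hF.curvature_trans hI hJ hx.2, hF.B_trans I J x hI hJ hx.1, smul_apply, map_smul, coAd_apply,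
    Ad_inv_Ad, smul_smul, smul_eq_mul, Complex.mul_conj, Complex.normSq_eq_norm_sq,
    Complex.real_smul]

theorem B_mild (u : Fin n → ℝ) (I : ι) : MildSing (Pb.chart I).target
    ((Pb.chart I).target ∩ (Pb.chart I).symm ⁻¹' range D.p)
    (fun w => F.B I ((Pb.chart I).symm w) u) := by
  refine MildSing.of_poles ?_ ?_
  · rintro w ⟨hw, hwp⟩
    have h1 := hF.B_smooth.contDiffAt_point (finite_range D.p).isClosed
      ((Pb.chart I).map_target hw) (fun h => hwp ⟨hw, h⟩) u
    rw [(Pb.chart I).right_inv hw] at h1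
    exact h1.continuousAt.continuousWithinAt
  · rintro s ⟨hs, hsp⟩ -
    obtain ⟨W, hW, h, hh, hfh⟩ := hF.B_poles I _ hsp ((Pb.chart I).map_target hs)
    rw [(Pb.chart I).right_inv hs] at hW hfh
    refine ⟨fun w => h (w, u), ContinuousAt.comp (g := h) (f := fun w : ℂ => (w, u))
      (hh.continuousOn.continuousAt (prod_mem_nhds hW univ_mem)) (by fun_prop), ?_⟩
    filter_upwards [nhdsWithin_le_nhds hW, self_mem_nhdsWithin] with w hw hws
    exact hfh w hw hws u

theorem gaugeAt_mild (u v : Fin n → ℝ) (I : ι) : MildSing (Pb.chart I).target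
    ((Pb.chart I).target ∩ (Pb.chart I).symm ⁻¹' range D.q)
    (fun w => F.gaugeAt I ((Pb.chart I).symm w) u v) := by
  have hsm := hF.gaugeAt_smooth (V := fun _ => v) contDiff_const
  have hp := hF.gaugeAt_poles (V := fun _ => v) contDiff_const
  refine MildSing.of_poles ?_ ?_
  · rintro w ⟨hw, hwp⟩
    have h1 := hsm.contDiffAt_point (finite_range D.q).isClosed
      ((Pb.chart I).map_target hw) (fun h => hwp ⟨hw, h⟩) u
    rw [(Pb.chart I).right_inv hw] at h1
    exact h1.continuousAt.continuousWithinAt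
  · rintro s ⟨hs, hsp⟩ -
    obtain ⟨W, hW, h, hh, hfh⟩ := hp I _ hsp ((Pb.chart I).map_target hs)
    rw [(Pb.chart I).right_inv hs] at hW hfh
    refine ⟨fun w => h (w, u), ContinuousAt.comp (g := h) (f := fun w : ℂ => (w, u))
      (hh.continuousOn.continuousAt (prod_mem_nhds hW univ_mem)) (by fun_prop), ?_⟩
    filter_upwards [nhdsWithin_le_nhds hW, self_mem_nhdsWithin] with w hw hws
    exact hfh w hw hws u

theorem dbar_gaugeAt_mild (u v : Fin n → ℝ) (I : ι) : MildSing (Pb.chart I).target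
    ((Pb.chart I).target ∩ (Pb.chart I).symm ⁻¹' range D.q)
    (dbar fun w => F.gaugeAt I ((Pb.chart I).symm w) u v) := by
  have hsm := hF.gaugeAt_smooth (V := fun _ => v) contDiff_const
  have hp := hF.gaugeAt_poles (V := fun _ => v) contDiff_const
  refine MildSing.of_poles ?_ ?_
  · rintro w ⟨hw, hwp⟩
    have h1 := hsm.contDiffAt_point (finite_range D.q).isClosed
      ((Pb.chart I).map_target hw) (fun h => hwp ⟨hw, h⟩) u
    rw [(Pb.chart I).right_inv hw] at h1
    exact (ContDiffAt.dbar h1).continuousAt.continuousWithinAt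
  · rintro s ⟨hs, hsp⟩ -
    obtain ⟨W, hW, h, hh, hfh⟩ := hp I _ hsp ((Pb.chart I).map_target hs)
    rw [(Pb.chart I).right_inv hs] at hW hfh
    have hcd : ∀ w ∈ interior W, ContDiffAt ℝ ∞ (fun w => h (w, u)) w := fun w hw =>
      ContDiffAt.comp (g := h) (f := fun w : ℂ => (w, u)) w
        (hh.contDiffAt (prod_mem_nhds (mem_interior_iff_mem_nhds.1 hw) univ_mem))
        (contDiffAt_id.prodMk contDiffAt_const)
    refine ⟨dbar fun w => h (w, u), (ContDiffAt.dbar (hcd s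
      (mem_interior_iff_mem_nhds.2 hW))).continuousAt, ?_⟩
    filter_upwards [nhdsWithin_le_nhds (interior_mem_nhds.2 hW), self_mem_nhdsWithin] with w hw hws
    have h1 : (fun w => F.gaugeAt I ((Pb.chart I).symm w) u v) =ᶠ[𝓝 w]
        fun w => (w - s)⁻¹ • h (w, u) := by
      filter_upwards [isOpen_interior.mem_nhds hw, isOpen_ne.mem_nhds hws] with z hz hzs
      exact hfh z (interior_subset hz) hzs u
    rw [Filter.EventuallyEq.dbar_eq h1]
    refine dbar_holomorphic_smul (c := fun w => (w - s)⁻¹) ?_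
      ((hcd w hw).differentiableAt (by simp))
    exact (differentiableAt_id.sub_const s).inv (sub_ne_zero.2 hws)

theorem A_continuousOn (u : Fin n → ℝ) (I : ι) :
    ContinuousOn (fun w => F.A I ((Pb.chart I).symm w) u) (Pb.chart I).target := by
  intro w hw
  have h1 := hF.A_smooth.contDiffAt_point isClosed_empty
      ((Pb.chart I).map_target hw) (notMem_empty _) u
  rw [(Pb.chart I).right_inv hw] at h1
  exact h1.continuousAt.continuousWithinAt

theorem fderiv_A_continuousOn (u v : Fin n → ℝ) (I : ι) : ContinuousOn
    (fun w => fderiv ℝ (F.A I ((Pb.chart I).symm w)) u v) (Pb.chart I).target := by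
  intro w hw
  have h1 := (hF.A_smooth.fderiv_time isClosed_empty
    (X := fun _ => v) contDiff_const).contDiffAt_point isClosed_empty
      ((Pb.chart I).map_target hw) (notMem_empty _) u
  rw [(Pb.chart I).right_inv hw] at h1
  exact h1.continuousAt.continuousWithinAt

theorem bracket_gaugeAt_mild (u v : Fin n → ℝ) (I : ι) : MildSing (Pb.chart I).target
    ((Pb.chart I).target ∩ (Pb.chart I).symm ⁻¹' range D.q)
    (fun w => bracket G (F.A I ((Pb.chart I).symm w) u)
      (F.gaugeAt I ((Pb.chart I).symm w) u v)) :=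
  MildSing.bilinear (L := fun w => adL G (F.A I ((Pb.chart I).symm w) u))
    (Pb.chart I).open_target ((adL G).continuous.comp_continuousOn (hF.A_continuousOn u I))
    (hF.gaugeAt_mild u v I)

theorem curvature_mild (u v : Fin n → ℝ) (I : ι) : MildSing (Pb.chart I).target
    ((Pb.chart I).target ∩ (Pb.chart I).symm ⁻¹' range D.q)
    (fun w => F.curvature Pb.toHolAtlas u v I ((Pb.chart I).symm w)) := by
  have h1 := ((hF.dbar_gaugeAt_mild u v I).add (mildSing_of_continuousOn
    (Pb.chart I).open_target (hF.fderiv_A_continuousOn u v I)).neg).add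
    (hF.bracket_gaugeAt_mild u v I)
  have h2 : ∀ w ∈ (Pb.chart I).target, F.curvature Pb.toHolAtlas u v I ((Pb.chart I).symm w) =
      dbar (fun w => F.gaugeAt I ((Pb.chart I).symm w) u v) w +
      -fderiv ℝ (F.A I ((Pb.chart I).symm w)) u v +
      bracket G (F.A I ((Pb.chart I).symm w) u) (F.gaugeAt I ((Pb.chart I).symm w) u v) := by
    intro w hw
    rw [curvature, (Pb.chart I).right_inv hw, sub_eq_add_neg]
  refine ⟨h1.1.congr fun w hw => h2 w hw.1, fun s hs hsT => ?_⟩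
  obtain ⟨c, hc⟩ := h1.2 s hs hsT
  refine ⟨c, ?_⟩
  filter_upwards [hc, nhdsWithin_le_nhds ((Pb.chart I).open_target.mem_nhds hsT)] with w hw hwT
  rwa [h2 w hwT]

theorem pairing_sing (u v : Fin n → ℝ) : SurfaceSing Pb.toHolAtlas (range D.p ∪ range D.q)
    (fun I x => F.B I x u (F.curvature Pb.toHolAtlas u v I x)) := by
  intro I
  have h := (hF.B_mild u I).apply (hF.curvature_mild u v I) (Pb.chart I).open_target
    (Pb.toHolAtlas.finite_preimage (finite_range D.p) I)
    (Pb.toHolAtlas.finite_preimage (finite_range D.q) I)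
    ((D.disjoint.preimage _).mono inter_subset_right inter_subset_right)
  rwa [← inter_union_distrib_left, ← preimage_union] at h

end Fields.Admissible

end FieldRegularity

end MixedBF

namespace MixedBF

section TestPairings

variable {V : Type*} [NormedAddCommGroup V] [NormedSpace ℂ V] {T S : Set ℂ} {f : ℂ → V}

theorem MildSing.integrableOn_apply {W : Type*} [NormedAddCommGroup W] [NormedSpace ℂ W]
    (hf : MildSing T S f) (hT : IsOpen T) (hS : S.Finite)
    {L : ℂ → V →L[ℂ] W} (hL : ContinuousOn L T) {K : Set ℂ} (hK : IsCompact K) (hKT : K ⊆ T)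
    (h0 : ∀ w ∉ K, L w = 0) : IntegrableOn (fun w => L w (f w)) T := by
  have h1 := (MildSing.bilinear hT hL hf).integrableOn hT hS hK hKT
  exact h1.of_forall_sdiff_eq_zero hT.measurableSet fun w hw => by rw [h0 w hw.2]; rfl

theorem ae_notMem_finite (hS : S.Finite) : ∀ᵐ w ∂(volume.restrict T : Measure ℂ), w ∉ S :=
  ae_restrict_of_ae (measure_eq_zero_iff_ae_notMem.1 (hS.measure_zero _))

theorem dbar_eq_zero_of_notMem_tsupport {ψ : ℂ → V} {w : ℂ} (hw : w ∉ tsupport ψ) :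
    dbar ψ w = 0 := by
  by_contra hne
  exact hw (tsupport_dbar_subset ψ (subset_tsupport _ hne))

theorem IsTest.contDiff_dbar {ψ : ℂ → V} (h : IsTest T ψ) : ContDiff ℝ ∞ (dbar ψ) :=
  contDiff_iff_contDiffAt.2 fun _ => ContDiffAt.dbar h.smooth.contDiffAt

/-- The formula of Cauchy and Pompeiu for a function with simple poles. -/
theorem integral_dbar_of_decomposition {S : Finset ℂ} {ψ : ℂ → StrongDual ℂ V} {H₀ : ℂ → V}
    {H : ℂ → ℂ → V} (hT : IsOpen T) (hψ : IsTest T ψ) (hH₀ : ContDiffOn ℝ ∞ H₀ T)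
    (hH : ∀ s, ContDiff ℝ ∞ (H s))
    (h : ∀ w ∈ T, w ∉ S → f w = H₀ w + ∑ s ∈ S, (w - s)⁻¹ • H s w) :
    ∫ w in T, dbar (fun z => ψ z (f z)) w = -Real.pi * ∑ s ∈ S, ψ s (H s s) := by
  have happ : ∀ {g : ℂ → V} {w : ℂ}, ContDiffAt ℝ ∞ g w → ContDiffAt ℝ ∞ (fun z => ψ z (g z)) w := by
    intro g w hg
    have h1 : ContDiffAt ℝ ∞ (fun z => (ψ z).restrictScalars ℝ) w :=
      (ContinuousLinearMap.restrictScalarsL ℂ V ℂ ℝ ℝ).contDiff.contDiffAt.comp w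
        hψ.smooth.contDiffAt
    exact h1.clm_apply hg
  have hzero : ∀ (g : ℂ → V) (w : ℂ), w ∉ tsupport ψ → ψ w (g w) = 0 := fun g w hw => by
    rw [image_eq_zero_of_notMem_tsupport hw]; rfl
  have hcs : ∀ g : ℂ → V, HasCompactSupport fun z => ψ z (g z) := fun g =>
    HasCompactSupport.intro hψ.compact fun w hw => hzero g w hw
  have hs0 : ContDiff ℝ ∞ fun z => ψ z (H₀ z) := by
    rw [contDiff_iff_contDiffAt]
    intro w
    by_cases hw : w ∈ tsupport ψ
    · exact happ (hH₀.contDiffAt (hT.mem_nhds (hψ.supp hw)))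
    · refine (contDiffAt_const (c := (0 : ℂ))).congr_of_eventuallyEq ?_
      filter_upwards [notMem_tsupport_iff_eventuallyEq.1 hw] with z hz
      rw [hz]; rfl
  have hs : ∀ s, ContDiff ℝ ∞ fun z => ψ z (H s z) := fun s =>
    contDiff_iff_contDiffAt.2 fun w => happ (hH s).contDiffAt
  have hcd : ∀ {g : ℂ → ℂ}, ContDiff ℝ ∞ g → ContDiff ℝ 1 g := fun hg =>
    hg.of_le (by exact_mod_cast le_top)
  have hint0 : Integrable (dbar fun z => ψ z (H₀ z)) :=
    (contDiff_iff_contDiffAt.2 fun _ => ContDiffAt.dbar hs0.contDiffAt).continuous.integrable_of_hasCompactSupport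
      ((hcs H₀).mono' ((subset_tsupport _).trans (tsupport_dbar_subset _)))
  have hints : ∀ s, Integrable fun w => (w - s)⁻¹ • dbar (fun z => ψ z (H s z)) w := fun s =>
    integrable_inv_smul (contDiff_iff_contDiffAt.2
      fun _ => ContDiffAt.dbar (hs s).contDiffAt).continuous
      ((hcs (H s)).mono' ((subset_tsupport _).trans (tsupport_dbar_subset _))) s
  have heq : ∀ w ∈ T, w ∉ S → dbar (fun z => ψ z (f z)) w =
      dbar (fun z => ψ z (H₀ z)) w + ∑ s ∈ S, (w - s)⁻¹ • dbar (fun z => ψ z (H s z)) w := by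
    intro w hw hwS
    have h1 : (fun z => ψ z (f z)) =ᶠ[𝓝 w]
        fun z => ψ z (H₀ z) + ∑ s ∈ S, (z - s)⁻¹ • ψ z (H s z) := by
      filter_upwards [hT.mem_nhds hw, S.finite_toSet.isClosed.isOpen_compl.mem_nhds hwS] with z hz hzS
      rw [h z hz hzS, map_add, map_sum]
      simp only [map_smul]
    have hinv : ∀ s ∈ S, DifferentiableAt ℂ (fun z : ℂ => (z - s)⁻¹) w := fun s hs =>
      (differentiableAt_id.sub_const s).inv (sub_ne_zero.2 fun h => hwS (by
        have h' : w = s := h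
        rwa [h']))
    have hd : ∀ s ∈ S, DifferentiableAt ℝ (fun z => (z - s)⁻¹ • ψ z (H s z)) w := fun s hs' =>
      ((hinv s hs').restrictScalars ℝ).smul ((hs s).differentiable (by simp) w)
    have hsum : ∀ S' ⊆ S, DifferentiableAt ℝ (fun z => ∑ s ∈ S', (z - s)⁻¹ • ψ z (H s z)) w ∧
        dbar (fun z => ∑ s ∈ S', (z - s)⁻¹ • ψ z (H s z)) w =
        ∑ s ∈ S', (w - s)⁻¹ • dbar (fun z => ψ z (H s z)) w := by
      classical
      intro S'
      induction S' using Finset.induction_on with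
      | empty => intro _; simp [dbar_const]
      | insert a S' ha ih =>
        intro hsub
        obtain ⟨i1, i2⟩ := ih ((Finset.subset_insert a S').trans hsub)
        have haS := hsub (Finset.mem_insert_self a S')
        simp only [Finset.sum_insert ha]
        refine ⟨(hd a haS).add i1, ?_⟩
        rw [dbar_add (hd a haS) i1, i2, dbar_holomorphic_smul (hinv a haS)
          ((hs a).differentiable (by simp) w)]
    rw [Filter.EventuallyEq.dbar_eq h1, dbar_add (hs0.differentiable (by simp) w)
      (hsum S subset_rfl).1, (hsum S subset_rfl).2]
  have hout0 : ∀ w ∉ T, dbar (fun z => ψ z (H₀ z)) w = 0 := fun w hw => by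
    by_contra hne
    have h2 := tsupport_dbar_subset _ (subset_tsupport _ hne)
    exact hw (hψ.supp ((closure_minimal (fun z hz => by
      by_contra hcon
      exact hz (hzero H₀ z hcon)) (isClosed_tsupport ψ)) h2))
  have houts : ∀ s, ∀ w ∉ T, (w - s)⁻¹ • dbar (fun z => ψ z (H s z)) w = 0 := fun s w hw => by
    have : dbar (fun z => ψ z (H s z)) w = 0 := by
      by_contra hne
      have h2 := tsupport_dbar_subset _ (subset_tsupport _ hne)
      exact hw (hψ.supp ((closure_minimal (fun z hz => by
        by_contra hcon
        exact hz (hzero (H s) z hcon)) (isClosed_tsupport ψ)) h2))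
    rw [this, smul_zero]
  calc ∫ w in T, dbar (fun z => ψ z (f z)) w
      = ∫ w in T, (dbar (fun z => ψ z (H₀ z)) w +
          ∑ s ∈ S, (w - s)⁻¹ • dbar (fun z => ψ z (H s z)) w) := by
        refine integral_congr_ae ?_
        filter_upwards [ae_notMem_finite (T := T) S.finite_toSet, ae_restrict_mem hT.measurableSet]
          with w hwS hwT
        exact heq w hwT hwS
    _ = ∫ w, (dbar (fun z => ψ z (H₀ z)) w +
          ∑ s ∈ S, (w - s)⁻¹ • dbar (fun z => ψ z (H s z)) w) := by
        refine setIntegral_eq_integral_of_forall_compl_eq_zero fun w hw => ?_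
        rw [hout0 w hw, Finset.sum_eq_zero fun s _ => houts s w hw, add_zero]
    _ = -Real.pi * ∑ s ∈ S, ψ s (H s s) := by
        rw [integral_add hint0 (integrable_finsetSum _ fun s _ => hints s),
          integral_finsetSum _ fun s _ => hints s, integral_dbar_eq_zero (hcd hs0) (hcs H₀), zero_add,
          Finset.mul_sum]
        refine Finset.sum_congr rfl fun s _ => ?_
        rw [← integral_dbar_mul_inv (hcd (hs s)) (hcs (H s)) s]
        refine integral_congr_ae (Eventually.of_forall fun w => ?_)
        simp only [smul_eq_mul, mul_comm]

end TestPairings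

section ParametricPairings

variable {C ι : Type*} [TopologicalSpace C] [ChartedSpace ℂ C] {n : ℕ}
  {V : Type*} [NormedAddCommGroup V] [NormedSpace ℂ V] {𝒰 : HolAtlas C ι} {S : Set C}
  {f : ι → C → (Fin n → ℝ) → V} {I : ι}

theorem continuous_integral_apply [T2Space C] (hsm : SmoothOff 𝒰 S f) (hp : SimplePoles 𝒰 S f) (hS : S.Finite)
    (I : ι) {Ψ : ℂ × (Fin n → ℝ) → V →L[ℂ] ℂ} {K : Set ℂ} (hK : IsCompact K)
    (hKT : K ⊆ (𝒰.chart I).target) (hΨ : ContinuousOn Ψ ((𝒰.chart I).target ×ˢ univ))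
    (h0 : ∀ w ∉ K, ∀ u, Ψ (w, u) = 0) :
    Continuous fun u => ∫ w in (𝒰.chart I).target, Ψ (w, u) (f I ((𝒰.chart I).symm w) u) := by
  obtain ⟨H₀, H, h1, h2, h3⟩ := hsm.exists_decomposition hp hS I
  set T := (𝒰.chart I).target
  have hT : IsOpen T := (𝒰.chart I).open_target
  have c0 : Continuous fun y : ℂ × (Fin n → ℝ) => Ψ y (H₀ y) :=
    continuous_of_eq_zero_off hT hK.isClosed hKT (hΨ.clm_apply h1.continuousOn)
      fun w hw u => by rw [h0 w hw]; rfl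
  have cs : ∀ s, Continuous fun y : ℂ × (Fin n → ℝ) => Ψ y (H s y) := fun s =>
    continuous_of_eq_zero_off hT hK.isClosed hKT (hΨ.clm_apply (h2 s).continuous.continuousOn)
      fun w hw u => by rw [h0 w hw]; rfl
  have z0 : ∀ w ∉ K, ∀ u, Ψ (w, u) (H₀ (w, u)) = 0 := fun w hw u => by rw [h0 w hw]; rfl
  have zs : ∀ s, ∀ w ∉ K, ∀ u, Ψ (w, u) (H s (w, u)) = 0 := fun s w hw u => by rw [h0 w hw]; rfl
  have hsect : ∀ u : Fin n → ℝ, Continuous fun w : ℂ => (w, u) := fun u => by fun_prop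
  have hint0 : ∀ u, Integrable fun w => Ψ (w, u) (H₀ (w, u)) := fun u =>
    (c0.comp (hsect u)).integrable_of_hasCompactSupport (HasCompactSupport.intro hK fun w hw => z0 w hw u)
  have hints : ∀ s u, Integrable fun w => (w - s)⁻¹ • Ψ (w, u) (H s (w, u)) := fun s u =>
    integrable_inv_smul ((cs s).comp (hsect u)) (HasCompactSupport.intro hK fun w hw => zs s w hw u) s
  have key : ∀ u, ∫ w in T, Ψ (w, u) (f I ((𝒰.chart I).symm w) u) =
      (∫ w in K, Ψ (w, u) (H₀ (w, u))) +
        ∑ s ∈ 𝒰.coords hS I, ∫ w, (w - s)⁻¹ • Ψ (w, u) (H s (w, u)) := by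
    intro u
    rw [setIntegral_eq_integral_of_forall_compl_eq_zero (fun w hw => z0 w hw u),
      ← integral_finsetSum _ fun s _ => hints s u,
      ← integral_add (hint0 u) (integrable_finsetSum _ fun s _ => hints s u)]
    have e : ∫ w, (Ψ (w, u) (H₀ (w, u)) + ∑ s ∈ 𝒰.coords hS I, (w - s)⁻¹ • Ψ (w, u) (H s (w, u))) =
        ∫ w in T, (Ψ (w, u) (H₀ (w, u)) +
          ∑ s ∈ 𝒰.coords hS I, (w - s)⁻¹ • Ψ (w, u) (H s (w, u))) := by
      refine (setIntegral_eq_integral_of_forall_compl_eq_zero fun w hw => ?_).symm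
      have hwK : w ∉ K := fun h => hw (hKT h)
      rw [z0 w hwK, Finset.sum_eq_zero fun s _ => by rw [zs s w hwK, smul_zero], add_zero]
    rw [e]
    refine integral_congr_ae ?_
    filter_upwards [ae_notMem_finite (T := T) (𝒰.coords hS I).finite_toSet,
      ae_restrict_mem hT.measurableSet] with w hwS hwT
    rw [h3 w hwT (by rwa [← HolAtlas.mem_coords_iff hwT (hS := hS)]), map_add, map_sum]
    simp only [map_smul]
  simp only [key]
  refine Continuous.add ?_ (continuous_finsetSum _ fun s _ =>
    continuous_integral_inv_smul (cs s) hK (zs s) s)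
  exact continuous_parametric_integral_of_continuous (μ := (volume : Measure ℂ))
    (f := fun u w => Ψ (w, u) (H₀ (w, u))) (c0.comp (by fun_prop)) hK

end ParametricPairings

end MixedBF

namespace MixedBF

section Distributions

variable {C ι E G : Type*} [TopologicalSpace C] [T2Space C] [ChartedSpace ℂ C]
  [IsManifold 𝓘(ℂ) ω C]
  [NormedAddCommGroup E] [NormedSpace ℂ E] [FiniteDimensional ℂ E]
  [TopologicalSpace G] [ChartedSpace E G] [Group G] [LieGroup 𝓘(ℂ, E) ω G]
  {n N : ℕ} {Pb : PBundle C ι E G} {D : Defects C E G n N} {F : Fields C ι E G n N}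
  {I J : ι} {x : C} {u v : Fin n → ℝ}

open Classical in
theorem HolAtlas.sum_coords {𝒰 : HolAtlas C ι} {S : Set C} (hS : S.Finite) (I : ι)
    (g : ℂ → C → ℂ) : ∑ s ∈ 𝒰.coords hS I, g s ((𝒰.chart I).symm s) =
      ∑ s ∈ hS.toFinset, if s ∈ (𝒰.chart I).source then g (𝒰.chart I s) s else 0 := by
  rw [← Finset.sum_filter]
  symm
  refine Finset.sum_bij (fun s _ => 𝒰.chart I s) ?_ ?_ ?_ ?_
  · intro s hs
    rw [Finset.mem_filter, hS.mem_toFinset] at hs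
    exact HolAtlas.mem_coords.2 ⟨s, hs.1, hs.2, rfl⟩
  · intro s hs s' hs' h
    rw [Finset.mem_filter] at hs hs'
    exact (𝒰.chart I).injOn hs.2 hs'.2 h
  · intro w hw
    obtain ⟨s, hs, hsI, rfl⟩ := HolAtlas.mem_coords.1 hw
    exact ⟨s, by rw [Finset.mem_filter, hS.mem_toFinset]; exact ⟨hs, hsI⟩, rfl⟩
  · intro s hs
    rw [Finset.mem_filter] at hs
    rw [(𝒰.chart I).left_inv hs.2]

namespace Fields.Admissible

variable (hF : F.Admissible Pb D)
include hF

open Classical in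
theorem curvatureDist_eq {ψ : ℂ → StrongDual ℂ E} (hψ : IsTest (Pb.chart I).target ψ)
    (u v : Fin n → ℝ) : F.curvatureDist Pb.toHolAtlas I u v ψ =
      (∫ w in (Pb.chart I).target, (-2 * Complex.I) *
        ψ w (F.curvature Pb.toHolAtlas u v I ((Pb.chart I).symm w))) -
      2 * Real.pi * Complex.I * ∑ s ∈ (finite_range D.q).toFinset,
        if s ∈ (Pb.chart I).source then
          ψ (Pb.chart I s) (residue Pb.toHolAtlas I s fun x => F.gaugeAt I x u v) else 0 := by
  have hq := finite_range D.q
  have hsm := hF.gaugeAt_smooth (V := fun _ => v) contDiff_const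
  have hp := hF.gaugeAt_poles (V := fun _ => v) contDiff_const
  have hT := (Pb.chart I).open_target
  obtain ⟨H₀, H, h1, h2, h3⟩ := hsm.exists_decomposition hp hq I
  have hfin := Pb.toHolAtlas.finite_preimage hq I
  have hP := integral_dbar_of_decomposition (S := Pb.toHolAtlas.coords hq I)
    (f := fun w => F.gaugeAt I ((Pb.chart I).symm w) u v) (H₀ := fun w => H₀ (w, u))
    (H := fun s w => H s (w, u)) hT hψ
    (h1.comp (contDiff_id.prodMk contDiff_const).contDiffOn fun w hw => ⟨hw, trivial⟩)
    (fun s => (h2 s).comp (contDiff_id.prodMk contDiff_const))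
    (fun w hw hwS => h3 w hw (by rwa [← HolAtlas.mem_coords_iff hw (hS := hq)]) u)
  have hsum : ∑ s ∈ Pb.toHolAtlas.coords hq I, ψ s (H s (s, u)) =
      ∑ s ∈ hq.toFinset, if s ∈ (Pb.chart I).source then
          ψ (Pb.chart I s) (residue Pb.toHolAtlas I s fun x => F.gaugeAt I x u v) else 0 := by
    rw [HolAtlas.sum_coords hq I (fun s _ => ψ s (H s (s, u)))]
    refine Finset.sum_congr rfl fun s hs => ?_
    split_ifs with hsI
    · have h4 : residue Pb.toHolAtlas I s (fun x => F.gaugeAt I x u v) =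
          H (Pb.chart I s) (Pb.chart I s, u) :=
        residue_eq_of_decomposition (f := fun I x u => F.gaugeAt I x u v) h1 h2 h3
          (hq.mem_toFinset.1 hs) hsI u
      rw [h4]
    · rfl
  rw [← hsum]
  have hψc : ContinuousOn ψ (Pb.chart I).target := hψ.smooth.continuous.continuousOn
  have i1 := (hF.curvature_mild u v I).integrableOn_apply hT hfin hψc hψ.compact hψ.supp
    fun w hw => image_eq_zero_of_notMem_tsupport hw
  have i2 := (hF.dbar_gaugeAt_mild u v I).integrableOn_apply hT hfin hψc hψ.compact hψ.supp
    fun w hw => image_eq_zero_of_notMem_tsupport hw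
  have i3 := (hF.gaugeAt_mild u v I).integrableOn_apply hT hfin
    (L := dbar ψ) hψ.contDiff_dbar.continuous.continuousOn hψ.compact hψ.supp
    fun w hw => dbar_eq_zero_of_notMem_tsupport hw
  have hdb : ∀ w ∈ (Pb.chart I).target, (Pb.chart I).symm w ∉ range D.q →
      dbar (fun z => ψ z (F.gaugeAt I ((Pb.chart I).symm z) u v)) w =
      dbar ψ w (F.gaugeAt I ((Pb.chart I).symm w) u v) +
      ψ w (dbar (fun z => F.gaugeAt I ((Pb.chart I).symm z) u v) w) := by
    intro w hw hwq
    refine dbar_clm_apply (hψ.smooth.differentiable (by simp) w) ?_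
    have h := hsm.contDiffAt_point hq.isClosed ((Pb.chart I).map_target hw) hwq u
    rw [(Pb.chart I).right_inv hw] at h
    exact h.differentiableAt (by simp)
  have e1 : F.curvatureDist Pb.toHolAtlas I u v ψ = ∫ w in (Pb.chart I).target,
      ((-2 * Complex.I) * ψ w (F.curvature Pb.toHolAtlas u v I ((Pb.chart I).symm w)) -
      (-2 * Complex.I) * dbar (fun z => ψ z (F.gaugeAt I ((Pb.chart I).symm z) u v)) w) := by
    refine integral_congr_ae ?_
    filter_upwards [ae_notMem_finite hfin, ae_restrict_mem hT.measurableSet] with w hwS hw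
    rw [hdb w hw fun h => hwS ⟨hw, h⟩, curvature, (Pb.chart I).right_inv hw, map_add,
      map_add, map_sub, map_neg]
    ring
  have i4 : IntegrableOn (fun w => (-2 * Complex.I) *
      dbar (fun z => ψ z (F.gaugeAt I ((Pb.chart I).symm z) u v)) w) (Pb.chart I).target := by
    refine Integrable.const_mul ?_ _
    refine (i3.add i2).congr ?_
    filter_upwards [ae_notMem_finite hfin, ae_restrict_mem hT.measurableSet] with w hwS hw
    exact (hdb w hw fun h => hwS ⟨hw, h⟩).symm
  rw [e1, integral_sub (i1.const_mul _) i4, integral_const_mul (-2 * Complex.I)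
    (dbar fun z => ψ z (F.gaugeAt I ((Pb.chart I).symm z) u v)), hP]
  ring

/-- The residues of the gauge field in two charts. -/
theorem residue_trans (hs : x ∈ range D.q) (hI : x ∈ (Pb.chart I).source)
    (hJ : x ∈ (Pb.chart J).source) (u v : Fin n → ℝ) :
    residue Pb.toHolAtlas I x (fun y => F.gaugeAt I y u v) = Pb.jac J I x • Ad (Pb.g I J x)
      (residue Pb.toHolAtlas J x fun y => F.gaugeAt J y u v) := by
  have hp := hF.gaugeAt_poles (V := fun _ => v) contDiff_const
  refine residue_eq_of_tendsto hI ?_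
  have h1 := hp.tendsto_residue hs hJ u
  have h2 : Tendsto (fun y => (Ad (Pb.g I J y) : E →L[ℂ] E)) (𝓝[≠] x) (𝓝 (Ad (Pb.g I J x))) := by
    have h3 := ((Pb.contDiffOn_Ad I J).contDiffAt ((Pb.toHolAtlas.isOpen_overlap I J).mem_nhds
      (Pb.toHolAtlas.chart_mem_overlap hI hJ))).continuousAt
    have h4 : ContinuousAt (fun y => (Ad (Pb.g I J ((Pb.chart I).symm (Pb.chart I y))) : E →L[ℂ] E))
        x := ContinuousAt.comp (g := fun w => (Ad (Pb.g I J ((Pb.chart I).symm w)) : E →L[ℂ] E)) h3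
        ((Pb.chart I).continuousAt hI)
    have h5 := h4.tendsto.mono_left (nhdsWithin_le_nhds (s := {x}ᶜ))
    rw [(Pb.chart I).left_inv hI] at h5
    refine h5.congr' ?_
    filter_upwards [nhdsWithin_le_nhds ((Pb.chart I).open_source.mem_nhds hI)] with y hy
    rw [(Pb.chart I).left_inv hy]
  have h3 : Tendsto (fun y => (Pb.chart J y - Pb.chart J x)⁻¹ * (Pb.chart I y - Pb.chart I x))
      (𝓝[≠] x) (𝓝 (Pb.jac J I x)) := by
    have h4 := (hasDerivAt_iff_tendsto_slope.1
      (Pb.toHolAtlas.hasDerivAt_trans_chart hJ hI)).comp (HolAtlas.tendsto_chart hJ)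
    refine h4.congr' ?_
    filter_upwards [nhdsWithin_le_nhds ((Pb.chart J).open_source.mem_nhds hJ)] with y hy
    simp [slope, Pb.toHolAtlas.trans_chart hy, Pb.toHolAtlas.trans_chart hJ]
  have h23 : Tendsto (fun y => (Ad (Pb.g I J y) : E →L[ℂ] E)
      ((Pb.chart J y - Pb.chart J x) • F.gaugeAt J y u v)) (𝓝[≠] x) (𝓝 (Ad (Pb.g I J x)
      (residue Pb.toHolAtlas J x fun y => F.gaugeAt J y u v))) := by
    have h4 : Continuous fun y : (E →L[ℂ] E) × E => y.1 y.2 :=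
      isBoundedBilinearMap_apply.continuous
    exact (h4.tendsto _).comp (h2.prodMk_nhds h1)
  refine (h3.smul h23).congr' ?_
  have hq : ∀ᶠ y in 𝓝[≠] x, y ∉ range D.q := by
    have h4 : (range D.q \ {x})ᶜ ∈ 𝓝 x :=
      ((finite_range D.q).subset sdiff_subset).isClosed.isOpen_compl.mem_nhds (by simp)
    filter_upwards [nhdsWithin_le_nhds h4, self_mem_nhdsWithin] with y hy hyx hcon
    exact hy ⟨hcon, hyx⟩
  filter_upwards [hq, nhdsWithin_le_nhds ((Pb.chart J).open_source.mem_nhds hJ),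
    nhdsWithin_le_nhds ((Pb.chart I).open_source.mem_nhds hI), self_mem_nhdsWithin,
    (HolAtlas.tendsto_chart hJ).eventually self_mem_nhdsWithin] with y hyq hyJ hyI hyx hne
  rw [map_smul, smul_smul, hF.gaugeAt_trans hyI hyJ hyq]
  congr 1
  have h5 : Pb.chart J y - Pb.chart J x ≠ 0 := sub_ne_zero.2 hne
  field_simp

theorem lagrangian_smul (ρ : PartitionOfUnity ι C) (u v : Fin n → ℝ) (c : ℝ) :
    F.lagrangian Pb.toHolAtlas ρ D u (c • v) = c * F.lagrangian Pb.toHolAtlas ρ D u v := by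
  have hg : ∀ I x, F.gaugeAt I x u (c • v) = (c : ℂ) • F.gaugeAt I x u v := fun I x => by
    rw [gaugeAt_smul, Complex.coe_smul]
  have hcurv : ∀ I x, F.curvature Pb.toHolAtlas u (c • v) I x =
      (c : ℂ) • F.curvature Pb.toHolAtlas u v I x := fun I x => by
    have h1 : dbar (fun w => F.gaugeAt I ((Pb.chart I).symm w) u (c • v)) (Pb.chart I x) =
        (c : ℂ) • dbar (fun w => F.gaugeAt I ((Pb.chart I).symm w) u v) (Pb.chart I x) := by
      rw [← dbar_const_smul]
      simp only [hg]
    rw [curvature, curvature, h1, hg, ← adL_apply, ← adL_apply, map_smul, map_smul, smul_add,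
      smul_sub, Complex.coe_smul c (fderiv ℝ (F.A I x) u v)]
  have h1 : F.bfTerm Pb.toHolAtlas ρ D u (c • v) = c * F.bfTerm Pb.toHolAtlas ρ D u v := by
    have hS : surfaceIntegral Pb.toHolAtlas ρ
        (fun I x => F.B I x u (F.curvature Pb.toHolAtlas u (c • v) I x)) =
        c * surfaceIntegral Pb.toHolAtlas ρ
        (fun I x => F.B I x u (F.curvature Pb.toHolAtlas u v I x)) := by
      rw [surfaceIntegral, surfaceIntegral, mul_finsum]
      refine finsum_congr fun I => ?_
      rw [← integral_const_mul]
      refine integral_congr_ae (Eventually.of_forall fun w => ?_)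
      simp only [hcurv, map_smul, smul_eq_mul]
      ring
    have hR : ∀ s ∈ range D.q, residue Pb.toHolAtlas (Pb.idx s) s
        (fun x => F.gaugeAt (Pb.idx s) x u (c • v)) = (c : ℂ) • residue Pb.toHolAtlas (Pb.idx s) s
        (fun x => F.gaugeAt (Pb.idx s) x u v) := fun s hs => by
      refine residue_eq_of_tendsto (Pb.mem_idx s) ?_
      have h := ((hF.gaugeAt_poles (V := fun _ => v) contDiff_const).tendsto_residue hs
        (Pb.mem_idx s) u).const_smul (c : ℂ)
      refine h.congr fun x => ?_
      rw [hg, smul_comm]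
    have hfin : ∑ᶠ s ∈ range D.q, (-(2 * Real.pi * Complex.I)) * F.B (Pb.idx s) s u
        (residue Pb.toHolAtlas (Pb.idx s) s (fun x => F.gaugeAt (Pb.idx s) x u (c • v))) =
        c * ∑ᶠ s ∈ range D.q, (-(2 * Real.pi * Complex.I)) * F.B (Pb.idx s) s u
        (residue Pb.toHolAtlas (Pb.idx s) s (fun x => F.gaugeAt (Pb.idx s) x u v)) := by
      rw [finsum_mem_eq_finite_toFinset_sum _ (finite_range D.q),
        finsum_mem_eq_finite_toFinset_sum _ (finite_range D.q), Finset.mul_sum]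
      refine Finset.sum_congr rfl fun s hs => ?_
      rw [hR s ((finite_range D.q).mem_toFinset.1 hs), map_smul, smul_eq_mul]
      ring
    rw [bfTerm, bfTerm, hS, hfin]
    ring
  have h2 : F.orbitTerm Pb.toHolAtlas D u (c • v) = c * F.orbitTerm Pb.toHolAtlas D u v := by
    rw [orbitTerm, orbitTerm, Finset.mul_sum]
    refine Finset.sum_congr rfl fun α _ => ?_
    have h3 : (leftLogDeriv (F.φ α (Pb.idx (D.p α))) u (c • v) : E) =
        (c : ℂ) • leftLogDeriv (F.φ α (Pb.idx (D.p α))) u v := by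
      rw [← leftLogCLM_apply, ← leftLogCLM_apply, map_smul, Complex.coe_smul]
    rw [h3, hg, map_smul, ← smul_add, map_smul, smul_eq_mul]
  have h3 : ∑ i, F.H Pb.toHolAtlas D i u * ((fderiv ℝ F.t u (c • v) i : ℝ) : ℂ) =
      c * ∑ i, F.H Pb.toHolAtlas D i u * ((fderiv ℝ F.t u v i : ℝ) : ℂ) := by
    rw [Finset.mul_sum]
    refine Finset.sum_congr rfl fun i _ => ?_
    rw [map_smul, Pi.smul_apply, smul_eq_mul, Complex.ofReal_mul]
    ring
  rw [lagrangian, lagrangian, h1, h2, h3]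
  ring

end Fields.Admissible

end Distributions

end MixedBF

namespace MixedBF

section Lines

theorem exists_sum_mul_eq_one {n : ℕ} {v : Fin n → ℝ} (hv : v ≠ 0) :
    ∃ c : Fin n → ℝ, ∑ j, v j * c j = 1 := by
  obtain ⟨j, hj⟩ := Function.ne_iff.1 hv
  have hj' : v j ≠ 0 := hj
  refine ⟨Pi.single j (v j)⁻¹, ?_⟩
  simp [Pi.single_apply, hj']

/-- A test function on a line extends to the whole space. -/
theorem exists_extend_line {n : ℕ} (u₀ : Fin n → ℝ) {v : Fin n → ℝ} (hv : v ≠ 0) {g : ℝ → ℝ}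
    (hg : ContDiff ℝ ∞ g) (hgc : HasCompactSupport g) :
    ∃ χ : (Fin n → ℝ) → ℝ, ContDiff ℝ ∞ χ ∧ HasCompactSupport χ ∧
      (∀ τ : ℝ, χ (u₀ + τ • v) = g τ) ∧ ∀ τ : ℝ, fderiv ℝ χ (u₀ + τ • v) v = deriv g τ := by
  obtain ⟨c, hc⟩ := exists_sum_mul_eq_one hv
  obtain ⟨b, hb, hbc, -, hb1⟩ := exists_bump (X := Fin n → ℝ) (s := 0) univ_mem
  let ℓ : (Fin n → ℝ) → ℝ := fun u => ∑ j, (u - u₀) j * c j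
  have hℓ : ContDiff ℝ ∞ ℓ := ContDiff.sum fun j _ =>
    ((contDiff_pi.1 (contDiff_id.sub contDiff_const) j).mul contDiff_const)
  have hℓv : ∀ τ : ℝ, ℓ (u₀ + τ • v) = τ := fun τ => by
    simp only [ℓ, add_sub_cancel_left, Pi.smul_apply, smul_eq_mul, mul_assoc, ← Finset.mul_sum, hc,
      mul_one]
  have hχ : ContDiff ℝ ∞ fun u => g (ℓ u) * b (u - u₀ - ℓ u • v) :=
    (hg.comp hℓ).mul (hb.comp ((contDiff_id.sub contDiff_const).sub (hℓ.smul contDiff_const)))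
  have hval : ∀ τ : ℝ, g (ℓ (u₀ + τ • v)) * b (u₀ + τ • v - u₀ - ℓ (u₀ + τ • v) • v) = g τ := by
    intro τ
    rw [hℓv, add_sub_cancel_left, sub_self, hb1.self_of_nhds, Pi.one_apply, mul_one]
  refine ⟨_, hχ, ?_, hval, fun τ => ?_⟩
  · refine HasCompactSupport.intro ((hgc.isCompact.prod hbc.isCompact).image
      (f := fun y : ℝ × (Fin n → ℝ) => u₀ + y.1 • v + y.2) (by fun_prop)) fun u hu => ?_
    by_contra hne
    refine hu ⟨(ℓ u, u - u₀ - ℓ u • v), ⟨subset_tsupport _ (left_ne_zero_of_mul hne),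
      subset_tsupport _ (right_ne_zero_of_mul hne)⟩, ?_⟩
    simp only
    abel
  · have h1 : HasDerivAt (fun τ : ℝ => u₀ + τ • v) v τ := by
      simpa using ((hasDerivAt_id τ).smul_const v).const_add u₀
    have h2 := ((hχ.differentiable (by simp)) (u₀ + τ • v)).hasFDerivAt.comp_hasDerivAt τ h1
    rw [← h2.deriv]
    congr 1
    ext τ
    exact hval τ

theorem hasDerivAt_comp_line {n : ℕ} {V : Type*} [NormedAddCommGroup V] [NormedSpace ℝ V]
    {f : (Fin n → ℝ) → V} (hf : Differentiable ℝ f) (u₀ v : Fin n → ℝ) (τ : ℝ) :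
    HasDerivAt (fun τ : ℝ => f (u₀ + τ • v)) (fderiv ℝ f (u₀ + τ • v) v) τ := by
  have h1 : HasDerivAt (fun τ : ℝ => u₀ + τ • v) v τ := by
    simpa using ((hasDerivAt_id τ).smul_const v).const_add u₀
  exact (hf (u₀ + τ • v)).hasFDerivAt.comp_hasDerivAt τ h1

/-- The fundamental lemma of the calculus of variations, with one integration by parts. -/
theorem add_eq_zero_of_integral_test {m m' k : ℝ → ℂ} (hm : ∀ τ, HasDerivAt m (m' τ) τ)
    (hm' : Continuous m') (hk : Continuous k)
    (h : ∀ g : ℝ → ℝ, ContDiff ℝ ∞ g → HasCompactSupport g →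
      ∫ τ, (deriv g τ • m τ - g τ • k τ) = 0) (τ : ℝ) : m' τ + k τ = 0 := by
  refine eq_zero_of_integral_test (f := fun τ => m' τ + k τ) (hm'.add hk) (fun g hg hgc => ?_) τ
  have hmc : Continuous m := continuous_iff_continuousAt.2 fun τ => (hm τ).continuousAt
  have hg' : Continuous (deriv g) := hg.continuous_deriv (by simp)
  have i1 : Integrable fun τ => deriv g τ • m τ :=
    (hg'.smul hmc).integrable_of_hasCompactSupport (hgc.deriv.smul_right)
  have i2 : Integrable fun τ => g τ • k τ :=
    (hg.continuous.smul hk).integrable_of_hasCompactSupport hgc.smul_right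
  have i3 : Integrable fun τ => g τ • m' τ :=
    (hg.continuous.smul hm').integrable_of_hasCompactSupport hgc.smul_right
  have i4 : Integrable fun τ => g τ • m τ :=
    (hg.continuous.smul hmc).integrable_of_hasCompactSupport hgc.smul_right
  have h1 : ∫ τ, g τ • m' τ = -∫ τ, deriv g τ • m τ := by
    have h2 := integral_bilinear_hasDerivAt_right_eq_neg_left_of_integrable
      (L := ContinuousLinearMap.lsmul ℝ ℝ) (u := g) (v := m) (u' := deriv g) (v' := m')
      (fun τ _ => ((hg.differentiable (by simp)) τ).hasDerivAt) (fun τ _ => hm τ) i3 i1 i4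
    simpa using h2
  have h2 := h g hg hgc
  rw [integral_sub i1 i2] at h2
  simp only [smul_add]
  rw [integral_add i3 i2, h1]
  linear_combination -h2

end Lines

section FirstVariation

variable {C ι E G : Type*} [TopologicalSpace C] [T2Space C] [ChartedSpace ℂ C]
  [IsManifold 𝓘(ℂ) ω C]
  [NormedAddCommGroup E] [NormedSpace ℂ E] [FiniteDimensional ℂ E]
  [TopologicalSpace G] [ChartedSpace E G] [Group G] [LieGroup 𝓘(ℂ, E) ω G]
  {n N : ℕ} {Pb : PBundle C ι E G} {ρ : PartitionOfUnity ι C}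
  {D : Defects C E G n N} {F : Fields C ι E G n N}
  {I J : ι} {x : C} {u v : Fin n → ℝ} {δ : Variation C ι E G n N}

theorem Variation.Admissible.vary (hδ : δ.Admissible Pb D F) (hF : F.Admissible Pb D) (ε : ℝ) :
    (F.vary δ ε).Admissible Pb D where
  B_smooth := hF.B_smooth.add ((hδ.δB_smooth.mono (empty_subset _)).const_smul ε)
  B_poles := hF.B_poles.add (hδ.δB_smooth.const_smul ε).simplePoles
  B_trans I J x hI hJ hx u := by
    simp only [Fields.vary]
    rw [hF.B_trans I J x hI hJ hx, hδ.δB_trans I J x hI hJ, coAd_add, smul_add, smul_comm ε,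
      ← Complex.coe_smul ε (coAd (Pb.g I J x) _), ← Complex.coe_smul ε (δ.δB J x u), coAd_smul]
  A_smooth := hF.A_smooth.add (hδ.δA_smooth.const_smul ε)
  A_trans I J x hI hJ u := by
    simp only [Fields.vary]
    rw [hF.A_trans I J x hI hJ, hδ.δA_trans I J x hI hJ, map_add, smul_add, smul_comm ε,
      ← Complex.coe_smul ε, ← Complex.coe_smul ε, map_smul]
    abel
  gauge_smooth := by
    have h1 : SmoothOff Pb.toHolAtlas (range D.q) (fun I x u => ε • δ.δgauge I x u) :=
      (hδ.δgauge_smooth.mono (empty_subset _)).const_smul ε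
    exact hF.gauge_smooth.add h1
  gauge_poles := hF.gauge_poles.add (hδ.δgauge_smooth.const_smul ε).simplePoles
  gauge_trans I J x hI hJ hx u j := by
    simp only [Fields.vary, Pi.add_apply, Pi.smul_apply]
    rw [hF.gauge_trans I J x hI hJ hx, hδ.δgauge_trans I J x hI hJ, map_add,
      ← Complex.coe_smul ε, ← Complex.coe_smul ε, map_smul]
  φ_smooth α I hI := by
    have h1 : ContMDiff 𝓘(ℝ, Fin n → ℝ) 𝓘(ℝ, ℝ × (Fin n → ℝ)) ∞ (fun u : Fin n → ℝ => (ε, u)) :=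
      (contDiff_const.prodMk contDiff_id).contMDiff
    exact (hδ.Φ_smooth α I hI).comp h1
  φ_trans α I J hI hJ u := hδ.Φ_trans α I J hI hJ ε u
  t_smooth := hF.t_smooth.add (hδ.δt_smooth.const_smul ε)

theorem isCurve_tan (u₀ : Fin n → ℝ) (hv : v ≠ 0) :
    IsCurve fun s => u₀ + Real.tan (Real.pi * (s - 1 / 2)) • v := by
  have hπ := Real.pi_pos
  have hnv : 0 < ‖v‖ := norm_pos_iff.2 hv
  have hcos : ∀ s ∈ Ioo (0 : ℝ) 1, Real.cos (Real.pi * (s - 1 / 2)) ≠ 0 := fun s hs =>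
    (Real.cos_pos_of_mem_Ioo ⟨by nlinarith [hs.1], by nlinarith [hs.2]⟩).ne'
  have hlim : ∀ l : Filter ℝ, Tendsto (fun s => ‖Real.tan (Real.pi * (s - 1 / 2))‖) l atTop →
      Tendsto (fun s => ‖u₀ + Real.tan (Real.pi * (s - 1 / 2)) • v‖) l atTop := by
    intro l hl
    refine tendsto_atTop_mono (fun s => ?_)
      ((tendsto_atTop_add_const_left l (-‖u₀‖) (hl.atTop_mul_const hnv)))
    rw [← norm_smul]
    have := norm_sub_norm_le (Real.tan (Real.pi * (s - 1 / 2)) • v) (-u₀)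
    rw [norm_neg, sub_neg_eq_add, add_comm _ u₀] at this
    linarith
  refine ⟨fun s hs => ?_, hlim _ ?_, hlim _ ?_⟩
  · have h1 : ContDiffAt ℝ ∞ Real.tan (Real.pi * (s - 1 / 2)) :=
      Real.contDiffAt_tan.2 (hcos s hs)
    have h2 : ContDiffAt ℝ ∞ (fun s : ℝ => Real.pi * (s - 1 / 2)) s :=
      contDiffAt_const.mul (contDiffAt_id.sub contDiffAt_const)
    exact (contDiffAt_const.add ((ContDiffAt.comp s h1 h2).smul
      (contDiffAt_const (c := v)))).contDiffWithinAt
  · refine tendsto_abs_atBot_atTop.comp (Real.tendsto_tan_neg_pi_div_two.comp ?_)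
    refine tendsto_nhdsWithin_iff.2 ⟨?_, ?_⟩
    · have h1 : Continuous fun s : ℝ => Real.pi * (s - 1 / 2) := by fun_prop
      have h2 := h1.tendsto 0
      rw [show Real.pi * ((0 : ℝ) - 1 / 2) = -(Real.pi / 2) by ring] at h2
      exact h2.mono_left nhdsWithin_le_nhds
    · filter_upwards [self_mem_nhdsWithin] with s hs
      have hs' : 0 < s := hs
      change -(Real.pi / 2) < Real.pi * (s - 1 / 2)
      nlinarith
  · refine tendsto_abs_atTop_atTop.comp (Real.tendsto_tan_pi_div_two.comp ?_)
    refine tendsto_nhdsWithin_iff.2 ⟨?_, ?_⟩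
    · have h1 : Continuous fun s : ℝ => Real.pi * (s - 1 / 2) := by fun_prop
      have h2 := h1.tendsto 1
      rw [show Real.pi * ((1 : ℝ) - 1 / 2) = Real.pi / 2 by ring] at h2
      exact h2.mono_left nhdsWithin_le_nhds
    · filter_upwards [self_mem_nhdsWithin] with s hs
      have hs' : s < 1 := hs
      change Real.pi * (s - 1 / 2) < Real.pi / 2
      nlinarith

theorem integral_comp_tan (f : ℝ → ℂ) :
    ∫ s in Ioo (0 : ℝ) 1, (Real.pi / Real.cos (Real.pi * (s - 1 / 2)) ^ 2) •
      f (Real.tan (Real.pi * (s - 1 / 2))) = ∫ τ, f τ := by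
  have hπ := Real.pi_pos
  have hmem : ∀ s ∈ Ioo (0 : ℝ) 1, Real.pi * (s - 1 / 2) ∈ Ioo (-(Real.pi / 2)) (Real.pi / 2) :=
    fun s hs => ⟨by nlinarith [hs.1], by nlinarith [hs.2]⟩
  have h := integral_image_eq_integral_abs_deriv_smul (s := Ioo (0 : ℝ) 1)
    (f := fun s => Real.tan (Real.pi * (s - 1 / 2)))
    (f' := fun s => Real.pi / Real.cos (Real.pi * (s - 1 / 2)) ^ 2) measurableSet_Ioo
    (fun s hs => ?_) (fun s hs s' hs' hss => ?_) f
  · have himg : (fun s => Real.tan (Real.pi * (s - 1 / 2))) '' Ioo (0 : ℝ) 1 = univ := by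
      rw [eq_univ_iff_forall]
      intro y
      have hy : y ∈ Real.tan '' Ioo (-(Real.pi / 2)) (Real.pi / 2) := by
        rw [Real.image_tan_Ioo]; trivial
      obtain ⟨θ, hθ, rfl⟩ := hy
      refine ⟨θ / Real.pi + 1 / 2, ⟨?_, ?_⟩, ?_⟩
      · have : -(1 / 2) < θ / Real.pi := by
          rw [lt_div_iff₀ hπ]; linarith [hθ.1]
        linarith
      · have : θ / Real.pi < 1 / 2 := by
          rw [div_lt_iff₀ hπ]; linarith [hθ.2]
        linarith
      · simp only [add_sub_cancel_right]
        rw [mul_div_cancel₀ _ hπ.ne']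
    rw [himg, Measure.restrict_univ] at h
    rw [h]
    refine setIntegral_congr_fun measurableSet_Ioo fun s hs => ?_
    have hcos := Real.cos_pos_of_mem_Ioo (hmem s hs)
    rw [abs_of_pos (by positivity)]
  · have hcos := Real.cos_pos_of_mem_Ioo (hmem s hs)
    have h2 : HasDerivAt (fun s : ℝ => Real.pi * (s - 1 / 2)) Real.pi s :=
      (((hasDerivAt_id s).sub_const (1 / 2)).const_mul Real.pi).congr_deriv (mul_one _)
    have h1 := (Real.hasDerivAt_tan hcos.ne').comp s h2
    exact (h1.congr_deriv (by ring)).hasDerivWithinAt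
  · have := Real.injOn_tan (hmem s hs) (hmem s' hs') hss
    have h3 := mul_left_cancel₀ hπ.ne' this
    linarith

theorem deriv_tan_line (u₀ v : Fin n → ℝ) {s : ℝ} (hs : s ∈ Ioo (0 : ℝ) 1) :
    deriv (fun s => u₀ + Real.tan (Real.pi * (s - 1 / 2)) • v) s =
      (Real.pi / Real.cos (Real.pi * (s - 1 / 2)) ^ 2) • v := by
  have hπ := Real.pi_pos
  have hcos : 0 < Real.cos (Real.pi * (s - 1 / 2)) :=
    Real.cos_pos_of_mem_Ioo ⟨by nlinarith [hs.1], by nlinarith [hs.2]⟩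
  have h2 : HasDerivAt (fun s : ℝ => Real.pi * (s - 1 / 2)) Real.pi s :=
    (((hasDerivAt_id s).sub_const (1 / 2)).const_mul Real.pi).congr_deriv (mul_one _)
  have h1 := (Real.hasDerivAt_tan hcos.ne').comp s h2
  have h3 : HasDerivAt (fun s => Real.tan (Real.pi * (s - 1 / 2)))
    (Real.pi / Real.cos (Real.pi * (s - 1 / 2)) ^ 2) s := h1.congr_deriv (by ring)
  exact ((h3.smul_const v).const_add u₀).deriv

/-- The first variation along a line. -/
theorem Fields.Critical.hasDerivAt_line (hC : F.Critical Pb ρ D) (hF : F.Admissible Pb D)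
    (hδ : δ.Admissible Pb D F) (u₀ : Fin n → ℝ) (hv : v ≠ 0) :
    HasDerivAt (fun ε : ℝ => ∫ τ : ℝ,
      ((F.vary δ ε).lagrangian Pb.toHolAtlas ρ D (u₀ + τ • v) v
        - F.lagrangian Pb.toHolAtlas ρ D (u₀ + τ • v) v)) 0 0 := by
  refine (hC _ (isCurve_tan u₀ hv) δ hδ).congr_of_eventuallyEq (Eventually.of_forall fun ε => ?_)
  simp only
  rw [← integral_comp_tan]
  refine setIntegral_congr_fun measurableSet_Ioo fun s hs => ?_
  rw [deriv_tan_line u₀ v hs, (hδ.vary hF ε).lagrangian_smul, hF.lagrangian_smul, ← mul_sub,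
    Complex.real_smul]

/-- The first variation along a line, if the Lagrangian is divisible by the parameter. -/
theorem Fields.Critical.integral_eq_zero (hC : F.Critical Pb ρ D) (hF : F.Admissible Pb D)
    (hδ : δ.Admissible Pb D F) (u₀ : Fin n → ℝ) (hv : v ≠ 0) {a : ℝ → ℝ → ℂ}
    (ha : Continuous (Function.uncurry a)) {K : Set ℝ} (hK : IsCompact K)
    (h0 : ∀ ε, ∀ τ ∉ K, a ε τ = 0)
    (h : ∀ ε τ, (F.vary δ ε).lagrangian Pb.toHolAtlas ρ D (u₀ + τ • v) v
        - F.lagrangian Pb.toHolAtlas ρ D (u₀ + τ • v) v = ε • a ε τ) : ∫ τ, a 0 τ = 0 := by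
  have h1 := hC.hasDerivAt_line hF hδ u₀ hv
  simp only [h] at h1
  exact (hasDerivAt_integral_smul_of_compact ha hK h0).unique h1

theorem Fields.Critical.integral_deriv_eq_zero (hC : F.Critical Pb ρ D) (hF : F.Admissible Pb D)
    (hδ : δ.Admissible Pb D F) (u₀ : Fin n → ℝ) (hv : v ≠ 0) {a a' : ℝ → ℝ → ℂ}
    (ha : ∀ ε, Continuous (a ε)) (ha' : Continuous (Function.uncurry a'))
    (hd : ∀ ε τ, HasDerivAt (fun e => a e τ) (a' ε τ) ε) {K : Set ℝ} (hK : IsCompact K)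
    (h0 : ∀ ε, ∀ τ ∉ K, a ε τ = 0)
    (h : ∀ ε τ, (F.vary δ ε).lagrangian Pb.toHolAtlas ρ D (u₀ + τ • v) v
        - F.lagrangian Pb.toHolAtlas ρ D (u₀ + τ • v) v = a ε τ) : ∫ τ, a' 0 τ = 0 := by
  have h1 := hC.hasDerivAt_line hF hδ u₀ hv
  simp only [h] at h1
  exact (hasDerivAt_integral_of_compact ha ha' hd hK h0 0).unique h1

/-- The trivial variation. -/
def Fields.zeroVariation (F : Fields C ι E G n N) : Variation C ι E G n N where
  δB _ _ _ := 0
  δA _ _ _ := 0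
  δgauge _ _ _ := 0
  Φ α I _ u := F.φ α I u
  δt _ := 0

theorem Fields.Admissible.zeroVariation (hF : F.Admissible Pb D) :
    F.zeroVariation.Admissible Pb D F where
  δB_smooth _ := contDiffOn_const
  δB_trans I J x _ _ u := by
    have h : coAd (Pb.g I J x) (0 : StrongDual ℂ E) = 0 := map_zero (coAdL (Pb.g I J x))
    change (0 : StrongDual ℂ E) = Pb.jac I J x • coAd (Pb.g I J x) (0 : StrongDual ℂ E)
    rw [h]
    ext X
    exact (mul_zero (Pb.jac I J x)).symm
  δA_smooth _ := contDiffOn_const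
  δA_trans I J x _ _ u := by simp [Fields.zeroVariation]
  δgauge_smooth _ := contDiffOn_const
  δgauge_trans I J x _ _ u j := by simp [Fields.zeroVariation]
  Φ_smooth α I hI := (hF.φ_smooth α I hI).comp contDiff_snd.contMDiff
  Φ_trans α I J hI hJ _ u := hF.φ_trans α I J hI hJ u
  Φ_zero _ _ _ := rfl
  δt_smooth := contDiff_const
  compact_support := ⟨∅, isCompact_empty, fun _ _ =>
    ⟨fun _ _ => rfl, fun _ _ => rfl, fun _ _ => rfl, fun _ _ _ => rfl, rfl⟩⟩

end FirstVariation

end MixedBF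

namespace MixedBF

section Families

variable {C ι : Type*} [TopologicalSpace C] [ChartedSpace ℂ C] {n : ℕ}
  {V W : Type*} [NormedAddCommGroup V] [NormedSpace ℂ V] [NormedAddCommGroup W] [NormedSpace ℂ W]
  {𝒰 : HolAtlas C ι} {S : Set C} {I : ι}

theorem SmoothOff.clm_apply {L : ι → C → (Fin n → ℝ) → V →L[ℂ] W} {f : ι → C → (Fin n → ℝ) → V}
    (hL : SmoothOff 𝒰 S L) (hf : SmoothOff 𝒰 S f) : SmoothOff 𝒰 S (fun I x u => L I x u (f I x u)) := by
  intro I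
  have h1 : ContDiffOn ℝ ∞ (fun y : ℂ × (Fin n → ℝ) =>
      (L I ((𝒰.chart I).symm y.1) y.2).restrictScalars ℝ)
      (((𝒰.chart I).target ∩ (𝒰.chart I).symm ⁻¹' Sᶜ) ×ˢ univ) :=
    (ContinuousLinearMap.restrictScalarsL ℂ V W ℝ ℝ).contDiff.comp_contDiffOn (hL I)
  exact h1.clm_apply (hf I)

/-- The product of a family of functions with a cut-off function in the chart. -/
theorem SmoothOff.contDiff_smul {f : ι → C → (Fin n → ℝ) → V} (hf : SmoothOff 𝒰 S f)
    (hS : IsClosed S) {ψ : ℂ → ℝ} (hψ : ContDiff ℝ ∞ ψ)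
    (hs : tsupport ψ ⊆ (𝒰.chart I).target ∩ (𝒰.chart I).symm ⁻¹' Sᶜ) :
    ContDiff ℝ ∞ fun y : ℂ × (Fin n → ℝ) => ψ y.1 • f I ((𝒰.chart I).symm y.1) y.2 := by
  have ho : IsOpen (((𝒰.chart I).target ∩ (𝒰.chart I).symm ⁻¹' Sᶜ) ×ˢ
      (univ : Set (Fin n → ℝ))) :=
    ((𝒰.chart I).isOpen_inter_preimage_symm hS.isOpen_compl).prod isOpen_univ
  refine contDiff_smul_of_tsupport_subset (χ := fun y : ℂ × (Fin n → ℝ) => ψ y.1) ho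
    (hψ.comp contDiff_fst) (hf I) fun y hy => ⟨hs ?_, trivial⟩
  exact tsupport_comp_subset_preimage ψ continuous_fst hy

/-- Differentiation under the integral sign along a line of the multi-time space. -/
theorem hasDerivAt_integral_line {Φ : ℂ × (Fin n → ℝ) → ℂ} (hΦ : ContDiff ℝ ∞ Φ) {K : Set ℂ}
    (hK : IsCompact K) (h0 : ∀ w ∉ K, ∀ u, Φ (w, u) = 0) (u v : Fin n → ℝ) :
    (∀ τ : ℝ, HasDerivAt (fun τ : ℝ => ∫ w, Φ (w, u + τ • v))
      (∫ w, fderiv ℝ Φ (w, u + τ • v) (0, v)) τ) ∧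
    Continuous fun τ : ℝ => ∫ w, fderiv ℝ Φ (w, u + τ • v) (0, v) := by
  have hF' : Continuous (Function.uncurry fun (τ : ℝ) (w : ℂ) => fderiv ℝ Φ (w, u + τ • v) (0, v)) :=
    ((hΦ.continuous_fderiv (by simp)).comp (by fun_prop)).clm_apply continuous_const
  have hd : ∀ (τ : ℝ) (w : ℂ), HasDerivAt (fun τ : ℝ => Φ (w, u + τ • v))
      (fderiv ℝ Φ (w, u + τ • v) (0, v)) τ := fun τ w => by
    have h1 : HasDerivAt (fun τ : ℝ => (w, u + τ • v)) ((0 : ℂ), v) τ :=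
      (hasDerivAt_const τ w).prodMk (by simpa using ((hasDerivAt_id τ).smul_const v).const_add u)
    exact ((hΦ.differentiable (by simp)) _).hasFDerivAt.comp_hasDerivAt τ h1
  refine ⟨fun τ => hasDerivAt_integral_of_compact (F := fun τ w => Φ (w, u + τ • v))
    (fun τ => hΦ.continuous.comp (by fun_prop)) hF' hd hK (fun τ w hw => h0 w hw _) τ, ?_⟩
  have h1 : ∀ τ : ℝ, ∫ w in K, fderiv ℝ Φ (w, u + τ • v) (0, v) =
      ∫ w, fderiv ℝ Φ (w, u + τ • v) (0, v) := fun τ =>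
    setIntegral_eq_integral_of_forall_compl_eq_zero fun w hw => by
      have h2 := hd τ w
      simp only [h0 w hw] at h2
      exact h2.unique (hasDerivAt_const τ 0)
  have h2 := continuous_parametric_integral_of_continuous (μ := (volume : Measure ℂ)) hF' hK
  simpa only [h1] using h2

theorem continuous_integral_line {Φ : ℂ × (Fin n → ℝ) → ℂ} (hΦ : Continuous Φ) {K : Set ℂ}
    (hK : IsCompact K) (h0 : ∀ w ∉ K, ∀ u, Φ (w, u) = 0) (u v : Fin n → ℝ) :
    Continuous fun τ : ℝ => ∫ w, Φ (w, u + τ • v) := by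
  have hc : Continuous (Function.uncurry fun (τ : ℝ) (w : ℂ) => Φ (w, u + τ • v)) :=
    hΦ.comp (by fun_prop)
  have h1 : ∀ τ : ℝ, ∫ w in K, Φ (w, u + τ • v) = ∫ w, Φ (w, u + τ • v) := fun τ =>
    setIntegral_eq_integral_of_forall_compl_eq_zero fun w hw => h0 w hw _
  have h2 := continuous_parametric_integral_of_continuous (μ := (volume : Measure ℂ)) hc hK
  simpa only [h1] using h2

end Families

section EulerLagrange

variable {C ι E G : Type*} [TopologicalSpace C] [T2Space C] [CompactSpace C] [ChartedSpace ℂ C]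
  [IsManifold 𝓘(ℂ) ω C]
  [NormedAddCommGroup E] [NormedSpace ℂ E] [FiniteDimensional ℂ E]
  [TopologicalSpace G] [ChartedSpace E G] [Group G] [LieGroup 𝓘(ℂ, E) ω G]
  {n N : ℕ} {Pb : PBundle C ι E G} {ρ : PartitionOfUnity ι C}
  {D : Defects C E G n N} {F F' : Fields C ι E G n N}
  {I J : ι} {x : C} {u v : Fin n → ℝ}

theorem Defects.q_notMem (D : Defects C E G n N) (i : Fin n) : D.q i ∉ range D.p := by
  rintro ⟨α, hα⟩
  exact D.p_ne_q α i hα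

theorem Defects.p_notMem (D : Defects C E G n N) (α : Fin N) : D.p α ∉ range D.q := by
  rintro ⟨i, hi⟩
  exact D.p_ne_q α i hi.symm

theorem Fields.eq_of_components {F F' : Fields C ι E G n N} (hB : F.B = F'.B) (hA : F.A = F'.A)
    (hg : F.gauge = F'.gauge) (hφ : F.φ = F'.φ) (ht : F.t = F'.t) : F = F' := by
  cases F
  cases F'
  simp_all

theorem Fields.vary_B_eq {δ : Variation C ι E G n N} {ε : ℝ} (h : ∀ I x u, δ.δB I x u = 0) :
    (F.vary δ ε).B = F.B := by
  funext I x u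
  ext X
  change F.B I x u X + ε • δ.δB I x u X = F.B I x u X
  rw [h, zero_apply, smul_zero, add_zero]

theorem Fields.vary_A_eq {δ : Variation C ι E G n N} {ε : ℝ} (h : ∀ I x u, δ.δA I x u = 0) :
    (F.vary δ ε).A = F.A := by
  funext I x u
  change F.A I x u + ε • δ.δA I x u = F.A I x u
  rw [h, smul_zero, add_zero]

theorem Fields.vary_gauge_eq {δ : Variation C ι E G n N} {ε : ℝ}
    (h : ∀ I x u, δ.δgauge I x u = 0) : (F.vary δ ε).gauge = F.gauge := by
  funext I x u
  change F.gauge I x u + ε • δ.δgauge I x u = F.gauge I x u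
  rw [h, smul_zero, add_zero]

theorem Fields.vary_t_eq {δ : Variation C ι E G n N} {ε : ℝ} (h : ∀ u, δ.δt u = 0) :
    (F.vary δ ε).t = F.t := by
  funext u
  change F.t u + ε • δ.δt u = F.t u
  rw [h, smul_zero, add_zero]

theorem Fields.Admissible.contDiff_H (hF : F.Admissible Pb D) (i : Fin n) :
    ContDiff ℝ ∞ (F.H Pb.toHolAtlas D i) := by
  have h1 : ContDiff ℝ ∞ (fun φ : StrongDual ℂ E => polyEval (D.P i) φ) :=
    ((contDiff_polyEval (D.P i)).restrict_scalars ℝ).of_le le_top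
  exact contDiff_const.mul (h1.comp (hF.B_smooth.contDiff_time (finite_range D.p).isClosed
    (Pb.mem_idx (D.q i)) (D.q_notMem i)))

/-- The difference of the surface terms for fields that differ only in a chart. -/
theorem Fields.Admissible.surfaceIntegral_pairing_sub
    (hρ : ρ.IsSubordinate (fun I => (Pb.chart I).source)) (hF : F.Admissible Pb D)
    (hF' : F'.Admissible Pb D) {Z : Set C} (hZ : IsCompact Z) (hZJ : Z ⊆ (Pb.chart J).source)
    (h0 : ∀ I x, x ∈ (Pb.chart I).source → x ∉ range D.p ∪ range D.q → x ∉ Z →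
      F'.B I x u (F'.curvature Pb.toHolAtlas u v I x) =
        F.B I x u (F.curvature Pb.toHolAtlas u v I x)) :
    surfaceIntegral Pb.toHolAtlas ρ (fun I x => F'.B I x u (F'.curvature Pb.toHolAtlas u v I x)) -
      surfaceIntegral Pb.toHolAtlas ρ (fun I x => F.B I x u (F.curvature Pb.toHolAtlas u v I x)) =
      ∫ w in (Pb.chart J).target, (-2 * Complex.I) *
        (F'.B J ((Pb.chart J).symm w) u (F'.curvature Pb.toHolAtlas u v J ((Pb.chart J).symm w)) -
        F.B J ((Pb.chart J).symm w) u (F.curvature Pb.toHolAtlas u v J ((Pb.chart J).symm w))) := by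
  refine surfaceIntegral_sub hρ ((finite_range D.p).union (finite_range D.q)) (hF.pairing_sing u v)
    (hF'.pairing_sing u v) hZ hZJ h0 fun I x hI hJ hx => ?_
  rw [hF'.pairing_trans hJ hI hx, hF.pairing_trans hJ hI hx, ← smul_sub]

theorem Fields.Critical.conservation (hC : F.Critical Pb ρ D) (hF : F.Admissible Pb D)
    (hv : v ≠ 0) (u : Fin n → ℝ) (i : Fin n) : fderiv ℝ (F.H Pb.toHolAtlas D i) u v = 0 := by
  have hH := hF.contDiff_H i
  have h := add_eq_zero_of_integral_test (k := fun _ => 0)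
    (hasDerivAt_comp_line (hH.differentiable (by simp)) u v)
    (((hH.continuous_fderiv (by simp)).comp (by fun_prop)).clm_apply continuous_const)
    continuous_const (fun g hg hgc => ?_) 0
  · simpa using h
  obtain ⟨χ, hχ, hχc, h1, h2⟩ := exists_extend_line u hv hg hgc
  let δ : Variation C ι E G n N :=
    { F.zeroVariation with δt := fun u => χ u • Pi.single i (1 : ℝ) }
  have hz := hF.zeroVariation
  have hδ : δ.Admissible Pb D F :=
    { δB_smooth := hz.δB_smooth
      δB_trans := hz.δB_trans
      δA_smooth := hz.δA_smooth
      δA_trans := hz.δA_trans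
      δgauge_smooth := hz.δgauge_smooth
      δgauge_trans := hz.δgauge_trans
      Φ_smooth := hz.Φ_smooth
      Φ_trans := hz.Φ_trans
      Φ_zero := hz.Φ_zero
      δt_smooth := hχ.smul contDiff_const
      compact_support := ⟨tsupport χ, hχc, fun u hu => ⟨fun _ _ => rfl, fun _ _ => rfl,
        fun _ _ => rfl, fun _ _ _ => rfl, by
          simp only [δ, image_eq_zero_of_notMem_tsupport hu, zero_smul]⟩⟩ }
  have h3 := hC.integral_eq_zero hF hδ u hv
    (a := fun _ τ => -(deriv g τ • F.H Pb.toHolAtlas D i (u + τ • v))) (K := tsupport g) ?_ hgc ?_ ?_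
  · simp only [integral_neg, neg_eq_zero] at h3
    simpa using h3
  · have : Continuous fun τ => -(deriv g τ • F.H Pb.toHolAtlas D i (u + τ • v)) :=
      ((hg.continuous_deriv (by simp)).smul (hH.continuous.comp (by fun_prop))).neg
    exact this.comp continuous_snd
  · intro _ τ hτ
    have : deriv g τ = 0 := by
      by_contra hne
      exact hτ (support_deriv_subset hne)
    simp [this]
  · intro ε τ
    have hv' : F.vary δ ε = { F with t := fun u => F.t u + ε • χ u • Pi.single i (1 : ℝ) } :=
      eq_of_components (vary_B_eq fun _ _ _ => rfl) (vary_A_eq fun _ _ _ => rfl)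
        (vary_gauge_eq fun _ _ _ => rfl) rfl rfl
    have hfd : fderiv ℝ (fun u => F.t u + ε • χ u • (Pi.single i 1 : Fin n → ℝ)) (u + τ • v) v =
        fderiv ℝ F.t (u + τ • v) v + ε • deriv g τ • Pi.single i (1 : ℝ) := by
      have e1 : HasFDerivAt (fun u => F.t u + ε • χ u • (Pi.single i 1 : Fin n → ℝ)) _ (u + τ • v) :=
        ((hF.t_smooth.differentiable (by simp)) _).hasFDerivAt.add
        ((((hχ.differentiable (by simp)) _).hasFDerivAt.smul_const
          (Pi.single i (1 : ℝ) : Fin n → ℝ)).const_smul ε)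
      rw [e1.fderiv, ← h2]
      rfl
    rw [hv']
    change (F.bfTerm Pb.toHolAtlas ρ D (u + τ • v) v + F.orbitTerm Pb.toHolAtlas D (u + τ • v) v
      - ∑ k, F.H Pb.toHolAtlas D k (u + τ • v) *
        ((fderiv ℝ (fun u => F.t u + ε • χ u • (Pi.single i 1 : Fin n → ℝ)) (u + τ • v) v k : ℝ) : ℂ))
      - (F.bfTerm Pb.toHolAtlas ρ D (u + τ • v) v + F.orbitTerm Pb.toHolAtlas D (u + τ • v) v
      - ∑ k, F.H Pb.toHolAtlas D k (u + τ • v) * ((fderiv ℝ F.t (u + τ • v) v k : ℝ) : ℂ)) = _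
    rw [hfd]
    simp only [Pi.add_apply, Pi.smul_apply, Complex.ofReal_add, mul_add, Finset.sum_add_distrib]
    rw [Finset.sum_eq_single (s := Finset.univ) (f := fun k => F.H Pb.toHolAtlas D k (u + τ • v) *
      ((ε • deriv g τ • (Pi.single i 1 : Fin n → ℝ) k : ℝ) : ℂ)) i]
    · simp only [Pi.single_eq_same, smul_eq_mul, mul_one, Complex.ofReal_mul, Complex.real_smul]
      ring
    · intro k _ hk
      simp [hk]
    · simp

end EulerLagrange

end MixedBF

namespace MixedBF

section LaxEquation

variable {C ι E G : Type*} [TopologicalSpace C] [T2Space C] [CompactSpace C] [ChartedSpace ℂ C]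
  [IsManifold 𝓘(ℂ) ω C]
  [NormedAddCommGroup E] [NormedSpace ℂ E] [FiniteDimensional ℂ E]
  [TopologicalSpace G] [ChartedSpace E G] [Group G] [LieGroup 𝓘(ℂ, E) ω G]
  {n N : ℕ} {Pb : PBundle C ι E G} {ρ : PartitionOfUnity ι C}
  {D : Defects C E G n N} {F : Fields C ι E G n N}
  {I J : ι} {x : C} {u v : Fin n → ℝ}

variable (Pb F) in
/-- The variation of the partial connection by a section supported in a chart. -/
def connectionVariation (J : ι) (ψ : ℂ → E) (χ : (Fin n → ℝ) → ℝ) : Variation C ι E G n N :=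
  { F.zeroVariation with
    δA := fun I x u => χ u • transport Pb.toHolAtlas (fun I J x =>
      (starRingEnd ℂ) (Pb.jac I J x) • (Ad (Pb.g I J x) : E →L[ℂ] E)) J ψ I x }

theorem Fields.Admissible.connectionVariation (hF : F.Admissible Pb D) {ψ : ℂ → E}
    (hψ : IsTest (Pb.chart J).target ψ) {χ : (Fin n → ℝ) → ℝ} (hχ : ContDiff ℝ ∞ χ)
    (hχc : HasCompactSupport χ) : (connectionVariation Pb F J ψ χ).Admissible Pb D F :=
  have hz := hF.zeroVariation
  { δB_smooth := hz.δB_smooth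
    δB_trans := hz.δB_trans
    δA_smooth := Pb.isCocycle_conj_Ad.smoothOff_transport hψ hχ
    δA_trans := fun I K x hI hK u => by
      simp only [MixedBF.connectionVariation]
      rw [Pb.isCocycle_conj_Ad.transport_trans hI hK, ← Complex.coe_smul, ← Complex.coe_smul,
        map_smul, smul_apply, smul_comm]
    δgauge_smooth := hz.δgauge_smooth
    δgauge_trans := hz.δgauge_trans
    Φ_smooth := hz.Φ_smooth
    Φ_trans := hz.Φ_trans
    Φ_zero := hz.Φ_zero
    δt_smooth := hz.δt_smooth
    compact_support := ⟨tsupport χ, hχc, fun u hu => ⟨fun _ _ => rfl, fun I x => by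
        simp only [MixedBF.connectionVariation, image_eq_zero_of_notMem_tsupport hu, zero_smul],
        fun _ _ => rfl, fun _ _ _ => rfl, rfl⟩⟩ }

theorem Fields.Admissible.curvature_connectionVariation (hF : F.Admissible Pb D) (ψ : ℂ → E)
    {χ : (Fin n → ℝ) → ℝ} (hχ : ContDiff ℝ ∞ χ) (ε : ℝ) (u v : Fin n → ℝ)
    (hx : x ∈ (Pb.chart I).source) :
    (F.vary (MixedBF.connectionVariation Pb F J ψ χ) ε).curvature Pb.toHolAtlas u v I x =
      F.curvature Pb.toHolAtlas u v I x +
      ((ε * χ u : ℝ) : ℂ) • bracket G (transport Pb.toHolAtlas (fun I J x =>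
        (starRingEnd ℂ) (Pb.jac I J x) • (Ad (Pb.g I J x) : E →L[ℂ] E)) J ψ I x)
        (F.gaugeAt I x u v) -
      ((ε * fderiv ℝ χ u v : ℝ) : ℂ) • transport Pb.toHolAtlas (fun I J x =>
        (starRingEnd ℂ) (Pb.jac I J x) • (Ad (Pb.g I J x) : E →L[ℂ] E)) J ψ I x := by
  set T := transport Pb.toHolAtlas (fun I J x =>
    (starRingEnd ℂ) (Pb.jac I J x) • (Ad (Pb.g I J x) : E →L[ℂ] E)) J ψ I x with hT
  have hg : (F.vary (MixedBF.connectionVariation Pb F J ψ χ) ε).gauge = F.gauge :=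
    vary_gauge_eq fun _ _ _ => rfl
  have hg' : ∀ x, (F.vary (MixedBF.connectionVariation Pb F J ψ χ) ε).gaugeAt I x u v =
      F.gaugeAt I x u v := fun x => by simp only [gaugeAt, hg]
  have hA : (F.vary (MixedBF.connectionVariation Pb F J ψ χ) ε).A I x =
      fun u => F.A I x u + ε • χ u • T := rfl
  have hd : HasFDerivAt (fun u => F.A I x u + ε • χ u • T) _ u :=
    (((hF.A_smooth.contDiff_time isClosed_empty hx (notMem_empty x)).differentiable
      (by simp)) u).hasFDerivAt.add
      ((((hχ.differentiable (by simp)) u).hasFDerivAt.smul_const T).const_smul ε)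
  rw [curvature, curvature, hA, hd.fderiv]
  simp only [hg', ← adL_apply, map_add, add_apply]
  have e1 : (ε • (fderiv ℝ χ u).smulRight T) v = ((ε * fderiv ℝ χ u v : ℝ) : ℂ) • T := by
    rw [Complex.coe_smul, mul_smul]; rfl
  have e2 : adL G (ε • χ u • T) (F.gaugeAt I x u v) =
      ((ε * χ u : ℝ) : ℂ) • adL G T (F.gaugeAt I x u v) := by
    rw [smul_smul, ← Complex.coe_smul, map_smul, smul_apply]
  rw [e2, e1]
  abel

theorem Fields.Admissible.smoothOff_lax (hF : F.Admissible Pb D) (v : Fin n → ℝ) (Y : E) :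
    SmoothOff Pb.toHolAtlas (range D.p ∪ range D.q) (fun I x u =>
      coad G (F.gaugeAt I x u v) (F.B I x u) Y) := by
  have h1 := hF.B_smooth.mono (subset_union_left (t := range D.q))
  have h2 := (hF.gaugeAt_smooth (V := fun _ => v) contDiff_const).mono
    (subset_union_right (s := range D.p))
  have h3 : SmoothOff Pb.toHolAtlas (range D.p ∪ range D.q) (fun I x u =>
      F.B I x u ((-(adL G).flip Y) (F.gaugeAt I x u v))) :=
    h1.clm_apply (h2.continuousLinearMap (-(adL G).flip Y))
  have e : ∀ I x u, F.B I x u ((-(adL G).flip Y) (F.gaugeAt I x u v)) =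
      coad G (F.gaugeAt I x u v) (F.B I x u) Y := fun I x u => by
    rw [coad_apply, neg_apply, map_neg]; rfl
  simpa only [e] using h3

/-- The equation obtained by varying the partial connection. -/
theorem Fields.Critical.lax (hC : F.Critical Pb ρ D)
    (hρ : ρ.IsSubordinate (fun I => (Pb.chart I).source)) (hF : F.Admissible Pb D)
    (hv : v ≠ 0) (u : Fin n → ℝ) (hx : x ∈ (Pb.chart J).source) (hxp : x ∉ range D.p)
    (hxq : x ∉ range D.q) :
    fderiv ℝ (F.B J x) u v + coad G (F.gaugeAt J x u v) (F.B J x u) = 0 := by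
  set S := range D.p ∪ range D.q with hS
  have hSc : IsClosed S := ((finite_range D.p).union (finite_range D.q)).isClosed
  set T := (Pb.chart J).target ∩ (Pb.chart J).symm ⁻¹' Sᶜ with hTdef
  have hT : IsOpen T := (Pb.chart J).isOpen_inter_preimage_symm hSc.isOpen_compl
  ext Y
  have hB : SmoothOff Pb.toHolAtlas S (fun I x u => F.B I x u Y) :=
    (hF.B_smooth.mono subset_union_left).continuousLinearMap (ContinuousLinearMap.apply ℂ ℂ Y)
  have hK := hF.smoothOff_lax v Y
  have hdB := hB.fderiv_time hSc (X := fun _ => v) contDiff_const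
  have hcont : ContinuousOn (fun w => fderiv ℝ (fun u => F.B J ((Pb.chart J).symm w) u Y) u v +
      coad G (F.gaugeAt J ((Pb.chart J).symm w) u v) (F.B J ((Pb.chart J).symm w) u) Y) T := by
    have h1 := ((hdB J).add (hK J)).continuousOn
    exact h1.comp (f := fun w : ℂ => (w, u)) (by fun_prop) fun w hw => ⟨hw, trivial⟩
  have hzero := eqOn_zero_of_integral_test hT hcont ?_ (w := Pb.chart J x)
    ⟨(Pb.chart J).map_source hx, by
      rw [mem_preimage, (Pb.chart J).left_inv hx, hS]; exact fun h => h.elim hxp hxq⟩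
  · rw [(Pb.chart J).left_inv hx] at hzero
    rw [add_apply, zero_apply, ← hzero]
    congr 1
    have h2 : HasFDerivAt (fun u => F.B J x u Y) _ u :=
      ((ContinuousLinearMap.apply ℂ ℂ Y).restrictScalars ℝ).hasFDerivAt.comp u
      (((hF.B_smooth.contDiff_time (finite_range D.p).isClosed hx hxp).differentiable
        (by simp)) u).hasFDerivAt
    rw [h2.fderiv]
    rfl
  intro κ hκ hκc hκs
  have hκT : tsupport κ ⊆ (Pb.chart J).target := hκs.trans inter_subset_left
  set ψ : ℂ → E := fun w => κ w • Y with hψdef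
  have hψ : IsTest (Pb.chart J).target ψ := ⟨hκ.smul contDiff_const, hκc.smul_right,
    (tsupport_smul_subset_left κ fun _ => Y).trans hκT⟩
  have hM := hB.contDiff_smul hSc (I := J) hκ hκs
  have hKs := hK.contDiff_smul hSc (I := J) hκ hκs
  have h0 : ∀ f : ℂ → (Fin n → ℝ) → ℂ, ∀ w ∉ tsupport κ, ∀ u, κ w • f w u = 0 := fun f w hw u => by
    rw [image_eq_zero_of_notMem_tsupport hw, zero_smul]
  obtain ⟨hM1, hM2⟩ := hasDerivAt_integral_line hM hκc
    (h0 fun w u => F.B J ((Pb.chart J).symm w) u Y) u v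
  have hK1 := continuous_integral_line hKs.continuous hκc
    (h0 fun w u => coad G (F.gaugeAt J ((Pb.chart J).symm w) u v) (F.B J ((Pb.chart J).symm w) u) Y)
    u v
  have key := add_eq_zero_of_integral_test hM1 hM2 hK1 (fun g hg hgc => ?_) 0
  · simp only [zero_smul, add_zero] at key
    have hi1 : Integrable fun w => fderiv ℝ (fun y : ℂ × (Fin n → ℝ) =>
        κ y.1 • F.B J ((Pb.chart J).symm y.1) y.2 Y) (w, u) (0, v) := by
      refine Continuous.integrable_of_hasCompactSupport
        (((hM.continuous_fderiv (by simp)).comp (by fun_prop)).clm_apply continuous_const)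
        (HasCompactSupport.intro hκc fun w hw => ?_)
      have h1 : (fun y : ℂ × (Fin n → ℝ) => κ y.1 • F.B J ((Pb.chart J).symm y.1) y.2 Y)
          =ᶠ[𝓝 (w, u)] fun _ => 0 := by
        have h2 : (tsupport κ)ᶜ ×ˢ (univ : Set (Fin n → ℝ)) ∈ 𝓝 (w, u) :=
          prod_mem_nhds ((isClosed_tsupport κ).isOpen_compl.mem_nhds hw) univ_mem
        filter_upwards [h2] with y hy
        exact h0 (fun w u => F.B J ((Pb.chart J).symm w) u Y) y.1 hy.1 y.2
      rw [h1.fderiv_eq]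
      simp
    have hi2 : Integrable fun w => κ w • coad G (F.gaugeAt J ((Pb.chart J).symm w) u v)
        (F.B J ((Pb.chart J).symm w) u) Y :=
      Continuous.integrable_of_hasCompactSupport (hKs.continuous.comp (f := fun w : ℂ => (w, u))
        (by fun_prop)) hκc.smul_right
    rw [← integral_add hi1 hi2] at key
    rw [← key]
    refine integral_congr_ae (Eventually.of_forall fun w => ?_)
    simp only [smul_add]
    congr 1
    have h1 : HasFDerivAt (fun u : Fin n → ℝ => (w, u)) (ContinuousLinearMap.inr ℝ ℂ (Fin n → ℝ)) u :=
      hasFDerivAt_prodMk_right w u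
    have h2 : HasFDerivAt (fun u => κ w • F.B J ((Pb.chart J).symm w) u Y) _ u :=
      ((hM.differentiable (by simp)) (w, u)).hasFDerivAt.comp u h1
    have h3 : fderiv ℝ (fun u => κ w • F.B J ((Pb.chart J).symm w) u Y) u v =
        κ w • fderiv ℝ (fun u => F.B J ((Pb.chart J).symm w) u Y) u v := by
      have h4 : fderiv ℝ (fun u => κ w • F.B J ((Pb.chart J).symm w) u Y) u =
          κ w • fderiv ℝ (fun u => F.B J ((Pb.chart J).symm w) u Y) u :=
        congrFun (fderiv_const_smul_field (κ w)) u
      rw [h4]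
      rfl
    rw [← h3, h2.fderiv]
    rfl
  · obtain ⟨χ, hχ, hχc, h1, h2⟩ := exists_extend_line u hv hg hgc
    have hδ := hF.connectionVariation hψ hχ hχc
    set M : ℝ → ℂ := fun τ => ∫ w, κ w • F.B J ((Pb.chart J).symm w) (u + τ • v) Y with hMdef
    set L : ℝ → ℂ := fun τ => ∫ w, κ w • coad G (F.gaugeAt J ((Pb.chart J).symm w) (u + τ • v) v)
      (F.B J ((Pb.chart J).symm w) (u + τ • v)) Y with hLdef
    have hMc : Continuous M := continuous_iff_continuousAt.2 fun τ => (hM1 τ).continuousAt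
    have hpi : (2 * Real.pi * Complex.I : ℂ) ≠ 0 := Complex.two_pi_I_ne_zero
    have h3 := hC.integral_eq_zero hF hδ u hv
      (a := fun _ τ => (1 / (2 * Real.pi * Complex.I)) * (2 * Complex.I) *
        (deriv g τ • M τ - g τ • L τ)) (K := tsupport g) ?_ hgc ?_ ?_
    · rw [integral_const_mul] at h3
      exact (mul_eq_zero.1 h3).resolve_left (by simp [Real.pi_ne_zero])
    · have : Continuous fun τ => (1 / (2 * Real.pi * Complex.I)) * (2 * Complex.I) *
          (deriv g τ • M τ - g τ • L τ) :=
        continuous_const.mul (((hg.continuous_deriv (by simp)).smul hMc).sub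
          (hg.continuous.smul hK1))
      exact this.comp continuous_snd
    · intro _ τ hτ
      have : deriv g τ = 0 := by
        by_contra hne
        exact hτ (support_deriv_subset hne)
      simp [this, image_eq_zero_of_notMem_tsupport hτ]
    · intro ε τ
      have hFv := hδ.vary hF ε
      have hBe : (F.vary (connectionVariation Pb F J ψ χ) ε).B = F.B := vary_B_eq fun _ _ _ => rfl
      have hge : (F.vary (connectionVariation Pb F J ψ χ) ε).gauge = F.gauge :=
        vary_gauge_eq fun _ _ _ => rfl
      have hte : (F.vary (connectionVariation Pb F J ψ χ) ε).t = F.t := vary_t_eq fun _ => rfl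
      have hφe : (F.vary (connectionVariation Pb F J ψ χ) ε).φ = F.φ := rfl
      have hsub := hF.surfaceIntegral_pairing_sub hρ hFv hψ.isCompact_image hψ.image_subset
        (u := u + τ • v) (v := v) (fun I x hI _ hxZ => by
          rw [hF.curvature_connectionVariation ψ hχ ε _ _ hI, transport_eq_zero hxZ, ← adL_apply,
            map_zero, zero_apply, smul_zero, smul_zero, add_zero, sub_zero, hBe])
      have hlag : (F.vary (connectionVariation Pb F J ψ χ) ε).lagrangian Pb.toHolAtlas ρ D
          (u + τ • v) v - F.lagrangian Pb.toHolAtlas ρ D (u + τ • v) v =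
          (1 / (2 * Real.pi * Complex.I)) * (surfaceIntegral Pb.toHolAtlas ρ
            (fun I x => (F.vary (connectionVariation Pb F J ψ χ) ε).B I x (u + τ • v)
            ((F.vary (connectionVariation Pb F J ψ χ) ε).curvature Pb.toHolAtlas (u + τ • v) v I x)) -
          surfaceIntegral Pb.toHolAtlas ρ
            (fun I x => F.B I x (u + τ • v) (F.curvature Pb.toHolAtlas (u + τ • v) v I x))) := by
        simp only [lagrangian, bfTerm, orbitTerm, H, gaugeAt, hBe, hge, hte, hφe]
        ring
      rw [hlag, hsub]
      have hint : ∫ w in (Pb.chart J).target, (-2 * Complex.I) *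
          ((F.vary (connectionVariation Pb F J ψ χ) ε).B J ((Pb.chart J).symm w) (u + τ • v)
            ((F.vary (connectionVariation Pb F J ψ χ) ε).curvature Pb.toHolAtlas (u + τ • v) v J
            ((Pb.chart J).symm w)) - F.B J ((Pb.chart J).symm w) (u + τ • v)
            (F.curvature Pb.toHolAtlas (u + τ • v) v J ((Pb.chart J).symm w))) =
          ∫ w, (-2 * Complex.I) * ((ε * g τ : ℝ) • (κ w • coad G
            (F.gaugeAt J ((Pb.chart J).symm w) (u + τ • v) v)
            (F.B J ((Pb.chart J).symm w) (u + τ • v)) Y) -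
            (ε * deriv g τ : ℝ) • (κ w • F.B J ((Pb.chart J).symm w) (u + τ • v) Y)) := by
        refine Eq.trans ?_ (setIntegral_eq_integral_of_forall_compl_eq_zero
          (s := (Pb.chart J).target) ?_)
        · refine setIntegral_congr_fun (Pb.chart J).open_target.measurableSet fun w hw => ?_
          have hws := (Pb.chart J).map_target hw
          have hsk : bracket G Y (F.gaugeAt J ((Pb.chart J).symm w) (u + τ • v) v) =
            -bracket G (F.gaugeAt J ((Pb.chart J).symm w) (u + τ • v) v) Y := bracket_skew _ _
          rw [hF.curvature_connectionVariation ψ hχ ε _ _ hws,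
            Pb.isCocycle_conj_Ad.transport_self hws, (Pb.chart J).right_inv hw, hBe, h1, h2, hψdef]
          simp only
          rw [map_sub, map_add, map_smul, map_smul, ← Complex.coe_smul (κ w) Y, map_smul,
            ← adL_apply, map_smul, smul_apply, adL_apply, hsk, map_smul, coad_apply, map_neg]
          simp only [Complex.real_smul, smul_eq_mul]
          ring
        · intro w hw
          have hκ0 : κ w = 0 := image_eq_zero_of_notMem_tsupport fun h => hw (hκT h)
          simp [hκ0]
      have hiL : Integrable fun w => κ w • coad G (F.gaugeAt J ((Pb.chart J).symm w) (u + τ • v) v)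
          (F.B J ((Pb.chart J).symm w) (u + τ • v)) Y :=
        Continuous.integrable_of_hasCompactSupport (hKs.continuous.comp
          (f := fun w : ℂ => (w, u + τ • v)) (by fun_prop)) hκc.smul_right
      have hiM : Integrable fun w => κ w • F.B J ((Pb.chart J).symm w) (u + τ • v) Y :=
        Continuous.integrable_of_hasCompactSupport (hM.continuous.comp
          (f := fun w : ℂ => (w, u + τ • v)) (by fun_prop)) hκc.smul_right
      have hiL' : Integrable fun w => (ε * g τ : ℝ) • (κ w • coad G
          (F.gaugeAt J ((Pb.chart J).symm w) (u + τ • v) v)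
          (F.B J ((Pb.chart J).symm w) (u + τ • v)) Y) := hiL.smul (ε * g τ : ℝ)
      have hiM' : Integrable fun w => (ε * deriv g τ : ℝ) •
          (κ w • F.B J ((Pb.chart J).symm w) (u + τ • v) Y) := hiM.smul (ε * deriv g τ : ℝ)
      rw [hint, integral_const_mul, integral_sub hiL' hiM', integral_smul, integral_smul]
      simp only [Complex.real_smul, Complex.ofReal_mul, hMdef, hLdef]
      ring

end LaxEquation

end MixedBF

namespace MixedBF

section MomentEquation

variable {C ι E G : Type*} [TopologicalSpace C] [T2Space C] [CompactSpace C] [ChartedSpace ℂ C]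
  [IsManifold 𝓘(ℂ) ω C]
  [NormedAddCommGroup E] [NormedSpace ℂ E] [FiniteDimensional ℂ E]
  [TopologicalSpace G] [ChartedSpace E G] [Group G] [LieGroup 𝓘(ℂ, E) ω G]
  {n N : ℕ} {Pb : PBundle C ι E G} {ρ : PartitionOfUnity ι C}
  {D : Defects C E G n N} {F : Fields C ι E G n N}
  {I J : ι} {x : C} {u v : Fin n → ℝ} {α : Fin N}

theorem Fields.Admissible.contDiff_Ad_inv (hF : F.Admissible Pb D)
    (hI : D.p α ∈ (Pb.chart I).source) :
    ContDiff ℝ ∞ (fun u => (Ad (F.φ α I u)⁻¹ : E →L[ℂ] E)) := by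
  have := lieGroup_real (E := E) (G := G)
  have h1 : ContMDiff 𝓘(ℝ, Fin n → ℝ) 𝓘(ℝ, E) ∞ fun u => (F.φ α I u)⁻¹ := by
    have h2 : ContMDiff 𝓘(ℝ, E) 𝓘(ℝ, E) ∞ (fun x : G => x⁻¹) := (contMDiff_inv 𝓘(ℝ, E) ω).of_le le_top
    exact h2.comp (hF.φ_smooth α I hI)
  exact contDiff_iff_contDiffAt.2 fun u => contDiffAt_Ad_comp (h1 u)

theorem Fields.Admissible.contDiff_orbit (hF : F.Admissible Pb D)
    (hI : D.p α ∈ (Pb.chart I).source) :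
    ContDiff ℝ ∞ (fun u => coAd (F.φ α I u) (D.Λ α)) :=
  ((ContinuousLinearMap.compL ℂ E E ℂ (D.Λ α)).restrictScalars ℝ).contDiff.comp
    (hF.contDiff_Ad_inv hI)

variable (Pb F) in
/-- The variation of the gauge field by a section supported in a chart. -/
def gaugeVariation (J : ι) (ψ : ℂ → E) (χ : (Fin n → ℝ) → ℝ) (c : Fin n → ℝ) :
    Variation C ι E G n N :=
  { F.zeroVariation with
    δgauge := fun I x u j => (χ u * c j) •
      transport Pb.toHolAtlas (fun I J x => (Ad (Pb.g I J x) : E →L[ℂ] E)) J ψ I x }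

theorem Fields.Admissible.gaugeVariation (hF : F.Admissible Pb D) {ψ : ℂ → E}
    (hψ : IsTest (Pb.chart J).target ψ) {χ : (Fin n → ℝ) → ℝ} (hχ : ContDiff ℝ ∞ χ)
    (hχc : HasCompactSupport χ) (c : Fin n → ℝ) :
    (gaugeVariation Pb F J ψ χ c).Admissible Pb D F :=
  have hz := hF.zeroVariation
  { δB_smooth := hz.δB_smooth
    δB_trans := hz.δB_trans
    δA_smooth := hz.δA_smooth
    δA_trans := hz.δA_trans
    δgauge_smooth := fun I => contDiffOn_pi.2 fun j =>
      Pb.isCocycle_Ad.smoothOff_transport hψ (χ := fun u => χ u * c j) (hχ.mul contDiff_const) I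
    δgauge_trans := fun I K x hI hK u j => by
      simp only [MixedBF.gaugeVariation]
      rw [Pb.isCocycle_Ad.transport_trans hI hK, ← Complex.coe_smul, ← Complex.coe_smul, map_smul]
    Φ_smooth := hz.Φ_smooth
    Φ_trans := hz.Φ_trans
    Φ_zero := hz.Φ_zero
    δt_smooth := hz.δt_smooth
    compact_support := ⟨tsupport χ, hχc, fun u hu => ⟨fun _ _ => rfl, fun _ _ => rfl,
        fun I x => by
          funext j
          simp only [MixedBF.gaugeVariation, image_eq_zero_of_notMem_tsupport hu, zero_mul,
            zero_smul, Pi.zero_apply],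
        fun _ _ _ => rfl, rfl⟩⟩ }

theorem Fields.gaugeAt_gaugeVariation (ψ : ℂ → E) (χ : (Fin n → ℝ) → ℝ) {c : Fin n → ℝ}
    (hc : ∑ j, v j * c j = 1) (ε : ℝ) (I : ι) (x : C) (u : Fin n → ℝ) :
    (F.vary (gaugeVariation Pb F J ψ χ c) ε).gaugeAt I x u v = F.gaugeAt I x u v +
      ((ε * χ u : ℝ) : ℂ) •
      transport Pb.toHolAtlas (fun I J x => (Ad (Pb.g I J x) : E →L[ℂ] E)) J ψ I x := by
  simp only [gaugeAt, vary, gaugeVariation, Pi.add_apply, Pi.smul_apply, smul_add,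
    Finset.sum_add_distrib, smul_smul, ← Finset.sum_smul, Complex.coe_smul]
  congr 2
  rw [← mul_one (ε * χ u), ← hc, Finset.mul_sum]
  exact Finset.sum_congr rfl fun j _ => by ring

theorem Fields.Admissible.curvature_gaugeVariation (hF : F.Admissible Pb D) {ψ : ℂ → E}
    (hψ : IsTest (Pb.chart J).target ψ) (χ : (Fin n → ℝ) → ℝ) {c : Fin n → ℝ}
    (hc : ∑ j, v j * c j = 1) (ε : ℝ) (u : Fin n → ℝ) (hx : x ∈ (Pb.chart I).source)
    (hxq : x ∉ range D.q) :
    (F.vary (MixedBF.gaugeVariation Pb F J ψ χ c) ε).curvature Pb.toHolAtlas u v I x =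
      F.curvature Pb.toHolAtlas u v I x + ((ε * χ u : ℝ) : ℂ) •
      (dbar (fun w => transport Pb.toHolAtlas (fun I J x => (Ad (Pb.g I J x) : E →L[ℂ] E)) J ψ I
        ((Pb.chart I).symm w)) (Pb.chart I x) + bracket G (F.A I x u)
        (transport Pb.toHolAtlas (fun I J x => (Ad (Pb.g I J x) : E →L[ℂ] E)) J ψ I x)) := by
  have hA : (F.vary (MixedBF.gaugeVariation Pb F J ψ χ c) ε).A = F.A := vary_A_eq fun _ _ _ => rfl
  have h1 := (hF.gaugeAt_smooth (V := fun _ => v) contDiff_const).contDiffAt_point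
    (finite_range D.q).isClosed hx hxq u
  have h2 := (Pb.isCocycle_Ad.contDiffOn_transport hψ I).contDiffAt
    ((Pb.chart I).open_target.mem_nhds ((Pb.chart I).map_source hx))
  rw [curvature, curvature, hA]
  simp only [gaugeAt_gaugeVariation ψ χ hc]
  have h3 : DifferentiableAt ℝ (fun w => ((ε * χ u : ℝ) : ℂ) • transport Pb.toHolAtlas (fun I J x =>
      (Ad (Pb.g I J x) : E →L[ℂ] E)) J ψ I ((Pb.chart I).symm w)) (Pb.chart I x) :=
    (h2.differentiableAt (by simp)).const_smul ((ε * χ u : ℝ) : ℂ)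
  rw [dbar_add (h1.differentiableAt (by simp)) h3, dbar_const_smul, ← adL_apply, ← adL_apply, ← adL_apply, map_add, map_smul, smul_add]
  abel

theorem Fields.Admissible.residue_gaugeVariation (hF : F.Admissible Pb D) {ψ : ℂ → E}
    (hψ : IsTest (Pb.chart J).target ψ) (χ : (Fin n → ℝ) → ℝ) {c : Fin n → ℝ}
    (hc : ∑ j, v j * c j = 1) (ε : ℝ) (u : Fin n → ℝ) (hx : x ∈ (Pb.chart I).source)
    (hxq : x ∈ range D.q) :
    residue Pb.toHolAtlas I x
      (fun y => (F.vary (MixedBF.gaugeVariation Pb F J ψ χ c) ε).gaugeAt I y u v) =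
      residue Pb.toHolAtlas I x fun y => F.gaugeAt I y u v := by
  refine residue_eq_of_tendsto hx ?_
  have h1 := (hF.gaugeAt_poles (V := fun _ => v) contDiff_const).tendsto_residue hxq hx u
  have h2 := (Pb.isCocycle_Ad.contDiffOn_transport hψ I).continuousOn.continuousAt
    ((Pb.chart I).open_target.mem_nhds ((Pb.chart I).map_source hx))
  have hle : 𝓝[≠] x ≤ 𝓝 x := nhdsWithin_le_nhds
  have h3 : Tendsto (fun y => (Pb.chart I y - Pb.chart I x) • ((ε * χ u : ℝ) : ℂ) •
      transport Pb.toHolAtlas (fun I J x => (Ad (Pb.g I J x) : E →L[ℂ] E)) J ψ I y) (𝓝[≠] x)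
      (𝓝 0) := by
    have h4 : Tendsto (fun y => Pb.chart I y - Pb.chart I x) (𝓝[≠] x) (𝓝 0) := by
      have h5 := (((Pb.chart I).continuousAt hx).tendsto.sub_const (Pb.chart I x)).mono_left hle
      rwa [sub_self] at h5
    have h6 := (h2.comp ((Pb.chart I).continuousAt hx)).tendsto.mono_left hle
    have h7 := h4.smul (h6.const_smul (((ε * χ u : ℝ) : ℂ)))
    rw [zero_smul] at h7
    refine h7.congr' ?_
    filter_upwards [hle ((Pb.chart I).open_source.mem_nhds hx)] with y hy
    simp only [Function.comp_apply]
    rw [(Pb.chart I).left_inv hy]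
  have h4 := h1.add h3
  rw [add_zero] at h4
  refine h4.congr fun y => ?_
  rw [gaugeAt_gaugeVariation ψ χ hc, smul_add]

open Classical in
/-- The equation obtained by varying the gauge field. -/
theorem Fields.Critical.moment (hC : F.Critical Pb ρ D)
    (hρ : ρ.IsSubordinate (fun I => (Pb.chart I).source)) (hF : F.Admissible Pb D)
    (hv : v ≠ 0) (u : Fin n → ℝ) {ψ : ℂ → E} (hψ : IsTest (Pb.chart J).target ψ) :
    F.momentDist Pb.toHolAtlas J u ψ =
      2 * Real.pi * Complex.I * ∑ α, if D.p α ∈ (Pb.chart J).source then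
        coAd (F.φ α J u) (D.Λ α) (ψ (Pb.chart J (D.p α))) else 0 := by
  obtain ⟨c, hc⟩ := exists_sum_mul_eq_one hv
  have hpi : (2 * Real.pi * Complex.I : ℂ) ≠ 0 := Complex.two_pi_I_ne_zero
  set Q : (Fin n → ℝ) → ℂ := fun u => ∫ w in (Pb.chart J).target, (-2 * Complex.I) *
    F.B J ((Pb.chart J).symm w) u (dbar ψ w + bracket G (F.A J ((Pb.chart J).symm w) u) (ψ w))
    with hQ
  set R : (Fin n → ℝ) → ℂ := fun u => ∑ α, if D.p α ∈ (Pb.chart J).source then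
        coAd (F.φ α J u) (D.Λ α) (ψ (Pb.chart J (D.p α))) else 0 with hR
  have hmom : F.momentDist Pb.toHolAtlas J u ψ = -Q u := by
    rw [momentDist, hQ, ← integral_neg]
    refine integral_congr_ae (Eventually.of_forall fun w => ?_)
    simp only [coad_apply, map_add]
    ring
  have hQc : Continuous Q := by
    have h := continuous_integral_apply hF.B_smooth hF.B_poles (finite_range D.p) J
      (Ψ := fun y => (-2 * Complex.I) • ContinuousLinearMap.apply ℂ ℂ (dbar ψ y.1 +
        adL G (F.A J ((Pb.chart J).symm y.1) y.2) (ψ y.1))) hψ.compact hψ.supp ?_ ?_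
    · exact h
    · have h1 : ContinuousOn (fun y : ℂ × (Fin n → ℝ) => F.A J ((Pb.chart J).symm y.1) y.2)
          ((Pb.chart J).target ×ˢ univ) := by
        have := (hF.A_smooth J).continuousOn
        simpa using this
      have h2 : ContinuousOn (fun y : ℂ × (Fin n → ℝ) => dbar ψ y.1 +
          adL G (F.A J ((Pb.chart J).symm y.1) y.2) (ψ y.1)) ((Pb.chart J).target ×ˢ univ) :=
        (hψ.contDiff_dbar.continuous.comp continuous_fst).continuousOn.add
          (((adL G).continuous.comp_continuousOn h1).clm_apply
          (hψ.smooth.continuous.comp continuous_fst).continuousOn)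
      have h3 : ContinuousOn (fun y : ℂ × (Fin n → ℝ) => ContinuousLinearMap.apply ℂ ℂ (dbar ψ y.1 +
          adL G (F.A J ((Pb.chart J).symm y.1) y.2) (ψ y.1))) ((Pb.chart J).target ×ˢ univ) :=
        (ContinuousLinearMap.apply ℂ ℂ (E := E)).continuous.comp_continuousOn h2
      exact h3.const_smul (-2 * Complex.I)
    · intro w hw u
      simp only
      rw [dbar_eq_zero_of_notMem_tsupport hw, image_eq_zero_of_notMem_tsupport hw, map_zero,
        add_zero, map_zero, smul_zero]
  have hRc : Continuous R := by
    refine continuous_finsetSum _ fun α _ => ?_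
    split_ifs with hα
    · exact ((ContinuousLinearMap.apply ℂ ℂ (ψ (Pb.chart J (D.p α)))).continuous.comp
        (hF.contDiff_orbit hα).continuous)
    · exact continuous_const
  suffices hk : (1 / (2 * Real.pi * Complex.I)) * Q u + R u = 0 by
    rw [hmom]
    field_simp at hk
    linear_combination -hk
  have hkc : Continuous fun τ : ℝ => (1 / (2 * Real.pi * Complex.I)) * Q (u + τ • v) +
      R (u + τ • v) :=
    (continuous_const.mul (hQc.comp (by fun_prop))).add (hRc.comp (by fun_prop))
  have key := eq_zero_of_integral_test hkc (fun g hg hgc => ?_) 0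
  · simpa using key
  obtain ⟨χ, hχ, hχc, h1, -⟩ := exists_extend_line u hv hg hgc
  have hδ := hF.gaugeVariation hψ hχ hχc c
  refine hC.integral_eq_zero hF hδ u hv
    (a := fun _ τ => g τ • ((1 / (2 * Real.pi * Complex.I)) * Q (u + τ • v) + R (u + τ • v)))
    (K := tsupport g) ((hg.continuous.smul hkc).comp continuous_snd) hgc (fun _ τ hτ => by
      simp only [image_eq_zero_of_notMem_tsupport hτ, zero_smul]) fun ε τ => ?_
  have hFv := hδ.vary hF ε
  have hBe : (F.vary (gaugeVariation Pb F J ψ χ c) ε).B = F.B := vary_B_eq fun _ _ _ => rfl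
  have hte : (F.vary (gaugeVariation Pb F J ψ χ c) ε).t = F.t := vary_t_eq fun _ => rfl
  have hφe : (F.vary (gaugeVariation Pb F J ψ χ c) ε).φ = F.φ := rfl
  set u' := u + τ • v with hu'
  have hsub := hF.surfaceIntegral_pairing_sub hρ hFv hψ.isCompact_image hψ.image_subset
    (u := u') (v := v) (fun I x hI hxS hxZ => by
      have hd : dbar (fun w => transport Pb.toHolAtlas (fun I J x =>
          (Ad (Pb.g I J x) : E →L[ℂ] E)) J ψ I ((Pb.chart I).symm w)) (Pb.chart I x) = 0 := by
        have h2 : (fun w => transport Pb.toHolAtlas (fun I J x =>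
          (Ad (Pb.g I J x) : E →L[ℂ] E)) J ψ I ((Pb.chart I).symm w)) =ᶠ[𝓝 (Pb.chart I x)]
            fun _ => 0 := by
          have h3 : ((Pb.chart J).symm '' tsupport ψ)ᶜ ∈ 𝓝 x :=
            hψ.isCompact_image.isClosed.isOpen_compl.mem_nhds hxZ
          have h4 := ((Pb.chart I).continuousAt_symm ((Pb.chart I).map_source hI)).tendsto
          rw [(Pb.chart I).left_inv hI] at h4
          filter_upwards [h4.eventually h3] with w hw
          exact transport_eq_zero hw
        rw [Filter.EventuallyEq.dbar_eq h2, dbar_const]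
      rw [hF.curvature_gaugeVariation hψ χ hc ε _ hI fun h => hxS (Or.inr h), hd,
        transport_eq_zero hxZ, ← adL_apply, map_zero, add_zero, smul_zero, add_zero, hBe])
  have hint : ∫ w in (Pb.chart J).target, (-2 * Complex.I) *
      ((F.vary (gaugeVariation Pb F J ψ χ c) ε).B J ((Pb.chart J).symm w) u'
        ((F.vary (gaugeVariation Pb F J ψ χ c) ε).curvature Pb.toHolAtlas u' v J
        ((Pb.chart J).symm w)) - F.B J ((Pb.chart J).symm w) u'
        (F.curvature Pb.toHolAtlas u' v J ((Pb.chart J).symm w))) = (ε * g τ : ℝ) * Q u' := by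
    rw [hQ, ← integral_const_mul]
    refine integral_congr_ae ?_
    filter_upwards [ae_notMem_finite (Pb.toHolAtlas.finite_preimage (finite_range D.q) J),
      ae_restrict_mem (Pb.chart J).open_target.measurableSet] with w hwS hw
    have hws := (Pb.chart J).map_target hw
    have hd : dbar (fun w => transport Pb.toHolAtlas (fun I J x =>
        (Ad (Pb.g I J x) : E →L[ℂ] E)) J ψ J ((Pb.chart J).symm w)) w = dbar ψ w := by
      refine Filter.EventuallyEq.dbar_eq ?_
      filter_upwards [(Pb.chart J).open_target.mem_nhds hw] with z hz
      rw [Pb.isCocycle_Ad.transport_self ((Pb.chart J).map_target hz), (Pb.chart J).right_inv hz]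
    rw [hF.curvature_gaugeVariation hψ χ hc ε _ hws fun h => hwS ⟨hw, h⟩, hBe,
      Pb.isCocycle_Ad.transport_self hws, (Pb.chart J).right_inv hw, hd, map_add, map_smul, hu', h1,
      smul_eq_mul]
    ring
  have horb : (F.vary (gaugeVariation Pb F J ψ χ c) ε).orbitTerm Pb.toHolAtlas D u' v =
      F.orbitTerm Pb.toHolAtlas D u' v + (ε * g τ : ℝ) * R u' := by
    rw [orbitTerm, orbitTerm, hR, Finset.mul_sum, ← Finset.sum_add_distrib]
    refine Finset.sum_congr rfl fun α _ => ?_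
    have e : ∀ (L : E →L[ℂ] E) (a b T : E) (z : ℂ),
        D.Λ α (a + L (b + z • T)) = D.Λ α (a + L b) + z * D.Λ α (L T) := fun L a b T z => by
      simp only [map_add, map_smul, smul_eq_mul]
      ring
    rw [hφe, gaugeAt_gaugeVariation ψ χ hc, e, hu', h1]
    congr 2
    split_ifs with hα
    · rw [transport_of_mem hα, coAd_apply, hF.φ_trans α (Pb.idx (D.p α)) J (Pb.mem_idx _) hα,
        ← Ad_mul_apply, mul_inv_rev, inv_mul_cancel_right]
    · rw [transport_of_notMem hα, map_zero, map_zero]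
  have hbf : (F.vary (gaugeVariation Pb F J ψ χ c) ε).bfTerm Pb.toHolAtlas ρ D u' v =
      F.bfTerm Pb.toHolAtlas ρ D u' v + (1 / (2 * Real.pi * Complex.I)) * ((ε * g τ : ℝ) * Q u') := by
    rw [bfTerm, bfTerm, ← hint, ← hsub, hBe]
    have hres : ∑ᶠ s ∈ range D.q, (-(2 * Real.pi * Complex.I)) * F.B (Pb.idx s) s u'
        (residue Pb.toHolAtlas (Pb.idx s) s
          (fun x => (F.vary (gaugeVariation Pb F J ψ χ c) ε).gaugeAt (Pb.idx s) x u' v)) =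
        ∑ᶠ s ∈ range D.q, (-(2 * Real.pi * Complex.I)) * F.B (Pb.idx s) s u'
        (residue Pb.toHolAtlas (Pb.idx s) s (fun x => F.gaugeAt (Pb.idx s) x u' v)) :=
      finsum_mem_congr rfl fun s hs => by
        rw [hF.residue_gaugeVariation hψ χ hc ε u' (Pb.mem_idx s) hs]
    rw [hres]
    ring
  rw [lagrangian, lagrangian, horb, hbf]
  simp only [H, hBe, hte, Complex.real_smul, Complex.ofReal_mul]
  ring

end MomentEquation

end MixedBF

namespace MixedBF

section OrbitEquation

variable {C ι E G : Type*} [TopologicalSpace C] [T2Space C] [CompactSpace C] [ChartedSpace ℂ C]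
  [IsManifold 𝓘(ℂ) ω C]
  [NormedAddCommGroup E] [NormedSpace ℂ E] [FiniteDimensional ℂ E]
  [TopologicalSpace G] [ChartedSpace E G] [Group G] [LieGroup 𝓘(ℂ, E) ω G]
  {n N : ℕ} {Pb : PBundle C ι E G} {ρ : PartitionOfUnity ι C}
  {D : Defects C E G n N} {F : Fields C ι E G n N}
  {I J : ι} {x : C} {u v : Fin n → ℝ} {α : Fin N}

/-- The inverse of a curve through the identity in the adjoint representation. -/
theorem hasDerivAt_Ad_inv_curve {γ : ℝ → G} (hγ : ContMDiff 𝓘(ℝ, ℝ) 𝓘(ℝ, E) ∞ γ) (h0 : γ 0 = 1) :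
    ContDiff ℝ ∞ (fun s => (Ad (γ s)⁻¹ : E →L[ℂ] E)) ∧
    HasDerivAt (fun s => (Ad (γ s)⁻¹ : E →L[ℂ] E)) (-adL G (leftLogDeriv γ 0 1)) 0 := by
  have := lieGroup_real (E := E) (G := G)
  have h1 : ContMDiff 𝓘(ℝ, ℝ) 𝓘(ℝ, E) ∞ fun s => (γ s)⁻¹ := by
    have h2 : ContMDiff 𝓘(ℝ, E) 𝓘(ℝ, E) ∞ (fun x : G => x⁻¹) :=
      (contMDiff_inv 𝓘(ℝ, E) ω).of_le le_top
    exact h2.comp hγ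
  have h2 : ContDiff ℝ ∞ (fun s => (Ad (γ s)⁻¹ : E →L[ℂ] E)) :=
    contDiff_iff_contDiffAt.2 fun u => contDiffAt_Ad_comp (h1 u)
  refine ⟨h2, ?_⟩
  have h3 := ((h2.differentiable (by simp)) 0).hasDerivAt
  refine h3.congr_deriv ?_
  ext Y
  have h4 : HasDerivAt (fun s => (Ad (γ s)⁻¹ : E →L[ℂ] E).restrictScalars ℝ)
      ((deriv (fun s => (Ad (γ s)⁻¹ : E →L[ℂ] E)) 0).restrictScalars ℝ) 0 :=
    (ContinuousLinearMap.restrictScalarsL ℂ E E ℝ ℝ).hasFDerivAt.comp_hasDerivAt 0 h3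
  have h5 : HasDerivAt (fun s => (Ad (γ s) : E →L[ℂ] E) Y) (adL G (leftLogDeriv γ 0 1) Y) 0 :=
    ((ContinuousLinearMap.apply ℂ E Y).restrictScalars ℝ).hasFDerivAt.comp_hasDerivAt 0
      (hasDerivAt_Ad_curve hγ h0)
  have h6 := h4.clm_apply h5
  have h7 : (fun s => ((Ad (γ s)⁻¹ : E →L[ℂ] E).restrictScalars ℝ) ((Ad (γ s) : E →L[ℂ] E) Y)) =
      fun _ => Y := by
    ext s
    exact Ad_inv_Ad _ _
  rw [h7] at h6
  have h8 := h6.unique (hasDerivAt_const 0 Y)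
  rw [h0, inv_one, Ad_one] at h8
  exact eq_neg_of_add_eq_zero_left h8

theorem Fields.Admissible.orbit_trans (hF : F.Admissible Pb D) (hI : D.p α ∈ (Pb.chart I).source)
    (hJ : D.p α ∈ (Pb.chart J).source) (u v : Fin n → ℝ) :
    fderiv ℝ (fun u' => coAd (F.φ α I u') (D.Λ α)) u v
      + coad G (F.gaugeAt I (D.p α) u v) (coAd (F.φ α I u) (D.Λ α)) =
    coAd (Pb.g I J (D.p α)) (fderiv ℝ (fun u' => coAd (F.φ α J u') (D.Λ α)) u v
      + coad G (F.gaugeAt J (D.p α) u v) (coAd (F.φ α J u) (D.Λ α))) := by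
  have h1 : ∀ u, coAd (F.φ α I u) (D.Λ α) = coAd (Pb.g I J (D.p α)) (coAd (F.φ α J u) (D.Λ α)) :=
    fun u => by rw [hF.φ_trans α I J hI hJ, coAd_mul]
  have h2 : HasFDerivAt (fun u' => coAd (F.φ α I u') (D.Λ α)) _ u :=
    (((coAdL (Pb.g I J (D.p α)) : StrongDual ℂ E →L[ℂ] StrongDual ℂ E).restrictScalars
      ℝ).hasFDerivAt.comp u (((hF.contDiff_orbit hJ).differentiable
      (by simp)) u).hasFDerivAt).congr_of_eventuallyEq (Eventually.of_forall h1)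
  rw [coAd_add, coAd_coad, h2.fderiv, hF.gaugeAt_trans hI hJ (D.p_notMem α), h1]
  rfl

open Classical in
variable (Pb D F) in
/-- The variation of the orbit variable at a marked point along a curve in the group. -/
def orbitVariation (α₀ : Fin N) (γ : ℝ → G) (χ : (Fin n → ℝ) → ℝ) : Variation C ι E G n N :=
  { F.zeroVariation with
    Φ := fun α I ε u => if α = α₀ ∧ D.p α ∈ (Pb.chart I).source then
      Pb.g I (Pb.idx (D.p α)) (D.p α) * (γ (ε * χ u) * F.φ α (Pb.idx (D.p α)) u) else F.φ α I u }

theorem Fields.Admissible.orbitVariation (hF : F.Admissible Pb D) (α₀ : Fin N) {γ : ℝ → G}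
    (hγ : ContMDiff 𝓘(ℝ, ℝ) 𝓘(ℝ, E) ∞ γ) (h0 : γ 0 = 1) {χ : (Fin n → ℝ) → ℝ}
    (hχ : ContDiff ℝ ∞ χ) (hχc : HasCompactSupport χ) :
    (orbitVariation Pb D F α₀ γ χ).Admissible Pb D F :=
  have hz := hF.zeroVariation
  have hone : ∀ α I u, (D.p α ∈ (Pb.chart I).source) →
      Pb.g I (Pb.idx (D.p α)) (D.p α) * (1 * F.φ α (Pb.idx (D.p α)) u) = F.φ α I u :=
    fun α I u h => by rw [one_mul, hF.φ_trans α I (Pb.idx (D.p α)) h (Pb.mem_idx _)]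
  { δB_smooth := hz.δB_smooth
    δB_trans := hz.δB_trans
    δA_smooth := hz.δA_smooth
    δA_trans := hz.δA_trans
    δgauge_smooth := hz.δgauge_smooth
    δgauge_trans := hz.δgauge_trans
    Φ_smooth := fun α I hI => by
      have := lieGroup_real (E := E) (G := G)
      by_cases h : α = α₀
      · simp only [MixedBF.orbitVariation, h, true_and]
        rw [← h]
        simp only [hI]
        have h1 : ContMDiff 𝓘(ℝ, ℝ × (Fin n → ℝ)) 𝓘(ℝ, ℝ) ∞
            (fun y : ℝ × (Fin n → ℝ) => y.1 * χ y.2) :=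
          (contDiff_fst.mul (hχ.comp contDiff_snd)).contMDiff
        have h2 : ContMDiff 𝓘(ℝ, ℝ × (Fin n → ℝ)) 𝓘(ℝ, Fin n → ℝ) ∞
            (fun y : ℝ × (Fin n → ℝ) => y.2) := contDiff_snd.contMDiff
        have h3 : ContMDiff 𝓘(ℝ, ℝ × (Fin n → ℝ)) 𝓘(ℝ, E) ∞ (fun y : ℝ × (Fin n → ℝ) =>
            (Pb.g I (Pb.idx (D.p α)) (D.p α) : G)) := contMDiff_const
        have h4 : LieGroup 𝓘(ℝ, E) ∞ G := LieGroup.of_le (m := ∞) (n := ω) le_top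
        exact h3.mul ((hγ.comp h1).mul ((hF.φ_smooth α _ (Pb.mem_idx _)).comp h2))
      · simp only [MixedBF.orbitVariation, h, false_and, if_false]
        exact hz.Φ_smooth α I hI
    Φ_trans := fun α I J hI hJ ε u => by
      simp only [MixedBF.orbitVariation, hI, hJ, and_true]
      split_ifs with h
      · rw [← mul_assoc (Pb.g I J (D.p α)), Pb.cocycle I J _ _ hI hJ (Pb.mem_idx _)]
      · exact hF.φ_trans α I J hI hJ u
    Φ_zero := fun α I u => by
      simp only [MixedBF.orbitVariation]
      split_ifs with h
      · rw [zero_mul, h0, hone α I u h.2]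
      · rfl
    δt_smooth := hz.δt_smooth
    compact_support := ⟨tsupport χ, hχc, fun u hu => ⟨fun _ _ => rfl, fun _ _ => rfl,
        fun _ _ => rfl, fun α I ε => by
          simp only [MixedBF.orbitVariation, image_eq_zero_of_notMem_tsupport hu, mul_zero]
          split_ifs with h
          · rw [h0, hone α I u h.2]
          · rfl, rfl⟩⟩ }

theorem Fields.Admissible.orbitTerm_orbitVariation (hF : F.Admissible Pb D) (α₀ : Fin N) {γ : ℝ → G}
    (hγ : ContMDiff 𝓘(ℝ, ℝ) 𝓘(ℝ, E) ∞ γ) {χ : (Fin n → ℝ) → ℝ}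
    (hχ : ContDiff ℝ ∞ χ) (ε : ℝ) (u v : Fin n → ℝ) :
    (F.vary (MixedBF.orbitVariation Pb D F α₀ γ χ) ε).orbitTerm Pb.toHolAtlas D u v -
      F.orbitTerm Pb.toHolAtlas D u v = coAd (F.φ α₀ (Pb.idx (D.p α₀)) u) (D.Λ α₀)
      ((ε * fderiv ℝ χ u v) • leftLogDeriv γ (ε * χ u) 1 +
        (Ad (γ (ε * χ u))⁻¹ (F.gaugeAt (Pb.idx (D.p α₀)) (D.p α₀) u v) -
        F.gaugeAt (Pb.idx (D.p α₀)) (D.p α₀) u v)) := by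
  have hg : (F.vary (MixedBF.orbitVariation Pb D F α₀ γ χ) ε).gauge = F.gauge :=
    vary_gauge_eq fun _ _ _ => rfl
  have hφ : ∀ α, α ≠ α₀ → (F.vary (MixedBF.orbitVariation Pb D F α₀ γ χ) ε).φ α = F.φ α :=
    fun α hα => by
      funext I u
      simp [vary, MixedBF.orbitVariation, hα]
  have hφ₀ : (F.vary (MixedBF.orbitVariation Pb D F α₀ γ χ) ε).φ α₀ (Pb.idx (D.p α₀)) =
      fun u => γ (ε * χ u) * F.φ α₀ (Pb.idx (D.p α₀)) u := by
    funext u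
    simp [vary, MixedBF.orbitVariation, Pb.mem_idx, Pb.g_self (Pb.mem_idx (D.p α₀))]
  rw [orbitTerm, orbitTerm, ← Finset.sum_sub_distrib, Finset.sum_eq_single α₀]
  · have hε : HasFDerivAt (fun u => ε * χ u) (ε • fderiv ℝ χ u) u :=
      ((hχ.differentiable (by simp)) u).hasFDerivAt.const_mul ε
    have hd : MDifferentiableAt 𝓘(ℝ, Fin n → ℝ) 𝓘(ℝ, E) (fun u => γ (ε * χ u)) u :=
      MDifferentiableAt.comp u (hγ.mdifferentiableAt (by simp))
        hε.differentiableAt.mdifferentiableAt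
    have hll : (leftLogDeriv (fun u => γ (ε * χ u)) u v : E) =
        (ε * fderiv ℝ χ u v) • leftLogDeriv γ (ε * χ u) 1 := by
      rw [leftLogDeriv_comp (hγ.mdifferentiableAt (by simp)) hε.differentiableAt, hε.fderiv,
        ← leftLogCLM_apply, ← leftLogCLM_apply, ← map_smul]
      congr 1
      simp
    simp only [gaugeAt, hg]
    rw [hφ₀, leftLogDeriv_mul hd ((hF.φ_smooth α₀ _ (Pb.mem_idx _)).mdifferentiableAt (by simp)),
      hll, mul_inv_rev, Ad_mul_apply, coAd_apply, map_add (Ad _), map_sub (Ad _), map_add, map_add,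
      map_add, map_add, map_sub]
    ring
  · intro α _ hα
    rw [hφ α hα]
    simp only [gaugeAt, hg, sub_self]
  · simp

/-- The equation obtained by varying the orbit variables. -/
theorem Fields.Critical.orbit (hC : F.Critical Pb ρ D) (hF : F.Admissible Pb D)
    (hv : v ≠ 0) (u : Fin n → ℝ) (hI : D.p α ∈ (Pb.chart I).source) :
    fderiv ℝ (fun u' => coAd (F.φ α I u') (D.Λ α)) u v
      + coad G (F.gaugeAt I (D.p α) u v) (coAd (F.φ α I u) (D.Λ α)) = 0 := by
  rw [hF.orbit_trans hI (Pb.mem_idx (D.p α))]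
  suffices h : fderiv ℝ (fun u' => coAd (F.φ α (Pb.idx (D.p α)) u') (D.Λ α)) u v
      + coad G (F.gaugeAt (Pb.idx (D.p α)) (D.p α) u v)
      (coAd (F.φ α (Pb.idx (D.p α)) u) (D.Λ α)) = 0 by
    rw [h]
    exact map_zero (coAdL (Pb.g I (Pb.idx (D.p α)) (D.p α)))
  ext X
  obtain ⟨γ, hγ, h0, hX, hl⟩ := exists_curve (G := G) X
  set J := Pb.idx (D.p α) with hJ
  set μ : (Fin n → ℝ) → StrongDual ℂ E := fun u => coAd (F.φ α J u) (D.Λ α) with hμ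
  set A : (Fin n → ℝ) → E := fun u => F.gaugeAt J (D.p α) u v with hA
  have hμs : ContDiff ℝ ∞ μ := hF.contDiff_orbit (Pb.mem_idx _)
  have hAs : ContDiff ℝ ∞ A := (hF.gaugeAt_smooth (V := fun _ => v) contDiff_const).contDiff_time
    (finite_range D.q).isClosed (Pb.mem_idx _) (D.p_notMem α)
  have hμX : ContDiff ℝ ∞ fun u => μ u X :=
    ((ContinuousLinearMap.apply ℂ ℂ X).restrictScalars ℝ).contDiff.comp hμs
  have hkc : Continuous fun u => μ u (adL G X (A u)) :=
    hμs.continuous.clm_apply ((adL G X).continuous.comp hAs.continuous)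
  obtain ⟨hk, hk'⟩ := hasDerivAt_Ad_inv_curve hγ h0
  rw [hX] at hk'
  set k : ℝ → E →L[ℂ] E := fun s => Ad (γ s)⁻¹ with hkdef
  have hm : Continuous (dslope k 0) := by
    refine continuous_iff_continuousAt.2 fun s => ?_
    rcases eq_or_ne s 0 with rfl | hs
    · exact continuousAt_dslope_same.2 hk'.differentiableAt
    · exact (continuousAt_dslope_of_ne hs).2 hk.continuous.continuousAt
  have hm0 : dslope k 0 0 = -adL G X := by rw [dslope_same, hk'.deriv]
  have hms : ∀ (s : ℝ) (Y : E), k s Y - Y = s • dslope k 0 s Y := fun s Y => by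
    have h1 := sub_smul_dslope k 0 s
    have h2 : k 0 = ContinuousLinearMap.id ℂ E := by simp only [hkdef, h0, inv_one, Ad_one]
    rw [sub_zero, h2] at h1
    have h3 := congrArg (fun L : E →L[ℂ] E => L Y) h1
    exact h3.symm
  have key := add_eq_zero_of_integral_test
    (hasDerivAt_comp_line (hμX.differentiable (by simp)) u v)
    (((hμX.continuous_fderiv (by simp)).comp (by fun_prop)).clm_apply continuous_const)
    (k := fun τ : ℝ => μ (u + τ • v) (adL G X (A (u + τ • v)))) (hkc.comp (by fun_prop))
    (fun g hg hgc => ?_) 0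
  · simp only [zero_smul, add_zero] at key
    have h2 : HasFDerivAt (fun u => μ u X) _ u :=
      ((ContinuousLinearMap.apply ℂ ℂ X).restrictScalars ℝ).hasFDerivAt.comp u
      ((hμs.differentiable (by simp)) u).hasFDerivAt
    rw [h2.fderiv] at key
    rw [add_apply, coad_apply, zero_apply, bracket_skew, map_neg, neg_neg]
    exact key
  obtain ⟨χ, hχ, hχc, h1, h2⟩ := exists_extend_line u hv hg hgc
  have hδ := hF.orbitVariation α hγ h0 hχ hχc
  have h3 := hC.integral_eq_zero hF hδ u hv
    (a := fun ε τ => μ (u + τ • v) (deriv g τ • leftLogDeriv γ (ε * g τ) 1 +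
      g τ • dslope k 0 (ε * g τ) (A (u + τ • v)))) (K := tsupport g) ?_ hgc ?_ ?_
  · rw [← h3]
    refine integral_congr_ae (Eventually.of_forall fun τ => ?_)
    simp only [zero_mul, hX, hm0, neg_apply, smul_neg, ← sub_eq_add_neg]
    rw [map_sub, ContinuousLinearMap.map_smul_of_tower, ContinuousLinearMap.map_smul_of_tower]
  · have c1 : Continuous fun y : ℝ × ℝ => y.1 * g y.2 :=
      continuous_fst.mul (hg.continuous.comp continuous_snd)
    have c2 : Continuous fun y : ℝ × ℝ => u + y.2 • v := by fun_prop
    exact (hμs.continuous.comp c2).clm_apply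
      ((((hg.continuous_deriv (by simp)).comp continuous_snd).smul (hl.comp c1)).add
      ((hg.continuous.comp continuous_snd).smul
      ((hm.comp c1).clm_apply (hAs.continuous.comp c2))))
  · intro ε τ hτ
    have : deriv g τ = 0 := by
      by_contra hne
      exact hτ (support_deriv_subset hne)
    simp [this, image_eq_zero_of_notMem_tsupport hτ]
  · intro ε τ
    have hBe : (F.vary (orbitVariation Pb D F α γ χ) ε).B = F.B := vary_B_eq fun _ _ _ => rfl
    have hAe : (F.vary (orbitVariation Pb D F α γ χ) ε).A = F.A := vary_A_eq fun _ _ _ => rfl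
    have hge : (F.vary (orbitVariation Pb D F α γ χ) ε).gauge = F.gauge :=
      vary_gauge_eq fun _ _ _ => rfl
    have hte : (F.vary (orbitVariation Pb D F α γ χ) ε).t = F.t := vary_t_eq fun _ => rfl
    have horb := hF.orbitTerm_orbitVariation α hγ hχ ε (u + τ • v) v
    have hlag : (F.vary (orbitVariation Pb D F α γ χ) ε).lagrangian Pb.toHolAtlas ρ D
        (u + τ • v) v - F.lagrangian Pb.toHolAtlas ρ D (u + τ • v) v =
        (F.vary (orbitVariation Pb D F α γ χ) ε).orbitTerm Pb.toHolAtlas D (u + τ • v) v -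
        F.orbitTerm Pb.toHolAtlas D (u + τ • v) v := by
      simp only [lagrangian, bfTerm, H, curvature, gaugeAt, hBe, hge, hte, hAe]
      ring
    rw [hlag, horb, h1, h2, ← hJ]
    have h4 : (Ad (γ (ε * g τ))⁻¹ : E →L[ℂ] E) (A (u + τ • v)) - A (u + τ • v) =
      (ε * g τ) • dslope k 0 (ε * g τ) (A (u + τ • v)) := hms _ _
    rw [h4, mul_smul, mul_smul, ← smul_add, ContinuousLinearMap.map_smul_of_tower]

end OrbitEquation

end MixedBF

namespace MixedBF

section CurvatureEquation

variable {C ι E G : Type*} [TopologicalSpace C] [T2Space C] [CompactSpace C] [ChartedSpace ℂ C]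
  [IsManifold 𝓘(ℂ) ω C]
  [NormedAddCommGroup E] [NormedSpace ℂ E] [FiniteDimensional ℂ E]
  [TopologicalSpace G] [ChartedSpace E G] [Group G] [LieGroup 𝓘(ℂ, E) ω G]
  {n N : ℕ} {Pb : PBundle C ι E G} {ρ : PartitionOfUnity ι C}
  {D : Defects C E G n N} {F : Fields C ι E G n N}
  {I J : ι} {x : C} {u v : Fin n → ℝ} {α : Fin N} {ψ : ℂ → StrongDual ℂ E}

theorem Fields.Admissible.continuous_curvatureDist (hF : F.Admissible Pb D)
    (hψ : IsTest (Pb.chart J).target ψ) (v : Fin n → ℝ) :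
    Continuous fun u => F.curvatureDist Pb.toHolAtlas J u v ψ := by
  have hT := (Pb.chart J).open_target
  have hsm := hF.gaugeAt_smooth (V := fun _ => v) contDiff_const
  have hp := hF.gaugeAt_poles (V := fun _ => v) contDiff_const
  have hdA := hF.A_smooth.fderiv_time isClosed_empty (X := fun _ => v) contDiff_const
  have hA : ContinuousOn (fun y : ℂ × (Fin n → ℝ) => F.A J ((Pb.chart J).symm y.1) y.2)
      ((Pb.chart J).target ×ˢ univ) := by
    have := (hF.A_smooth J).continuousOn
    simpa using this
  let Ψ₁ : ℂ × (Fin n → ℝ) → E →L[ℂ] ℂ := fun y => -dbar ψ y.1 +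
    (ψ y.1).comp (adL G (F.A J ((Pb.chart J).symm y.1) y.2))
  let Ψ₂ : ℂ × (Fin n → ℝ) → E →L[ℂ] ℂ := fun y => -ψ y.1
  have c1 : ContinuousOn Ψ₁ ((Pb.chart J).target ×ˢ univ) :=
    (hψ.contDiff_dbar.continuous.comp continuous_fst).neg.continuousOn.add
      ((hψ.smooth.continuous.comp continuous_fst).continuousOn.clm_comp
      ((adL G).continuous.comp_continuousOn hA))
  have c2 : ContinuousOn Ψ₂ ((Pb.chart J).target ×ˢ univ) :=
    (hψ.smooth.continuous.comp continuous_fst).neg.continuousOn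
  have z1 : ∀ w ∉ tsupport ψ, ∀ u, Ψ₁ (w, u) = 0 := fun w hw u => by
    simp only [Ψ₁, dbar_eq_zero_of_notMem_tsupport hw, image_eq_zero_of_notMem_tsupport hw]
    ext; simp
  have z2 : ∀ w ∉ tsupport ψ, ∀ u, Ψ₂ (w, u) = 0 := fun w hw u => by
    simp only [Ψ₂, image_eq_zero_of_notMem_tsupport hw, neg_zero]
  have k1 := continuous_integral_apply hsm hp (finite_range D.q) J hψ.compact hψ.supp c1 z1
  have k2 := continuous_integral_apply hdA (hdA.simplePoles (S := ∅)) finite_empty J hψ.compact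
    hψ.supp c2 z2
  have hsec : ∀ u : Fin n → ℝ, ContinuousOn (fun w : ℂ => (w, u)) (Pb.chart J).target := fun u => by fun_prop
  have hmap : ∀ u : Fin n → ℝ, MapsTo (fun w : ℂ => (w, u)) (Pb.chart J).target
    ((Pb.chart J).target ×ˢ univ) := fun u w hw => ⟨hw, trivial⟩
  have key : ∀ u, F.curvatureDist Pb.toHolAtlas J u v ψ = (-2 * Complex.I) *
      ((∫ w in (Pb.chart J).target, Ψ₁ (w, u) (F.gaugeAt J ((Pb.chart J).symm w) u v)) +
      ∫ w in (Pb.chart J).target, Ψ₂ (w, u) (fderiv ℝ (F.A J ((Pb.chart J).symm w)) u v)) := by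
    intro u
    have i1 : IntegrableOn (fun w => Ψ₁ (w, u) (F.gaugeAt J ((Pb.chart J).symm w) u v))
        (Pb.chart J).target := (hF.gaugeAt_mild u v J).integrableOn_apply hT
      (Pb.toHolAtlas.finite_preimage (finite_range D.q) J)
      (c1.comp (hsec u) (hmap u)) hψ.compact hψ.supp fun w hw => z1 w hw u
    have i2 : IntegrableOn (fun w => Ψ₂ (w, u) (fderiv ℝ (F.A J ((Pb.chart J).symm w)) u v))
        (Pb.chart J).target := (mildSing_of_continuousOn hT (hF.fderiv_A_continuousOn u v J)
      (S := ∅)).integrableOn_apply hT finite_empty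
      (c2.comp (hsec u) (hmap u)) hψ.compact hψ.supp fun w hw => z2 w hw u
    rw [← integral_add i1 i2, ← integral_const_mul, curvatureDist]
    refine integral_congr_ae (Eventually.of_forall fun w => ?_)
    simp only [Ψ₁, Ψ₂, add_apply, neg_apply, ContinuousLinearMap.comp_apply, adL_apply, map_add,
      map_neg]
    ring
  simp only [key]
  exact continuous_const.mul (k1.add k2)

variable (Pb F) in
/-- The variation of `B` by a section supported in a chart. -/
def higgsVariation (J : ι) (ψ : ℂ → StrongDual ℂ E) (χ : (Fin n → ℝ) → ℝ) :
    Variation C ι E G n N :=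
  { F.zeroVariation with
    δB := fun I x u => χ u • transport Pb.toHolAtlas (fun I J x => Pb.jac I J x •
      (coAdL (Pb.g I J x) : StrongDual ℂ E →L[ℂ] StrongDual ℂ E)) J ψ I x }

theorem Fields.Admissible.higgsVariation (hF : F.Admissible Pb D)
    (hψ : IsTest (Pb.chart J).target ψ) {χ : (Fin n → ℝ) → ℝ} (hχ : ContDiff ℝ ∞ χ)
    (hχc : HasCompactSupport χ) : (higgsVariation Pb F J ψ χ).Admissible Pb D F :=
  have hz := hF.zeroVariation
  { δB_smooth := Pb.isCocycle_coAd.smoothOff_transport hψ hχ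
    δB_trans := fun I K x hI hK u => by
      simp only [MixedBF.higgsVariation]
      rw [Pb.isCocycle_coAd.transport_trans hI hK]
      ext Y
      exact smul_comm (χ u) (Pb.jac I K x) (transport Pb.toHolAtlas (fun I J x => Pb.jac I J x •
        (coAdL (Pb.g I J x) : StrongDual ℂ E →L[ℂ] StrongDual ℂ E)) J ψ K x (Ad (Pb.g I K x)⁻¹ Y))
    δA_smooth := hz.δA_smooth
    δA_trans := hz.δA_trans
    δgauge_smooth := hz.δgauge_smooth
    δgauge_trans := hz.δgauge_trans
    Φ_smooth := hz.Φ_smooth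
    Φ_trans := hz.Φ_trans
    Φ_zero := hz.Φ_zero
    δt_smooth := hz.δt_smooth
    compact_support := ⟨tsupport χ, hχc, fun u hu => ⟨fun I x => by
        simp only [MixedBF.higgsVariation, image_eq_zero_of_notMem_tsupport hu]
        ext Y
        exact zero_smul ℝ (transport Pb.toHolAtlas (fun I J x => Pb.jac I J x •
          (coAdL (Pb.g I J x) : StrongDual ℂ E →L[ℂ] StrongDual ℂ E)) J ψ I x Y),
        fun _ _ => rfl, fun _ _ => rfl, fun _ _ _ => rfl, rfl⟩⟩ }

open Classical in
theorem Fields.Admissible.bfTerm_higgsVariation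
    (hρ : ρ.IsSubordinate (fun I => (Pb.chart I).source)) (hF : F.Admissible Pb D)
    (hψ : IsTest (Pb.chart J).target ψ) {χ : (Fin n → ℝ) → ℝ} (hχ : ContDiff ℝ ∞ χ)
    (hχc : HasCompactSupport χ) (ε : ℝ) (u v : Fin n → ℝ) :
    (F.vary (MixedBF.higgsVariation Pb F J ψ χ) ε).bfTerm Pb.toHolAtlas ρ D u v -
      F.bfTerm Pb.toHolAtlas ρ D u v = (ε * χ u : ℝ) * ((1 / (2 * Real.pi * Complex.I)) *
      F.curvatureDist Pb.toHolAtlas J u v ψ) := by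
  set T := fun I x => transport Pb.toHolAtlas (fun I J x => Pb.jac I J x •
    (coAdL (Pb.g I J x) : StrongDual ℂ E →L[ℂ] StrongDual ℂ E)) J ψ I x with hT
  have hAe : (F.vary (MixedBF.higgsVariation Pb F J ψ χ) ε).A = F.A := vary_A_eq fun _ _ _ => rfl
  have hge : (F.vary (MixedBF.higgsVariation Pb F J ψ χ) ε).gauge = F.gauge :=
    vary_gauge_eq fun _ _ _ => rfl
  have hB : ∀ I x Y, (F.vary (MixedBF.higgsVariation Pb F J ψ χ) ε).B I x u Y =
      F.B I x u Y + (ε * χ u : ℝ) * T I x Y := fun I x Y => by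
    change F.B I x u Y + ε • χ u • T I x Y = _
    rw [smul_smul, Complex.real_smul]
  have hcv : ∀ I x, (F.vary (MixedBF.higgsVariation Pb F J ψ χ) ε).curvature Pb.toHolAtlas u v I x =
      F.curvature Pb.toHolAtlas u v I x := fun I x => by
    simp only [curvature, gaugeAt, hAe, hge]
  have hsub := hF.surfaceIntegral_pairing_sub hρ ((hF.higgsVariation hψ hχ hχc).vary hF ε)
    hψ.isCompact_image hψ.image_subset (u := u) (v := v) (fun I x hI hxS hxZ => by
      have : T I x = 0 := transport_eq_zero hxZ
      rw [hcv, hB, this, zero_apply, mul_zero, add_zero])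
  have hint : ∫ w in (Pb.chart J).target, (-2 * Complex.I) *
      ((F.vary (MixedBF.higgsVariation Pb F J ψ χ) ε).B J ((Pb.chart J).symm w) u
        ((F.vary (MixedBF.higgsVariation Pb F J ψ χ) ε).curvature Pb.toHolAtlas u v J
        ((Pb.chart J).symm w)) - F.B J ((Pb.chart J).symm w) u
        (F.curvature Pb.toHolAtlas u v J ((Pb.chart J).symm w))) =
      (ε * χ u : ℝ) * ∫ w in (Pb.chart J).target, (-2 * Complex.I) *
        ψ w (F.curvature Pb.toHolAtlas u v J ((Pb.chart J).symm w)) := by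
    rw [← integral_const_mul]
    refine setIntegral_congr_fun (Pb.chart J).open_target.measurableSet fun w hw => ?_
    have hws := (Pb.chart J).map_target hw
    have hTw : T J ((Pb.chart J).symm w) = ψ w := by
      rw [hT]
      simp only
      rw [Pb.isCocycle_coAd.transport_self hws, (Pb.chart J).right_inv hw]
    simp only [hcv, hB, hTw]
    ring
  have hres : ∀ s ∈ range D.q, T (Pb.idx s) s (residue Pb.toHolAtlas (Pb.idx s) s
      fun x => F.gaugeAt (Pb.idx s) x u v) = if s ∈ (Pb.chart J).source then
        ψ (Pb.chart J s) (residue Pb.toHolAtlas J s fun x => F.gaugeAt J x u v) else 0 := by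
    intro s hs
    split_ifs with hsJ
    · rw [hT]
      simp only
      rw [transport_of_mem hsJ, hF.residue_trans hs (Pb.mem_idx s) hsJ, map_smul, smul_apply,
        smul_apply, coAdL_apply, coAd_apply, Ad_inv_Ad, smul_smul,
        Pb.toHolAtlas.jac_mul_symm hsJ (Pb.mem_idx s), one_smul]
    · rw [hT]
      simp only
      rw [transport_of_notMem hsJ, zero_apply]
  rw [hF.curvatureDist_eq hψ, bfTerm, bfTerm, ← mul_sub, add_sub_add_comm, hsub, hint,
    finsum_mem_eq_finite_toFinset_sum _ (finite_range D.q),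
    finsum_mem_eq_finite_toFinset_sum _ (finite_range D.q), ← Finset.sum_sub_distrib]
  have hsum : ∑ s ∈ (finite_range D.q).toFinset, (-(2 * Real.pi * Complex.I) *
      (F.vary (MixedBF.higgsVariation Pb F J ψ χ) ε).B (Pb.idx s) s u
      (residue Pb.toHolAtlas (Pb.idx s) s fun x =>
        (F.vary (MixedBF.higgsVariation Pb F J ψ χ) ε).gaugeAt (Pb.idx s) x u v) -
      -(2 * Real.pi * Complex.I) * F.B (Pb.idx s) s u
      (residue Pb.toHolAtlas (Pb.idx s) s fun x => F.gaugeAt (Pb.idx s) x u v)) =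
      (ε * χ u : ℝ) * (-(2 * Real.pi * Complex.I) * ∑ s ∈ (finite_range D.q).toFinset,
        if s ∈ (Pb.chart J).source then
        ψ (Pb.chart J s) (residue Pb.toHolAtlas J s fun x => F.gaugeAt J x u v) else 0) := by
    rw [Finset.mul_sum, Finset.mul_sum]
    refine Finset.sum_congr rfl fun s hs => ?_
    rw [← hres s ((finite_range D.q).mem_toFinset.1 hs)]
    simp only [gaugeAt, hge, hB]
    ring
  rw [hsum]
  ring

open Classical in
theorem Fields.Admissible.H_trans (hF : F.Admissible Pb D) {i : Fin n}
    (hI : D.q i ∈ (Pb.chart I).source) (u : Fin n → ℝ) (ψ : ℂ → StrongDual ℂ E) :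
    D.comp Pb.toHolAtlas i I ^ (D.d i + 1) * transport Pb.toHolAtlas (fun I J x => Pb.jac I J x •
        (coAdL (Pb.g I J x) : StrongDual ℂ E →L[ℂ] StrongDual ℂ E)) J ψ I (D.q i)
        (grad (D.P i) (F.B I (D.q i) u)) =
      if D.q i ∈ (Pb.chart J).source then D.comp Pb.toHolAtlas i J ^ (D.d i + 1) *
          ψ (Pb.chart J (D.q i)) (grad (D.P i) (F.B J (D.q i) u)) else 0 := by
  split_ifs with h
  · rw [transport_of_mem h, hF.B_trans I J _ hI h (D.q_notMem i),
      grad_smul (D.P_hom i) (Pb.toHolAtlas.jac_ne_zero hI h), grad_coAd (D.P_inv i),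
      D.comp_trans Pb.toHolAtlas i hI h, map_smul, smul_apply, smul_apply, coAdL_apply, coAd_apply,
      Ad_inv_Ad, mul_pow, pow_succ (Pb.jac I J (D.q i))]
    simp only [smul_eq_mul]
    ring
  · rw [transport_of_notMem h, zero_apply, mul_zero]

open Classical in
/-- The equation obtained by varying `B`. -/
theorem Fields.Critical.curvature (hC : F.Critical Pb ρ D)
    (hρ : ρ.IsSubordinate (fun I => (Pb.chart I).source)) (hF : F.Admissible Pb D)
    (hv : v ≠ 0) (u : Fin n → ℝ) (hψ : IsTest (Pb.chart J).target ψ) :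
    F.curvatureDist Pb.toHolAtlas J u v ψ = 2 * Real.pi * Complex.I *
      ∑ i, (if D.q i ∈ (Pb.chart J).source then D.comp Pb.toHolAtlas i J ^ (D.d i + 1) *
        ψ (Pb.chart J (D.q i)) (grad (D.P i) (F.B J (D.q i) u)) else 0) *
        ((fderiv ℝ F.t u v i : ℝ) : ℂ) := by
  set T := fun i => transport Pb.toHolAtlas (fun I J x => Pb.jac I J x •
    (coAdL (Pb.g I J x) : StrongDual ℂ E →L[ℂ] StrongDual ℂ E)) J ψ (Pb.idx (D.q i)) (D.q i)
    with hT
  set b : Fin n → (Fin n → ℝ) → StrongDual ℂ E := fun i u => F.B (Pb.idx (D.q i)) (D.q i) u with hb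
  set κ : Fin n → ℂ := fun i => D.comp Pb.toHolAtlas i (Pb.idx (D.q i)) ^ (D.d i + 1) with hκ
  set R : (Fin n → ℝ) → ℂ := fun u => F.curvatureDist Pb.toHolAtlas J u v ψ with hR
  have hRc : Continuous R := hF.continuous_curvatureDist hψ v
  have hbc : ∀ i, Continuous (b i) := fun i => (hF.B_smooth.contDiff_time
    (finite_range D.p).isClosed (Pb.mem_idx (D.q i)) (D.q_notMem i)).continuous
  have htc : ∀ i, Continuous fun u => ((fderiv ℝ F.t u v i : ℝ) : ℂ) := fun i =>
    Complex.continuous_ofReal.comp ((continuous_apply i).comp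
      ((hF.t_smooth.continuous_fderiv (by simp)).clm_apply continuous_const))
  have hgc : ∀ i, Continuous fun φ : StrongDual ℂ E => grad (D.P i) φ := fun i =>
    (contDiff_grad_real (D.P i)).continuous
  have hPc : ∀ i, Continuous fun φ : StrongDual ℂ E => polyEval (D.P i) φ := fun i =>
    (contDiff_polyEval (D.P i)).continuous
  suffices hk : (1 / (2 * Real.pi * Complex.I)) * R u -
      ∑ i, κ i * T i (grad (D.P i) (b i u)) * ((fderiv ℝ F.t u v i : ℝ) : ℂ) = 0 by
    have hpi : (2 * Real.pi * Complex.I : ℂ) ≠ 0 := Complex.two_pi_I_ne_zero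
    have hs : ∑ i, κ i * T i (grad (D.P i) (b i u)) * ((fderiv ℝ F.t u v i : ℝ) : ℂ) =
      ∑ i, (if D.q i ∈ (Pb.chart J).source then D.comp Pb.toHolAtlas i J ^ (D.d i + 1) *
        ψ (Pb.chart J (D.q i)) (grad (D.P i) (F.B J (D.q i) u)) else 0) *
        ((fderiv ℝ F.t u v i : ℝ) : ℂ) :=
      Finset.sum_congr rfl fun i _ => by rw [← hF.H_trans (Pb.mem_idx (D.q i)) u ψ]
    rw [← hs, ← sub_eq_zero.1 hk]
    change R u = _
    field_simp
  set k : ℝ → ℂ := fun τ => (1 / (2 * Real.pi * Complex.I)) * R (u + τ • v) -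
    ∑ i, κ i * T i (grad (D.P i) (b i (u + τ • v))) * ((fderiv ℝ F.t (u + τ • v) v i : ℝ) : ℂ)
    with hkdef
  have hl : Continuous fun τ : ℝ => u + τ • v := by fun_prop
  have hkc : Continuous k :=
    (continuous_const.mul (hRc.comp hl)).sub (continuous_finsetSum _ fun i _ =>
      ((continuous_const.mul ((T i).continuous.comp ((hgc i).comp ((hbc i).comp hl)))).mul
        ((htc i).comp hl)))
  have key := eq_zero_of_integral_test hkc (fun g hg hgs => ?_) 0
  · simpa [hkdef] using key
  obtain ⟨χ, hχ, hχc, h1, -⟩ := exists_extend_line u hv hg hgs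
  have hδ := hF.higgsVariation hψ hχ hχc
  have h3 := hC.integral_deriv_eq_zero hF hδ u hv
    (a := fun ε τ => (ε * g τ : ℝ) * ((1 / (2 * Real.pi * Complex.I)) * R (u + τ • v)) -
      ∑ i, κ i * (polyEval (D.P i) (b i (u + τ • v) + (ε * g τ) • T i) -
        polyEval (D.P i) (b i (u + τ • v))) * ((fderiv ℝ F.t (u + τ • v) v i : ℝ) : ℂ))
    (a' := fun ε τ => (g τ : ℂ) * ((1 / (2 * Real.pi * Complex.I)) * R (u + τ • v)) -
      ∑ i, κ i * ((g τ : ℂ) * T i (grad (D.P i) (b i (u + τ • v) + (ε * g τ) • T i))) *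
        ((fderiv ℝ F.t (u + τ • v) v i : ℝ) : ℂ)) (K := tsupport g) ?_ ?_ ?_ hgs ?_ ?_
  · rw [← h3]
    refine integral_congr_ae (Eventually.of_forall fun τ => ?_)
    simp only [zero_mul, hkdef, Complex.real_smul, mul_sub, Finset.mul_sum]
    congr 1
    refine Finset.sum_congr rfl fun i _ => ?_
    have h4 : b i (u + τ • v) + (0 : ℝ) • T i = b i (u + τ • v) := by
      ext Y
      change b i (u + τ • v) Y + (0 : ℝ) • T i Y = b i (u + τ • v) Y
      rw [zero_smul, add_zero]
    rw [h4]
    ring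
  · intro ε
    have hg1 : Continuous fun τ => ε * g τ := continuous_const.mul hg.continuous
    exact ((Complex.continuous_ofReal.comp hg1).mul (continuous_const.mul (hRc.comp hl))).sub
      (continuous_finsetSum _ fun i _ => (continuous_const.mul
        (((hPc i).comp (((hbc i).comp hl).add (hg1.smul continuous_const))).sub
        ((hPc i).comp ((hbc i).comp hl)))).mul ((htc i).comp hl))
  · have hl2 : Continuous fun y : ℝ × ℝ => u + y.2 • v := by fun_prop
    have hg2 : Continuous fun y : ℝ × ℝ => (g y.2 : ℂ) :=
      Complex.continuous_ofReal.comp (hg.continuous.comp continuous_snd)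
    have hg1 : Continuous fun y : ℝ × ℝ => y.1 * g y.2 :=
      continuous_fst.mul (hg.continuous.comp continuous_snd)
    exact (hg2.mul (continuous_const.mul (hRc.comp hl2))).sub
      (continuous_finsetSum _ fun i _ => (continuous_const.mul
        (hg2.mul ((T i).continuous.comp ((hgc i).comp
        (((hbc i).comp hl2).add (hg1.smul continuous_const)))))).mul ((htc i).comp hl2))
  · intro ε τ
    have hlin : HasDerivAt (fun e : ℝ => e * g τ) (g τ) ε := by
      simpa using (hasDerivAt_id ε).mul_const (g τ)
    have hP : ∀ i, HasDerivAt (fun e : ℝ => polyEval (D.P i) (b i (u + τ • v) + (e * g τ) • T i))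
        ((g τ : ℂ) * T i (grad (D.P i) (b i (u + τ • v) + (ε * g τ) • T i))) ε := fun i => by
      have e1 : HasDerivAt (fun e : ℝ => b i (u + τ • v) + (e * g τ) • T i) (g τ • T i) ε :=
        (hlin.smul_const (T i)).const_add _
      have e2 := ((hasFDerivAt_polyEval (D.P i)
        (b i (u + τ • v) + (ε * g τ) • T i)).restrictScalars ℝ).comp_hasDerivAt ε e1
      refine HasDerivAt.congr_deriv e2 ?_
      change g τ • T i (grad (D.P i) (b i (u + τ • v) + (ε * g τ) • T i)) = _
      rw [Complex.real_smul]
    refine HasDerivAt.sub ?_ (HasDerivAt.fun_sum fun i _ => ?_)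
    · exact hlin.ofReal_comp.mul_const _
    · exact (((hP i).sub_const _).const_mul (κ i)).mul_const _
  · intro ε τ hτ
    have hg0 : g τ = 0 := image_eq_zero_of_notMem_tsupport hτ
    have h4 : ∀ i, b i (u + τ • v) + (ε * g τ) • T i = b i (u + τ • v) := fun i => by
      ext Y
      change b i (u + τ • v) Y + (ε * g τ : ℝ) • T i Y = b i (u + τ • v) Y
      rw [hg0, mul_zero, zero_smul, add_zero]
    simp only [h4, sub_self, mul_zero, zero_mul, Finset.sum_const_zero]
    rw [hg0, mul_zero, Complex.ofReal_zero, zero_mul, sub_zero]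
  · intro ε τ
    have hte : (F.vary (higgsVariation Pb F J ψ χ) ε).t = F.t := vary_t_eq fun _ => rfl
    have hge : (F.vary (higgsVariation Pb F J ψ χ) ε).gauge = F.gauge :=
      vary_gauge_eq fun _ _ _ => rfl
    have hφe : (F.vary (higgsVariation Pb F J ψ χ) ε).φ = F.φ := rfl
    have hbf := hF.bfTerm_higgsVariation hρ hψ hχ hχc ε (u + τ • v) v
    have hH : ∀ i, (F.vary (higgsVariation Pb F J ψ χ) ε).H Pb.toHolAtlas D i (u + τ • v) =
        κ i * polyEval (D.P i) (b i (u + τ • v) + (ε * g τ) • T i) := fun i => by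
      rw [H, mul_smul, ← h1]
      rfl
    have hH' : ∀ i, F.H Pb.toHolAtlas D i (u + τ • v) = κ i * polyEval (D.P i) (b i (u + τ • v)) :=
      fun i => rfl
    have horb : (F.vary (higgsVariation Pb F J ψ χ) ε).orbitTerm Pb.toHolAtlas D (u + τ • v) v =
        F.orbitTerm Pb.toHolAtlas D (u + τ • v) v := by
      simp only [orbitTerm, gaugeAt, hge, hφe]
    rw [lagrangian, lagrangian, horb, hte]
    simp only [hH, hH', mul_sub, sub_mul, Finset.sum_sub_distrib]
    rw [h1] at hbf
    simp only [hR]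
    linear_combination hbf

end CurvatureEquation

end MixedBF

namespace MixedBF

section Jacobian

variable {ι C E G : Type*} [TopologicalSpace C] [ChartedSpace ℂ C]
  [NormedAddCommGroup E] [NormedSpace ℂ E] [TopologicalSpace G] [ChartedSpace E G] [Group G]
  {n N : ℕ} {F : Fields C ι E G n N} {u v : Fin n → ℝ}

theorem contDiff_det {X : Type*} [NormedAddCommGroup X] [NormedSpace ℝ X]
    {M : X → Matrix (Fin n) (Fin n) ℝ} (hM : ∀ i j, ContDiff ℝ ∞ fun x => M x i j) :
    ContDiff ℝ ∞ fun x => (M x).det := by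
  simp only [Matrix.det_apply']
  exact ContDiff.sum fun σ _ => contDiff_const.mul (contDiff_prod fun i _ => hM _ _)

theorem Fields.jacobian_mulVec (F : Fields C ι E G n N) (u v : Fin n → ℝ) :
    (F.jacobian u).mulVec v = fderiv ℝ F.t u v := by
  have h := LinearMap.pi_apply_eq_sum_univ (fderiv ℝ F.t u : (Fin n → ℝ) →ₗ[ℝ] (Fin n → ℝ)) v
  simp only [ContinuousLinearMap.coe_coe] at h
  rw [h]
  ext i
  rw [Matrix.mulVec, dotProduct, Finset.sum_apply]
  refine Finset.sum_congr rfl fun j _ => ?_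
  have e : (fun k => if j = k then (1 : ℝ) else 0) = Pi.single j 1 := by
    ext k; simp [Pi.single_apply, eq_comm]
  rw [e, Pi.smul_apply, smul_eq_mul, mul_comm]
  rfl

theorem Fields.fderiv_timeVec (h : IsUnit (F.jacobian u).det) (i k : Fin n) :
    fderiv ℝ F.t u (F.timeVec u i) k = if k = i then 1 else 0 := by
  rw [← F.jacobian_mulVec, ← Matrix.one_apply, ← Matrix.mul_nonsing_inv _ h]
  rfl

theorem Fields.timeVec_ne_zero (h : IsUnit (F.jacobian u).det) (i : Fin n) :
    F.timeVec u i ≠ 0 := fun h0 => by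
  have h1 := fderiv_timeVec h i i
  simp [h0] at h1

theorem Fields.contDiff_timeVec (ht : ContDiff ℝ ∞ F.t) (h : ∀ u, IsUnit (F.jacobian u).det)
    (i : Fin n) : ContDiff ℝ ∞ fun u => F.timeVec u i := by
  have hJ : ∀ k j, ContDiff ℝ ∞ fun u => F.jacobian u k j := fun k j =>
    contDiff_pi.1 ((ht.fderiv_right (m := ∞) (by simp)).clm_apply contDiff_const) k
  refine contDiff_pi.2 fun j => ?_
  have e : (fun u => F.timeVec u i j) =
      fun u => ((F.jacobian u).det)⁻¹ * (F.jacobian u).adjugate j i := by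
    ext u
    rw [timeVec, Matrix.inv_def, Matrix.smul_apply, Ring.inverse_eq_inv', smul_eq_mul]
  rw [e]
  refine ((contDiff_det hJ).inv fun u => (h u).ne_zero).mul ?_
  simp only [Matrix.adjugate_apply]
  refine contDiff_det fun k l => ?_
  simp only [Matrix.updateRow_apply]
  split_ifs
  · exact contDiff_const
  · exact hJ k l

/-- The vector fields `∂_{t^i}` commute. -/
theorem Fields.fderiv_timeVec_comm (ht : ContDiff ℝ ∞ F.t)
    (h : ∀ u, IsUnit (F.jacobian u).det) (u : Fin n → ℝ) (i j : Fin n) :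
    fderiv ℝ (fun u => F.timeVec u j) u (F.timeVec u i) =
      fderiv ℝ (fun u => F.timeVec u i) u (F.timeVec u j) := by
  have hd : ∀ i j, fderiv ℝ (fderiv ℝ F.t) u (F.timeVec u i) (F.timeVec u j) +
      fderiv ℝ F.t u (fderiv ℝ (fun u => F.timeVec u j) u (F.timeVec u i)) = 0 := fun i j => by
    have h1 : HasFDerivAt (fun u => fderiv ℝ F.t u (F.timeVec u j)) _ u :=
      (((ht.fderiv_right (m := ∞) (by simp)).differentiable (by simp)) u).hasFDerivAt.clm_apply
      (((contDiff_timeVec ht h j).differentiable (by simp)) u).hasFDerivAt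
    have h2 : (fun u => fderiv ℝ F.t u (F.timeVec u j)) = fun _ => Pi.single j 1 := by
      ext u k
      rw [fderiv_timeVec (h u), Pi.single_apply]
    rw [h2] at h1
    have h3 := congrArg (fun L : (Fin n → ℝ) →L[ℝ] (Fin n → ℝ) => L (F.timeVec u i))
      (h1.unique (hasFDerivAt_const _ u))
    simp only [add_apply, ContinuousLinearMap.comp_apply, ContinuousLinearMap.flip_apply,
      zero_apply] at h3
    rw [add_comm]
    exact h3
  have hs : fderiv ℝ (fderiv ℝ F.t) u (F.timeVec u i) (F.timeVec u j) =
      fderiv ℝ (fderiv ℝ F.t) u (F.timeVec u j) (F.timeVec u i) :=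
    (ht.contDiffAt.isSymmSndFDerivAt (by
      rw [minSmoothness_of_isRCLikeNormedField]; exact ENat.LEInfty.out)).eq _ _
  have h4 := hd i j
  rw [hs, ← hd j i, add_right_inj, ← F.jacobian_mulVec, ← F.jacobian_mulVec] at h4
  exact Matrix.mulVec_injective_iff_isUnit.2 ((Matrix.isUnit_iff_isUnit_det _).2 (h u)) h4

end Jacobian

section LocalEquations

variable {C ι E G : Type*} [TopologicalSpace C] [T2Space C] [CompactSpace C] [ChartedSpace ℂ C]
  [IsManifold 𝓘(ℂ) ω C]
  [NormedAddCommGroup E] [NormedSpace ℂ E] [FiniteDimensional ℂ E]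
  [TopologicalSpace G] [ChartedSpace E G] [Group G] [LieGroup 𝓘(ℂ, E) ω G]
  {n N : ℕ} {Pb : PBundle C ι E G} {ρ : PartitionOfUnity ι C}
  {D : Defects C E G n N} {F : Fields C ι E G n N}

theorem Fields.GaugedUnivariational.isUnit_det_jacobian (hU : F.GaugedUnivariational Pb ρ D)
    (hρ : ρ.IsSubordinate (fun I => (Pb.chart I).source)) (hF : F.Admissible Pb D)
    (u : Fin n → ℝ) : IsUnit (F.jacobian u).det := by
  rw [isUnit_iff_ne_zero]
  intro h0
  obtain ⟨v, hv, h⟩ := Matrix.exists_mulVec_eq_zero_iff.2 h0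
  rw [F.jacobian_mulVec] at h
  refine hv (hU.nondegenerate u v (fun I x hx hxp hxq => hU.critical.lax hρ hF hv u hx hxp hxq)
    (fun I ψ hψ => ?_) (fun α I hI => hU.critical.orbit hF hv u hI) h)
  rw [hU.critical.curvature hρ hF hv u hψ]
  simp [h]

theorem Fields.GaugedUnivariational.localEquations (hU : F.GaugedUnivariational Pb ρ D)
    (hρ : ρ.IsSubordinate (fun I => (Pb.chart I).source)) (hF : F.Admissible Pb D) (hn : 1 ≤ n)
    (I : ι) : F.LocalEquations Pb.toHolAtlas D I univ := by
  have hJ := hU.isUnit_det_jacobian hρ hF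
  have ht : Pb.chart I '' ((Pb.chart I).source ∩ univ) = (Pb.chart I).target := by
    rw [inter_univ, (Pb.chart I).image_source_eq_target]
  constructor
  · intro u i ψ hψ
    rw [ht] at hψ
    rw [hU.critical.curvature hρ hF (timeVec_ne_zero (hJ u) i) u hψ]
    simp only [fderiv_timeVec (hJ u)]
    rw [Finset.sum_eq_single i (fun k _ hk => by simp [hk]) (by simp)]
    rw [if_pos rfl, Complex.ofReal_one, mul_one]
    split_ifs
    · ring
    · rw [mul_zero]
  · intro u X hX
    rw [ht] at hX
    exact hU.critical.moment hρ hF (timeVec_ne_zero (hJ u) ⟨0, hn⟩) u hX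
  · intro u j x hx hxp hxq
    exact hU.critical.lax hρ hF (timeVec_ne_zero (hJ u) j) u hx.1 hxp hxq
  · intro u i j
    exact hU.critical.conservation hF (timeVec_ne_zero (hJ u) j) u i
  · intro u j α hα
    exact hU.critical.orbit hF (timeVec_ne_zero (hJ u) j) u hα.1

end LocalEquations

end MixedBF

namespace MixedBF

section RemovableSingularities

variable {V : Type*} [NormedAddCommGroup V] [NormedSpace ℂ V]

theorem ContinuousAt.eq_of_eventuallyEq_nhdsNE {X Y : Type*} [TopologicalSpace X]
    [TopologicalSpace Y] [T2Space Y] {f g : X → Y} {s : X} [(𝓝[≠] s).NeBot]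
    (hf : ContinuousAt f s) (hg : ContinuousAt g s) (h : f =ᶠ[𝓝[≠] s] g) : f s = g s :=
  tendsto_nhds_unique_of_eventuallyEq (hf.mono_left nhdsWithin_le_nhds)
    (hg.mono_left nhdsWithin_le_nhds) h

/-- The order of a pole of a solution of a `∂̄`-equation decreases if the solution is bounded. -/
theorem exists_contDiffOn_of_pow_succ_smul [CompleteSpace V] {U : Set ℂ} (hU : IsOpen U) {s : ℂ}
    (hs : s ∈ U) {k X : ℂ → V} {L : ℂ → V →L[ℂ] V} (r : ℕ) (hk : ContDiffOn ℝ ∞ k U)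
    (hkX : ∀ z ∈ U, z ≠ s → k z = (z - s) ^ (r + 1) • X z)
    (hX : ∀ z ∈ U, z ≠ s → DifferentiableAt ℝ X z) (hL : ContDiffOn ℝ ∞ L U)
    (hd : ∀ z ∈ U, z ≠ s → dbar X z = L z (X z)) (hb : X =O[𝓝[≠] s] (fun _ => (1 : ℝ))) :
    ∃ m : ℂ → V, ContDiffOn ℝ ∞ m U ∧ ∀ z ∈ U, z ≠ s → m z = (z - s) ^ r • X z := by
  have hUs : ∀ z ∈ U, z ≠ s → ∀ᶠ y in 𝓝 z, y ∈ U ∧ y ≠ s := fun z hz hzs =>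
    Filter.Eventually.and (hU.mem_nhds hz) (isOpen_ne.mem_nhds hzs)
  have hne : ∀ᶠ z in 𝓝[≠] s, z ∈ U ∧ z ≠ s :=
    Filter.Eventually.and (nhdsWithin_le_nhds (hU.mem_nhds hs)) self_mem_nhdsWithin
  have hd' : ∀ z ∈ U, z ≠ s → dbar k z = L z (k z) := fun z hz hzs => by
    have h1 : k =ᶠ[𝓝 z] fun y => (y - s) ^ (r + 1) • X y :=
      (hUs z hz hzs).mono fun y hy => hkX y hy.1 hy.2
    rw [Filter.EventuallyEq.dbar_eq h1, dbar_holomorphic_smul (by fun_prop) (hX z hz hzs),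
      hd z hz hzs, hkX z hz hzs, map_smul]
  have hkd : ContinuousAt (dbar k) s :=
    (ContDiffAt.dbar (hk.contDiffAt (hU.mem_nhds hs))).continuousAt
  have hkc : ContinuousAt k s := (hk.contDiffAt (hU.mem_nhds hs)).continuousAt
  have hds : dbar k s = L s (k s) := ContinuousAt.eq_of_eventuallyEq_nhdsNE hkd
    ((hL.contDiffAt (hU.mem_nhds hs)).continuousAt.clm_apply hkc)
    (hne.mono fun z hz => hd' z hz.1 hz.2)
  have h0 : k s = 0 := by
    refine tendsto_nhds_unique (hkc.mono_left nhdsWithin_le_nhds) (l := 𝓝[≠] s)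
      (Tendsto.congr' (hne.mono fun z hz => (hkX z hz.1 hz.2).symm) ?_)
    have h1 : Tendsto (fun z : ℂ => (z - s) ^ (r + 1)) (𝓝[≠] s) (𝓝 0) := by
      have : Continuous fun z : ℂ => (z - s) ^ (r + 1) := by fun_prop
      simpa using (this.tendsto s).mono_left nhdsWithin_le_nhds
    exact h1.zero_smul_isBoundedUnder_le ((Asymptotics.isBigO_one_iff ℝ).1 hb)
  obtain ⟨m, hm, hkm⟩ := exists_eq_sub_smul_of_dbar_eq hU hs hk hL (fun z hz => by
    rcases eq_or_ne z s with rfl | hzs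
    · exact hds
    · exact hd' z hz hzs) h0
  refine ⟨m, hm, fun z hz hzs => ?_⟩
  have h2 := hkX z hz hzs
  rw [hkm, pow_succ', mul_smul] at h2
  exact smul_right_injective V (sub_ne_zero.2 hzs) h2

theorem isBigO_one_inv_smul {W : Type*} [NormedAddCommGroup W] [NormedSpace ℂ W] {n : ℂ → W}
    {s : ℂ} (hn : DifferentiableAt ℝ n s) (h0 : n s = 0) :
    (fun z => (z - s)⁻¹ • n z) =O[𝓝[≠] s] (fun _ => (1 : ℝ)) := by
  have h1 : n =O[𝓝 s] fun z => z - s := by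
    simpa [h0] using hn.isBigO_sub
  have h2 := ((Asymptotics.isBigO_refl (fun z : ℂ => (z - s)⁻¹) (𝓝[≠] s)).smul
    (h1.mono (nhdsWithin_le_nhds : 𝓝[≠] s ≤ 𝓝 s)))
  refine h2.trans ?_
  refine Asymptotics.IsBigO.of_bound 1 (Eventually.of_forall fun z => ?_)
  simp only [smul_eq_mul, norm_mul, norm_inv, norm_one, mul_one]
  exact inv_mul_le_one

end RemovableSingularities

section PointwiseCurvature

variable {C ι E G : Type*} [TopologicalSpace C] [T2Space C] [CompactSpace C] [ChartedSpace ℂ C]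
  [IsManifold 𝓘(ℂ) ω C]
  [NormedAddCommGroup E] [NormedSpace ℂ E] [FiniteDimensional ℂ E]
  [TopologicalSpace G] [ChartedSpace E G] [Group G] [LieGroup 𝓘(ℂ, E) ω G]
  {n N : ℕ} {Pb : PBundle C ι E G} {ρ : PartitionOfUnity ι C}
  {D : Defects C E G n N} {F : Fields C ι E G n N}
  {I : ι} {x : C} {u v : Fin n → ℝ}

theorem isTest_smul_const {T : Set ℂ} {V : Type*} [NormedAddCommGroup V] [NormedSpace ℂ V]
    {g : ℂ → ℝ} (hg : ContDiff ℝ ∞ g) (hgc : HasCompactSupport g) (hgT : tsupport g ⊆ T) (c : V) :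
    IsTest T fun w => g w • c :=
  ⟨hg.smul contDiff_const, hgc.smul_right, (tsupport_smul_subset_left g fun _ => c).trans hgT⟩

open Classical in
/-- The curvature vanishes off the poles of the gauge field. -/
theorem Fields.Critical.curvature_eq_zero (hC : F.Critical Pb ρ D)
    (hρ : ρ.IsSubordinate (fun I => (Pb.chart I).source)) (hF : F.Admissible Pb D)
    (hv : v ≠ 0) (u : Fin n → ℝ) (hx : x ∈ (Pb.chart I).source) (hxq : x ∉ range D.q) :
    F.curvature Pb.toHolAtlas u v I x = 0 := by
  refine dual_separates fun φ => ?_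
  set K : ℂ → E := fun w => F.curvature Pb.toHolAtlas u v I ((Pb.chart I).symm w) with hK
  have ho : IsOpen ((Pb.chart I).target ∩ (Pb.chart I).symm ⁻¹' (range D.q)ᶜ) :=
    (Pb.chart I).isOpen_inter_preimage_symm (finite_range D.q).isClosed.isOpen_compl
  have hc : ContinuousOn K ((Pb.chart I).target ∩ (Pb.chart I).symm ⁻¹' (range D.q)ᶜ) :=
    (hF.curvature_mild u v I).1.mono fun w hw => ⟨hw.1, fun h => hw.2 h.2⟩
  have key := eqOn_zero_of_integral_test ho (f := fun w => φ (K w))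
    (φ.continuous.comp_continuousOn hc) (fun g hg hgc hgT => ?_)
    (w := Pb.chart I x) ⟨(Pb.chart I).map_source hx, by simpa [(Pb.chart I).left_inv hx] using hxq⟩
  · simpa [hK, (Pb.chart I).left_inv hx] using key
  have hψ := isTest_smul_const hg hgc (hgT.trans inter_subset_left) φ
  have h1 := hC.curvature hρ hF hv u hψ
  have hz : ∀ s ∈ range D.q, s ∈ (Pb.chart I).source → g (Pb.chart I s) = 0 := fun s hs hsI => by
    refine image_eq_zero_of_notMem_tsupport fun hgs => (hgT hgs).2 ?_
    rwa [(Pb.chart I).left_inv hsI]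
  have hz' : ∀ s ∈ range D.q, s ∈ (Pb.chart I).source → ∀ Y, (g (Pb.chart I s) • φ) Y = 0 :=
    fun s hs hsI Y => by
      rw [hz s hs hsI]
      exact zero_smul ℝ (φ Y)
  rw [hF.curvatureDist_eq hψ, Finset.sum_eq_zero, mul_zero, sub_zero, Finset.sum_eq_zero, mul_zero,
    integral_const_mul] at h1
  · have h2 := (mul_eq_zero.1 h1).resolve_left (by simp)
    rw [← h2]
    refine (setIntegral_eq_integral_of_forall_compl_eq_zero fun w hw => ?_).symm
    have h3 : g w = 0 := image_eq_zero_of_notMem_tsupport fun h => hw (hgT h).1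
    rw [h3, zero_smul]
  · intro i _
    split_ifs with h
    · rw [hz' _ (mem_range_self i) h, mul_zero, zero_mul]
    · rw [zero_mul]
  · intro s hs
    split_ifs with h
    · exact hz' s ((finite_range D.q).mem_toFinset.1 hs) h _
    · rfl

open Classical in
/-- The residues of the gauge field. -/
theorem Fields.Critical.residue_gaugeAt (hC : F.Critical Pb ρ D)
    (hρ : ρ.IsSubordinate (fun I => (Pb.chart I).source)) (hF : F.Admissible Pb D)
    (hv : v ≠ 0) (u : Fin n → ℝ) (hx : x ∈ (Pb.chart I).source) (hxq : x ∈ range D.q) :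
    residue Pb.toHolAtlas I x (fun y => F.gaugeAt I y u v) =
      -∑ i, ((fderiv ℝ F.t u v i : ℝ) : ℂ) • (if D.q i = x then
        D.comp Pb.toHolAtlas i I ^ (D.d i + 1) else 0) • grad (D.P i) (F.B I x u) := by
  rw [← sub_eq_zero]
  refine dual_separates fun φ => ?_
  have hq := finite_range D.q
  have ho : IsOpen ((Pb.chart I).target ∩ (Pb.chart I).symm ⁻¹' (range D.q \ {x})ᶜ) :=
    (Pb.chart I).isOpen_inter_preimage_symm (hq.subset sdiff_subset).isClosed.isOpen_compl
  obtain ⟨g, hg, hgc, hgT, hg1⟩ := exists_bump (ho.mem_nhds (x := Pb.chart I x)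
    ⟨(Pb.chart I).map_source hx, by simp [(Pb.chart I).left_inv hx]⟩)
  have hψ := isTest_smul_const hg hgc (hgT.trans inter_subset_left) φ
  have h1 := hC.curvature hρ hF hv u hψ
  have hz : ∀ s ∈ range D.q, s ∈ (Pb.chart I).source → ∀ Y, (g (Pb.chart I s) • φ) Y =
      if s = x then φ Y else 0 := fun s hs hsI Y => by
    split_ifs with h
    · rw [h, hg1.self_of_nhds]
      exact one_smul ℝ (φ Y)
    · have : g (Pb.chart I s) = 0 := by
        refine image_eq_zero_of_notMem_tsupport fun hgs => (hgT hgs).2 ?_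
        rw [(Pb.chart I).left_inv hsI]
        exact ⟨hs, h⟩
      rw [this]
      exact zero_smul ℝ (φ Y)
  rw [hF.curvatureDist_eq hψ, integral_eq_zero_of_ae, zero_sub, Finset.sum_eq_single x] at h1
  · rw [if_pos hx, hz x hxq hx, if_pos rfl, ← mul_neg] at h1
    have h2 := mul_left_cancel₀ Complex.two_pi_I_ne_zero h1
    rw [sub_neg_eq_add, map_add, map_zero, add_eq_zero_iff_neg_eq, h2, map_sum]
    refine Finset.sum_congr rfl fun i _ => ?_
    rw [map_smul, map_smul, smul_eq_mul, smul_eq_mul, mul_comm]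
    congr 1
    by_cases h : D.q i = x
    · rw [if_pos h, if_pos (h ▸ hx), hz _ (mem_range_self i) (h ▸ hx), if_pos h, h]
    · rw [if_neg h, zero_mul]
      split_ifs with h'
      · rw [hz _ (mem_range_self i) h', if_neg h, mul_zero]
      · rfl
  · intro s hs hsx
    split_ifs with h
    · rw [hz s ((finite_range D.q).mem_toFinset.1 hs) h, if_neg hsx]
    · rfl
  · intro h
    exact absurd (hq.mem_toFinset.2 hxq) h
  · filter_upwards [ae_notMem_finite (Pb.toHolAtlas.finite_preimage hq I),
      ae_restrict_mem (Pb.chart I).open_target.measurableSet] with w hw hwT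
    rw [hC.curvature_eq_zero hρ hF hv u ((Pb.chart I).map_target hwT) fun h => hw ⟨hwT, h⟩]
    simp

end PointwiseCurvature

end MixedBF

namespace MixedBF

section Commutation

variable {V X : Type*} [NormedAddCommGroup V] [NormedSpace ℂ V] [NormedAddCommGroup X]
  [NormedSpace ℝ X]

theorem fderiv_dbar_comm {Φ : ℂ × X → V} {w : ℂ} {u : X} (h : ContDiffAt ℝ ∞ Φ (w, u)) (v : X) :
    fderiv ℝ (fun u => dbar (fun w => Φ (w, u)) w) u v =
      dbar (fun w => fderiv ℝ (fun u => Φ (w, u)) u v) w := by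
  have hev : ∀ᶠ y in 𝓝 (w, u), DifferentiableAt ℝ Φ y :=
    ((h.of_le (m := 1) (by simp)).eventually (by simp)).mono fun y hy =>
      hy.differentiableAt (by simp)
  have h2 : HasFDerivAt (fderiv ℝ Φ) (fderiv ℝ (fderiv ℝ Φ) (w, u)) (w, u) :=
    ((h.fderiv_right (m := ∞) (by simp)).differentiableAt (by simp)).hasFDerivAt
  have hl : HasFDerivAt (fun w : ℂ => (w, u)) (ContinuousLinearMap.inl ℝ ℂ X) w :=
    hasFDerivAt_prodMk_left w u
  have hr : HasFDerivAt (fun u : X => (w, u)) (ContinuousLinearMap.inr ℝ ℂ X) u :=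
    hasFDerivAt_prodMk_right w u
  have e1 : (fun u => dbar (fun w => Φ (w, u)) w) =ᶠ[𝓝 u] fun u =>
      (1 / 2 : ℂ) • (fderiv ℝ Φ (w, u) (1, 0) + Complex.I • fderiv ℝ Φ (w, u) (Complex.I, 0)) := by
    filter_upwards [hr.continuousAt.eventually hev] with y hy
    have h3 : HasFDerivAt (fun w => Φ (w, y)) _ w :=
      hy.hasFDerivAt.comp w (hasFDerivAt_prodMk_left w y)
    rw [HasFDerivAt.dbar_eq h3]
    rfl
  have e2 : (fun w => fderiv ℝ (fun u => Φ (w, u)) u v) =ᶠ[𝓝 w] fun w =>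
      fderiv ℝ Φ (w, u) (0, v) := by
    filter_upwards [hl.continuousAt.eventually hev] with y hy
    have h3 : HasFDerivAt (fun u => Φ (y, u)) _ u :=
      hy.hasFDerivAt.comp u (hasFDerivAt_prodMk_right y u)
    rw [h3.fderiv]
    rfl
  have d1 : ∀ a : ℂ × X, HasFDerivAt (fun u => fderiv ℝ Φ (w, u) a) _ u := fun a =>
    (h2.comp u hr).clm_apply (hasFDerivAt_const a u)
  have d2 : HasFDerivAt (fun w => fderiv ℝ Φ (w, u) (0, v)) _ w :=
    (h2.comp w hl).clm_apply (hasFDerivAt_const ((0 : ℂ), v) w)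
  have d3 := ((d1 (1, 0)).add ((d1 (Complex.I, 0)).const_smul Complex.I)).const_smul (1 / 2 : ℂ)
  have d4 : HasFDerivAt (fun u => (1 / 2 : ℂ) • (fderiv ℝ Φ (w, u) (1, 0) +
    Complex.I • fderiv ℝ Φ (w, u) (Complex.I, 0))) _ u := d3
  have hs : ∀ a b, fderiv ℝ (fderiv ℝ Φ) (w, u) a b = fderiv ℝ (fderiv ℝ Φ) (w, u) b a :=
    fun a b => (h.isSymmSndFDerivAt (by
      rw [minSmoothness_of_isRCLikeNormedField]; exact ENat.LEInfty.out)).eq _ _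
  rw [e1.fderiv_eq, d4.fderiv, Filter.EventuallyEq.dbar_eq e2, HasFDerivAt.dbar_eq d2]
  simp only [dbarOf, smul_apply, add_apply, ContinuousLinearMap.comp_apply,
    ContinuousLinearMap.flip_apply, ContinuousLinearMap.inr_apply, ContinuousLinearMap.inl_apply,
    zero_apply, map_zero, zero_add]
  rw [hs (0, v), hs (0, v)]

end Commutation

section TimeCurvature

variable {C ι E G : Type*} [TopologicalSpace C] [T2Space C] [CompactSpace C] [ChartedSpace ℂ C]
  [IsManifold 𝓘(ℂ) ω C]
  [NormedAddCommGroup E] [NormedSpace ℂ E] [FiniteDimensional ℂ E]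
  [TopologicalSpace G] [ChartedSpace E G] [Group G] [LieGroup 𝓘(ℂ, E) ω G]
  {n N : ℕ} {Pb : PBundle C ι E G} {ρ : PartitionOfUnity ι C}
  {D : Defects C E G n N} {F : Fields C ι E G n N}
  {I J : ι} {x : C} {u v v' : Fin n → ℝ}

/-- The curvature `∂_v 𝒜_{v'} - ∂_{v'} 𝒜_v + [𝒜_v, 𝒜_{v'}]` of the gauge field. -/
def Fields.timeCurvature (F : Fields C ι E G n N) (I : ι) (x : C) (u v v' : Fin n → ℝ) : E :=
  fderiv ℝ (fun u => F.gaugeAt I x u v') u v - fderiv ℝ (fun u => F.gaugeAt I x u v) u v' +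
    bracket G (F.gaugeAt I x u v) (F.gaugeAt I x u v')

namespace Fields.Admissible

variable (hF : F.Admissible Pb D)
include hF

theorem gaugeAt_contDiff (hI : x ∈ (Pb.chart I).source) (hx : x ∉ range D.q) (v : Fin n → ℝ) :
    ContDiff ℝ ∞ fun u => F.gaugeAt I x u v :=
  (hF.gaugeAt_smooth (V := fun _ => v) contDiff_const).contDiff_time
    (finite_range D.q).isClosed hI hx

theorem fderiv_gaugeAt_trans (hI : x ∈ (Pb.chart I).source) (hJ : x ∈ (Pb.chart J).source)
    (hx : x ∉ range D.q) (u v v' : Fin n → ℝ) : fderiv ℝ (fun u => F.gaugeAt I x u v) u v' =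
      Ad (Pb.g I J x) (fderiv ℝ (fun u => F.gaugeAt J x u v) u v') := by
  have h1 : (fun u => F.gaugeAt I x u v) = fun u => ((Ad (Pb.g I J x) : E →L[ℂ] E).restrictScalars
    ℝ) (F.gaugeAt J x u v) := funext fun u => hF.gaugeAt_trans hI hJ hx u v
  have h2 := (ContinuousLinearMap.hasFDerivAt
    ((Ad (Pb.g I J x) : E →L[ℂ] E).restrictScalars ℝ)).comp u
    (((hF.gaugeAt_contDiff hJ hx v).differentiable (by simp)) u).hasFDerivAt
  have h3 : HasFDerivAt (fun u => ((Ad (Pb.g I J x) : E →L[ℂ] E).restrictScalars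
    ℝ) (F.gaugeAt J x u v)) _ u := h2
  rw [h1, h3.fderiv]
  rfl

theorem timeCurvature_trans (hI : x ∈ (Pb.chart I).source) (hJ : x ∈ (Pb.chart J).source)
    (hx : x ∉ range D.q) (u v v' : Fin n → ℝ) :
    F.timeCurvature I x u v v' = Ad (Pb.g I J x) (F.timeCurvature J x u v v') := by
  rw [timeCurvature, timeCurvature, hF.fderiv_gaugeAt_trans hI hJ hx,
    hF.fderiv_gaugeAt_trans hI hJ hx, hF.gaugeAt_trans hI hJ hx, hF.gaugeAt_trans hI hJ hx, map_add,
    map_sub, Ad_bracket]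

theorem fderiv_gaugeAt_smooth (v v' : Fin n → ℝ) : SmoothOff Pb.toHolAtlas (range D.q)
    (fun I x u => fderiv ℝ (fun u => F.gaugeAt I x u v) u v') :=
  (hF.gaugeAt_smooth (V := fun _ => v) contDiff_const).fderiv_time (finite_range D.q).isClosed
    (X := fun _ => v') contDiff_const

theorem timeCurvature_smooth (v v' : Fin n → ℝ) : SmoothOff Pb.toHolAtlas (range D.q)
    (fun I x u => F.timeCurvature I x u v v') := by
  have h1 := (hF.gaugeAt_smooth (V := fun _ => v) contDiff_const).continuousLinearMap (adL G)
  have h2 := h1.clm_apply (hF.gaugeAt_smooth (V := fun _ => v') contDiff_const)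
  intro I
  exact ((hF.fderiv_gaugeAt_smooth v' v I).sub (hF.fderiv_gaugeAt_smooth v v' I)).add (h2 I)

end Fields.Admissible

theorem fderiv_bilinear {V₁ V₂ V₃ : Type*} [NormedAddCommGroup V₁] [NormedSpace ℂ V₁]
    [NormedAddCommGroup V₂] [NormedSpace ℂ V₂] [NormedAddCommGroup V₃] [NormedSpace ℂ V₃]
    (T : V₁ →L[ℂ] V₂ →L[ℂ] V₃) {f : (Fin n → ℝ) → V₁} {g : (Fin n → ℝ) → V₂}
    (hf : DifferentiableAt ℝ f u) (hg : DifferentiableAt ℝ g u) (v : Fin n → ℝ) :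
    fderiv ℝ (fun u => T (f u) (g u)) u v =
      T (fderiv ℝ f u v) (g u) + T (f u) (fderiv ℝ g u v) := by
  let T' : V₁ →L[ℝ] V₂ →L[ℝ] V₃ :=
    (ContinuousLinearMap.restrictScalarsL ℂ V₂ V₃ ℝ ℝ).comp (T.restrictScalars ℝ)
  have h1 : HasFDerivAt (fun u => T' (f u)) _ u := (T'.hasFDerivAt (x := f u)).comp u hf.hasFDerivAt
  have h3 : HasFDerivAt (fun u => T (f u) (g u)) _ u := h1.clm_apply hg.hasFDerivAt
  rw [h3.fderiv, add_comm]
  rfl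

theorem fderiv_bracket {f g : (Fin n → ℝ) → E} (hf : DifferentiableAt ℝ f u)
    (hg : DifferentiableAt ℝ g u) (v : Fin n → ℝ) :
    fderiv ℝ (fun u => bracket G (f u) (g u)) u v =
      bracket G (fderiv ℝ f u v) (g u) + bracket G (f u) (fderiv ℝ g u v) :=
  fderiv_bilinear (adL G) hf hg v

theorem fderiv_coad_apply {f : (Fin n → ℝ) → E} {φ : (Fin n → ℝ) → StrongDual ℂ E}
    (hf : DifferentiableAt ℝ f u) (hφ : DifferentiableAt ℝ φ u) (v : Fin n → ℝ) :
    fderiv ℝ (fun u => coad G (f u) (φ u)) u v =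
      coad G (fderiv ℝ f u v) (φ u) + coad G (f u) (fderiv ℝ φ u v) :=
  fderiv_bilinear (-((ContinuousLinearMap.compL ℂ E E ℂ).flip.comp (adL G))) hf hφ v

/-- The curvature of the gauge field centralises the Higgs field. -/
theorem Fields.Critical.coad_timeCurvature (hC : F.Critical Pb ρ D)
    (hρ : ρ.IsSubordinate (fun I => (Pb.chart I).source)) (hF : F.Admissible Pb D)
    (hv : v ≠ 0) (hv' : v' ≠ 0) (u : Fin n → ℝ) (hI : x ∈ (Pb.chart I).source)
    (hxp : x ∉ range D.p) (hxq : x ∉ range D.q) :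
    coad G (F.timeCurvature I x u v v') (F.B I x u) = 0 := by
  have hB : ContDiff ℝ ∞ (F.B I x) :=
    hF.B_smooth.contDiff_time (finite_range D.p).isClosed hI hxp
  have hBd : ∀ u, DifferentiableAt ℝ (F.B I x) u := hB.differentiable (by simp)
  have hA : ∀ v u, DifferentiableAt ℝ (fun u => F.gaugeAt I x u v) u := fun v =>
    (hF.gaugeAt_contDiff hI hxq v).differentiable (by simp)
  have hlax : ∀ v, v ≠ 0 → ∀ u, fderiv ℝ (F.B I x) u v =
      -coad G (F.gaugeAt I x u v) (F.B I x u) := fun v hv u =>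
    eq_neg_of_add_eq_zero_left (hC.lax hρ hF hv u hI hxp hxq)
  have h2 : ∀ v v', v ≠ 0 → v' ≠ 0 → fderiv ℝ (fderiv ℝ (F.B I x)) u v v' =
      -(coad G (fderiv ℝ (fun u => F.gaugeAt I x u v') u v) (F.B I x u)) +
      coad G (F.gaugeAt I x u v') (coad G (F.gaugeAt I x u v) (F.B I x u)) := by
    intro v v' hv hv'
    have e1 : HasFDerivAt (fun u => fderiv ℝ (F.B I x) u v') _ u :=
      ((hB.fderiv_right (m := ∞) (by simp)).differentiable (by simp) u).hasFDerivAt.clm_apply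
      (hasFDerivAt_const v' u)
    have e2 : fderiv ℝ (fun u => fderiv ℝ (F.B I x) u v') u v =
        fderiv ℝ (fderiv ℝ (F.B I x)) u v v' := by
      rw [e1.fderiv]
      simp
    have e3 : (fun u => fderiv ℝ (F.B I x) u v') =
      fun u => -coad G (F.gaugeAt I x u v') (F.B I x u) := funext fun u => hlax v' hv' u
    rw [← e2, e3, fderiv_fun_neg, neg_apply, fderiv_coad_apply (hA v' u) (hBd u), hlax v hv,
      ← coadL_apply (F.gaugeAt I x u v'), map_neg, neg_add, neg_neg]
    rfl
  have hs : fderiv ℝ (fderiv ℝ (F.B I x)) u v v' = fderiv ℝ (fderiv ℝ (F.B I x)) u v' v :=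
    (hB.contDiffAt.isSymmSndFDerivAt (by
      rw [minSmoothness_of_isRCLikeNormedField]; exact ENat.LEInfty.out)).eq _ _
  rw [h2 v v' hv hv', h2 v' v hv' hv] at hs
  ext Y
  have h3 := congrArg (fun φ : StrongDual ℂ E => φ Y) hs
  simp only [add_apply, neg_apply, coad_apply, timeCurvature, ← adL_apply, map_add, map_sub,
    sub_apply, zero_apply] at h3 ⊢
  have hj := bracket_jacobi (G := G) (F.gaugeAt I x u v) (F.gaugeAt I x u v') Y
  simp only [← adL_apply] at hj
  rw [hj, map_add] at h3
  linear_combination -h3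

/-- The curvature of the gauge field is annihilated by `∂̄ + [A'', ·]`. -/
theorem Fields.Critical.dbar_timeCurvature (hC : F.Critical Pb ρ D)
    (hρ : ρ.IsSubordinate (fun I => (Pb.chart I).source)) (hF : F.Admissible Pb D)
    (hv : v ≠ 0) (hv' : v' ≠ 0) (u : Fin n → ℝ) (hI : x ∈ (Pb.chart I).source)
    (hxq : x ∉ range D.q) :
    dbar (fun w => F.timeCurvature I ((Pb.chart I).symm w) u v v') (Pb.chart I x) +
      bracket G (F.A I x u) (F.timeCurvature I x u v v') = 0 := by
  have hq := (finite_range D.q).isClosed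
  have hAs : ContDiff ℝ ∞ (F.A I x) := hF.A_smooth.contDiff_time isClosed_empty hI (notMem_empty x)
  have hg : ∀ v u, DifferentiableAt ℝ (fun u => F.gaugeAt I x u v) u := fun v =>
    (hF.gaugeAt_contDiff hI hxq v).differentiable (by simp)
  have hgw : ∀ v, DifferentiableAt ℝ (fun w => F.gaugeAt I ((Pb.chart I).symm w) u v)
      (Pb.chart I x) := fun v => ((hF.gaugeAt_smooth (V := fun _ => v)
    contDiff_const).contDiffAt_point hq hI hxq u).differentiableAt (by simp)
  have hdw : ∀ v v', DifferentiableAt ℝ (fun w => fderiv ℝ (fun u => F.gaugeAt I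
      ((Pb.chart I).symm w) u v) u v') (Pb.chart I x) := fun v v' =>
    ((hF.fderiv_gaugeAt_smooth v v').contDiffAt_point hq hI hxq u).differentiableAt (by simp)
  have hcurv : ∀ v, v ≠ 0 → ∀ u, dbar (fun w => F.gaugeAt I ((Pb.chart I).symm w) u v)
      (Pb.chart I x) = fderiv ℝ (F.A I x) u v - bracket G (F.A I x u) (F.gaugeAt I x u v) := by
    intro v hv u
    have h1 := hC.curvature_eq_zero hρ hF hv u hI hxq
    rw [Fields.curvature] at h1
    rw [← sub_eq_zero, ← h1]
    abel
  have hcomm : ∀ v v', v ≠ 0 → dbar (fun w => fderiv ℝ (fun u => F.gaugeAt I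
      ((Pb.chart I).symm w) u v) u v') (Pb.chart I x) =
      fderiv ℝ (fderiv ℝ (F.A I x)) u v' v - (bracket G (fderiv ℝ (F.A I x) u v')
      (F.gaugeAt I x u v) + bracket G (F.A I x u) (fderiv ℝ (fun u => F.gaugeAt I x u v) u v')) := by
    intro v v' hv
    rw [← fderiv_dbar_comm (Φ := fun y => F.gaugeAt I ((Pb.chart I).symm y.1) y.2 v)
      ((hF.gaugeAt_smooth (V := fun _ => v) contDiff_const).contDiffAt hq hI hxq u) v']
    simp only [hcurv v hv]
    have e1 : HasFDerivAt (fun u => fderiv ℝ (F.A I x) u v) _ u :=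
      ((hAs.fderiv_right (m := ∞) (by simp)).differentiable (by simp) u).hasFDerivAt.clm_apply
      (hasFDerivAt_const v u)
    have e2 : DifferentiableAt ℝ (fun u => bracket G (F.A I x u) (F.gaugeAt I x u v)) u := by
      have h1 : ContDiff ℝ ∞ fun u => ContinuousLinearMap.restrictScalarsL ℂ E E ℝ ℝ
          (((adL G).restrictScalars ℝ) (F.A I x u)) :=
        (ContinuousLinearMap.contDiff _).comp ((ContinuousLinearMap.contDiff _).comp hAs)
      exact (h1.clm_apply (hF.gaugeAt_contDiff hI hxq v)).differentiable (by simp) u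
    rw [fderiv_fun_sub e1.differentiableAt e2, sub_apply, fderiv_bracket
      (hAs.differentiable (by simp) u) (hg v u), e1.fderiv]
    simp
  have hs : fderiv ℝ (fderiv ℝ (F.A I x)) u v v' = fderiv ℝ (fderiv ℝ (F.A I x)) u v' v :=
    (hAs.contDiffAt.isSymmSndFDerivAt (by
      rw [minSmoothness_of_isRCLikeNormedField]; exact ENat.LEInfty.out)).eq _ _
  have hL : DifferentiableAt ℝ (fun w => adL G (F.gaugeAt I ((Pb.chart I).symm w) u v))
      (Pb.chart I x) :=
    (((adL G : E →L[ℂ] E →L[ℂ] E).restrictScalars ℝ).differentiableAt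
      (x := F.gaugeAt I ((Pb.chart I).symm (Pb.chart I x)) u v)).comp (Pb.chart I x) (hgw v)
  have h1 : dbar (fun w => F.timeCurvature I ((Pb.chart I).symm w) u v v') (Pb.chart I x) =
      dbar (fun w => fderiv ℝ (fun u => F.gaugeAt I ((Pb.chart I).symm w) u v') u v)
        (Pb.chart I x) + (-1 : ℂ) • dbar (fun w => fderiv ℝ (fun u => F.gaugeAt I
        ((Pb.chart I).symm w) u v) u v') (Pb.chart I x) +
      (bracket G (dbar (fun w => F.gaugeAt I ((Pb.chart I).symm w) u v) (Pb.chart I x))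
        (F.gaugeAt I x u v') + bracket G (F.gaugeAt I x u v)
        (dbar (fun w => F.gaugeAt I ((Pb.chart I).symm w) u v') (Pb.chart I x))) := by
    have e1 := dbar_clm_apply hL (hgw v')
    rw [dbar_clm (adL G) (hgw v), (Pb.chart I).left_inv hI] at e1
    have d2 : DifferentiableAt ℝ (fun w => (-1 : ℂ) • fderiv ℝ (fun u => F.gaugeAt I
      ((Pb.chart I).symm w) u v) u v') (Pb.chart I x) := (hdw v v').const_smul (-1 : ℂ)
    have d3 : DifferentiableAt ℝ (fun w => fderiv ℝ (fun u => F.gaugeAt I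
      ((Pb.chart I).symm w) u v') u v + (-1 : ℂ) • fderiv ℝ (fun u => F.gaugeAt I
      ((Pb.chart I).symm w) u v) u v') (Pb.chart I x) := (hdw v' v).add d2
    have d4 : DifferentiableAt ℝ (fun w => adL G (F.gaugeAt I ((Pb.chart I).symm w) u v)
        (F.gaugeAt I ((Pb.chart I).symm w) u v')) (Pb.chart I x) :=
      (((ContinuousLinearMap.restrictScalarsL ℂ E E ℝ ℝ).differentiableAt
        (x := adL G (F.gaugeAt I ((Pb.chart I).symm (Pb.chart I x)) u v))).comp
        (Pb.chart I x) hL).clm_apply (hgw v')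
    rw [← adL_apply, ← adL_apply, ← e1, ← dbar_const_smul, ← dbar_add (hdw v' v) d2,
      ← dbar_add d3 d4]
    simp only [timeCurvature, neg_one_smul, ← sub_eq_add_neg]
    rfl
  rw [h1, hcomm v' v hv', hcomm v v' hv, hs, hcurv v hv, hcurv v' hv', timeCurvature]
  have hj := bracket_jacobi (G := G) (F.A I x u) (F.gaugeAt I x u v) (F.gaugeAt I x u v')
  have hk := bracket_skew (G := G) (F.gaugeAt I x u v) (fderiv ℝ (F.A I x) u v')
  simp only [← adL_apply, map_add, map_sub, sub_apply] at hj hk ⊢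
  rw [hj, hk, neg_one_smul]
  abel

end TimeCurvature

end MixedBF

namespace MixedBF

section PolarParts

variable {C ι E G : Type*} [TopologicalSpace C] [T2Space C] [CompactSpace C] [ChartedSpace ℂ C]
  [IsManifold 𝓘(ℂ) ω C]
  [NormedAddCommGroup E] [NormedSpace ℂ E] [FiniteDimensional ℂ E]
  [TopologicalSpace G] [ChartedSpace E G] [Group G] [LieGroup 𝓘(ℂ, E) ω G]
  {n N : ℕ} {Pb : PBundle C ι E G} {ρ : PartitionOfUnity ι C}
  {D : Defects C E G n N} {F : Fields C ι E G n N}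
  {I J : ι} {x : C} {u v v' : Fin n → ℝ} {κ : Fin n → ℂ}

/-- A combination of gradients with the coefficients of the residues of the gauge field. -/
def polarPart (D : Defects C E G n N) (F : Fields C ι E G n N) (κ : Fin n → ℂ) (u v : Fin n → ℝ)
    (φ : StrongDual ℂ E) : E :=
  -∑ i, ((fderiv ℝ F.t u v i : ℝ) : ℂ) • κ i • grad (D.P i) φ

theorem bracket_polarPart (φ : StrongDual ℂ E) :
    bracket G (polarPart D F κ u v φ) (polarPart D F κ u v' φ) = 0 := by
  have h : ∀ i j, adL G (grad (D.P i) φ) (grad (D.P j) φ) = 0 := fun i j =>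
    bracket_grad_grad (D.P_inv i) (D.P_inv j) φ
  simp only [polarPart, ← adL_apply, map_neg, map_sum, neg_apply, sum_apply,
    map_smul, smul_apply, h, smul_zero, Finset.sum_const_zero, neg_zero]

theorem contDiff_polarPart {X : Type*} [NormedAddCommGroup X] [NormedSpace ℝ X] {S : Set X}
    (hF : F.Admissible Pb D) {f : X → Fin n → ℝ} {b : X → StrongDual ℂ E} (hf : ContDiffOn ℝ ∞ f S)
    (hb : ContDiffOn ℝ ∞ b S) : ContDiffOn ℝ ∞ (fun y => polarPart D F κ (f y) v (b y)) S := by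
  refine (ContDiffOn.sum fun i _ => ?_).neg
  have h1 : ContDiff ℝ ∞ fun u => fderiv ℝ F.t u v i :=
    contDiff_pi.1 ((hF.t_smooth.fderiv_right (m := ∞) (by simp)).clm_apply contDiff_const) i
  exact (Complex.ofRealCLM.contDiff.comp_contDiffOn (h1.comp_contDiffOn hf)).smul
    (((contDiff_grad_real (D.P i)).comp_contDiffOn hb).const_smul (κ i))

theorem Fields.Critical.fderiv_polarPart (hC : F.Critical Pb ρ D)
    (hρ : ρ.IsSubordinate (fun I => (Pb.chart I).source)) (hF : F.Admissible Pb D)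
    (hv : v ≠ 0) (v' u : Fin n → ℝ) (hI : x ∈ (Pb.chart I).source) (hxp : x ∉ range D.p)
    (hxq : x ∉ range D.q) (κ : Fin n → ℂ) :
    fderiv ℝ (fun u => polarPart D F κ u v' (F.B I x u)) u v =
      -∑ i, fderiv ℝ (fderiv ℝ F.t) u v v' i • κ i • grad (D.P i) (F.B I x u) -
        bracket G (F.gaugeAt I x u v) (polarPart D F κ u v' (F.B I x u)) := by
  have hB : HasFDerivAt (F.B I x) _ u :=
    ((hF.B_smooth.contDiff_time (finite_range D.p).isClosed hI hxp).differentiable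
      (by simp) u).hasFDerivAt
  have ht : ∀ i, HasFDerivAt (fun u => fderiv ℝ F.t u v' i) ((ContinuousLinearMap.proj i).comp
      ((fderiv ℝ (fderiv ℝ F.t) u).flip v')) u := fun i => by
    have h1 := ((hF.t_smooth.fderiv_right (m := ∞) (by simp)).differentiable
      (by simp) u).hasFDerivAt.clm_apply (hasFDerivAt_const v' u)
    have h2 := (ContinuousLinearMap.proj (R := ℝ) (φ := fun _ : Fin n => ℝ) i).hasFDerivAt.comp u h1
    refine HasFDerivAt.congr_fderiv h2 ?_
    ext a
    simp
  have hg : ∀ i, HasFDerivAt (fun u => κ i • grad (D.P i) (F.B I x u)) (κ i •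
      (fderiv ℝ (fun φ => grad (D.P i) φ) (F.B I x u)).comp (fderiv ℝ (F.B I x) u)) u := fun i =>
    ((((contDiff_grad_real (D.P i)).differentiable (by simp) (F.B I x u)).hasFDerivAt).comp u
      hB).const_smul (κ i)
  have hsum : HasFDerivAt (fun u => -∑ i, fderiv ℝ F.t u v' i • κ i •
      grad (D.P i) (F.B I x u)) _ u :=
    (HasFDerivAt.fun_sum (u := Finset.univ) fun i _ => (ht i).smul (hg i)).fun_neg
  have he : (fun u => polarPart D F κ u v' (F.B I x u)) =
      fun u => -∑ i, fderiv ℝ F.t u v' i • κ i • grad (D.P i) (F.B I x u) := by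
    ext u
    simp only [polarPart, Complex.coe_smul]
  have hlax : fderiv ℝ (F.B I x) u v = -coad G (F.gaugeAt I x u v) (F.B I x u) :=
    eq_neg_of_add_eq_zero_left (hC.lax hρ hF hv u hI hxp hxq)
  have hgr : ∀ i, fderiv ℝ (fun φ => grad (D.P i) φ) (F.B I x u) (fderiv ℝ (F.B I x) u v) =
      -adL G (F.gaugeAt I x u v) (grad (D.P i) (F.B I x u)) := fun i => by
    rw [hlax, map_neg, fderiv_grad_coad (D.P_inv i), adL_apply]
  have hs : ∀ i, adL G (F.gaugeAt I x u v) (fderiv ℝ F.t u v' i • κ i • grad (D.P i) (F.B I x u)) =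
      fderiv ℝ F.t u v' i • κ i • adL G (F.gaugeAt I x u v) (grad (D.P i) (F.B I x u)) := fun i => by
    rw [ContinuousLinearMap.map_smul_of_tower, map_smul]
  rw [he, hsum.fderiv, neg_apply, sum_apply]
  simp only [add_apply, smul_apply, ContinuousLinearMap.comp_apply, hgr,
    ContinuousLinearMap.smulRight_apply, ContinuousLinearMap.proj_apply,
    ContinuousLinearMap.flip_apply, polarPart, ← adL_apply, map_neg, map_sum, hs, smul_neg,
    Complex.coe_smul, Finset.sum_add_distrib, Finset.sum_neg_distrib]
  abel

theorem contDiffOn_fderiv_snd {V : Type*} [NormedAddCommGroup V] [NormedSpace ℝ V] {U : Set ℂ}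
    (hU : IsOpen U) {f : ℂ × (Fin n → ℝ) → V} (hf : ContDiffOn ℝ ∞ f (U ×ˢ univ))
    (u v : Fin n → ℝ) : ContDiffOn ℝ ∞ (fun w => fderiv ℝ (fun u => f (w, u)) u v) U := by
  have ho := hU.prod (isOpen_univ (X := Fin n → ℝ))
  have h1 := ((hf.fderiv_of_isOpen (m := ∞) ho (by simp)).clm_apply
    (contDiffOn_const (c := ((0 : ℂ), v)))).comp (f := fun w : ℂ => (w, u)) (s := U)
    (by fun_prop) fun w hw => ⟨hw, trivial⟩
  refine h1.congr fun w hw => ?_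
  have h2 := ((hf.contDiffAt (ho.mem_nhds (x := (w, u)) ⟨hw, trivial⟩)).differentiableAt
    (by simp)).hasFDerivAt.comp u (hasFDerivAt_prodMk_right w u)
  have h3 : HasFDerivAt (fun u => f (w, u)) _ u := h2
  rw [h3.fderiv]
  rfl

open Classical in
/-- Near a pole, the gauge field is the sum of an explicit polar part and of a bounded remainder. -/
theorem Fields.Critical.exists_pole_remainder (hC : F.Critical Pb ρ D)
    (hρ : ρ.IsSubordinate (fun I => (Pb.chart I).source)) (hF : F.Admissible Pb D)
    (hv : v ≠ 0) (hI : x ∈ (Pb.chart I).source) (hxq : x ∈ range D.q) :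
    ∃ U : Set ℂ, IsOpen U ∧ Pb.chart I x ∈ U ∧ (∀ w ∈ U, w ∈ (Pb.chart I).target ∧
      (Pb.chart I).symm w ∉ range D.p ∧ (w ≠ Pb.chart I x → (Pb.chart I).symm w ∉ range D.q)) ∧
      ∃ f : ℂ × (Fin n → ℝ) → E, ContDiffOn ℝ ∞ f (U ×ˢ univ) ∧ (∀ u, f (Pb.chart I x, u) = 0) ∧
      ∀ w ∈ U, w ≠ Pb.chart I x → ∀ u, F.gaugeAt I ((Pb.chart I).symm w) u v =
        (w - Pb.chart I x)⁻¹ • (f (w, u) + polarPart D F (fun i => if D.q i = x then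
          D.comp Pb.toHolAtlas i I ^ (D.d i + 1) else 0) u v (F.B I ((Pb.chart I).symm w) u)) := by
  have hxp : x ∉ range D.p := D.disjoint.notMem_of_mem_right hxq
  obtain ⟨W, hW, h, hh, hfh⟩ := hF.gaugeAt_poles (V := fun _ => v) contDiff_const I x hxq hI
  have ho : IsOpen ((Pb.chart I).target ∩
      (Pb.chart I).symm ⁻¹' (range D.p ∪ range D.q \ {x})ᶜ) :=
    (Pb.chart I).isOpen_inter_preimage_symm ((finite_range D.p).union
      ((finite_range D.q).subset sdiff_subset)).isClosed.isOpen_compl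
  have hx : Pb.chart I x ∈ (Pb.chart I).target ∩
      (Pb.chart I).symm ⁻¹' (range D.p ∪ range D.q \ {x})ᶜ :=
    ⟨(Pb.chart I).map_source hI, by simpa [(Pb.chart I).left_inv hI] using hxp⟩
  refine ⟨_, isOpen_interior.inter ho, ⟨mem_interior_iff_mem_nhds.2 hW, hx⟩, fun w hw => ⟨hw.2.1,
    fun hp => hw.2.2 (Or.inl hp), fun hws hq => hw.2.2 (Or.inr ⟨hq, fun h => hws ?_⟩)⟩,
    fun y => h y - polarPart D F (fun i => if D.q i = x then
      D.comp Pb.toHolAtlas i I ^ (D.d i + 1) else 0) y.2 v (F.B I ((Pb.chart I).symm y.1) y.2),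
    ?_, fun u => ?_, fun w hw hws u => ?_⟩
  · rw [← mem_singleton_iff.1 h, (Pb.chart I).right_inv hw.2.1]
  · refine (hh.mono (prod_mono (inter_subset_left.trans interior_subset) subset_rfl)).sub
      (contDiff_polarPart hF contDiffOn_snd ((hF.B_smooth I).mono (prod_mono (fun w hw =>
        ⟨hw.2.1, fun hp => hw.2.2 (Or.inl hp)⟩) subset_rfl)))
  · have h1 : residue Pb.toHolAtlas I x (fun y => F.gaugeAt I y u v) = h (Pb.chart I x, u) := by
      refine residue_eq_of_tendsto hI ?_
      have h2 : Tendsto (fun w => h (w, u)) (𝓝 (Pb.chart I x)) (𝓝 (h (Pb.chart I x, u))) :=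
        ContinuousAt.comp (g := h) (f := fun w : ℂ => (w, u))
          (hh.continuousOn.continuousAt (prod_mem_nhds hW univ_mem)) (by fun_prop)
      have hc := HolAtlas.tendsto_chart (𝒰 := Pb.toHolAtlas) hI
      refine (h2.comp (hc.mono_right nhdsWithin_le_nhds)).congr' ?_
      filter_upwards [hc.eventually self_mem_nhdsWithin,
        hc.eventually (nhdsWithin_le_nhds hW), nhdsWithin_le_nhds
        ((Pb.chart I).open_source.mem_nhds hI)] with y hy hyW hyI
      have h3 := hfh _ hyW hy u
      rw [(Pb.chart I).left_inv hyI] at h3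
      change F.gaugeAt I y u v = _ at h3
      rw [h3, smul_inv_smul₀ (sub_ne_zero.2 hy), Function.comp_apply]
    change h (Pb.chart I x, u) - _ = 0
    rw [← h1, hC.residue_gaugeAt hρ hF hv u hI hxq, polarPart, (Pb.chart I).left_inv hI, sub_self]
  · rw [sub_add_cancel]
    exact hfh w (interior_subset hw.1) hws u

theorem bracket_pole_cancel {a b p q X Y σ : E} (c : ℂ) (h : bracket G p q = 0) :
    c • (X + (σ - bracket G (c • (a + p)) q)) - c • (Y + (σ - bracket G (c • (b + q)) p)) +
      bracket G (c • (a + p)) (c • (b + q)) = c • X - c • Y + bracket G (c • a) (c • b) := by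
  have h' : bracket G q p = 0 := by rw [bracket_skew, h, neg_zero]
  have h2 := bracket_skew (G := G) b p
  simp only [← adL_apply, map_add, map_smul, add_apply, smul_apply] at h h' h2 ⊢
  rw [h, h', h2]
  module

theorem Fields.Critical.exists_timeCurvature_extension (hC : F.Critical Pb ρ D)
    (hρ : ρ.IsSubordinate (fun I => (Pb.chart I).source)) (hF : F.Admissible Pb D)
    (hv : v ≠ 0) (hv' : v' ≠ 0) (u : Fin n → ℝ) (hI : x ∈ (Pb.chart I).source)
    (hxq : x ∈ range D.q) :
    ∃ U : Set ℂ, IsOpen U ∧ Pb.chart I x ∈ U ∧ U ⊆ (Pb.chart I).target ∧ ∃ m : ℂ → E,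
      ContDiffOn ℝ ∞ m U ∧ ∀ w ∈ U, w ≠ Pb.chart I x →
        m w = F.timeCurvature I ((Pb.chart I).symm w) u v v' := by
  obtain ⟨U₁, hU₁, hx₁, hm₁, f₁, hf₁, h0₁, hg₁⟩ := hC.exists_pole_remainder hρ hF hv hI hxq
  obtain ⟨U₂, hU₂, hx₂, hm₂, f₂, hf₂, h0₂, hg₂⟩ := hC.exists_pole_remainder hρ hF hv' hI hxq
  set s := Pb.chart I x with hs
  have hU := hU₁.inter hU₂
  replace hf₁ := hf₁.mono (prod_mono (inter_subset_left (t := U₂)) (Subset.refl univ))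
  replace hf₂ := hf₂.mono (prod_mono (inter_subset_right (s := U₁)) (Subset.refl univ))
  have hsec : ∀ {f : ℂ × (Fin n → ℝ) → E}, ContDiffOn ℝ ∞ f ((U₁ ∩ U₂) ×ˢ univ) →
      ContDiffOn ℝ ∞ (fun w => f (w, u)) (U₁ ∩ U₂) := fun hf =>
    hf.comp (by fun_prop) fun w hw => ⟨hw, trivial⟩
  have hT : ∀ w ∈ U₁ ∩ U₂, w ≠ s → F.timeCurvature I ((Pb.chart I).symm w) u v v' =
      (w - s)⁻¹ • fderiv ℝ (fun u => f₂ (w, u)) u v - (w - s)⁻¹ • fderiv ℝ (fun u => f₁ (w, u)) u v'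
        + bracket G ((w - s)⁻¹ • f₁ (w, u)) ((w - s)⁻¹ • f₂ (w, u)) := by
    intro w hw hws
    obtain ⟨hwT, hwp, hwq⟩ := hm₁ w hw.1
    replace hwq := hwq hws
    have hwI := (Pb.chart I).map_target hwT
    have hd : ∀ {f : ℂ × (Fin n → ℝ) → E}, ContDiffOn ℝ ∞ f ((U₁ ∩ U₂) ×ˢ univ) →
        DifferentiableAt ℝ (fun u => f (w, u)) u := fun hf =>
      ((hf.contDiffAt ((hU.prod isOpen_univ).mem_nhds (x := (w, u))
        ⟨hw, trivial⟩)).differentiableAt (by simp)).comp u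
        (hasFDerivAt_prodMk_right w u).differentiableAt
    have hBs := hF.B_smooth.contDiff_time (finite_range D.p).isClosed hwI hwp
    have hP : ∀ κ v, DifferentiableAt ℝ (fun u => polarPart D F κ u v
        (F.B I ((Pb.chart I).symm w) u)) u := fun κ v =>
      (contDiffOn_univ.1 (contDiff_polarPart hF (S := univ) contDiffOn_id
        hBs.contDiffOn)).differentiable (by simp) u
    have hA : ∀ {f : ℂ × (Fin n → ℝ) → E} {v : Fin n → ℝ} (κ : Fin n → ℂ) (a : Fin n → ℝ),
        ContDiffOn ℝ ∞ f ((U₁ ∩ U₂) ×ˢ univ) → (∀ u, F.gaugeAt I ((Pb.chart I).symm w) u v =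
          (w - s)⁻¹ • (f (w, u) + polarPart D F κ u v (F.B I ((Pb.chart I).symm w) u))) → a ≠ 0 →
        fderiv ℝ (fun u => F.gaugeAt I ((Pb.chart I).symm w) u v) u a =
          (w - s)⁻¹ • (fderiv ℝ (fun u => f (w, u)) u a + (-∑ i, fderiv ℝ (fderiv ℝ F.t) u a v i •
            κ i • grad (D.P i) (F.B I ((Pb.chart I).symm w) u) -
            bracket G (F.gaugeAt I ((Pb.chart I).symm w) u a)
            (polarPart D F κ u v (F.B I ((Pb.chart I).symm w) u)))) := by
      intro f v κ a hf he ha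
      rw [← hC.fderiv_polarPart hρ hF ha v u hwI hwp hwq κ, ← add_apply,
        ← fderiv_fun_add (hd hf) (hP κ v), ← smul_apply]
      have h1 := (((hd hf).add (hP κ v)).hasFDerivAt.const_smul (w - s)⁻¹).fderiv
      simp only [he]
      exact congrArg (fun L : (Fin n → ℝ) →L[ℝ] E => L a) h1
    have hsym : fderiv ℝ (fderiv ℝ F.t) u v' v = fderiv ℝ (fderiv ℝ F.t) u v v' :=
      (hF.t_smooth.contDiffAt.isSymmSndFDerivAt (by
        rw [minSmoothness_of_isRCLikeNormedField]; exact ENat.LEInfty.out)).eq _ _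
    rw [timeCurvature, hA _ _ hf₂ (hg₂ w hw.2 hws) hv, hA _ _ hf₁ (hg₁ w hw.1 hws) hv', hsym,
      hg₁ w hw.1 hws, hg₂ w hw.2 hws]
    exact bracket_pole_cancel _ (bracket_polarPart _)
  have hX : ∀ w ∈ U₁ ∩ U₂, w ≠ s → ContDiffAt ℝ ∞
      (fun w => F.timeCurvature I ((Pb.chart I).symm w) u v v') w := fun w hw hws => by
    obtain ⟨hwT, hwp, hwq⟩ := hm₁ w hw.1
    have h1 := (hF.timeCurvature_smooth v v').contDiffAt_point (finite_range D.q).isClosed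
      ((Pb.chart I).map_target hwT) (hwq hws) u
    rwa [(Pb.chart I).right_inv hwT] at h1
  have hL : ContDiffOn ℝ ∞ (fun w => -adL G (F.A I ((Pb.chart I).symm w) u)) (U₁ ∩ U₂) := by
    refine (((adL G : E →L[ℂ] E →L[ℂ] E).restrictScalars ℝ).contDiff.comp_contDiffOn
      (ContDiffOn.comp (g := fun y : ℂ × (Fin n → ℝ) => F.A I ((Pb.chart I).symm y.1) y.2)
      (hF.A_smooth I) (f := fun w : ℂ => (w, u)) (by fun_prop) fun w hw => ?_)).neg
    exact ⟨⟨(hm₁ w hw.1).1, notMem_empty _⟩, trivial⟩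
  have hdb : ∀ w ∈ U₁ ∩ U₂, w ≠ s → dbar (fun w => F.timeCurvature I ((Pb.chart I).symm w) u v v')
      w = (-adL G (F.A I ((Pb.chart I).symm w) u))
        (F.timeCurvature I ((Pb.chart I).symm w) u v v') := fun w hw hws => by
    obtain ⟨hwT, hwp, hwq⟩ := hm₁ w hw.1
    have h1 := hC.dbar_timeCurvature hρ hF hv hv' u ((Pb.chart I).map_target hwT) (hwq hws)
    rw [(Pb.chart I).right_inv hwT] at h1
    exact eq_neg_of_add_eq_zero_left h1
  have hxU : s ∈ U₁ ∩ U₂ := ⟨hx₁, hx₂⟩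
  have hdf : ∀ {f : ℂ → E}, ContDiffOn ℝ ∞ f (U₁ ∩ U₂) → DifferentiableAt ℝ f s := fun hf =>
    (hf.contDiffAt (hU.mem_nhds hxU)).differentiableAt (by simp)
  have hk₁ := contDiffOn_fderiv_snd hU hf₁ u v'
  have hk₂ := contDiffOn_fderiv_snd hU hf₂ u v
  have hb : (fun w => F.timeCurvature I ((Pb.chart I).symm w) u v v') =O[𝓝[≠] s]
      (fun _ => (1 : ℝ)) := by
    have b1 := isBigO_one_inv_smul (hdf hk₁) (by simp [h0₁])
    have b2 := isBigO_one_inv_smul (hdf hk₂) (by simp [h0₂])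
    have b3 := isBigO_one_inv_smul (hdf (hsec hf₁)) (h0₁ u)
    have b4 := isBigO_one_inv_smul (hdf (hsec hf₂)) (h0₂ u)
    have b5 := ((adL G : E →L[ℂ] E →L[ℂ] E).isBoundedBilinearMap.isBigO_comp
      (g := fun w => (w - s)⁻¹ • f₁ (w, u)) (h := fun w => (w - s)⁻¹ • f₂ (w, u))
      (l := 𝓝[≠] s)).trans (b3.norm_left.mul b4.norm_left)
    simp only [mul_one] at b5
    refine ((b2.sub b1).add b5).congr' ?_ EventuallyEq.rfl
    filter_upwards [self_mem_nhdsWithin, nhdsWithin_le_nhds (hU.mem_nhds hxU)] with w hws hw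
    exact (hT w hw hws).symm
  have hk : ContDiffOn ℝ ∞ (fun w => (w - s) • (fderiv ℝ (fun u => f₂ (w, u)) u v -
      fderiv ℝ (fun u => f₁ (w, u)) u v') + adL G (f₁ (w, u)) (f₂ (w, u))) (U₁ ∩ U₂) := by
    refine ((contDiff_id.sub contDiff_const).contDiffOn.smul (hk₂.sub hk₁)).add ?_
    have h1 : ContDiffOn ℝ ∞ (fun w => ContinuousLinearMap.restrictScalarsL ℂ E E ℝ ℝ
        ((adL G : E →L[ℂ] E →L[ℂ] E).restrictScalars ℝ (f₁ (w, u)))) (U₁ ∩ U₂) :=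
      (ContinuousLinearMap.contDiff _).comp_contDiffOn
        ((ContinuousLinearMap.contDiff _).comp_contDiffOn (hsec hf₁))
    exact h1.clm_apply (hsec hf₂)
  obtain ⟨m₁, hm₁', hmX⟩ := exists_contDiffOn_of_pow_succ_smul hU hxU 1 hk (fun w hw hws => by
    have hne := sub_ne_zero.2 hws
    rw [hT w hw hws, ← adL_apply]
    simp only [map_smul, smul_apply, smul_add, smul_sub, smul_smul]
    have e1 : (w - s) ^ (1 + 1) * (w - s)⁻¹ = w - s := by field_simp
    have e2 : (w - s) ^ (1 + 1) * ((w - s)⁻¹ * (w - s)⁻¹) = 1 := by field_simp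
    rw [e1, e2, one_smul]) (fun w hw hws => (hX w hw hws).differentiableAt (by simp)) hL hdb hb
  obtain ⟨m, hm, hmX⟩ := exists_contDiffOn_of_pow_succ_smul hU hxU 0 hm₁' hmX
    (fun w hw hws => (hX w hw hws).differentiableAt (by simp)) hL hdb hb
  refine ⟨_, hU, hxU, fun w hw => (hm₁ w hw.1).1, m, hm, fun w hw hws => ?_⟩
  rw [hmX w hw hws, pow_zero, one_smul]

end PolarParts

end MixedBF

namespace MixedBF

section ZeroCurvature

variable {C ι E G : Type*} [TopologicalSpace C] [T2Space C] [CompactSpace C] [ChartedSpace ℂ C]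
  [IsManifold 𝓘(ℂ) ω C]
  [NormedAddCommGroup E] [NormedSpace ℂ E] [FiniteDimensional ℂ E]
  [TopologicalSpace G] [ChartedSpace E G] [Group G] [LieGroup 𝓘(ℂ, E) ω G]
  {n N : ℕ} {Pb : PBundle C ι E G} {ρ : PartitionOfUnity ι C}
  {D : Defects C E G n N} {F : Fields C ι E G n N}
  {I J : ι} {x : C} {u v v' : Fin n → ℝ}

theorem Fields.Critical.timeCurvature_eq_zero (hC : F.Critical Pb ρ D)
    (hρ : ρ.IsSubordinate (fun I => (Pb.chart I).source)) (hF : F.Admissible Pb D)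
    (hS : F.Stable Pb D u) (hv : v ≠ 0) (hv' : v' ≠ 0) (hI : x ∈ (Pb.chart I).source)
    (hxq : x ∉ range D.q) : F.timeCurvature I x u v v' = 0 := by
  have hqc : ∀ S ⊆ range D.q, IsClosed S := fun S h => ((finite_range D.q).subset h).isClosed
  have hloc : ∀ I, ∀ x ∈ (Pb.chart I).source, ∃ U : Set ℂ, IsOpen U ∧ Pb.chart I x ∈ U ∧
      U ⊆ (Pb.chart I).target ∧ ∃ m : ℂ → E, ContDiffOn ℝ ∞ m U ∧ ∀ w ∈ U,
      (Pb.chart I).symm w ∉ range D.q → m w = F.timeCurvature I ((Pb.chart I).symm w) u v v' := by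
    intro I x hI
    by_cases hx : x ∈ range D.q
    · obtain ⟨U, hU, hxU, hUT, m, hm, hmX⟩ :=
        hC.exists_timeCurvature_extension hρ hF hv hv' u hI hx
      refine ⟨U, hU, hxU, hUT, m, hm, fun w hw hwq => hmX w hw fun h => hwq ?_⟩
      rwa [h, (Pb.chart I).left_inv hI]
    · refine ⟨_, (Pb.chart I).isOpen_inter_preimage_symm (hqc _ subset_rfl).isOpen_compl,
        ⟨(Pb.chart I).map_source hI, by simpa [(Pb.chart I).left_inv hI] using hx⟩,
        inter_subset_left, _, fun w hw => ?_, fun w _ _ => rfl⟩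
      have h1 := (hF.timeCurvature_smooth v v').contDiffAt_point (hqc _ subset_rfl)
        ((Pb.chart I).map_target hw.1) hw.2 u
      rw [(Pb.chart I).right_inv hw.1] at h1
      exact h1.contDiffWithinAt
  have hpq : ∀ S : Set C, S.Finite → ∀ I, ∀ x ∈ (Pb.chart I).source, ∀ᶠ w in 𝓝[≠] Pb.chart I x,
      w ∈ (Pb.chart I).target ∧ (Pb.chart I).symm w ∉ S := by
    intro S hS I x hI
    have h1 : ∀ᶠ y in 𝓝[≠] x, y ∉ S := by
      have : (S \ {x})ᶜ ∈ 𝓝 x := (hS.subset sdiff_subset).isClosed.isOpen_compl.mem_nhds (by simp)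
      filter_upwards [nhdsWithin_le_nhds this, self_mem_nhdsWithin] with y hy hyx hyS
      exact hy ⟨hyS, hyx⟩
    exact Filter.Eventually.and (nhdsWithin_le_nhds ((Pb.chart I).open_target.mem_nhds
      ((Pb.chart I).map_source hI))) ((HolAtlas.tendsto_symm (𝒰 := Pb.toHolAtlas) hI).eventually h1)
  set X : ι → C → E := fun I x =>
    limUnder (𝓝[≠] Pb.chart I x) fun w => F.timeCurvature I ((Pb.chart I).symm w) u v v' with hX
  have hXm : ∀ I, ∀ U ⊆ (Pb.chart I).target, IsOpen U → ∀ m : ℂ → E, ContDiffOn ℝ ∞ m U →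
      (∀ w ∈ U, (Pb.chart I).symm w ∉ range D.q →
        m w = F.timeCurvature I ((Pb.chart I).symm w) u v v') →
      ∀ w ∈ U, X I ((Pb.chart I).symm w) = m w := by
    intro I U hUT hU m hm hmX w hw
    rw [hX]
    simp only [(Pb.chart I).right_inv (hUT hw)]
    refine Tendsto.limUnder_eq (((hm.continuousOn.continuousAt (hU.mem_nhds hw)).tendsto.mono_left
      nhdsWithin_le_nhds).congr' ?_)
    have h1 := hpq _ (finite_range D.q) I _ ((Pb.chart I).map_target (hUT hw))
    rw [(Pb.chart I).right_inv (hUT hw)] at h1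
    filter_upwards [h1, nhdsWithin_le_nhds (hU.mem_nhds hw)] with z hz hzU
    exact hmX z hzU hz.2
  have hXs : ∀ I, ContDiffOn ℝ ∞ (fun w => X I ((Pb.chart I).symm w)) (Pb.chart I).target := by
    intro I w hw
    obtain ⟨U, hU, hxU, hUT, m, hm, hmX⟩ := hloc I _ ((Pb.chart I).map_target hw)
    rw [(Pb.chart I).right_inv hw] at hxU
    exact (((hm.contDiffAt (hU.mem_nhds hxU)).congr_of_eventuallyEq
      (Filter.mem_of_superset (hU.mem_nhds hxU) fun z hz =>
        hXm I U hUT hU m hm hmX z hz))).contDiffWithinAt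
  have hXc : ∀ I, ∀ x ∈ (Pb.chart I).source, x ∉ range D.q →
      X I x = F.timeCurvature I x u v v' := by
    intro I x hI hx
    obtain ⟨U, hU, hxU, hUT, m, hm, hmX⟩ := hloc I x hI
    have h1 := hXm I U hUT hU m hm hmX _ hxU
    rw [hmX _ hxU (by rwa [(Pb.chart I).left_inv hI]), (Pb.chart I).left_inv hI] at h1
    exact h1
  have hXa : ∀ I, ∀ x ∈ (Pb.chart I).source,
      ContDiffAt ℝ ∞ (fun w => X I ((Pb.chart I).symm w)) (Pb.chart I x) := fun I x hI =>
    (hXs I).contDiffAt ((Pb.chart I).open_target.mem_nhds ((Pb.chart I).map_source hI))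
  rw [← hXc I x hI hxq]
  refine hS X hXs (fun I J x hI hJ => ?_) (fun I x hI => ?_) (fun I x hI hxp => ?_) I x hI
  · have ho := Pb.toHolAtlas.chart_mem_overlap hI hJ
    have hoo := (Pb.toHolAtlas.isOpen_overlap I J).mem_nhds ho
    have h1 := ContinuousAt.eq_of_eventuallyEq_nhdsNE (s := Pb.chart I x)
      (f := fun w => X I ((Pb.chart I).symm w)) (g := fun w => Ad (Pb.g I J ((Pb.chart I).symm w))
        (X J ((Pb.chart J).symm (Pb.toHolAtlas.trans I J w)))) (hXa I x hI).continuousAt ?_ ?_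
    · simpa [Pb.toHolAtlas.trans_chart hI, (Pb.chart I).left_inv hI,
        (Pb.chart J).left_inv hJ] using h1
    · refine ((Pb.contDiffOn_Ad I J).continuousOn.continuousAt hoo).clm_apply
        (ContinuousAt.comp (g := fun w => X J ((Pb.chart J).symm w))
        (f := Pb.toHolAtlas.trans I J) ?_
        (Pb.toHolAtlas.hasDerivAt_trans_chart hI hJ).continuousAt)
      rw [Pb.toHolAtlas.trans_chart hI]
      exact (hXa J x hJ).continuousAt
    · filter_upwards [hpq _ (finite_range D.q) I x hI, nhdsWithin_le_nhds hoo] with w hw hwo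
      rw [Pb.toHolAtlas.symm_trans hwo, hXc I _ ((Pb.chart I).map_target hw.1) hw.2,
        hXc J _ hwo.2 hw.2]
      exact hF.timeCurvature_trans ((Pb.chart I).map_target hw.1) hwo.2 hw.2 u v v'
  · have h1 := ContinuousAt.eq_of_eventuallyEq_nhdsNE (s := Pb.chart I x)
      (f := fun w => dbar (fun w => X I ((Pb.chart I).symm w)) w +
        bracket G (F.A I ((Pb.chart I).symm w) u) (X I ((Pb.chart I).symm w)))
      (g := fun _ => (0 : E)) ?_ continuousAt_const ?_
    · simpa [(Pb.chart I).left_inv hI] using h1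
    · exact (ContDiffAt.dbar (hXa I x hI)).continuousAt.add (((adL G).continuous.continuousAt.comp
        ((hF.A_continuousOn u I).continuousAt ((Pb.chart I).open_target.mem_nhds
        ((Pb.chart I).map_source hI)))).clm_apply (hXa I x hI).continuousAt)
    · filter_upwards [hpq _ (finite_range D.q) I x hI] with w hw
      have hwI := (Pb.chart I).map_target hw.1
      have h2 : (fun w => X I ((Pb.chart I).symm w)) =ᶠ[𝓝 w]
          fun w => F.timeCurvature I ((Pb.chart I).symm w) u v v' := by
        filter_upwards [((Pb.chart I).isOpen_inter_preimage_symm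
          (hqc _ subset_rfl).isOpen_compl).mem_nhds hw] with z hz
        exact hXc I _ ((Pb.chart I).map_target hz.1) hz.2
      have h3 := hC.dbar_timeCurvature hρ hF hv hv' u hwI hw.2
      rw [(Pb.chart I).right_inv hw.1] at h3
      rw [Filter.EventuallyEq.dbar_eq h2, hXc I _ hwI hw.2, h3]
  · have h1 := ContinuousAt.eq_of_eventuallyEq_nhdsNE (s := Pb.chart I x)
      (f := fun w => coad G (X I ((Pb.chart I).symm w)) (F.B I ((Pb.chart I).symm w) u))
      (g := fun _ => (0 : StrongDual ℂ E)) ?_ continuousAt_const ?_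
    · simpa [(Pb.chart I).left_inv hI] using h1
    · have h2 : Continuous fun y : E × StrongDual ℂ E => coad G y.1 y.2 :=
        (continuous_snd.clm_comp ((adL G).continuous.comp continuous_fst)).neg
      exact h2.continuousAt.comp ((hXa I x hI).continuousAt.prodMk
        (hF.B_smooth.contDiffAt_point (finite_range D.p).isClosed hI hxp u).continuousAt)
    · filter_upwards [hpq _ (finite_range D.q) I x hI, hpq _ (finite_range D.p) I x hI]
        with w hw hwp
      have hwI := (Pb.chart I).map_target hw.1
      rw [hXc I _ hwI hw.2]
      exact hC.coad_timeCurvature hρ hF hv hv' u hwI hwp.2 hw.2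

theorem Fields.Admissible.fderiv_tgauge (hF : F.Admissible Pb D)
    (hJ : ∀ u, IsUnit (F.jacobian u).det) (hI : x ∈ (Pb.chart I).source) (hxq : x ∉ range D.q)
    (j : Fin n) (u a : Fin n → ℝ) : fderiv ℝ (F.tgauge I x j) u a =
      F.gaugeAt I x u (fderiv ℝ (fun u => F.timeVec u j) u a) +
      fderiv ℝ (fun u' => F.gaugeAt I x u' (F.timeVec u j)) u a := by
  have hg : ∀ k, HasFDerivAt (fun u => F.gauge I x u k) _ u := fun k =>
    ((contDiff_pi.1 (hF.gauge_smooth.contDiff_time (finite_range D.q).isClosed hI hxq)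
      k).differentiable (by simp) u).hasFDerivAt
  have hV := ((contDiff_timeVec hF.t_smooth hJ j).differentiable (by simp) u).hasFDerivAt
  have hVk : ∀ k, HasFDerivAt (fun u => F.timeVec u j k) ((ContinuousLinearMap.proj k).comp
      (fderiv ℝ (fun u => F.timeVec u j) u)) u := fun k =>
    (ContinuousLinearMap.proj (R := ℝ) (φ := fun _ : Fin n => ℝ) k).hasFDerivAt.comp u hV
  have h1 : HasFDerivAt (F.tgauge I x j) _ u :=
    HasFDerivAt.fun_sum (u := Finset.univ) fun k _ => (hVk k).smul (hg k)
  have h2 : HasFDerivAt (fun u' => F.gaugeAt I x u' (F.timeVec u j)) _ u :=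
    HasFDerivAt.fun_sum (u := Finset.univ) fun k _ => (hg k).const_smul (F.timeVec u j k)
  rw [h1.fderiv, h2.fderiv, gaugeAt, sum_apply, sum_apply, ← Finset.sum_add_distrib]
  exact Finset.sum_congr rfl fun k _ => add_comm _ _

theorem Fields.GaugedUnivariational.zeroCurvature (hU : F.GaugedUnivariational Pb ρ D)
    (hρ : ρ.IsSubordinate (fun I => (Pb.chart I).source)) (hF : F.Admissible Pb D)
    (hS : F.Stable Pb D u) : F.ZeroCurvature Pb.toHolAtlas D u := by
  have hJ := hU.isUnit_det_jacobian hρ hF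
  intro I x hI hxq i j
  have h1 := hU.critical.timeCurvature_eq_zero hρ hF hS (timeVec_ne_zero (hJ u) i)
    (timeVec_ne_zero (hJ u) j) hI hxq
  rw [dt, dt, hF.fderiv_tgauge hJ hI hxq, hF.fderiv_tgauge hJ hI hxq,
    fderiv_timeVec_comm hF.t_smooth hJ u i j, add_sub_add_left_eq_sub]
  exact h1

end ZeroCurvature

end MixedBF

namespace MixedBF

section TransportedTests

variable {C ι : Type*} [TopologicalSpace C] [ChartedSpace ℂ C] [IsManifold 𝓘(ℂ) ω C] [T2Space C]
  {V : Type*} [NormedAddCommGroup V] [NormedSpace ℂ V] {𝒰 : HolAtlas C ι}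
  {T : ι → ι → C → V →L[ℂ] V} {I J : ι} {ψ : ℂ → V}

theorem IsTest.mono {S S' : Set ℂ} (h : IsTest S ψ) (hS : S ⊆ S') : IsTest S' ψ :=
  ⟨h.smooth, h.compact, h.supp.trans hS⟩

/-- A test function supported in the overlap of two charts, in the other chart. -/
def transportTest (𝒰 : HolAtlas C ι) (T : ι → ι → C → V →L[ℂ] V) (J I : ι) (ψ : ℂ → V) : ℂ → V :=
  (𝒰.chart I).target.indicator fun w => transport 𝒰 T J ψ I ((𝒰.chart I).symm w)

theorem transportTest_of_mem {w : ℂ} (hw : w ∈ (𝒰.chart I).target) :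
    transportTest 𝒰 T J I ψ w = transport 𝒰 T J ψ I ((𝒰.chart I).symm w) :=
  indicator_of_mem hw _

theorem IsCocycle.isTest_transportTest (hT : IsCocycle 𝒰 T) (h : IsTest (𝒰.overlap J I) ψ) :
    IsTest (𝒰.overlap I J) (transportTest 𝒰 T J I ψ) := by
  have hJ := h.mono (inter_subset_left : 𝒰.overlap J I ⊆ (𝒰.chart J).target)
  have hK : IsCompact (𝒰.trans J I '' tsupport ψ) := IsCompact.image_of_continuousOn h.compact
    ((𝒰.contDiffOn_trans J I).continuousOn.mono h.supp)
  have hKo : 𝒰.trans J I '' tsupport ψ ⊆ 𝒰.overlap I J := by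
    rintro _ ⟨w, hw, rfl⟩
    exact 𝒰.trans_mem_overlap (h.supp hw)
  have h0 : ∀ w ∉ 𝒰.trans J I '' tsupport ψ, transportTest 𝒰 T J I ψ w = 0 := fun w hw => by
    by_cases hwI : w ∈ (𝒰.chart I).target
    · rw [transportTest_of_mem hwI]
      refine transport_eq_zero fun ⟨z, hz, hzw⟩ => hw ⟨z, hz, ?_⟩
      rw [HolAtlas.trans, hzw, (𝒰.chart I).right_inv hwI]
    · exact indicator_of_notMem hwI _
  refine ⟨contDiff_iff_contDiffAt.2 fun w => ?_, HasCompactSupport.intro hK h0,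
    (closure_minimal (fun w hw => ?_) hK.isClosed).trans hKo⟩
  · by_cases hw : w ∈ 𝒰.trans J I '' tsupport ψ
    · have hwI := (𝒰.chart I).open_target.mem_nhds (hKo hw).1
      refine ((hT.contDiffOn_transport hJ I).contDiffAt hwI).congr_of_eventuallyEq ?_
      filter_upwards [hwI] with z hz
      exact transportTest_of_mem hz
    · refine (contDiffAt_const (c := (0 : V))).congr_of_eventuallyEq ?_
      filter_upwards [hK.isClosed.isOpen_compl.mem_nhds hw] with z hz
      exact h0 z hz
  · by_contra hcon
    exact hw (h0 w hcon)

end TransportedTests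

section Compatibility

variable {C ι E G : Type*} [TopologicalSpace C] [T2Space C] [CompactSpace C] [ChartedSpace ℂ C]
  [IsManifold 𝓘(ℂ) ω C]
  [NormedAddCommGroup E] [NormedSpace ℂ E] [FiniteDimensional ℂ E]
  [TopologicalSpace G] [ChartedSpace E G] [Group G] [LieGroup 𝓘(ℂ, E) ω G]
  {n N : ℕ} {Pb : PBundle C ι E G} {D : Defects C E G n N} {F : Fields C ι E G n N}
  {I J : ι} {u v : Fin n → ℝ}

theorem IsTest.eq_zero_of_notMem {V : Type*} [NormedAddCommGroup V] [NormedSpace ℂ V] {S : Set ℂ}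
    {ψ : ℂ → V} {w : ℂ} (h : IsTest S ψ) (hw : w ∉ S) : ψ w = 0 ∧ dbar ψ w = 0 :=
  ⟨image_eq_zero_of_notMem_tsupport fun hc => hw (h.supp hc),
    dbar_eq_zero_of_notMem_tsupport fun hc => hw (h.supp hc)⟩

theorem Fields.Admissible.curvatureDist_trans (hF : F.Admissible Pb D) {ψ : ℂ → StrongDual ℂ E}
    (hψ : IsTest (Pb.toHolAtlas.overlap J I) ψ) (u v : Fin n → ℝ) :
    F.curvatureDist Pb.toHolAtlas J u v ψ = F.curvatureDist Pb.toHolAtlas I u v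
      (transportTest Pb.toHolAtlas (fun I J x => Pb.jac I J x •
        (coAdL (Pb.g I J x) : StrongDual ℂ E →L[ℂ] StrongDual ℂ E)) J I ψ) := by
  have hψ' := Pb.isCocycle_coAd.isTest_transportTest hψ
  rw [hF.curvatureDist_eq (hψ.mono inter_subset_left),
    hF.curvatureDist_eq (hψ'.mono inter_subset_left)]
  congr 1
  · refine integral_target_eq (finite_range D.q) (fun w hw _ hwI => ?_) (fun w hw _ hwJ => ?_)
      fun w hw hwq => ?_
    · rw [(hψ.eq_zero_of_notMem fun h => hwI h.2).1, zero_apply, mul_zero]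
    · rw [(hψ'.eq_zero_of_notMem fun h => hwJ h.2).1, zero_apply, mul_zero]
    · rw [transportTest_of_mem hw.1, transport_of_mem hw.2, smul_apply, smul_apply, coAdL_apply,
        coAd_apply, hF.curvature_trans ((Pb.chart I).map_target hw.1) hw.2 hwq, map_smul,
        Ad_inv_Ad, map_smul, Pb.toHolAtlas.symm_trans hw, smul_smul, Complex.mul_conj,
        Complex.normSq_eq_norm_sq, Complex.real_smul, smul_eq_mul]
      change _ = _ * (-2 * Complex.I * ψ (Pb.chart J ((Pb.chart I).symm w)) _)
      ring
  · congr 1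
    refine Finset.sum_congr rfl fun s hs => ?_
    replace hs := (finite_range D.q).mem_toFinset.1 hs
    by_cases hI : s ∈ (Pb.chart I).source
    · by_cases hJ : s ∈ (Pb.chart J).source
      · rw [if_pos hI, if_pos hJ, transportTest_of_mem ((Pb.chart I).map_source hI),
          (Pb.chart I).left_inv hI, transport_of_mem hJ, hF.residue_trans hs hI hJ, map_smul,
          smul_apply, smul_apply, coAdL_apply, coAd_apply, Ad_inv_Ad, smul_smul,
          Pb.toHolAtlas.jac_mul_symm hJ hI, one_smul]
      · rw [if_pos hI, if_neg hJ, transportTest_of_mem ((Pb.chart I).map_source hI),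
          (Pb.chart I).left_inv hI, transport_of_notMem hJ, zero_apply]
    · rw [if_neg hI]
      split_ifs with hJ
      · rw [(hψ.eq_zero_of_notMem fun h => hI ?_).1, zero_apply]
        rw [← (Pb.chart J).left_inv hJ]
        exact h.2
      · rfl

theorem Fields.Admissible.momentDist_trans (hF : F.Admissible Pb D) {X : ℂ → E}
    (hX : IsTest (Pb.toHolAtlas.overlap J I) X) (u : Fin n → ℝ) :
    F.momentDist Pb.toHolAtlas J u X = F.momentDist Pb.toHolAtlas I u
      (transportTest Pb.toHolAtlas (fun I J x => (Ad (Pb.g I J x) : E →L[ℂ] E)) J I X) := by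
  have hX' := Pb.isCocycle_Ad.isTest_transportTest hX
  refine integral_target_eq (finite_range D.p) (fun w hw _ hwI => ?_) (fun w hw _ hwJ => ?_)
    fun w hw hwp => ?_
  · obtain ⟨h1, h2⟩ := hX.eq_zero_of_notMem (w := w) fun h => hwI h.2
    simp [h1, h2]
  · obtain ⟨h1, h2⟩ := hX'.eq_zero_of_notMem (w := w) fun h => hwJ h.2
    simp [h1, h2]
  · have hI := (Pb.chart I).map_target hw.1
    have h1 := dbar_add_bracket_trans (Pb := Pb) (G := G) (Y := transportTest Pb.toHolAtlas
      (fun I J x => (Ad (Pb.g I J x) : E →L[ℂ] E)) J I X) (Y' := X) hI hw.2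
      (hX.smooth.differentiable (by simp) _) ?_ (hF.A_trans I J _ hI hw.2 u)
    · rw [(Pb.chart I).right_inv hw.1] at h1
      have h2 : ∀ K z Y, -(F.B K ((Pb.chart K).symm z) u (dbar Y z)) +
          coad G (F.A K ((Pb.chart K).symm z) u) (F.B K ((Pb.chart K).symm z) u) (Y z) =
          -(F.B K ((Pb.chart K).symm z) u (dbar Y z +
            bracket G (F.A K ((Pb.chart K).symm z) u) (Y z))) := fun K z Y => by
        rw [coad_apply, map_add, neg_add]
      simp only [h2]
      rw [h1, Pb.toHolAtlas.symm_trans hw, hF.B_trans I J _ hI hw.2 hwp, smul_apply, map_smul,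
        coAd_apply, Ad_inv_Ad, smul_smul, Complex.mul_conj, Complex.normSq_eq_norm_sq,
        Complex.real_smul, smul_eq_mul]
      change _ = _ * (-2 * Complex.I * -(F.B J ((Pb.chart I).symm w) u
        (dbar X (Pb.chart J ((Pb.chart I).symm w)) + bracket G (F.A J ((Pb.chart I).symm w) u)
        (X (Pb.chart J ((Pb.chart I).symm w))))))
      ring
    · rw [(Pb.chart I).right_inv hw.1]
      filter_upwards [(Pb.toHolAtlas.isOpen_overlap I J).mem_nhds hw] with z hz
      rw [transportTest_of_mem hz.1, transport_of_mem hz.2]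
      rfl

theorem HolAtlas.image_source_inter (𝒰 : HolAtlas C ι) (I J : ι) :
    𝒰.chart I '' ((𝒰.chart I).source ∩ (𝒰.chart J).source) = 𝒰.overlap I J := by
  rw [(𝒰.chart I).image_source_inter_eq']
  rfl

theorem Fields.Admissible.localEquations_trans (hF : F.Admissible Pb D)
    (h : F.LocalEquations Pb.toHolAtlas D I (Pb.chart J).source) :
    F.LocalEquations Pb.toHolAtlas D J (Pb.chart I).source := by
  constructor
  · intro u i ψ hψ
    rw [Pb.toHolAtlas.image_source_inter] at hψ
    have h1 := h.curvature u i _ (by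
      rw [Pb.toHolAtlas.image_source_inter]
      exact Pb.isCocycle_coAd.isTest_transportTest hψ)
    rw [hF.curvatureDist_trans hψ, h1]
    by_cases hI : D.q i ∈ (Pb.chart I).source
    · have h2 := hF.H_trans (J := J) hI u ψ
      rw [if_pos hI, transportTest_of_mem ((Pb.chart I).map_source hI),
        (Pb.chart I).left_inv hI, mul_assoc, h2]
      split_ifs
      · ring
      · rw [mul_zero]
    · rw [if_neg hI]
      split_ifs with hJ
      · rw [(hψ.eq_zero_of_notMem fun h => hI ?_).1, zero_apply, mul_zero]
        rw [← (Pb.chart J).left_inv hJ]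
        exact h.2
      · rfl
  · intro u X hX
    rw [Pb.toHolAtlas.image_source_inter] at hX
    have h1 := h.moment u _ (by
      rw [Pb.toHolAtlas.image_source_inter]
      exact Pb.isCocycle_Ad.isTest_transportTest hX)
    rw [hF.momentDist_trans hX, h1]
    congr 1
    refine Finset.sum_congr rfl fun α _ => ?_
    by_cases hI : D.p α ∈ (Pb.chart I).source
    · rw [if_pos hI, transportTest_of_mem ((Pb.chart I).map_source hI), (Pb.chart I).left_inv hI]
      split_ifs with hJ
      · rw [transport_of_mem hJ, hF.φ_trans α I J hI hJ, coAd_mul, coAd_apply, Ad_inv_Ad]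
      · rw [transport_of_notMem hJ, map_zero]
    · rw [if_neg hI]
      split_ifs with hJ
      · rw [(hX.eq_zero_of_notMem fun h => hI ?_).1, map_zero]
        rw [← (Pb.chart J).left_inv hJ]
        exact h.2
      · rfl
  · intro u j x hx hxp hxq
    have h1 := h.lax u j x ⟨hx.2, hx.1⟩ hxp hxq
    have h2 : F.dt j (F.B J x) u + coad G (F.tgauge J x j u) (F.B J x u) = Pb.jac J I x •
        coAd (Pb.g J I x) (F.dt j (F.B I x) u + coad G (F.tgauge I x j u) (F.B I x u)) := by
      rw [coAd_add, coAd_coad, dt, hF.fderiv_B_trans hx.1 hx.2 hxp, tgauge,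
        hF.gaugeAt_trans hx.1 hx.2 hxq, hF.B_trans J I x hx.1 hx.2 hxp, smul_add,
        ← coadL_apply, map_smul]
      rfl
    rw [h2, h1]
    exact map_zero (Pb.jac J I x • coAdL (Pb.g J I x) :
      StrongDual ℂ E →L[ℂ] StrongDual ℂ E)
  · exact h.conservation
  · intro u j α hα
    have h1 := hF.orbit_trans hα.1 hα.2 u (F.timeVec u j)
    have h2 := h.orbit u j α ⟨hα.2, hα.1⟩
    rw [dt, tgauge] at h2 ⊢
    rw [h1, h2]
    exact map_zero (coAdL (Pb.g J I (D.p α)))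

end Compatibility

end MixedBF

end

theorem theorem5p3
    {C : Type*} [TopologicalSpace C] [T2Space C] [CompactSpace C] [ConnectedSpace C]
    [ChartedSpace ℂ C] [IsManifold 𝓘(ℂ) ω C]
    {E : Type*} [NormedAddCommGroup E] [NormedSpace ℂ E] [FiniteDimensional ℂ E]
    {G : Type*} [TopologicalSpace G] [ChartedSpace E G] [Group G] [LieGroup 𝓘(ℂ, E) ω G]
    [ConnectedSpace G]
    {ι : Type*} (Pb : MixedBF.PBundle C ι E G)
    (ρ : PartitionOfUnity ι C) (hρ : ρ.IsSubordinate (fun I => (Pb.chart I).source))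
    {n N : ℕ} (hn : 1 ≤ n) (D : MixedBF.Defects C E G n N)
    (F : MixedBF.Fields C ι E G n N) (hF : F.Admissible Pb D) :
    (F.GaugedUnivariational Pb ρ D →
      (∀ u, IsUnit (F.jacobian u).det) ∧
      (∀ I, F.LocalEquations Pb.toHolAtlas D I Set.univ) ∧
      (∀ u, F.Stable Pb D u → F.ZeroCurvature Pb.toHolAtlas D u)) ∧
    (∀ I J, F.LocalEquations Pb.toHolAtlas D I (Pb.chart J).source ↔
      F.LocalEquations Pb.toHolAtlas D J (Pb.chart I).source) := by
  refine ⟨fun hU => ⟨hU.isUnit_det_jacobian hρ hF, hU.localEquations hρ hF hn,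
    fun u hS => hU.zeroCurvature hρ hF hS⟩,
    fun I J => ⟨hF.localEquations_trans, hF.localEquations_trans⟩⟩
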